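/- **Setting.** $\mathcal S^6\subset\operatorname{Im}\mathbb O=\mathbb R^7$ is the unit sphere with $J_pv=p\times v$ ($\times$ the octonionic cross product) and $\omega_p(v,w)=g(J_pv,w)$. Let $L$ be a connected Lagrangian in $\mathcal S^6$, i.e. a connected smooth (immersed) $3$-dimensional submanifold with $\omega|_L\equiv0$. $L$ is *ruled* if there is a smooth fibration $\pi:L\to B$ over a $2$-manifold whose fibres are oriented geodesic circles (great circles) of $\mathcal S^6$. $L$ is *linearly full* if it lies in no totally geodesic $\mathcal S^n$, $n<6$, and *simple* if it lies in a totally geodesic $\mathcal S^3$. Surfaces are smooth $2$-manifolds, holomorphic and pseudoholomorphic curves are immersed surfaces with complex tangent planes; a pseudoholomorphic curve in $\mathcal S^6$ is *non-totally-geodesic* if it is connected and its second fundamental form $h_\Sigma$ does not vanish identically. Consider the following subsets of $\mathcal S^6$. * $L_3(\mathbf u,\Sigma)$, for a holomorphic curve $\mathbf u:\Sigma\to\mathbb{CP}^2$: the image of the pulled-back Hopf circle bundle $\mathcal C(\Sigma)\to\mathcal S^5\subset\mathbb C^3$ under a linear isometry $\mathbb C^3\cong n^\perp\subset\operatorname{Im}\mathbb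 O$, for a unit vector $n$, that takes multiplication by $i$ to $n\times\cdot$. * $L_4(\mathbf u,\Sigma)$, for a non-totally-geodesic pseudoholomorphic curve $\mathbf u:\Sigma\to\mathcal S^6$: the set of unit vectors of the second normal bundle $N_2\Sigma$ (the orthogonal complement in the normal bundle of the values of $h_\Sigma$, extended continuously over the isolated totally geodesic points). * $L_6(\mathbf u,\Sigma,\Gamma)$, for such $(\mathbf u,\Sigma)$ and a holomorphic curve $\Gamma$ in $\mathcal X(\Sigma)$. Here $\mathcal B(\Sigma)$ is the $U(2)$-bundle of frames $(\mathbf f_1,\mathbf f_2,\mathbf f_3)$ of $T^{1,0}\mathcal S^6|_\Sigma$ with $\mathbf f_j$ orthogonal of length $1/\sqrt2$, $\mathbf f_1$ spanning $T^{1,0}\Sigma$ and $\mathbf f_1\times\mathbf f_2=\bar{\mathbf f}_3$; $\mathcal X(\Sigma)$ is its quotient by $(e^{is}\mathbf f_1,e^{-is}\mathbf f_2,\mathbf f_3)$ and $(e^{-it}\mathbf f_1,e^{-it}\mathbf f_2,e^{2it}\mathbf f_3)$, a $\mathbb{CP}^1$-bundle over $\Sigma$, with the complex structure whose $(1,0)$-forms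 are spanned by $\theta_1$ and $\kappa_{32}$, where $d\mathbf u=-2i\mathbf f_1\theta_1+2i\bar{\mathbf f}_1\bar\theta_1$ and $\kappa_{32}$ is the $\mathbf f_3$-coefficient of $d\mathbf f_2$. $L_6$ is the set of all $\mathbf f_3+\bar{\mathbf f}_3$ for frames lying over $\Gamma$. Say that *$L$ is locally of type $T$* if there is an open dense $L^*\subset L$ such that each $x\in L^*$ has an open neighbourhood $U$ in $L$ for which $U\cap L^*$ is embedded and equal to a set of type $T$. **Theorem.** 1. If $L$ is ruled, then $L$ is locally of type "$L_3$ or $L_4$ or $L_6$". More precisely, $L$ is locally of this type if and only if every point of some open dense subset of $L$ has a ruled open neighbourhood in $L$. 2. Let $L$ be ruled. Then $L$ is not linearly full if and only if $L$ is locally of type $L_3$; if some nonempty embedded open subset of $L$ is an $L_3(\mathbf u,\Sigma)$, then $L$ is not linearly full; and if $L$ is neither linearly full nor simple, then $L=L_3(\mathbf u,\Sigma)$ globally, for some holomorphic curve $\mathbf u:\Sigma\to\mathbb{CP}^2$. 3. The general family is given by $L_6$: every linearly full ruled $L$ is locally of type $L_6$; and, conversely, every connected immersed $3$-dimensional submanifold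 of $\mathcal S^6$ that is locally of type $L_6$ is Lagrangian. -/

import Mathlib

open scoped Manifold ContDiff

noncomputable section

namespace S6

/-! ### The nearly Kähler 6-sphere in the imaginary octonions -/

/-- The imaginary octonions `Im 𝕆 = ℝ⁷` with their Euclidean structure; the coordinate with index
`j : Fin 7` belongs to the imaginary unit `ε_{j+1}`. -/
abbrev ImO : Type := EuclideanSpace ℝ (Fin 7)

/-- The complexification `Im 𝕆 ⊗ ℂ = ℂ⁷`. -/
abbrev ImOC : Type := Fin 7 → ℂ

/-- The octonionic cross product in coordinates, over any commutative ring of scalars. It encodes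
`ε₁ε₂ = ε₃`, `ε₁ε₄ = ε₅`, `ε₁ε₆ = ε₇`, `ε₂ε₄ = ε₆`, `ε₂ε₅ = -ε₇`, `ε₃ε₄ = -ε₇`, `ε₃ε₅ = -ε₆`
and their cyclic permutations. -/
def crossCoord {R : Type*} [CommRing R] (a b : Fin 7 → R) : Fin 7 → R :=
  let m : Fin 7 → Fin 7 → R := fun i j => a i * b j - a j * b i
  ![m 1 2 + m 3 4 + m 5 6,
    m 2 0 + m 3 5 - m 4 6,
    m 0 1 - m 3 6 - m 4 5,
    m 4 0 + m 5 1 - m 6 2,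
    m 0 3 - m 6 1 - m 5 2,
    m 6 0 + m 1 3 - m 2 4,
    m 0 5 - m 1 4 - m 2 3]

/-- The octonionic cross product on `Im 𝕆`. The almost complex structure of the unit sphere is
`J_p v = cross p v` for `v ⟂ p`. -/
def cross (a b : ImO) : ImO := WithLp.toLp 2 (crossCoord (WithLp.ofLp a) (WithLp.ofLp b))

/-- The inclusion of `Im 𝕆` in its complexification. -/
def toC (a : ImO) : ImOC := fun i => ((a i : ℝ) : ℂ)

/-- The Hermitian form `ω_p(v, w) = g(J_p v, w)` of the nearly Kähler structure. -/
def omega (p v w : ImO) : ℝ := inner ℝ (cross p v) w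

/-- `f : M → Im 𝕆` is a smooth immersion of the `n`-manifold `M` in the unit sphere `𝒮⁶`. -/
structure IsImmersedInS6 {n : ℕ} {M : Type*} [TopologicalSpace M]
    [ChartedSpace (EuclideanSpace ℝ (Fin n)) M] (f : M → ImO) : Prop where
  smooth : ContMDiff (𝓡 n) 𝓘(ℝ, ImO) ∞ f
  norm_eq_one : ∀ x, ‖f x‖ = 1
  immersive : ∀ x, Function.Injective (mfderiv (𝓡 n) 𝓘(ℝ, ImO) f x)

/-- The Hermitian form vanishes on the tangent spaces. -/
def IsLagrangian {L : Type*} [TopologicalSpace L] [ChartedSpace (EuclideanSpace ℝ (Fin 3)) L]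
    (ι : L → ImO) : Prop :=
  ∀ (x : L) (v w : TangentSpace (𝓡 3) x),
    omega (ι x) (mfderiv (𝓡 3) 𝓘(ℝ, ImO) ι x v) (mfderiv (𝓡 3) 𝓘(ℝ, ImO) ι x w) = 0

/-- Contained in no totally geodesic `𝒮ⁿ`, `n < 6`, i.e. in no proper linear subspace. -/
def IsLinearlyFull {L : Type*} (ι : L → ImO) : Prop :=
  ¬ ∃ W : Submodule ℝ ImO, W ≠ ⊤ ∧ ∀ x, ι x ∈ W

/-- Contained in a totally geodesic `𝒮³`, i.e. in a 4-dimensional linear subspace. -/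
def IsSimple {L : Type*} (ι : L → ImO) : Prop :=
  ∃ W : Submodule ℝ ImO, Module.finrank ℝ W = 4 ∧ ∀ x, ι x ∈ W

/-! ### Surfaces and rulings -/

/-- Smooth 2-manifolds (Hausdorff, second countable, not necessarily connected). -/
structure Surface where
  carrier : Type
  [top : TopologicalSpace carrier]
  [charted : ChartedSpace (EuclideanSpace ℝ (Fin 2)) carrier]
  [mfd : IsManifold (𝓡 2) ∞ carrier]
  [t2 : T2Space carrier]
  [sc : SecondCountableTopology carrier]

instance : CoeSort Surface Type := ⟨Surface.carrier⟩

attribute [instance] Surface.top Surface.charted Surface.mfd Surface.t2 Surface.sc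

/-- The geodesic circle through the unit vector `x` with unit tangent vector `e` at `x`. -/
def greatCircle (x e : ImO) : Set ImO :=
  Set.range fun t : ℝ => Real.cos t • x + Real.sin t • e

/-- `L` is ruled: there is a smooth fibration `π` of `L` over a 2-manifold whose fibres are
geodesic circles of `𝒮⁶`; these are oriented by the smooth unit tangent field `e`. -/
def IsRuled {L : Type*} [TopologicalSpace L] [ChartedSpace (EuclideanSpace ℝ (Fin 3)) L]
    (ι : L → ImO) : Prop :=
  ∃ (S : Surface) (π : L → S) (e : L → ImO),
    ContMDiff (𝓡 3) (𝓡 2) ∞ π ∧ Function.Surjective π ∧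
    (∀ x, Function.Surjective (mfderiv (𝓡 3) (𝓡 2) π x)) ∧
    ContMDiff (𝓡 3) 𝓘(ℝ, ImO) ∞ e ∧
    (∀ x, ‖e x‖ = 1 ∧ inner ℝ (ι x) (e x) = 0) ∧
    ∀ x, Set.BijOn ι (π ⁻¹' {π x}) (greatCircle (ι x) (e x))

/-- Every point of some open dense subset of `L` has a ruled open neighbourhood in `L`. -/
def IsGenericallyLocallyRuled {L : Type*} [TopologicalSpace L]
    [ChartedSpace (EuclideanSpace ℝ (Fin 3)) L] (ι : L → ImO) : Prop :=
  ∃ O : Set L, IsOpen O ∧ Dense O ∧ ∀ x ∈ O, ∃ W : TopologicalSpace.Opens L, x ∈ W ∧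
    IsRuled (fun y : W => ι y)

/-! ### Hopf lifts of holomorphic curves in `ℂP²` -/

/-- `ℂ³` with its Hermitian structure. -/
abbrev C3 : Type := EuclideanSpace ℂ (Fin 3)

/-- `ℂP²`. -/
abbrev CP2 : Type := Projectivization ℂ C3

/-- The differential of a map from a surface to `ℂ³`. -/
def dlift {S : Surface} (z : S → C3) (q : S) : EuclideanSpace ℝ (Fin 2) →L[ℝ] C3 :=
  mfderiv (𝓡 2) 𝓘(ℝ, C3) z q

/-- An immersed surface in `ℂP²` whose tangent planes are complex lines, in terms of local smooth
lifts `z` to `ℂ³ \ {0}`: the tangent space of `ℂP²` at `[z]` is, up to a complex scalar,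
`ℂ³ / ℂ z`. (Equivalently, a holomorphic immersion for the complex structure that it induces on the
surface.) -/
def IsHolomorphicCurveCP2 {S : Surface} (u : S → CP2) : Prop :=
  ∀ p : S, ∃ (W : Set S) (z : S → C3), IsOpen W ∧ p ∈ W ∧
    ContMDiffOn (𝓡 2) 𝓘(ℝ, C3) ∞ z W ∧
    ∀ q ∈ W, (∃ h : z q ≠ 0, u q = Projectivization.mk ℂ (z q) h) ∧
      (∀ v, dlift z q v ∈ Submodule.span ℂ {z q} → v = 0) ∧
      (∀ v, ∃ w, dlift z q w - Complex.I • dlift z q v ∈ Submodule.span ℂ {z q})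

/-- The circle bundle over the surface induced by the Hopf fibration `𝒮⁵ → ℂP²`. -/
def HopfBundle {S : Surface} (u : S → CP2) : Type :=
  {y : S × C3 // ‖y.2‖ = 1 ∧ y.2 ∈ (u y.1).submodule}

instance {S : Surface} (u : S → CP2) : TopologicalSpace (HopfBundle u) :=
  inferInstanceAs (TopologicalSpace {y : S × C3 // ‖y.2‖ = 1 ∧ y.2 ∈ (u y.1).submodule})

/-- A linear isometry of `ℂ³` onto a hyperplane `n^⟂` of `Im 𝕆` that takes multiplication by `i`
to the complex structure `n × ·` of the hyperplane. Its restriction to `𝒮⁵` is the totally geodesic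
embedding `𝒮⁵ → 𝒮⁶` used for Hopf lifts. -/
def IsAdapted (i : C3 →ₗᵢ[ℝ] ImO) : Prop :=
  ∃ n : ImO, ‖n‖ = 1 ∧ ∀ y : C3, i (Complex.I • y) = cross n (i y)

/-- The map `i ∘ x` of the circle bundle to `𝒮⁶`. -/
def hopfMap {S : Surface} (u : S → CP2) (i : C3 →ₗᵢ[ℝ] ImO) (y : HopfBundle u) : ImO := i y.1.2

/-- The subset `A` of `𝒮⁶` is the Hopf lift `L₃(u, Σ)` of a holomorphic curve in `ℂP²`. -/
def IsL3 (A : Set ImO) : Prop :=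
  ∃ (S : Surface) (u : S → CP2) (i : C3 →ₗᵢ[ℝ] ImO),
    IsHolomorphicCurveCP2 u ∧ IsAdapted i ∧ A = Set.range (hopfMap u i)

/-- The immersed submanifold `ι : L → 𝒮⁶` is, as a whole, the Hopf lift `L₃(u, Σ)` of a
holomorphic curve in `ℂP²`. -/
def IsGloballyL3 {L : Type*} [TopologicalSpace L] (ι : L → ImO) : Prop :=
  ∃ (S : Surface) (u : S → CP2) (i : C3 →ₗᵢ[ℝ] ImO) (Φ : L ≃ₜ HopfBundle u),
    IsHolomorphicCurveCP2 u ∧ IsAdapted i ∧ ∀ x, ι x = hopfMap u i (Φ x)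

/-! ### Pseudoholomorphic curves in `𝒮⁶` -/

/-- The differential of a map from a surface to `Im 𝕆`. -/
def dmap {S : Surface} (u : S → ImO) (p : S) : EuclideanSpace ℝ (Fin 2) →L[ℝ] ImO :=
  mfderiv (𝓡 2) 𝓘(ℝ, ImO) u p

/-- An immersed surface in `𝒮⁶` whose tangent planes are invariant under `J`. -/
structure IsPseudoholomorphic {S : Surface} (u : S → ImO) : Prop where
  immersed : IsImmersedInS6 (n := 2) u
  tangent : ∀ (p : S) (v : EuclideanSpace ℝ (Fin 2)), ∃ w, dmap u p w = cross (u p) (dmap u p v)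

/-- The normal space at `p` of an immersed surface in `𝒮⁶`. -/
def normalSpace {S : Surface} (u : S → ImO) (p : S) : Submodule ℝ ImO :=
  (Submodule.span ℝ {u p} ⊔ LinearMap.range (dmap u p).toLinearMap)ᗮ

/-- The second fundamental form at `p` of an immersed surface in `𝒮⁶`: the normal component of the
second derivative in the preferred chart at `p`, which is the chart that identifies the tangent
space at `p` with `ℝ²`. -/
def secondFF {S : Surface} (u : S → ImO) (p : S) (a b : EuclideanSpace ℝ (Fin 2)) : ImO :=
  (normalSpace u p).starProjection
    (fderiv ℝ (fderiv ℝ (u ∘ (extChartAt (𝓡 2) p).symm)) (extChartAt (𝓡 2) p p) a b)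

/-- `p` is a totally geodesic point. -/
def IsGeodesicPoint {S : Surface} (u : S → ImO) (p : S) : Prop := ∀ a b, secondFF u p a b = 0

/-- A connected pseudoholomorphic curve that is not totally geodesic. -/
structure IsNonGeodesicCurve {S : Surface} (u : S → ImO) : Prop where
  connected : ConnectedSpace S
  pseudoholomorphic : IsPseudoholomorphic u
  not_geodesic : ∃ p, ¬ IsGeodesicPoint u p

/-- The unit circle bundle of the second normal bundle `N₂Σ` over the non-totally-geodesic points:
`N₂Σ` is the orthogonal complement in the normal bundle of the values of the second fundamental
form. -/
def unitN2 {S : Surface} (u : S → ImO) : Set (S × ImO) :=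
  {y | ¬ IsGeodesicPoint u y.1 ∧ y.2 ∈ normalSpace u y.1 ∧ ‖y.2‖ = 1 ∧
    ∀ a b, inner ℝ y.2 (secondFF u y.1 a b) = 0}

/-- The subset `A` of `𝒮⁶` is the tube `L₄(u, Σ)` of radius `π/2` in the second normal bundle of a
non-totally-geodesic pseudoholomorphic curve. The closure extends `N₂Σ` continuously over the
totally geodesic points, which are isolated. -/
def IsL4 (A : Set ImO) : Prop :=
  ∃ (S : Surface) (u : S → ImO), IsNonGeodesicCurve u ∧ A = Prod.snd '' closure (unitN2 u)

/-! ### The `ℂP¹`-bundle `𝒳(Σ)` and its holomorphic curves -/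

/-- Special unitary frames `(f₁, f₂, f₃)` (here `f 0`, `f 1`, `f 2`) of `T𝒮⁶` at `u p`, with `f₁`
spanning `T^{1,0}Σ`: the `f_j` are of type `(1,0)`, orthogonal and of length `1/√2`, and
`f₁ × f₂` is the conjugate of `f₃`. -/
structure IsAdaptedFrame {S : Surface} (u : S → ImO) (p : S) (f : Fin 3 → ImOC) : Prop where
  type_one_zero : ∀ j, crossCoord (toC (u p)) (f j) = Complex.I • f j
  unitary : ∀ j k, f j ⬝ᵥ star (f k) = if j = k then 1 / 2 else 0
  special : crossCoord (f 0) (f 1) = star (f 2)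
  tangent : ∃ a : EuclideanSpace ℝ (Fin 2),
    f 0 = (1 / 2 : ℂ) • (toC (dmap u p a) - Complex.I • toC (cross (u p) (dmap u p a)))

/-- The `U(2)`-bundle `ℬ(Σ)` of adapted special unitary frames. -/
structure FrameBundle {S : Surface} (u : S → ImO) where
  pt : S
  frame : Fin 3 → ImOC
  adapted : IsAdaptedFrame u pt frame

/-- `e^{it}`. -/
def phase (t : ℝ) : ℂ := Complex.exp (t * Complex.I)

theorem phase_mul (s t : ℝ) (x : ImOC) : phase s • phase t • x = phase (s + t) • x := by
  rw [smul_smul]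
  congr 1
  unfold phase
  rw [← Complex.exp_add]
  congr 1
  push_cast
  ring

theorem phase_zero (x : ImOC) : phase 0 • x = x := by simp [phase]

/-- The orbit relation on `ℬ(Σ)` of the commuting actions of `U(1)_l`,
`(f₁, f₂, f₃) ↦ (e^{is} f₁, e^{-is} f₂, f₃)`, and of `U(1)_r`,
`(f₁, f₂, f₃) ↦ (e^{-it} f₁, e^{-it} f₂, e^{2it} f₃)`. -/
def torusSetoid {S : Surface} (u : S → ImO) : Setoid (FrameBundle u) where
  r b c := b.pt = c.pt ∧ ∃ s t : ℝ, c.frame 0 = phase (s - t) • b.frame 0 ∧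
    c.frame 1 = phase (-s - t) • b.frame 1 ∧ c.frame 2 = phase (2 * t) • b.frame 2
  iseqv :=
    { refl := fun b => ⟨rfl, 0, 0, by simp [phase_zero], by simp [phase_zero],
        by simp [phase_zero]⟩
      symm := by
        rintro b c ⟨h, s, t, h0, h1, h2⟩
        refine ⟨h.symm, -s, -t, ?_, ?_, ?_⟩
        · rw [h0, phase_mul, show -s - -t + (s - t) = 0 by ring, phase_zero]
        · rw [h1, phase_mul, show - -s - -t + (-s - t) = 0 by ring, phase_zero]
        · rw [h2, phase_mul, show 2 * -t + 2 * t = 0 by ring, phase_zero]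
      trans := by
        rintro b c d ⟨h, s, t, h0, h1, h2⟩ ⟨h', s', t', h0', h1', h2'⟩
        refine ⟨h.trans h', s' + s, t' + t, ?_, ?_, ?_⟩
        · rw [h0', h0, phase_mul]; congr 2; ring
        · rw [h1', h1, phase_mul]; congr 2; ring
        · rw [h2', h2, phase_mul]; congr 2; ring }

/-- The bundle `𝒳(Σ) = ℬ(Σ) / (U(1)_l × U(1)_r)`. Its point over `p` given by a frame is the complex
line spanned by `f₃` in the normal space at `p`. -/
def XBundle {S : Surface} (u : S → ImO) : Type := Quotient (torusSetoid u)

/-- The projection `ℬ(Σ) → 𝒳(Σ)`. -/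
def toX {S : Surface} (u : S → ImO) (b : FrameBundle u) : XBundle u :=
  Quotient.mk (torusSetoid u) b

section Forms

variable {S : Surface} (u : S → ImO) {G : Surface} (F : G → FrameBundle u) (q : G)

/-- The `ℂ`-valued 1-form `θ₁` on `ℬ(Σ)`, pulled back by `F : G → ℬ(Σ)`. It is defined by
`du = -2i f₁ θ₁ + 2i conj(f₁ θ₁)`, so that `θ₁ = i du · conj(f₁)`. -/
def theta1 (v : EuclideanSpace ℝ (Fin 2)) : ℂ :=
  Complex.I * (toC (dmap (fun q' => u (F q').pt) q v) ⬝ᵥ star ((F q).frame 0))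

/-- The `ℂ`-valued 1-form `κ₃₂` on `ℬ(Σ)`, pulled back by `F : G → ℬ(Σ)`. It is the coefficient of
`f₃` in `df₂`, that is `κ₃₂ = 2 df₂ · conj(f₃)`. -/
def kappa32 (v : EuclideanSpace ℝ (Fin 2)) : ℂ :=
  2 * ((mfderiv (𝓡 2) 𝓘(ℝ, ImOC) (fun q' => (F q').frame 1) q v : ImOC) ⬝ᵥ
    star ((F q).frame 2))

end Forms

/-- `γ : G → 𝒳(Σ)` is a holomorphic curve, i.e. an immersed surface whose tangent planes are complex
lines for the complex structure `I` of `𝒳(Σ)`. In terms of local smooth lifts `F` to `ℬ(Σ)`: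
the forms `θ₁` and `κ₃₂` on `ℬ(Σ)` have as common kernel the tangent spaces of the torus orbits, and
the torus acts on each of them by a phase; so they identify the tangent spaces of `𝒳(Σ)` with `ℂ²`,
up to phases, and `I` is the structure for which they are of type `(1,0)`. (Where the coefficient
`k₃` in `κ₃₁ = k₃ θ₁` does not vanish, which is an open dense set, this is the complex structure
with the `(2,0)`-form `κ₃₂ ∧ k₃ θ₁`.) -/
def IsHolomorphicCurveX {S : Surface} (u : S → ImO) {G : Surface} (γ : G → XBundle u) : Prop :=
  ∀ q₀ : G, ∃ (W : Set G) (F : G → FrameBundle u), IsOpen W ∧ q₀ ∈ W ∧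
    ContMDiffOn (𝓡 2) (𝓡 2) ∞ (fun q => (F q).pt) W ∧
    (∀ j, ContMDiffOn (𝓡 2) 𝓘(ℝ, ImOC) ∞ (fun q => (F q).frame j) W) ∧
    ∀ q ∈ W, γ q = toX u (F q) ∧
      (∀ v, theta1 u F q v = 0 → kappa32 u F q v = 0 → v = 0) ∧
      (∀ v, ∃ w, theta1 u F q w = Complex.I * theta1 u F q v ∧
        kappa32 u F q w = Complex.I * kappa32 u F q v)

/-- The subset `A` of `𝒮⁶` is `L₆(u, Σ, Γ)` for a non-totally-geodesic pseudoholomorphic curve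
`u : Σ → 𝒮⁶` and a holomorphic curve `Γ` in `𝒳(Σ)`: the image of the preimage of `Γ` under the map
`x = f₃ + conj(f₃)`. -/
def IsL6 (A : Set ImO) : Prop :=
  ∃ (S : Surface) (u : S → ImO) (G : Surface) (γ : G → XBundle u),
    IsNonGeodesicCurve u ∧ IsHolomorphicCurveX u γ ∧
    A = {x | ∃ (q : G) (b : FrameBundle u), toX u b = γ q ∧
      toC x = b.frame 2 + star (b.frame 2)}

/-! ### Local descriptions -/

/-- There is an open dense subset `L*` of `L` such that every `x ∈ L*` has an open neighbourhood `U`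
for which `U ∩ L*` is an embedded submanifold of `𝒮⁶` with the property `P`. -/
def LocallyOnDense {L : Type*} [TopologicalSpace L] (ι : L → ImO) (P : Set ImO → Prop) : Prop :=
  ∃ Lstar : Set L, IsOpen Lstar ∧ Dense Lstar ∧ ∀ x ∈ Lstar, ∃ U : Set L, IsOpen U ∧ x ∈ U ∧
    Topology.IsEmbedding ((U ∩ Lstar).domRestrict ι) ∧ P (ι '' (U ∩ Lstar))

end S6

end

noncomputable section
namespace S6

/-- The real inner product. -/
notation:max "⟪" a ", " b "⟫" => inner ℝ a b

/-- The Fréchet derivative over `ℝ`. -/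
notation:max "𝒟" => fderiv ℝ

/-- Being infinitely differentiable over `ℝ`. -/
notation:max "Smooth" => ContDiff ℝ ∞

theorem _root_.ContDiff.diff {E F : Type*} [NormedAddCommGroup E] [NormedSpace ℝ E]
    [NormedAddCommGroup F] [NormedSpace ℝ F] {f : E → F} (hf : Smooth f) :
    Differentiable ℝ f :=
  hf.differentiable (by simp)

theorem inner_self_of_norm_one {a : ImO} (h : ‖a‖ = 1) : ⟪a, a⟫ = (1 : ℝ) := by
  rw [real_inner_self_eq_norm_sq, h, one_pow]

theorem inner_eq_sum (a b : ImO) : ⟪a, b⟫ = a 0 * b 0 + a 1 * b 1 + a 2 * b 2 + a 3 * b 3 +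
    a 4 * b 4 + a 5 * b 5 + a 6 * b 6 := by
  simp [PiLp.inner_apply, Fin.sum_univ_seven]
  ring

theorem cross_apply (a b : ImO) (i : Fin 7) : cross a b i = crossCoord (⇑a) (⇑b) i := rfl

/-- The cross product as a bilinear map. -/
def crossB : ImO →L[ℝ] ImO →L[ℝ] ImO :=
  LinearMap.toContinuousLinearMap <|
    (LinearMap.toContinuousLinearMap (𝕜 := ℝ) (E := ImO) (F' := ImO)).toLinearMap.comp <|
    LinearMap.mk₂ ℝ cross
      (by intro a b c; ext i; fin_cases i <;> simp [cross_apply, crossCoord] <;> ring)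
      (by intro s a b; ext i; fin_cases i <;> simp [cross_apply, crossCoord] <;> ring)
      (by intro a b c; ext i; fin_cases i <;> simp [cross_apply, crossCoord] <;> ring)
      (by intro s a b; ext i; fin_cases i <;> simp [cross_apply, crossCoord] <;> ring)

theorem crossB_apply (a b : ImO) : crossB a b = cross a b := rfl

theorem cross_add_left (a b c : ImO) : cross (a + b) c = cross a c + cross b c := by
  simp [← crossB_apply]
theorem cross_add_right (a b c : ImO) : cross a (b + c) = cross a b + cross a c := by
  simp [← crossB_apply]
theorem cross_smul_left (s : ℝ) (a c : ImO) : cross (s • a) c = s • cross a c := by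
  simp [← crossB_apply]
theorem cross_smul_right (s : ℝ) (a c : ImO) : cross a (s • c) = s • cross a c := by
  simp [← crossB_apply]
theorem cross_neg_left (a c : ImO) : cross (-a) c = -cross a c := by
  simp [← crossB_apply]
theorem cross_neg_right (a c : ImO) : cross a (-c) = -cross a c := by
  simp [← crossB_apply]
theorem cross_zero_left (c : ImO) : cross 0 c = 0 := by
  simp [← crossB_apply]
theorem cross_zero_right (c : ImO) : cross c 0 = 0 := by
  simp [← crossB_apply]
theorem cross_self (a : ImO) : cross a a = 0 := by
  ext i; fin_cases i <;> simp [cross_apply, crossCoord] <;> ring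
theorem cross_anticomm (a b : ImO) : cross a b = -cross b a := by
  ext i; fin_cases i <;> simp [cross_apply, crossCoord] <;> ring

theorem inner_cross_cyclic (a b c : ImO) : ⟪cross a b, c⟫ = ⟪cross b c, a⟫ := by
  simp [inner_eq_sum, cross_apply, crossCoord]; ring
theorem inner_cross_swap (a b c : ImO) : ⟪cross a b, c⟫ = -⟪cross b a, c⟫ := by
  rw [cross_anticomm, inner_neg_left]
theorem inner_cross_swap' (a b c : ImO) : ⟪cross a b, c⟫ = -⟪cross a c, b⟫ := by
  simp [inner_eq_sum, cross_apply, crossCoord]; ring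
@[simp] theorem inner_cross_left_self (a b : ImO) : ⟪cross a b, a⟫ = 0 := by
  simp [inner_eq_sum, cross_apply, crossCoord]; ring
@[simp] theorem inner_cross_right_self (a b : ImO) : ⟪cross a b, b⟫ = 0 := by
  simp [inner_eq_sum, cross_apply, crossCoord]; ring
@[simp] theorem inner_self_cross_left (a b : ImO) : ⟪a, cross a b⟫ = 0 := by
  rw [real_inner_comm, inner_cross_left_self]
@[simp] theorem inner_self_cross_right (a b : ImO) : ⟪b, cross a b⟫ = 0 := by
  rw [real_inner_comm, inner_cross_right_self]
theorem inner_cross_cross (a b c : ImO) : ⟪cross a b, cross a c⟫ =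
    ⟪a, a⟫ * ⟪b, c⟫ - ⟪a, b⟫ * ⟪a, c⟫ := by
  simp only [inner_eq_sum]; simp [cross_apply, crossCoord]; ring

theorem cross_cross_add (a b c : ImO) : cross a (cross b c) + cross b (cross a c) =
    (-2 * ⟪a, b⟫) • c + ⟪a, c⟫ • b + ⟪b, c⟫ • a := by
  simp only [inner_eq_sum]
  ext i; fin_cases i <;> simp [cross_apply, crossCoord] <;> ring

theorem cross_cross_self (a b : ImO) : cross a (cross a b) = ⟪a, b⟫ • a - ⟪a, a⟫ • b := by
  simp only [inner_eq_sum]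
  ext i; fin_cases i <;> simp [cross_apply, crossCoord] <;> ring

theorem cross_cross_swap (a b : ImO) : cross a (cross b a) = ⟪a, a⟫ • b - ⟪a, b⟫ • a := by
  rw [cross_anticomm b, cross_neg_right, cross_cross_self, neg_sub]

theorem cross_cross_anti {a b c : ImO} (hab : ⟪a, b⟫ = 0) (hac : ⟪a, c⟫ = 0)
    (hbc : ⟪b, c⟫ = 0) : cross a (cross b c) = -cross b (cross a c) := by
  have := cross_cross_add a b c
  simp only [hab, hac, hbc, mul_zero, zero_smul, add_zero] at this
  exact eq_neg_of_add_eq_zero_left this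

/-- The standard basis of `Im 𝕆`. -/
def eps (k : Fin 7) : ImO := EuclideanSpace.single k 1

/-- A linear isometry of `Im 𝕆` that preserves the cross product. -/
def IsG2 (Ψ : ImO ≃ₗᵢ[ℝ] ImO) : Prop := ∀ a b, cross (Ψ a) (Ψ b) = Ψ (cross a b)

theorem exists_g2 {u x τ : ImO} (hu : ‖u‖ = 1) (hx : ‖x‖ = 1) (hτ : ‖τ‖ = 1)
    (hux : ⟪u, x⟫ = 0) (huτ : ⟪u, τ⟫ = 0) (hxτ : ⟪x, τ⟫ = 0)
    (hφ : ⟪cross u x, τ⟫ = 0) :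
    ∃ Ψ : ImO ≃ₗᵢ[ℝ] ImO, IsG2 Ψ ∧ ∀ c, Ψ c = c 0 • u + c 1 • x + c 2 • cross u x + c 3 • τ +
      c 4 • cross u τ + c 5 • cross x τ + c 6 • cross u (cross x τ) := by
  have huu : ⟪u, u⟫ = 1 := inner_self_of_norm_one hu
  have hxx : ⟪x, x⟫ = 1 := inner_self_of_norm_one hx
  have hττ : ⟪τ, τ⟫ = 1 := inner_self_of_norm_one hτ
  have hxu : ⟪x, u⟫ = 0 := inner_eq_zero_symm.1 hux
  have hτu : ⟪τ, u⟫ = 0 := inner_eq_zero_symm.1 huτ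
  have hτx : ⟪τ, x⟫ = 0 := inner_eq_zero_symm.1 hxτ
  set e := cross u x with he
  set s := cross u τ with hs
  set y := cross x τ with hy
  set z := cross u y with hz
  -- inner products with u x τ
  have hyu : ⟪y, u⟫ = 0 := by rw [hy, ← inner_cross_cyclic]; exact hφ
  have huy : ⟪u, y⟫ = 0 := inner_eq_zero_symm.1 hyu
  have hsx : ⟪s, x⟫ = 0 := by rw [hs, inner_cross_swap', ← he, hφ, neg_zero]
  have t_uu : cross u u = 0 := cross_self u
  have t_ue : cross u e = -x := by rw [he, cross_cross_self, hux, huu]; simp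
  have t_us : cross u s = -τ := by rw [hs, cross_cross_self, huτ, huu]; simp
  have t_uz : cross u z = -y := by rw [hz, cross_cross_self, huy, huu]; simp
  have hxy : ⟪x, y⟫ = 0 := inner_self_cross_left _ _
  have hτy : ⟪τ, y⟫ = 0 := inner_self_cross_right _ _
  have t_xe : cross x e = u := by rw [he, cross_cross_swap, hxx, hxu]; simp
  have t_xy : cross x y = -τ := by rw [hy, cross_cross_self, hxτ, hxx]; simp
  have t_τs : cross τ s = u := by rw [hs, cross_cross_swap, hττ, hτu]; simp
  have t_τy : cross τ y = x := by rw [hy, cross_cross_swap, hττ, hτx]; simp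
  have t_xs : cross x s = -z := cross_cross_anti hxu hxτ huτ
  have t_τe : cross τ e = z := by
    rw [he, cross_cross_anti hτu hτx hux, cross_anticomm τ x, cross_neg_right, neg_neg]
  have t_xz : cross x z = s := by
    rw [hz, cross_cross_anti hxu hxy huy, t_xy, cross_neg_right, neg_neg]
  have t_τz : cross τ z = -e := by rw [hz, cross_cross_anti hτu hτy huy, t_τy]
  have heu : ⟪e, u⟫ = 0 := inner_cross_left_self _ _
  have hee : ⟪e, e⟫ = 1 := by rw [he, inner_cross_cross, huu, hxx, hux]; norm_num
  have hex : ⟪e, x⟫ = 0 := inner_cross_right_self _ _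
  have hss : ⟪s, s⟫ = 1 := by rw [hs, inner_cross_cross, huu, hττ, huτ]; norm_num
  have hyy : ⟪y, y⟫ = 1 := by rw [hy, inner_cross_cross, hxx, hττ, hxτ]; norm_num
  have hzz : ⟪z, z⟫ = 1 := by rw [hz, inner_cross_cross, huu, hyy, huy]; norm_num
  have hes : ⟪e, s⟫ = 0 := by rw [he, hs, inner_cross_cross, hxτ, hux]; norm_num
  have hez : ⟪e, z⟫ = 0 := by rw [he, hz, inner_cross_cross, hxy, hux]; norm_num
  have hsz : ⟪s, z⟫ = 0 := by rw [hs, hz, inner_cross_cross, hτy, huτ]; norm_num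
  have hyz : ⟪y, z⟫ = 0 := inner_self_cross_right _ _
  have huz : ⟪u, z⟫ = 0 := inner_self_cross_left _ _
  have hsu : ⟪s, u⟫ = 0 := inner_cross_left_self _ _
  have hsτ : ⟪s, τ⟫ = 0 := inner_cross_right_self _ _
  have hey : ⟪e, y⟫ = 0 := by
    rw [he, hy, cross_anticomm u x, inner_neg_left, inner_cross_cross, hxu, huτ, hxτ]; norm_num
  have hsy : ⟪s, y⟫ = 0 := by
    rw [hs, hy, cross_anticomm u τ, cross_anticomm x τ, inner_neg_neg, inner_cross_cross, hux, hτu,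
      hτx]; norm_num
  have hzx : ⟪z, x⟫ = 0 := by rw [hz, inner_cross_swap', ← he, hey, neg_zero]
  have hzτ : ⟪z, τ⟫ = 0 := by rw [hz, inner_cross_swap', ← hs, hsy, neg_zero]
  have t_es : cross e s = -y := by
    rw [hs, cross_cross_anti heu hφ huτ, cross_anticomm e τ, t_τe,
      cross_neg_right, neg_neg, t_uz]
  have t_ey : cross e y = s := by
    rw [hy, cross_cross_anti hex hφ hxτ, cross_anticomm e τ, t_τe,
      cross_neg_right, neg_neg, t_xz]
  have t_ez : cross e z = τ := by
    rw [hz, cross_cross_anti heu hey huy, t_ey, t_us, neg_neg]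
  have t_sy : cross s y = -e := by
    rw [hy, cross_cross_anti hsx hsτ hxτ, cross_anticomm s τ, t_τs,
      cross_neg_right, neg_neg, cross_anticomm x u]
  have t_sz : cross s z = -x := by
    rw [hz, cross_cross_anti hsu hsy huy, t_sy, cross_neg_right,
      neg_neg, t_ue]
  have t_yz : cross y z = u := by
    rw [hz, cross_cross_swap, hyy, hyu]; simp
  let E : Fin 7 → ImO := ![u, x, e, τ, s, y, z]
  have hE : Orthonormal ℝ E := by
    rw [orthonormal_iff_ite]
    intro i j
    fin_cases i <;> fin_cases j <;>
      simp only [E, Fin.reduceFinMk, Fin.zero_eta, Fin.mk_one, Matrix.cons_val, Fin.reduceEq,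
        ↓reduceIte] <;> first | assumption | (rw [real_inner_comm]; assumption)
  let bas := (basisOfOrthonormalOfCardEqFinrank hE (by simp)).toOrthonormalBasis (by simpa using hE)
  have hbas : ∀ c, bas.repr.symm c = c 0 • u + c 1 • x + c 2 • e + c 3 • τ +
      c 4 • s + c 5 • y + c 6 • z := by
    intro c
    rw [← bas.sum_repr_symm]
    simp [Fin.sum_univ_seven, bas, E]
  refine ⟨bas.repr.symm, ?_, hbas⟩
  intro a b
  simp only [hbas, cross_add_left, cross_add_right, cross_smul_left, cross_smul_right, cross_self,
    ← he, ← hs, ← hy, ← hz, t_ue, t_us, t_uz, t_xe, t_xy, t_τs, t_τy, t_xs, t_τe, t_xz, t_τz,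
    cross_anticomm x u, cross_anticomm e u, cross_anticomm τ u, cross_anticomm s u,
    cross_anticomm y u, cross_anticomm z u, cross_anticomm e x, cross_anticomm τ x,
    cross_anticomm s x, cross_anticomm y x, cross_anticomm z x, cross_anticomm s τ,
    cross_anticomm y τ, cross_anticomm z τ, cross_anticomm e τ, t_es, t_ey, t_ez, t_sy, t_sz, t_yz,
    cross_anticomm s e, cross_anticomm y e, cross_anticomm z e, cross_anticomm y s,
    cross_anticomm z s, cross_anticomm z y]
  simp only [cross_apply, crossCoord, Matrix.cons_val]
  module

open MeasureTheory

/-! ### Divergence form operators on `ℝ³` and unique continuation -/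

abbrev R3 : Type := EuclideanSpace ℝ (Fin 3)

/-- The `i`-th partial derivative. -/
def pd (i : Fin 3) (f : R3 → ℝ) : R3 → ℝ := fun x => 𝒟 f x (EuclideanSpace.single i 1)

theorem contDiff_pd {f : R3 → ℝ} (hf : Smooth f) (i : Fin 3) : Smooth (pd i f) :=
  (hf.fderiv_right (m := ∞) (by simp)).clm_apply contDiff_const

theorem pd_mul {f h : R3 → ℝ} (hf : Smooth f) (hh : Smooth h) (i : Fin 3) (x : R3) :
    pd i (fun y => f y * h y) x = f x * pd i h x + h x * pd i f x := by
  unfold pd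
  rw [fderiv_fun_mul (hf.diff x) (hh.diff x)]
  simp

theorem pd_add {f h : R3 → ℝ} (hf : Smooth f) (hh : Smooth h) (i : Fin 3) (x : R3) :
    pd i (fun y => f y + h y) x = pd i f x + pd i h x := by
  unfold pd
  rw [fderiv_fun_add (hf.diff x) (hh.diff x)]
  simp

theorem pd_comm {f : R3 → ℝ} (hf : Smooth f) (i j : Fin 3) (x : R3) :
    pd i (pd j f) x = pd j (pd i f) x := by
  unfold pd
  have hd : DifferentiableAt ℝ (𝒟 f) x :=
    (hf.fderiv_right (m := ∞) (by simp)).diff x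
  rw [fderiv_clm_apply hd (by fun_prop), fderiv_clm_apply hd (by fun_prop)]
  simp
  exact (hf.contDiffAt.isSymmSndFDerivAt (by simp; exact WithTop.coe_le_coe.2 (le_top (a := (2 : ℕ∞))))) _ _

theorem hasCompactSupport_pd {f : R3 → ℝ} (hf : HasCompactSupport f) (i : Fin 3) :
    HasCompactSupport (pd i f) :=
  (hf.fderiv ℝ).comp_left (g := fun L : R3 →L[ℝ] ℝ => L (EuclideanSpace.single i 1)) (by simp)

theorem pd_eq_zero {f : R3 → ℝ} {x : R3} (hx : f =ᶠ[nhds x] 0) (i : Fin 3) : pd i f x = 0 := by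
  unfold pd; rw [hx.fderiv_eq]; simp

theorem pd_congr {f g : R3 → ℝ} {x : R3} (hx : f =ᶠ[nhds x] g) (i : Fin 3) : pd i f x = pd i g x := by
  unfold pd; rw [hx.fderiv_eq]

theorem integral_pd {f : R3 → ℝ} (hf : Smooth f) (hc : HasCompactSupport f) (i : Fin 3) :
    ∫ x, pd i f x = 0 := by
  have h1 := (contDiff_pd hf i).continuous.integrable_of_hasCompactSupport (μ := volume)
    (hasCompactSupport_pd hc i)
  have h2 := hf.continuous.integrable_of_hasCompactSupport (μ := volume) hc
  have h := integral_mul_fderiv_eq_neg_fderiv_mul_of_integrable (μ := (volume : Measure R3))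
    (f := fun _ => (1 : ℝ)) (g := f) (v := EuclideanSpace.single i 1) (by simp)
    (by simp only [one_mul]; exact h1) (by simp only [one_mul]; exact h2) (by fun_prop)
    (fun x _ => hf.diff x)
  simpa [pd] using h

section Gamma

variable (G : Fin 3 → Fin 3 → R3 → ℝ)

/-- The bilinear form `Σ Gᵢⱼ ∂ᵢf ∂ⱼh`. -/
def Gam (f h : R3 → ℝ) : R3 → ℝ := fun x => ∑ i, ∑ j, G i j x * pd i f x * pd j h x

/-- The `i`-th component of `G ∇h`. -/
def flux (i : Fin 3) (h : R3 → ℝ) : R3 → ℝ := fun x => ∑ j, G i j x * pd j h x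

/-- The operator `div (G ∇h)`. -/
def Pop (h : R3 → ℝ) : R3 → ℝ := fun x => ∑ i, pd i (flux G i h) x

variable {G} (hG : ∀ i j, Smooth (G i j)) (hs : ∀ i j x, G i j x = G j i x)

include hG in
theorem contDiff_Gam {f h : R3 → ℝ} (hf : Smooth f) (hh : Smooth h) :
    Smooth (Gam G f h) :=
  ContDiff.sum fun i _ => ContDiff.sum fun j _ => ((hG i j).mul (contDiff_pd hf i)).mul
    (contDiff_pd hh j)

include hG in
theorem contDiff_flux {h : R3 → ℝ} (hh : Smooth h) (i : Fin 3) :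
    Smooth (flux G i h) :=
  ContDiff.sum fun j _ => (hG i j).mul (contDiff_pd hh j)

include hG in
theorem contDiff_Pop {h : R3 → ℝ} (hh : Smooth h) : Smooth (Pop G h) :=
  ContDiff.sum fun i _ => contDiff_pd (contDiff_flux hG hh i) i

include hs in
theorem Gam_symm (f h : R3 → ℝ) (x : R3) : Gam G f h x = Gam G h f x := by
  unfold Gam
  rw [Finset.sum_comm]
  refine Finset.sum_congr rfl fun i _ => Finset.sum_congr rfl fun j _ => ?_
  rw [hs]; ring

theorem Gam_mul {f g h : R3 → ℝ} (hf : Smooth f) (hg : Smooth g) (x : R3) :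
    Gam G (fun y => f y * g y) h x = f x * Gam G g h x + g x * Gam G f h x := by
  simp only [Gam, pd_mul hf hg, Finset.mul_sum, ← Finset.sum_add_distrib]
  refine Finset.sum_congr rfl fun i _ => Finset.sum_congr rfl fun j _ => ?_
  ring

theorem Gam_flux (f h : R3 → ℝ) (x : R3) : Gam G f h x = ∑ i, flux G i h x * pd i f x := by
  simp only [Gam, flux, Finset.sum_mul]
  refine Finset.sum_congr rfl fun i _ => Finset.sum_congr rfl fun j _ => ?_
  ring

include hG in
theorem pd_mul_flux {f h : R3 → ℝ} (hf : Smooth f) (hh : Smooth h) (x : R3) :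
    ∑ i, pd i (fun y => f y * flux G i h y) x = f x * Pop G h x + Gam G f h x := by
  simp only [pd_mul hf (contDiff_flux hG hh _), Gam_flux, Pop, Finset.mul_sum,
    Finset.sum_add_distrib]

theorem flux_mul {f h : R3 → ℝ} (hf : Smooth f) (hh : Smooth h) (i : Fin 3) :
    flux G i (fun y => f y * h y) = fun y => f y * flux G i h y + h y * flux G i f y := by
  ext x
  simp only [flux, pd_mul hf hh, Finset.mul_sum, ← Finset.sum_add_distrib]
  refine Finset.sum_congr rfl fun j _ => ?_
  ring

include hG hs in
theorem Pop_mul {f h : R3 → ℝ} (hf : Smooth f) (hh : Smooth h) (x : R3) :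
    Pop G (fun y => f y * h y) x = f x * Pop G h x + h x * Pop G f x + 2 * Gam G f h x := by
  have h1 := pd_mul_flux hG hf hh x
  have h2 := pd_mul_flux hG hh hf x
  rw [Gam_symm hs h f] at h2
  have : Pop G (fun y => f y * h y) x = ∑ i, pd i (fun y => f y * flux G i h y) x +
      ∑ i, pd i (fun y => h y * flux G i f y) x := by
    rw [← Finset.sum_add_distrib]
    refine Finset.sum_congr rfl fun i _ => ?_
    rw [flux_mul hf hh, pd_add (hf.mul (contDiff_flux hG hh i)) (hh.mul (contDiff_flux hG hf i))]
  rw [this, h1, h2]; ring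

include hG in
theorem integral_null {f h : R3 → ℝ} (hf : Smooth f) (hc : HasCompactSupport f)
    (hh : Smooth h) : Integrable (fun x => f x * Pop G h x + Gam G f h x) ∧
      ∫ x, (f x * Pop G h x + Gam G f h x) = 0 := by
  simp only [← pd_mul_flux hG hf hh]
  have hi : ∀ i, Integrable (fun x => pd i (fun y => f y * flux G i h y) x) := fun i =>
    (contDiff_pd (hf.mul (contDiff_flux hG hh i)) i).continuous.integrable_of_hasCompactSupport
      (hasCompactSupport_pd (hc.mul_right) i)
  refine ⟨integrable_finsetSum _ fun i _ => hi i, ?_⟩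
  rw [integral_finsetSum _ fun i _ => hi i]
  exact Finset.sum_eq_zero fun i _ => integral_pd (hf.mul (contDiff_flux hG hh i)) hc.mul_right i

theorem Gam_eq_zero {f h : R3 → ℝ} {x : R3} (hx : f =ᶠ[nhds x] 0) : Gam G f h x = 0 := by
  simp [Gam, pd_eq_zero hx]

theorem hasCompactSupport_Gam {f h : R3 → ℝ} (hc : HasCompactSupport f) :
    HasCompactSupport (Gam G f h) := by
  refine HasCompactSupport.intro hc (fun x hx => Gam_eq_zero ?_)
  exact notMem_tsupport_iff_eventuallyEq.mp hx

variable (G) in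
/-- The Hessian quadratic form of `w` for the carré du champ `Gam G`. -/
def Hess (w v : R3 → ℝ) : R3 → ℝ := fun x =>
  Gam G (Gam G w v) v x - 1 / 2 * Gam G (Gam G v v) w x

end Gamma

section Carleman
variable {G : Fin 3 → Fin 3 → R3 → ℝ} (hG : ∀ i j, Smooth (G i j))
  (hs : ∀ i j x, G i j x = G j i x)

theorem pd_sum {ι : Type*} (s : Finset ι) {f : ι → R3 → ℝ} (hf : ∀ k, Smooth (f k))
    (i : Fin 3) (x : R3) : pd i (fun y => ∑ k ∈ s, f k y) x = ∑ k ∈ s, pd i (f k) x := by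
  unfold pd
  rw [fderiv_fun_sum fun k _ => (hf k).diff x]
  simp

theorem sum_second_derivatives {A V : Fin 3 → Fin 3 → ℝ} (w v : Fin 3 → ℝ)
    (hA : ∀ i j, A i j = A j i) (hV : ∀ i j, V i j = V j i) :
    ∑ i, ∑ j, A i j * (∑ k, ∑ l, A k l * w k * V i l) * v j =
      1 / 2 * ∑ i, ∑ j, A i j * (∑ k, ∑ l, A k l * (V i k * v l + v k * V i l)) * w j := by
  simp only [Fin.sum_univ_three]
  rw [hA 1 0, hA 2 0, hA 2 1, hV 1 0, hV 2 0, hV 2 1]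
  ring

/-- The coefficients of the Hessian quadratic form of `w`. -/
def hessCoeff (G : Fin 3 → Fin 3 → R3 → ℝ) (w : R3 → ℝ) (l j : Fin 3) : R3 → ℝ := fun x =>
  ∑ i, ∑ k, (G i j x * pd i (fun y => G k l y * pd k w y) x -
    1 / 2 * (G i k x * pd i (G l j) x * pd k w x))

theorem sum_first_derivatives (A : Fin 3 → Fin 3 → ℝ) (B D : Fin 3 → Fin 3 → Fin 3 → ℝ)
    (w v : Fin 3 → ℝ) :
    ∑ i, ∑ j, A i j * (∑ k, ∑ l, B i k l * v l) * v j -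
      1 / 2 * ∑ i, ∑ j, A i j * (∑ k, ∑ l, D i k l * v k * v l) * w j =
    ∑ l, ∑ j, (∑ i, ∑ k, (A i j * B i k l - 1 / 2 * (A i k * D i l j * w k))) * v l * v j := by
  simp only [Fin.sum_univ_three]
  ring

include hG hs in
theorem Hess_eq {w v : R3 → ℝ} (hw : Smooth w) (hv : Smooth v) (x : R3) :
    Hess G w v x = ∑ l, ∑ j, hessCoeff G w l j x * pd l v x * pd j v x := by
  have e1 : ∀ i, pd i (Gam G w v) x = ∑ k, ∑ l, pd i (fun y => G k l y * pd k w y) x * pd l v x +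
      ∑ k, ∑ l, G k l x * pd k w x * pd i (pd l v) x := by
    intro i
    unfold Gam
    rw [pd_sum _ (fun k => ContDiff.sum fun l _ => ((hG k l).mul (contDiff_pd hw k)).mul
      (contDiff_pd hv l)), ← Finset.sum_add_distrib]
    refine Finset.sum_congr rfl fun k _ => ?_
    rw [pd_sum _ (fun l => ((hG k l).mul (contDiff_pd hw k)).mul (contDiff_pd hv l)),
      ← Finset.sum_add_distrib]
    refine Finset.sum_congr rfl fun l _ => ?_
    rw [pd_mul ((hG k l).mul (contDiff_pd hw k)) (contDiff_pd hv l)]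
    ring
  have e2 : ∀ i, pd i (Gam G v v) x = ∑ k, ∑ l, pd i (G k l) x * pd k v x * pd l v x +
      ∑ k, ∑ l, G k l x * (pd i (pd k v) x * pd l v x + pd k v x * pd i (pd l v) x) := by
    intro i
    unfold Gam
    rw [pd_sum _ (fun k => ContDiff.sum fun l _ => ((hG k l).mul (contDiff_pd hv k)).mul
      (contDiff_pd hv l)), ← Finset.sum_add_distrib]
    refine Finset.sum_congr rfl fun k _ => ?_
    rw [pd_sum _ (fun l => ((hG k l).mul (contDiff_pd hv k)).mul (contDiff_pd hv l)),
      ← Finset.sum_add_distrib]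
    refine Finset.sum_congr rfl fun l _ => ?_
    rw [pd_mul ((hG k l).mul (contDiff_pd hv k)) (contDiff_pd hv l),
      pd_mul (hG k l) (contDiff_pd hv k)]
    ring
  have h1 := sum_first_derivatives (fun i j => G i j x)
    (fun i k l => pd i (fun y => G k l y * pd k w y) x) (fun i k l => pd i (G k l) x)
    (fun k => pd k w x) (fun k => pd k v x)
  have h2 := sum_second_derivatives (A := fun i j => G i j x) (V := fun i j => pd i (pd j v) x)
    (fun k => pd k w x) (fun k => pd k v x) (fun i j => hs i j x) (fun i j => pd_comm hv i j x)
  unfold Hess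
  conv_lhs => unfold Gam
  change ∑ i, ∑ j, G i j x * pd i (Gam G w v) x * pd j v x -
    1 / 2 * ∑ i, ∑ j, G i j x * pd i (Gam G v v) x * pd j w x = _
  simp only [hessCoeff]
  rw [← h1]
  simp only [e1, e2, mul_add, add_mul, Finset.sum_add_distrib] at h2 ⊢
  linarith

/-- The vanishing of the integral of `f Ph + Γ(f, h)` is Green's formula. -/
def nul (G : Fin 3 → Fin 3 → R3 → ℝ) (f h : R3 → ℝ) : R3 → ℝ := fun x =>
  f x * Pop G h x + Gam G f h x

/-- The operator `P` conjugated by `exp (σ w²)`. -/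
def conjOp (G : Fin 3 → Fin 3 → R3 → ℝ) (w : R3 → ℝ) (σ : ℝ) (v : R3 → ℝ) : R3 → ℝ := fun x =>
  Pop G v x - 4 * σ * w x * Gam G w v x - σ * Pop G (fun y => w y * w y) x * v x +
    4 * σ ^ 2 * w x ^ 2 * Gam G w w x * v x

/-- The coefficient of `v²` in the Carleman estimate. -/
def carlCoeff (G : Fin 3 → Fin 3 → R3 → ℝ) (w : R3 → ℝ) (σ C : ℝ) : R3 → ℝ := fun x =>
  σ ^ 3 * w x ^ 2 * (32 * Gam G w w x ^ 2 + 16 * w x * Gam G (Gam G w w) w x -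
    32 * C * w x * Gam G w w x) - 16 * σ ^ 2 * C ^ 2 * w x ^ 2 -
    σ * (Pop G (Pop G (fun y => w y * w y)) x + 4 * C * Pop G w x)

/-- The divergence terms in the Carleman estimate. -/
def carlNull (G : Fin 3 → Fin 3 → R3 → ℝ) (w : R3 → ℝ) (σ C : ℝ) (v : R3 → ℝ) : R3 → ℝ := fun x =>
  -8 * σ * nul G (fun y => w y * Gam G w v y) v x
  + -2 * σ * nul G (fun y => Pop G (fun y => w y * w y) y * v y) v x
  + -8 * σ ^ 3 * nul G (fun y => (w y * w y) * (Gam G w w y * (v y * v y))) (fun y => w y * w y) x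
  + σ * nul G (fun y => v y * v y) (Pop G (fun y => w y * w y)) x
  + 2 * σ * nul G (Gam G v v) (fun y => w y * w y) x
  + -8 * σ * C * nul G (fun y => w y * v y) v x
  + 4 * σ * C * nul G (fun y => v y * v y) w x

include hG hs in
theorem carleman_pointwise {w v : R3 → ℝ} (hw : Smooth w) (hv : Smooth v)
    {σ C : ℝ} (hσ : 0 ≤ σ) (x : R3) (hH : -(C * w x * Gam G v v x) ≤ w x * Hess G w v x) :
    v x ^ 2 * carlCoeff G w σ C x + carlNull G w σ C v x ≤ conjOp G w σ v x ^ 2 := by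
  have hww := hw.mul hw
  have hvv := hv.mul hv
  have hwv := contDiff_Gam hG hw hv
  have hw2 := contDiff_Gam hG hw hw
  have hr := contDiff_Pop hG hww
  have s1 : ∀ f, Gam G f (fun y => w y * w y) x = 2 * w x * Gam G f w x := fun f => by
    rw [Gam_symm hs, Gam_mul hw hw, Gam_symm hs w f]; ring
  have hHd : Hess G w v x = Gam G (Gam G w v) v x - 1 / 2 * Gam G (Gam G v v) w x := rfl
  have key : conjOp G w σ v x ^ 2 = v x ^ 2 * carlCoeff G w σ C x + carlNull G w σ C v x +
      (Pop G v x + 4 * σ ^ 2 * w x ^ 2 * Gam G w w x * v x + 4 * σ * C * w x * v x) ^ 2 +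
      σ ^ 2 * (4 * w x * Gam G w v x + Pop G (fun y => w y * w y) x * v x) ^ 2 +
      8 * σ * Gam G w v x ^ 2 + 8 * σ * (w x * Hess G w v x + C * w x * Gam G v v x) := by
    simp only [carlNull, nul, conjOp, carlCoeff, s1]
    rw [Gam_mul hw hwv, Gam_mul hr hv, Gam_mul hww (hw2.mul hvv), Gam_mul hw2 hvv, Gam_mul hv hv,
      Gam_mul hv hv, Gam_mul hw hv, Gam_mul hw hw, hHd, Gam_symm hs v w,
      Gam_symm hs v (Pop G (fun y => w y * w y))]
    ring
  have h1 : 0 ≤ 8 * σ * (w x * Hess G w v x + C * w x * Gam G v v x) := by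
    apply mul_nonneg (by linarith); linarith
  rw [key]
  have h2 := sq_nonneg (Pop G v x + 4 * σ ^ 2 * w x ^ 2 * Gam G w w x * v x + 4 * σ * C * w x * v x)
  have h3 := mul_nonneg (sq_nonneg σ) (sq_nonneg (4 * w x * Gam G w v x +
    Pop G (fun y => w y * w y) x * v x))
  have h4 := mul_nonneg (mul_nonneg (by norm_num : (0 : ℝ) ≤ 8) hσ) (sq_nonneg (Gam G w v x))
  linarith

theorem integral_nul (hG : ∀ i j, Smooth (G i j)) (c : ℝ) {f h : R3 → ℝ}
    (hf : Smooth f) (hc : HasCompactSupport f)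
    (hh : Smooth h) : Integrable (fun x => c * nul G f h x) ∧ ∫ x, c * nul G f h x = 0 := by
  obtain ⟨h1, h2⟩ := integral_null hG hf hc hh
  refine ⟨h1.const_mul c, ?_⟩
  rw [integral_const_mul]
  exact mul_eq_zero_of_right _ h2

theorem integral_add_zero {f g : R3 → ℝ} (hf : Integrable f ∧ ∫ x, f x = 0)
    (hg : Integrable g ∧ ∫ x, g x = 0) :
    Integrable (fun x => f x + g x) ∧ ∫ x, (f x + g x) = 0 :=
  ⟨hf.1.add hg.1, by rw [integral_add hf.1 hg.1, hf.2, hg.2, add_zero]⟩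

include hG in
theorem integral_carlNull {w v : R3 → ℝ} (hw : Smooth w) (hv : Smooth v)
    (hc : HasCompactSupport v) (σ C : ℝ) :
    Integrable (carlNull G w σ C v) ∧ ∫ x, carlNull G w σ C v x = 0 := by
  have hww := hw.mul hw
  have hvv := hv.mul hv
  have hwv := contDiff_Gam hG hw hv
  have hw2 := contDiff_Gam hG hw hw
  have hr := contDiff_Pop hG hww
  have cg : HasCompactSupport (Gam G w v) := by
    refine HasCompactSupport.intro hc (fun x hx => ?_)
    have := notMem_tsupport_iff_eventuallyEq.mp hx
    simp [Gam, pd_eq_zero this]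
  unfold carlNull
  refine integral_add_zero (integral_add_zero (integral_add_zero (integral_add_zero
    (integral_add_zero (integral_add_zero ?_ ?_) ?_) ?_) ?_) ?_) ?_
  · exact integral_nul hG _ (hw.mul hwv) cg.mul_left hv
  · exact integral_nul hG _ (hr.mul hv) hc.mul_left hv
  · exact integral_nul hG _ (hww.mul (hw2.mul hvv)) (hc.mul_left (f := v)).mul_left.mul_left hww
  · exact integral_nul hG _ hvv hc.mul_left hr
  · exact integral_nul hG _ (contDiff_Gam hG hv hv) (hasCompactSupport_Gam hc) hww
  · exact integral_nul hG _ (hw.mul hv) hc.mul_left hv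
  · exact integral_nul hG _ hvv hc.mul_left hw

include hG hs in
/-- Carleman estimate. -/
theorem carleman {w v : R3 → ℝ} (hw : Smooth w) (hv : Smooth v)
    (hc : HasCompactSupport v) {σ C c : ℝ} (hσ : 0 ≤ σ)
    (hw0 : ∀ x ∈ tsupport v, 0 ≤ w x)
    (hH : ∀ x ∈ tsupport v, |Hess G w v x| ≤ C * Gam G v v x)
    (hcc : ∀ x ∈ tsupport v, c ≤ carlCoeff G w σ C x) :
    c * ∫ x, v x ^ 2 ≤ ∫ x, conjOp G w σ v x ^ 2 := by
  have h0 := integral_carlNull hG hw hv hc σ C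
  have hconj : Smooth (conjOp G w σ v) := by
    have hww := hw.mul hw
    have := contDiff_Pop hG hv
    have := contDiff_Pop hG hww
    have := contDiff_Gam hG hw hv
    have := contDiff_Gam hG hw hw
    unfold conjOp
    fun_prop
  have hcconj : HasCompactSupport (fun x => conjOp G w σ v x ^ 2) := by
    refine HasCompactSupport.intro hc (fun x hx => ?_)
    have h1 := notMem_tsupport_iff_eventuallyEq.mp hx
    have h2 : ∀ i, flux G i v =ᶠ[nhds x] 0 := fun i => by
      filter_upwards [h1.eventuallyEq_nhds] with y hy
      simp [flux, pd_eq_zero hy]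
    have h3 : v x = 0 := h1.eq_of_nhds
    simp [conjOp, Gam, pd_eq_zero h1, Pop, pd_eq_zero (h2 _), h3]
  have hint : Integrable (fun x => conjOp G w σ v x ^ 2) :=
    (hconj.continuous.pow 2).integrable_of_hasCompactSupport hcconj
  have hvint : Integrable (fun x => c * v x ^ 2) := by
    apply Integrable.const_mul
    have h1 : HasCompactSupport (fun x => v x ^ 2) := by
      simp only [pow_two]; exact hc.mul_left
    exact (hv.continuous.pow 2).integrable_of_hasCompactSupport h1
  have hle : ∀ x, c * v x ^ 2 + carlNull G w σ C v x ≤ conjOp G w σ v x ^ 2 := by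
    intro x
    by_cases hx : x ∈ tsupport v
    · have h1 := carleman_pointwise hG hs hw hv (C := C) hσ x (by
        have h2 := neg_le_of_abs_le (hH x hx)
        nlinarith [mul_le_mul_of_nonneg_left h2 (hw0 x hx)])
      nlinarith [mul_le_mul_of_nonneg_left (hcc x hx) (sq_nonneg (v x))]
    · have h1 := notMem_tsupport_iff_eventuallyEq.mp hx
      have h3 : v x = 0 := h1.eq_of_nhds
      have h4 : Gam G v v =ᶠ[nhds x] 0 := by
        filter_upwards [h1.eventuallyEq_nhds] with y hy
        exact Gam_eq_zero hy
      have h5 : Gam G w v =ᶠ[nhds x] 0 := by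
        filter_upwards [h1.eventuallyEq_nhds] with y hy
        simp [Gam, pd_eq_zero hy]
      have h2 := carleman_pointwise hG hs hw hv (C := C) hσ x (by
        simp [Hess, Gam_eq_zero h4, Gam_eq_zero h5, h4.eq_of_nhds])
      simp [h3] at h2 ⊢
      exact h2
  have := integral_mono (hvint.add h0.1) hint hle
  simp only [Pi.add_apply] at this
  rw [integral_add hvint h0.1, h0.2, add_zero, integral_const_mul] at this
  exact this

end Carleman

open Metric

section UC
variable {G : Fin 3 → Fin 3 → R3 → ℝ}

theorem exists_form_bound {M : Fin 3 → Fin 3 → R3 → ℝ} (hG : ∀ i j, Continuous (G i j))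
    (hM : ∀ i j, Continuous (M i j))
    (hp : ∀ x (ξ : Fin 3 → ℝ), ξ ≠ 0 → 0 < ∑ i, ∑ j, G i j x * ξ i * ξ j) {K : Set R3}
    (hK : IsCompact K) : ∃ C, ∀ x ∈ K, ∀ ξ : Fin 3 → ℝ,
      |∑ i, ∑ j, M i j x * ξ i * ξ j| ≤ C * ∑ i, ∑ j, G i j x * ξ i * ξ j := by
  have hc : IsCompact (K ×ˢ sphere (0 : Fin 3 → ℝ) 1) := hK.prod (isCompact_sphere _ _)
  obtain ⟨C, hC⟩ := hc.exists_bound_of_continuousOn (f := fun p : R3 × (Fin 3 → ℝ) =>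
    (∑ i, ∑ j, M i j p.1 * p.2 i * p.2 j) / ∑ i, ∑ j, G i j p.1 * p.2 i * p.2 j) (by
      apply ContinuousOn.div
      · exact Continuous.continuousOn (by fun_prop)
      · exact Continuous.continuousOn (by fun_prop)
      · rintro ⟨x, ξ⟩ ⟨_, hξ⟩
        refine (hp x ξ ?_).ne'
        rintro rfl
        simp at hξ)
  refine ⟨C, fun x hx ξ => ?_⟩
  rcases eq_or_ne ξ 0 with rfl | h0
  · simp
  have hn : ‖ξ‖ ≠ 0 := norm_ne_zero_iff.mpr h0
  have h1 := hC (x, ‖ξ‖⁻¹ • ξ) ⟨hx, by simp [norm_smul, hn]⟩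
  have hs : ∀ A : Fin 3 → Fin 3 → R3 → ℝ, ∑ i, ∑ j, A i j x * (‖ξ‖⁻¹ • ξ) i * (‖ξ‖⁻¹ • ξ) j =
      (‖ξ‖⁻¹ ^ 2) * ∑ i, ∑ j, A i j x * ξ i * ξ j := fun A => by
    simp only [Pi.smul_apply, smul_eq_mul, Finset.mul_sum]
    refine Finset.sum_congr rfl fun i _ => Finset.sum_congr rfl fun j _ => ?_
    ring
  simp only [hs] at h1
  rw [mul_div_mul_left _ _ (by positivity), Real.norm_eq_abs, abs_div,
    abs_of_pos (hp x ξ h0), div_le_iff₀ (hp x ξ h0)] at h1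
  exact h1

variable (hG : ∀ i j, Smooth (G i j)) (hs : ∀ i j x, G i j x = G j i x)
  (hp : ∀ x (ξ : Fin 3 → ℝ), ξ ≠ 0 → 0 < ∑ i, ∑ j, G i j x * ξ i * ξ j)

include hG hs hp in
theorem exists_hess_bound {w : R3 → ℝ} (hw : Smooth w) {K : Set R3} (hK : IsCompact K) :
    ∃ C, ∀ x ∈ K, ∀ v, Smooth v → |Hess G w v x| ≤ C * Gam G v v x := by
  obtain ⟨C, hC⟩ := exists_form_bound (M := hessCoeff G w) (fun i j => (hG i j).continuous)
    (fun i j => by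
      unfold hessCoeff
      refine continuous_finsetSum _ fun k _ => continuous_finsetSum _ fun l _ => ?_
      have h1 := (contDiff_pd ((hG l i).mul (contDiff_pd hw l)) k).continuous
      have h2 := (contDiff_pd (hG i j) k).continuous
      have h3 := (contDiff_pd hw l).continuous
      have h4 := (hG k j).continuous
      have h5 := (hG k l).continuous
      fun_prop) hp hK
  refine ⟨C, fun x hx v hv => ?_⟩
  rw [Hess_eq hG hs hw hv]
  exact hC x hx (fun i => pd i v x)

include hG hs in
theorem conjOp_exp {w h : R3 → ℝ} (hw : Smooth w) (hh : Smooth h) (σ : ℝ) (x : R3) :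
    conjOp G w σ (fun y => Real.exp (σ * (w y * w y)) * h y) x =
      Real.exp (σ * (w x * w x)) * Pop G h x := by
  have hww := hw.mul hw
  have he : Smooth fun y => Real.exp (σ * (w y * w y)) := (contDiff_const.mul hww).exp
  have hpe : ∀ i y, pd i (fun y => Real.exp (σ * (w y * w y))) y =
      Real.exp (σ * (w y * w y)) * (σ * pd i (fun y => w y * w y) y) := by
    intro i y
    have hd : DifferentiableAt ℝ (fun y => w y * w y) y := hww.diff y
    unfold pd
    rw [fderiv_exp (hd.const_mul σ), fderiv_const_mul hd]
    simp
  have hge : ∀ f y, Gam G (fun y => Real.exp (σ * (w y * w y))) f y =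
      Real.exp (σ * (w y * w y)) * (σ * Gam G (fun y => w y * w y) f y) := by
    intro f y
    simp only [Gam, hpe, Finset.mul_sum]
    refine Finset.sum_congr rfl fun i _ => Finset.sum_congr rfl fun j _ => ?_
    ring
  have hfl : ∀ i, flux G i (fun y => Real.exp (σ * (w y * w y))) =
      fun y => (Real.exp (σ * (w y * w y))) * (σ * flux G i (fun y => w y * w y) y) := by
    intro i
    ext y
    simp only [flux, hpe, Finset.mul_sum]
    refine Finset.sum_congr rfl fun j _ => ?_
    ring
  have hPe : Pop G (fun y => Real.exp (σ * (w y * w y))) x = Real.exp (σ * (w x * w x)) *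
      (σ * Pop G (fun y => w y * w y) x +
        σ ^ 2 * Gam G (fun y => w y * w y) (fun y => w y * w y) x) := by
    have h1 : ∀ i, pd i (flux G i (fun y => Real.exp (σ * (w y * w y)))) x =
        Real.exp (σ * (w x * w x)) * (σ * pd i (flux G i (fun y => w y * w y)) x) +
        Real.exp (σ * (w x * w x)) * (σ ^ 2 * (flux G i (fun y => w y * w y) x *
          pd i (fun y => w y * w y) x)) := by
      intro i
      rw [hfl, pd_mul he (contDiff_const.mul (contDiff_flux hG hww i)), hpe,
        pd_mul contDiff_const (contDiff_flux hG hww i)]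
      have : pd i (fun _ : R3 => σ) x = 0 := by simp [pd]
      rw [this]; ring
    rw [Gam_flux]
    simp only [Pop, h1, Finset.sum_add_distrib, ← Finset.mul_sum]
    ring
  have s1 : ∀ f, Gam G (fun y => w y * w y) f x = 2 * w x * Gam G w f x := fun f => by
    rw [Gam_mul hw hw]; ring
  rw [conjOp, Pop_mul hG hs he hh, hPe, hge, Gam_symm hs w, Gam_mul he hh, hge, s1, s1, Gam_symm hs w,
    s1, Gam_symm hs h w]
  ring

theorem pd_const_add (T : ℝ) (f : R3 → ℝ) (i : Fin 3) : pd i (fun x => T + f x) = pd i f := by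
  ext x; simp [pd]

theorem Gam_const_add (T : ℝ) (f h : R3 → ℝ) : Gam G (fun x => T + f x) h = Gam G f h := by
  unfold Gam; simp only [pd_const_add]

theorem Gam_const_add_right (T : ℝ) (f h : R3 → ℝ) : Gam G f (fun x => T + h x) = Gam G f h := by
  unfold Gam; simp only [pd_const_add]

theorem Hess_const_add (T : ℝ) (w v : R3 → ℝ) : Hess G (fun x => T + w x) v = Hess G w v := by
  unfold Hess; simp only [Gam_const_add, Gam_const_add_right]

set_option maxHeartbeats 1000000 in
include hG hs hp in
/-- Unique continuation across a sphere. -/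
theorem unique_continuation_local {h V : R3 → ℝ} (hh : Smooth h) (hV : Continuous V)
    (hPh : ∀ x, Pop G h x = V x * h x) {z q : R3} {r : ℝ} (hr : 0 < r) (hq : dist q z = r)
    (hz : ∀ x ∈ ball z r, h x = 0) : ∃ N : Set R3, IsOpen N ∧ q ∈ N ∧ ∀ x ∈ N, h x = 0 := by
  set z' : R3 := (1 / 2 : ℝ) • (z + q) with hz'
  set w0 : R3 → ℝ := fun x => -‖x - z'‖ ^ 2 with hw0
  have hw0s : Smooth w0 := ((contDiff_id.sub contDiff_const).norm_sq ℝ).neg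
  have hqz : q - z' = (1 / 2 : ℝ) • (q - z) := by rw [hz']; module
  have hnq : ‖q - z'‖ = r / 2 := by
    rw [hqz, norm_smul, ← dist_eq_norm, hq]; norm_num; ring
  -- points away from the ball have smaller weight
  have hlt : ∀ x, x ∉ ball z r → x ≠ q → w0 x < w0 q := by
    intro x hx hxq
    simp only [mem_ball, not_lt, dist_eq_norm] at hx
    have h1 : x - z = (x - q) + (q - z) := by abel
    have h2 : x - z' = (x - q) + (1 / 2 : ℝ) • (q - z) := by rw [hz']; module
    have h3 := norm_add_sq_real (x - q) (q - z)
    have h4 := norm_add_sq_real (x - q) ((1 / 2 : ℝ) • (q - z))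
    rw [← h1] at h3
    rw [← h2, inner_smul_right, norm_smul] at h4
    have h5 : ‖q - z‖ = r := by rw [← dist_eq_norm, hq]
    have h6 : 0 < ‖x - q‖ := norm_pos_iff.mpr (sub_ne_zero.mpr hxq)
    simp only [hw0, hnq]
    rw [h5] at h3 h4
    norm_num at h4
    nlinarith [sq_nonneg (‖x - z‖ - r)]
  set q0 := Gam G w0 w0 with hq0
  have hq0s : Smooth q0 := contDiff_Gam hG hw0s hw0s
  have hq0pos : 0 < q0 q := by
    refine hp q (fun i => pd i w0 q) fun hcon => ?_
    have h1 : ∀ i, pd i w0 q = -2 * (q - z') i := by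
      intro i
      have hd : HasFDerivAt (fun x : R3 => ‖x - z'‖ ^ 2)
          (2 • (innerSL ℝ (q - z')).comp (ContinuousLinearMap.id ℝ R3)) q :=
        ((hasFDerivAt_id q).sub_const z').norm_sq
      unfold pd
      rw [(show HasFDerivAt w0 _ q from hd.neg).fderiv]
      simp [EuclideanSpace.inner_single_right]
    have h2 : q - z' = 0 := by
      ext i
      have := congrFun hcon i
      simp only [h1] at this
      simpa using this
    rw [h2, norm_zero] at hnq
    linarith
  obtain ⟨C, hC⟩ := exists_hess_bound hG hs hp hw0s (isCompact_closedBall q 1)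
  set Λ : ℝ → R3 → ℝ := fun T x => 32 * q0 x ^ 2 + 16 * (T + w0 x) * Gam G q0 w0 x -
    32 * C * (T + w0 x) * q0 x with hΛ
  have hGq : Continuous (Gam G q0 w0) := (contDiff_Gam hG hq0s hw0s).continuous
  have hq0c := hq0s.continuous
  have hw0c := hw0s.continuous
  obtain ⟨T, hT1, hT2⟩ : ∃ T, 0 < T + w0 q ∧ 0 < Λ T q := by
    have hcont : ContinuousAt (fun T => Λ T q) (-w0 q) := by
      simp only [hΛ]; fun_prop
    have hpos : 0 < Λ (-w0 q) q := by simp [hΛ]; positivity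
    obtain ⟨δ, hδ, hball⟩ := Metric.eventually_nhds_iff.mp (hcont.eventually (lt_mem_nhds hpos))
    refine ⟨-w0 q + δ / 2, by linarith, hball ?_⟩
    rw [Real.dist_eq, add_sub_cancel_left, abs_of_pos (by linarith)]; linarith
  set w : R3 → ℝ := fun x => T + w0 x with hw
  have hws : Smooth w := contDiff_const.add hw0s
  have hwc := hws.continuous
  have hΛc : Continuous (Λ T) := by simp only [hΛ]; fun_prop
  obtain ⟨ε, hε, hεb⟩ : ∃ ε > 0, ∀ x ∈ closedBall q ε, x ∈ closedBall q 1 ∧ 0 < w x ∧ 0 < Λ T x := by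
    have h1 : ∀ᶠ x in nhds q, x ∈ closedBall q 1 ∧ 0 < w x ∧ 0 < Λ T x := by
      filter_upwards [closedBall_mem_nhds q one_pos,
        hwc.continuousAt.eventually (lt_mem_nhds (by simp only [hw]; exact hT1)),
        hΛc.continuousAt.eventually (lt_mem_nhds hT2)] with x h1 h2 h3 using ⟨h1, h2, h3⟩
    obtain ⟨ε, hε, hb⟩ := Metric.eventually_nhds_iff_ball.mp h1
    exact ⟨ε / 2, by linarith, fun x hx => hb x (closedBall_subset_ball (by linarith) hx)⟩
  have hKc := isCompact_closedBall q ε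
  have hne : (closedBall q ε).Nonempty := ⟨q, mem_closedBall_self hε.le⟩
  obtain ⟨m, hm, hmb⟩ : ∃ m > 0, ∀ x ∈ closedBall q ε, m ≤ w x ^ 2 * Λ T x := by
    obtain ⟨x0, hx0, hmin⟩ := hKc.exists_isMinOn hne
      ((hwc.pow 2).mul hΛc).continuousOn
    exact ⟨_, mul_pos (pow_pos (hεb x0 hx0).2.1 2) (hεb x0 hx0).2.2, fun x hx => hmin hx⟩
  have hww := hws.mul hws
  obtain ⟨A, hA⟩ := hKc.exists_bound_of_continuousOn
    (f := fun x => 16 * C ^ 2 * w x ^ 2) (by fun_prop)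
  obtain ⟨B, hB⟩ := hKc.exists_bound_of_continuousOn
    (f := fun x => Pop G (Pop G (fun y => w y * w y)) x + 4 * C * Pop G w x) (by
      have h1 := (contDiff_Pop hG (contDiff_Pop hG hww)).continuous
      have h2 := (contDiff_Pop hG hws).continuous
      fun_prop)
  obtain ⟨Vm, hVm⟩ := hKc.exists_bound_of_continuousOn hV.continuousOn
  have hcoef : ∀ σ, 1 ≤ σ → ∀ x ∈ closedBall q ε,
      σ ^ 3 * m - σ ^ 2 * (A + B) ≤ carlCoeff G w σ C x := by
    intro σ hσ x hx
    have h1 := hmb x hx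
    have h2 := le_of_abs_le (hA x hx)
    have h3 := le_of_abs_le (hB x hx)
    have h3' := (norm_nonneg _).trans (hB x hx)
    have h4 : carlCoeff G w σ C x = σ ^ 3 * (w x ^ 2 * Λ T x) - σ ^ 2 * (16 * C ^ 2 * w x ^ 2) -
        σ * (Pop G (Pop G (fun y => w y * w y)) x + 4 * C * Pop G w x) := by
      have e1 : Gam G w w = q0 := by rw [hw, Gam_const_add, Gam_const_add_right]
      have e2 : Gam G q0 w = Gam G q0 w0 := by rw [hw, Gam_const_add_right]
      rw [carlCoeff, e1, e2, hΛ]; ring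
    rw [h4]
    have h5 : σ ^ 3 * m ≤ σ ^ 3 * (w x ^ 2 * Λ T x) := by gcongr
    have h6 : σ ^ 2 * (16 * C ^ 2 * w x ^ 2) ≤ σ ^ 2 * A := by gcongr
    have h7 : σ * (Pop G (Pop G (fun y => w y * w y)) x + 4 * C * Pop G w x) ≤ σ * B := by gcongr
    have h8 : σ * B ≤ σ ^ 2 * B := by gcongr; nlinarith
    linarith
  -- the cutoff function
  let χ : ContDiffBump q := ⟨ε / 2, ε, by linarith, by linarith⟩
  have hχs : Smooth (χ : R3 → ℝ) := χ.contDiff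
  have hχsupp : tsupport (χ : R3 → ℝ) = closedBall q ε := χ.tsupport_eq
  have hχc : HasCompactSupport (χ : R3 → ℝ) := χ.hasCompactSupport
  set E : R3 → ℝ := fun x => h x * Pop G χ x + 2 * Gam G χ h x with hE
  have hEs : Smooth E := (hh.mul (contDiff_Pop hG hχs)).add
    (contDiff_const.mul (contDiff_Gam hG hχs hh))
  have flux_zero : ∀ {f : R3 → ℝ} {x : R3}, f =ᶠ[nhds x] 0 → Pop G f x = 0 := by
    intro f x h1
    have h2 : ∀ i, flux G i f =ᶠ[nhds x] 0 := fun i => by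
      filter_upwards [h1.eventuallyEq_nhds] with y hy
      simp [flux, pd_eq_zero hy]
    simp [Pop, pd_eq_zero (h2 _)]
  have hE0 : ∀ x, E x ≠ 0 → x ∈ closedBall q ε ∧ x ∉ ball q (ε / 2) ∧ x ∉ ball z r := by
    intro x hx
    refine ⟨?_, fun hx2 => hx ?_, fun hx2 => hx ?_⟩
    · by_contra hcon
      rw [← hχsupp] at hcon
      have h1 := notMem_tsupport_iff_eventuallyEq.mp hcon
      exact hx (by simp [hE, flux_zero h1, Gam_eq_zero h1])
    · have h1 : (χ : R3 → ℝ) =ᶠ[nhds x] fun _ => 1 := by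
        filter_upwards [isOpen_ball.mem_nhds hx2] with y hy
        exact χ.one_of_mem_closedBall (ball_subset_closedBall hy)
      have h2 : ∀ᶠ y in nhds x, ∀ i, pd i (χ : R3 → ℝ) y = 0 := by
        filter_upwards [h1.eventuallyEq_nhds] with y hy
        intro i
        rw [pd_congr hy]; simp [pd]
      have h3 : ∀ i, flux G i (χ : R3 → ℝ) =ᶠ[nhds x] 0 := fun i => by
        filter_upwards [h2] with y hy
        simp [flux, hy]
      simp [hE, Pop, pd_eq_zero (h3 _), Gam, h2.self_of_nhds]
    · have h1 : h =ᶠ[nhds x] 0 := by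
        filter_upwards [isOpen_ball.mem_nhds hx2] with y hy using hz y hy
      have h2 : h x = 0 := h1.eq_of_nhds
      simp [hE, h2, Gam, pd_eq_zero h1]
  have hwq : w0 q + T = w q := by simp [hw, add_comm]
  obtain ⟨s1, hs1, hs1b⟩ : ∃ s1 < w q ^ 2, ∀ x, E x ≠ 0 → w x ^ 2 ≤ s1 := by
    have hK' : IsCompact ((closedBall q ε \ ball q (ε / 2)) \ ball z r) :=
      (hKc.diff isOpen_ball).diff isOpen_ball
    rcases ((closedBall q ε \ ball q (ε / 2)) \ ball z r).eq_empty_or_nonempty with he | hne'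
    · refine ⟨w q ^ 2 - 1, by linarith, fun x hx => ?_⟩
      have : x ∈ (closedBall q ε \ ball q (ε / 2)) \ ball z r :=
        ⟨⟨(hE0 x hx).1, (hE0 x hx).2.1⟩, (hE0 x hx).2.2⟩
      rw [he] at this; exact this.elim
    · obtain ⟨x0, hx0, hmax⟩ := hK'.exists_isMaxOn hne' (hwc.pow 2).continuousOn
      refine ⟨w x0 ^ 2, ?_, fun x hx => hmax ⟨⟨(hE0 x hx).1, (hE0 x hx).2.1⟩, (hE0 x hx).2.2⟩⟩
      have h1 : x0 ≠ q := by
        rintro rfl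
        exact hx0.1.2 (mem_ball_self (by linarith))
      have h2 := hlt x0 hx0.2 h1
      have h3 := (hεb x0 hx0.1.1).2.1
      have h4 : w x0 < w q := by simp only [hw]; linarith
      nlinarith
  obtain ⟨s2, hs12, hs2⟩ := exists_between hs1
  set N : Set R3 := ball q (ε / 2) ∩ {x | s2 < w x ^ 2} with hN
  have hNo : IsOpen N := isOpen_ball.inter (isOpen_lt continuous_const (hwc.pow 2))
  have hqN : q ∈ N := ⟨mem_ball_self (by linarith), hs2⟩
  set I := ∫ x in N, h x ^ 2 with hI
  have hEc : HasCompactSupport (fun x => E x ^ 2) := by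
    refine HasCompactSupport.intro hKc fun x hx => ?_
    by_contra hcon
    exact hx (hE0 x (fun h0 => hcon (by simp [h0]))).1
  have hχh : Smooth fun x => χ x * h x := hχs.mul hh
  have hNint : IntegrableOn (fun x => h x ^ 2) N :=
    ((hh.continuous.pow 2).continuousOn.integrableOn_compact hKc).mono_set
      (fun x hx => closedBall_subset_closedBall (by linarith) (ball_subset_closedBall hx.1))
  have main : ∀ σ, 1 ≤ σ → 1 ≤ σ ^ 3 * m - σ ^ 2 * (A + B) - 2 * Vm ^ 2 →
      Real.exp (2 * σ * (s2 - s1)) * I ≤ 2 * ∫ x, E x ^ 2 := by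
    intro σ hσ hbig
    set v : R3 → ℝ := fun y => Real.exp (σ * (w y * w y)) * (χ y * h y) with hv
    have hvs : Smooth v := ((contDiff_const.mul hww).exp).mul hχh
    have hvc : HasCompactSupport v := (hχc.mul_right).mul_left
    have hvsub : tsupport v ⊆ closedBall q ε := by
      rw [← hχsupp]
      exact (tsupport_mul_subset_right).trans tsupport_mul_subset_left
    have h1 := carleman hG hs hws hvs hvc (σ := σ) (C := C) (by linarith)
      (fun x hx => (hεb x (hvsub hx)).2.1.le)
      (fun x hx => by
        rw [hw, Hess_const_add]; exact hC x (hεb x (hvsub hx)).1 v hvs)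
      (fun x hx => hcoef σ hσ x (hvsub hx))
    have hvint : Integrable (fun x => v x ^ 2) := by
      have h2 : HasCompactSupport (fun x => v x ^ 2) := by
        simp only [pow_two]; exact hvc.mul_left
      exact (hvs.continuous.pow 2).integrable_of_hasCompactSupport h2
    have hEint : Integrable (fun x => E x ^ 2) :=
      (hEs.continuous.pow 2).integrable_of_hasCompactSupport hEc
    have h2 : ∫ x, conjOp G w σ v x ^ 2 ≤ 2 * Vm ^ 2 * (∫ x, v x ^ 2) +
        2 * Real.exp (2 * σ * s1) * ∫ x, E x ^ 2 := by
      rw [← integral_const_mul, ← integral_const_mul, ← integral_add (hvint.const_mul _)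
        (hEint.const_mul _)]
      refine integral_mono_of_nonneg (Filter.Eventually.of_forall fun x => sq_nonneg _)
        ((hvint.const_mul _).add (hEint.const_mul _)) (Filter.Eventually.of_forall fun x => ?_)
      simp only
      have e1 : conjOp G w σ v x = Real.exp (σ * (w x * w x)) * (V x * (χ x * h x) + E x) := by
        rw [hv, conjOp_exp hG hs hws hχh, Pop_mul hG hs hχs hh, hPh, hE]; ring
      have e2 : conjOp G w σ v x = V x * v x + Real.exp (σ * (w x * w x)) * E x := by
        rw [e1, hv]; ring
      have e3 : (Real.exp (σ * (w x * w x)) * E x) ^ 2 ≤ Real.exp (2 * σ * s1) * E x ^ 2 := by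
        rcases eq_or_ne (E x) 0 with h0 | h0
        · simp [h0]
        · rw [mul_pow, ← Real.exp_nat_mul]
          refine mul_le_mul_of_nonneg_right (Real.exp_le_exp.mpr ?_) (sq_nonneg _)
          have := mul_le_mul_of_nonneg_left (hs1b x h0) (by linarith : (0 : ℝ) ≤ σ)
          push_cast
          linarith
      have e4 : (V x * v x) ^ 2 ≤ Vm ^ 2 * v x ^ 2 := by
        rw [mul_pow]
        by_cases hx : x ∈ closedBall q ε
        · have h3 := hVm x hx
          rw [Real.norm_eq_abs] at h3
          exact mul_le_mul_of_nonneg_right (sq_le_sq.mpr (h3.trans (le_abs_self _))) (sq_nonneg _)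
        · have : v x = 0 := by
            by_contra hcon
            exact hx (hvsub (subset_tsupport _ hcon))
          simp [this]
      rw [e2]
      nlinarith [sq_nonneg (V x * v x - Real.exp (σ * (w x * w x)) * E x)]
    have h3 : ∫ x, v x ^ 2 ≤ 2 * Real.exp (2 * σ * s1) * ∫ x, E x ^ 2 := by
      have h4 : 0 ≤ ∫ x, v x ^ 2 := integral_nonneg fun x => sq_nonneg _
      have h5 := mul_le_mul_of_nonneg_right hbig h4
      linarith
    have h5 : Real.exp (2 * σ * s2) * I ≤ ∫ x, v x ^ 2 := by
      rw [hI, ← integral_const_mul]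
      refine le_trans ?_ (setIntegral_le_integral hvint (s := N)
        (Filter.Eventually.of_forall fun x => sq_nonneg _))
      refine setIntegral_mono_on (hNint.const_mul _) hvint.integrableOn hNo.measurableSet ?_
      intro x hx
      have e1 : χ x = 1 := χ.one_of_mem_closedBall (ball_subset_closedBall hx.1)
      simp only [hv, e1, one_mul]
      rw [mul_pow, ← Real.exp_nat_mul]
      have : s2 < w x ^ 2 := hx.2
      have := mul_le_mul_of_nonneg_left this.le (by linarith : (0 : ℝ) ≤ σ)
      refine mul_le_mul_of_nonneg_right (Real.exp_le_exp.mpr ?_) (sq_nonneg _)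
      push_cast
      linarith
    have h6 : Real.exp (2 * σ * s2) = Real.exp (2 * σ * (s2 - s1)) * Real.exp (2 * σ * s1) := by
      rw [← Real.exp_add]; ring_nf
    rw [h6] at h5
    have h7 := h5.trans h3
    have h8 := Real.exp_pos (2 * σ * s1)
    have h9 : Real.exp (2 * σ * s1) * (Real.exp (2 * σ * (s2 - s1)) * I) ≤
        Real.exp (2 * σ * s1) * (2 * ∫ x, E x ^ 2) := by linarith
    exact le_of_mul_le_mul_left h9 h8
  have hI0 : I ≤ 0 := by
    by_contra hIpos
    push Not at hIpos
    have ht : Filter.Tendsto (fun σ : ℝ => Real.exp (2 * σ * (s2 - s1)) * I) Filter.atTop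
        Filter.atTop := by
      apply Filter.Tendsto.atTop_mul_const hIpos
      apply Real.tendsto_exp_atTop.comp
      apply Filter.Tendsto.atTop_mul_const (by linarith)
      exact Filter.tendsto_id.const_mul_atTop (by norm_num)
    have hb : ∀ᶠ σ : ℝ in Filter.atTop, 1 ≤ σ ^ 3 * m - σ ^ 2 * (A + B) - 2 * Vm ^ 2 := by
      filter_upwards [Filter.eventually_ge_atTop (1 : ℝ),
        Filter.eventually_ge_atTop ((A + B + 1 + 2 * Vm ^ 2) / m)] with σ h1 h2
      rw [div_le_iff₀ hm] at h2
      have h3 : 0 ≤ Vm ^ 2 := sq_nonneg _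
      have h4 : 1 ≤ σ ^ 2 := by nlinarith
      nlinarith [mul_le_mul_of_nonneg_left h2 (sq_nonneg σ)]
    obtain ⟨σ, h1, h2, h3⟩ := ((Filter.eventually_ge_atTop (1 : ℝ)).and (hb.and
      (ht.eventually_gt_atTop (2 * ∫ x, E x ^ 2)))).exists
    exact absurd (main σ h1 h2) (not_le.mpr h3)
  have hI1 : I = 0 := le_antisymm hI0 (integral_nonneg fun x => sq_nonneg _)
  have hae : (fun x => h x ^ 2) =ᵐ[volume.restrict N] 0 :=
    (integral_eq_zero_iff_of_nonneg (fun x => sq_nonneg _) hNint).mp hI1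
  have heq := Measure.eqOn_open_of_ae_eq hae hNo (hh.continuous.pow 2).continuousOn
    continuousOn_const
  exact ⟨N, hNo, hqN, fun x hx => by simpa using heq hx⟩

include hG hs hp in
/-- Weak unique continuation for elliptic operators in divergence form on `ℝ³`. -/
theorem unique_continuation {h V : R3 → ℝ} (hh : Smooth h) (hV : Continuous V)
    (hPh : ∀ x, Pop G h x = V x * h x) {O : Set R3} (hO : IsOpen O) (hne : O.Nonempty)
    (hz : ∀ x ∈ O, h x = 0) (x : R3) : h x = 0 := by
  set Z := interior {x | h x = 0} with hZ
  by_cases hZu : Zᶜ = ∅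
  · have : x ∈ Z := by rw [Set.compl_empty_iff] at hZu; rw [hZu]; trivial
    exact (interior_subset this : x ∈ {x | h x = 0})
  obtain ⟨z, hzO⟩ := hne
  have hzZ : z ∈ Z := interior_maximal hz hO hzO
  have hZc : IsClosed Zᶜ := isOpen_interior.isClosed_compl
  obtain ⟨q, hqZ, hqd⟩ := hZc.exists_infDist_eq_dist (Set.nonempty_iff_ne_empty.mpr hZu) z
  have hpos : 0 < dist z q := dist_pos.mpr (fun hcon => hqZ (hcon ▸ hzZ))
  obtain ⟨N, hNo, hqN, hN⟩ := unique_continuation_local hG hs hp hh hV hPh hpos (dist_comm q z)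
    (fun y hy => by
      have : y ∈ Z := by
        by_contra hcon
        have := infDist_le_dist_of_mem (x := z) (show y ∈ Zᶜ from hcon)
        rw [mem_ball, dist_comm] at hy
        linarith
      exact (interior_subset this : y ∈ {x | h x = 0}))
  exact absurd (interior_maximal hN hNo hqN) hqZ

end UC

/-! ### Calculus of cross products -/

section Calculus
variable {E' : Type*} [NormedAddCommGroup E'] [NormedSpace ℝ E']

theorem ContDiffAt.cross {f g : E' → ImO} {x : E'} {k : WithTop ℕ∞} (hf : ContDiffAt ℝ k f x)
    (hg : ContDiffAt ℝ k g x) : ContDiffAt ℝ k (fun y => cross (f y) (g y)) x := by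
  simp only [← crossB_apply]
  exact (crossB.contDiff.contDiffAt.comp x hf).clm_apply hg

theorem _root_.ContDiff.cross {f g : E' → ImO} {k : WithTop ℕ∞} (hf : ContDiff ℝ k f)
    (hg : ContDiff ℝ k g) : ContDiff ℝ k (fun y => cross (f y) (g y)) :=
  contDiff_iff_contDiffAt.mpr fun _ => ContDiffAt.cross hf.contDiffAt hg.contDiffAt

theorem fderiv_cross {f g : E' → ImO} {x : E'} (hf : DifferentiableAt ℝ f x)
    (hg : DifferentiableAt ℝ g x) (v : E') : 𝒟 (fun y => cross (f y) (g y)) x v =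
      cross (𝒟 f x v) (g x) + cross (f x) (𝒟 g x v) := by
  have := crossB.fderiv_of_bilinear hf hg
  simp only [crossB_apply] at this
  rw [this]
  simp [crossB_apply, add_comm]

theorem fderiv_inner_apply' {f g : E' → ImO} {x : E'} (hf : DifferentiableAt ℝ f x)
    (hg : DifferentiableAt ℝ g x) (v : E') : 𝒟 (fun y => ⟪f y, g y⟫) x v =
      ⟪𝒟 f x v, g x⟫ + ⟪f x, 𝒟 g x v⟫ := by
  rw [fderiv_inner_apply (𝕜 := ℝ) hf hg, add_comm]

/-- If `⟨f, g⟩` is constant near `x`, then `⟨df, g⟩ + ⟨f, dg⟩ = 0`. -/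
theorem inner_fderiv_add {f g : E' → ImO} {x : E'} (hf : DifferentiableAt ℝ f x)
    (hg : DifferentiableAt ℝ g x) {c : ℝ} (h : ∀ᶠ y in nhds x, ⟪f y, g y⟫ = c) (v : E') :
    ⟪𝒟 f x v, g x⟫ + ⟪f x, 𝒟 g x v⟫ = 0 := by
  rw [← fderiv_inner_apply' hf hg]
  have : (fun y => ⟪f y, g y⟫) =ᶠ[nhds x] fun _ => c := h
  rw [this.fderiv_eq]; simp

theorem inner_fderiv_self {f : E' → ImO} {x : E'} (hf : DifferentiableAt ℝ f x)
    (h : ∀ᶠ y in nhds x, ‖f y‖ = 1) (v : E') : ⟪f x, 𝒟 f x v⟫ = 0 := by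
  have := inner_fderiv_add hf hf (c := 1) (by
    filter_upwards [h] with y hy; rw [real_inner_self_eq_norm_sq, hy]; norm_num) v
  rw [real_inner_comm] at this
  linarith

theorem fderiv_fderiv_symm {F : Type*} [NormedAddCommGroup F] [NormedSpace ℝ F] {f : E' → F}
    {x : E'} (hf : ContDiffAt ℝ ∞ f x) (v w : E') :
    𝒟 (fun y => 𝒟 f y v) x w = 𝒟 (fun y => 𝒟 f y w) x v := by
  have hd : DifferentiableAt ℝ (𝒟 f) x :=
    (hf.fderiv_right (m := ∞) (by simp)).differentiableAt (by simp)
  rw [fderiv_clm_apply hd (by fun_prop), fderiv_clm_apply hd (by fun_prop)]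
  simp
  exact (hf.isSymmSndFDerivAt (by simp; exact WithTop.coe_le_coe.2 (le_top (a := (2 : ℕ∞))))) _ _

theorem contDiffAt_fderiv_apply {F : Type*} [NormedAddCommGroup F] [NormedSpace ℝ F] {f : E' → F}
    {x : E'} (hf : ContDiffAt ℝ ∞ f x) (v : E') : ContDiffAt ℝ ∞ (fun y => 𝒟 f y v) x :=
  (hf.fderiv_right (m := ∞) (by simp)).clm_apply contDiffAt_const

theorem contDiff_fderiv_apply {F : Type*} [NormedAddCommGroup F] [NormedSpace ℝ F] {f : E' → F}
    (hf : Smooth f) (v : E') : Smooth (fun y => 𝒟 f y v) :=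
  contDiff_iff_contDiffAt.mpr fun _ => contDiffAt_fderiv_apply hf.contDiffAt v

end Calculus

/-! ### Coassociative subspaces -/

theorem exists_unit_perp {E : Submodule ℝ ImO} {k : ℕ} (s : Fin k → ImO)
    (h : k < Module.finrank ℝ E) : ∃ e ∈ E, ‖e‖ = 1 ∧ ∀ i, ⟪s i, e⟫ = 0 := by
  let φ : E →ₗ[ℝ] (Fin k → ℝ) := LinearMap.pi fun i => (innerₛₗ ℝ (s i)).comp E.subtype
  have hk : LinearMap.ker φ ≠ ⊥ := LinearMap.ker_ne_bot_of_finrank_lt (by simpa using h)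
  obtain ⟨v, hv, hv0⟩ := Submodule.exists_mem_ne_zero_of_ne_bot hk
  have hn : ‖(v : ImO)‖ ≠ 0 := by simpa using hv0
  refine ⟨‖(v : ImO)‖⁻¹ • (v : ImO), E.smul_mem _ v.2, by simp [norm_smul, hn], fun i => ?_⟩
  have := congrFun (LinearMap.mem_ker.mp hv) i
  simp only [φ, LinearMap.pi_apply] at this
  rw [inner_smul_right]
  exact mul_eq_zero_of_right _ this

/-- The associative 3-form vanishes on `E`. -/
def PhiZero (E : Submodule ℝ ImO) : Prop := ∀ a ∈ E, ∀ b ∈ E, ∀ c ∈ E, ⟪cross a b, c⟫ = 0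

theorem PhiZero.normal_form {E : Submodule ℝ ImO} (hE : PhiZero E) (hd : Module.finrank ℝ E = 4)
    {f x : ImO} (hfE : f ∈ E) (hxE : x ∈ E) (hf : ‖f‖ = 1) (hx : ‖x‖ = 1)
    (hfx : ⟪f, x⟫ = 0) :
    ∃ Ψ : ImO ≃ₗᵢ[ℝ] ImO, IsG2 Ψ ∧ Ψ (eps 0) = f ∧ Ψ (eps 1) = x ∧
      ∀ q : ImO, Ψ q ∈ E ↔ q 2 = 0 ∧ q 4 = 0 ∧ q 5 = 0 := by
  obtain ⟨τ, hτE, hτ, hperp⟩ := exists_unit_perp (E := E) ![f, x] (by rw [hd]; norm_num)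
  have hfτ : ⟪f, τ⟫ = 0 := hperp 0
  have hxτ : ⟪x, τ⟫ = 0 := hperp 1
  obtain ⟨Ψ, hΨ, hc⟩ := exists_g2 hf hx hτ hfx hfτ hxτ (hE f hfE x hxE τ hτE)
  have e0 : Ψ (eps 0) = f := by rw [hc]; simp [eps]
  have e1 : Ψ (eps 1) = x := by rw [hc]; simp [eps]
  have e3 : Ψ (eps 3) = τ := by rw [hc]; simp [eps]
  let E' : Submodule ℝ ImO := Submodule.span ℝ {f, x, τ, Ψ (eps 6)}
  have hsub : ∀ q : ImO, Ψ q ∈ E → q 2 = 0 ∧ q 4 = 0 ∧ q 5 = 0 := by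
    intro q hq
    have h2 := hE f hfE x hxE _ hq
    have h4 := hE f hfE τ hτE _ hq
    have h5 := hE x hxE τ hτE _ hq
    rw [← e0, ← e1, hΨ, Ψ.inner_map_map] at h2
    rw [← e0, ← e3, hΨ, Ψ.inner_map_map] at h4
    rw [← e1, ← e3, hΨ, Ψ.inner_map_map] at h5
    simp [inner_eq_sum, cross_apply, crossCoord, eps] at h2 h4 h5
    exact ⟨h2, h4, h5⟩
  have hin : ∀ q : ImO, q 2 = 0 ∧ q 4 = 0 ∧ q 5 = 0 → Ψ q ∈ E' := by
    rintro q ⟨h2, h4, h5⟩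
    have : q = q 0 • eps 0 + q 1 • eps 1 + q 3 • eps 3 + q 6 • eps 6 := by
      ext i; fin_cases i <;> simp [eps, h2, h4, h5]
    rw [this]
    simp only [map_add, map_smul, e0, e1, e3]
    refine add_mem (add_mem (add_mem ?_ ?_) ?_) ?_ <;>
      exact Submodule.smul_mem _ _ (Submodule.subset_span (by simp))
  have hle : E ≤ E' := by
    intro p hp
    have h1 := hin (Ψ.symm p) (hsub _ (by simpa using hp))
    simpa using h1
  have heq : E = E' := by
    apply Submodule.eq_of_le_of_finrank_le hle
    rw [hd]
    classical
    have := finrank_span_le_card (R := ℝ) ({f, x, τ, Ψ (eps 6)} : Set ImO)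
    refine this.trans ?_
    rw [Set.toFinset_card, ← Nat.card_eq_fintype_card, Nat.card_coe_set_eq]
    have h1 := Set.ncard_insert_le f {x, τ, Ψ (eps 6)}
    have h2 := Set.ncard_insert_le x {τ, Ψ (eps 6)}
    have h3 := Set.ncard_insert_le τ {Ψ (eps 6)}
    have h4 := Set.ncard_singleton (Ψ (eps 6))
    change Set.ncard _ ≤ 4
    omega
  refine ⟨Ψ, hΨ, e0, e1, fun q => ⟨hsub q, fun h => ?_⟩⟩
  rw [heq]; exact hin q h

theorem exists_two_unit {E : Submodule ℝ ImO} (hd : Module.finrank ℝ E = 4) :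
    ∃ f ∈ E, ∃ x ∈ E, ‖f‖ = 1 ∧ ‖x‖ = 1 ∧ ⟪f, x⟫ = 0 := by
  obtain ⟨f, hfE, hf, _⟩ := exists_unit_perp (E := E) (k := 0) (fun _ => 0) (by rw [hd]; norm_num)
  obtain ⟨x, hxE, hx, hp⟩ := exists_unit_perp (E := E) (k := 1) (fun _ => f) (by rw [hd]; norm_num)
  exact ⟨f, hfE, x, hxE, hf, hx, hp 0⟩

/-- The orthogonal complement of a coassociative subspace acts on it. -/
theorem PhiZero.cross_mem {E : Submodule ℝ ImO} (hE : PhiZero E) (hd : Module.finrank ℝ E = 4)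
    {ν p : ImO} (hν : ∀ q ∈ E, ⟪ν, q⟫ = 0) (hp : p ∈ E) : cross ν p ∈ E := by
  obtain ⟨f, hfE, x, hxE, hf, hx, hfx⟩ := exists_two_unit hd
  obtain ⟨Ψ, hΨ, -, -, hmem⟩ := hE.normal_form hd hfE hxE hf hx hfx
  obtain ⟨ν, rfl⟩ := Ψ.surjective ν
  obtain ⟨p, rfl⟩ := Ψ.surjective p
  have h0 := hν (Ψ (eps 0)) ((hmem _).mpr (by simp [eps]))
  have h1 := hν (Ψ (eps 1)) ((hmem _).mpr (by simp [eps]))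
  have h3 := hν (Ψ (eps 3)) ((hmem _).mpr (by simp [eps]))
  have h6 := hν (Ψ (eps 6)) ((hmem _).mpr (by simp [eps]))
  obtain ⟨p2, p4, p5⟩ := (hmem _).mp hp
  rw [Ψ.inner_map_map] at h0 h1 h3 h6
  simp [inner_eq_sum, eps] at h0 h1 h3 h6
  rw [hΨ, hmem]
  simp [cross_apply, crossCoord, h0, h1, h3, h6, p2, p4, p5]

theorem PhiZero.cross_perp {E : Submodule ℝ ImO} (hE : PhiZero E) {a b : ImO}
    (ha : a ∈ E) (hb : b ∈ E) : ∀ q ∈ E, ⟪cross a b, q⟫ = 0 := fun q hq => hE a ha b hb q hq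

theorem PhiZero.of_span {s : Set ImO}
    (h : ∀ a ∈ s, ∀ b ∈ s, ∀ c ∈ s, ⟪cross a b, c⟫ = 0) :
    PhiZero (Submodule.span ℝ s) := by
  intro a ha b hb c hc
  induction ha using Submodule.span_induction with
  | zero => simp [cross_zero_left]
  | add a a' _ _ h1 h2 => rw [cross_add_left, inner_add_left, h1, h2, add_zero]
  | smul r a _ h1 => rw [cross_smul_left, inner_smul_left, h1, mul_zero]
  | mem a ha =>
    induction hb using Submodule.span_induction with
    | zero => simp [cross_zero_right]
    | add a a' _ _ h1 h2 => rw [cross_add_right, inner_add_left, h1, h2, add_zero]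
    | smul r a _ h1 => rw [cross_smul_right, inner_smul_left, h1, mul_zero]
    | mem b hb =>
      induction hc using Submodule.span_induction with
      | zero => simp
      | add a a' _ _ h1 h2 => rw [inner_add_right, h1, h2, add_zero]
      | smul r a _ h1 => rw [inner_smul_right, h1, mul_zero]
      | mem c hc => exact h a ha b hb c hc

/-- A triple of independent tangent vectors at a point of a Lagrangian submanifold. -/
structure LagTriple (f a b c : ImO) : Prop where
  norm_eq : ‖f‖ = 1
  perp_a : ⟪f, a⟫ = 0
  perp_b : ⟪f, b⟫ = 0
  perp_c : ⟪f, c⟫ = 0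
  indep : LinearIndependent ℝ ![a, b, c]
  fab : ⟪cross f a, b⟫ = 0
  fbc : ⟪cross f b, c⟫ = 0
  fca : ⟪cross f c, a⟫ = 0
  abc : ⟪cross a b, c⟫ = 0

theorem inner_cross_zero_of {a b c : ImO} (h : ⟪cross a b, c⟫ = 0) :
    ⟪cross b c, a⟫ = 0 ∧ ⟪cross c a, b⟫ = 0 ∧ ⟪cross b a, c⟫ = 0 ∧
    ⟪cross c b, a⟫ = 0 ∧ ⟪cross a c, b⟫ = 0 := by
  have h1 : ⟪cross b c, a⟫ = 0 := by rw [← inner_cross_cyclic]; exact h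
  have h2 : ⟪cross c a, b⟫ = 0 := by rw [← inner_cross_cyclic]; exact h1
  refine ⟨h1, h2, ?_, ?_, ?_⟩
  · rw [inner_cross_swap, h, neg_zero]
  · rw [inner_cross_swap, h1, neg_zero]
  · rw [inner_cross_swap, h2, neg_zero]

theorem LagTriple.indep4 {f a b c : ImO} (h : LagTriple f a b c) :
    LinearIndependent ℝ ![f, a, b, c] := by
  rw [Fintype.linearIndependent_iff]
  intro g hg
  simp [Fin.sum_univ_four] at hg
  have h0 : g 0 = 0 := by
    have := congrArg (inner ℝ f) hg
    simpa [inner_add_right, inner_smul_right, h.perp_a, h.perp_b, h.perp_c, h.norm_eq] using this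
  have h1 := Fintype.linearIndependent_iff.mp h.indep ![g 1, g 2, g 3] (by
    simpa [Fin.sum_univ_three, h0] using hg)
  intro i
  fin_cases i
  · exact h0
  · exact h1 0
  · exact h1 1
  · exact h1 2

theorem LagTriple.phiZero {f a b c : ImO} (h : LagTriple f a b c) :
    PhiZero (Submodule.span ℝ (Set.range ![f, a, b, c])) := by
  apply PhiZero.of_span
  obtain ⟨a1, a2, a3, a4, a5⟩ := inner_cross_zero_of h.fab
  obtain ⟨b1, b2, b3, b4, b5⟩ := inner_cross_zero_of h.fbc
  obtain ⟨c1, c2, c3, c4, c5⟩ := inner_cross_zero_of h.fca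
  obtain ⟨d1, d2, d3, d4, d5⟩ := inner_cross_zero_of h.abc
  rintro _ ⟨i, rfl⟩ _ ⟨j, rfl⟩ _ ⟨k, rfl⟩
  fin_cases i <;> fin_cases j <;> fin_cases k <;>
    simp [cross_self, h.fab, h.fbc, h.fca, h.abc, *]

theorem LagTriple.finrank {f a b c : ImO} (h : LagTriple f a b c) :
    Module.finrank ℝ (Submodule.span ℝ (Set.range ![f, a, b, c])) = 4 := by
  rw [finrank_span_eq_card h.indep4]; simp

/-- Vectors in the span of `ε₂, ε₄, ε₇`. -/
def vec3 (p q r : ℝ) : ImO := p • eps 1 + q • eps 3 + r • eps 6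

theorem inner_vec3 (p q r p' q' r' : ℝ) :
    ⟪vec3 p q r, vec3 p' q' r'⟫ = p * p' + q * q' + r * r' := by
  simp [inner_eq_sum, vec3, eps]

theorem cross_cross_vec3 (p q r p' q' r' : ℝ) :
    cross (eps 0) (cross (vec3 p q r) (vec3 p' q' r')) =
      vec3 (q * r' - r * q') (r * p' - p * r') (p * q' - q * p') := by
  ext i; fin_cases i <;> simp [cross_apply, crossCoord, vec3, eps]

theorem inner_cross_vec3 (p q r p' q' r' p'' q'' r'' : ℝ) :
    ⟪cross (vec3 p q r) (vec3 p' q' r'), cross (eps 0) (vec3 p'' q'' r'')⟫ =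
      -((q * r' - r * q') * p'' + (r * p' - p * r') * q'' + (p * q' - q * p') * r'') := by
  simp [inner_eq_sum, cross_apply, crossCoord, vec3, eps]; ring

theorem cross_vec3_cyclic (p q r p' q' r' p'' q'' r'' : ℝ) :
    cross (vec3 p q r) (cross (vec3 p' q' r') (vec3 p'' q'' r'')) +
    cross (vec3 p' q' r') (cross (vec3 p'' q'' r'') (vec3 p q r)) +
    cross (vec3 p'' q'' r'') (cross (vec3 p q r) (vec3 p' q' r')) =
      (-3 * ((q' * r'' - r' * q'') * p + (r' * p'' - p' * r'') * q + (p' * q'' - q' * p'') * r)) •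
        eps 0 := by
  ext i; fin_cases i <;> simp [cross_apply, crossCoord, vec3, eps] <;> ring

theorem smul_vec3 (s p q r : ℝ) : s • vec3 p q r = vec3 (s * p) (s * q) (s * r) := by
  simp only [vec3]; module

theorem add_vec3 (p q r p' q' r' : ℝ) : vec3 p q r + vec3 p' q' r' =
    vec3 (p + p') (q + q') (r + r') := by
  simp only [vec3]; module

theorem LagTriple.coords {f a b c : ImO} (h : LagTriple f a b c) :
    ∃ (Ψ : ImO ≃ₗᵢ[ℝ] ImO) (p q r : Fin 3 → ℝ), IsG2 Ψ ∧ f = Ψ (eps 0) ∧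
      a = Ψ (vec3 (p 0) (q 0) (r 0)) ∧
      b = Ψ (vec3 (p 1) (q 1) (r 1)) ∧
      c = Ψ (vec3 (p 2) (q 2) (r 2)) := by
  set E := Submodule.span ℝ (Set.range ![f, a, b, c]) with hE
  have hfE : f ∈ E := Submodule.subset_span ⟨0, rfl⟩
  have haE : a ∈ E := Submodule.subset_span ⟨1, rfl⟩
  have hbE : b ∈ E := Submodule.subset_span ⟨2, rfl⟩
  have hcE : c ∈ E := Submodule.subset_span ⟨3, rfl⟩
  obtain ⟨x, hxE, hx, hp⟩ := exists_unit_perp (E := E) (k := 1) (fun _ => f)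
    (by rw [h.finrank]; norm_num)
  obtain ⟨Ψ, hΨ, e0, e1, hmem⟩ := h.phiZero.normal_form h.finrank hfE hxE h.norm_eq hx (hp 0)
  have key : ∀ v ∈ E, ⟪f, v⟫ = 0 → v = Ψ (vec3 ((Ψ.symm v) 1) ((Ψ.symm v) 3)
      ((Ψ.symm v) 6)) := by
    intro v hv hfv
    obtain ⟨w, rfl⟩ := Ψ.surjective v
    obtain ⟨h2, h4, h5⟩ := (hmem w).mp hv
    rw [← e0, Ψ.inner_map_map] at hfv
    simp [inner_eq_sum, eps] at hfv
    congr 1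
    ext i; fin_cases i <;> simp [vec3, eps, h2, h4, h5, hfv]
  exact ⟨Ψ, ![(Ψ.symm a) 1, (Ψ.symm b) 1, (Ψ.symm c) 1], ![(Ψ.symm a) 3, (Ψ.symm b) 3, (Ψ.symm c) 3],
    ![(Ψ.symm a) 6, (Ψ.symm b) 6, (Ψ.symm c) 6], hΨ, e0.symm, key a haE h.perp_a,
    key b hbE h.perp_b, key c hcE h.perp_c⟩

/-- `f × (b × c)`, `f × (c × a)`, `f × (a × b)`. -/
def dualTriple (f a b c : ImO) : Fin 3 → ImO :=
  ![cross f (cross b c), cross f (cross c a), cross f (cross a b)]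

/-- The volume of the parallelepiped spanned by a Lagrangian triple. -/
def tripleVol (f a b c : ImO) : ℝ := ⟪cross b c, cross f a⟫

theorem LagTriple.algebra {f a b c : ImO} (h : LagTriple f a b c) :
    (∀ i k, ⟪dualTriple f a b c i, ![a, b, c] k⟫ =
      if i = k then -tripleVol f a b c else 0) ∧
    (∀ i, ∑ j, ⟪dualTriple f a b c i, dualTriple f a b c j⟫ • ![a, b, c] j =
      -tripleVol f a b c • dualTriple f a b c i) ∧
    cross a (cross b c) + cross b (cross c a) + cross c (cross a b) =
      (3 * tripleVol f a b c) • f := by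
  obtain ⟨Ψ, p, q, r, hΨ, rfl, rfl, rfl, rfl⟩ := h.coords
  clear h
  unfold dualTriple tripleVol
  simp only [hΨ _ _, Ψ.inner_map_map, cross_cross_vec3, inner_cross_vec3]
  refine ⟨?_, ?_, ?_⟩
  · intro i k
    fin_cases i <;> fin_cases k <;> simp only [Fin.reduceFinMk, Fin.zero_eta, Fin.mk_one,
      Matrix.cons_val, Fin.reduceEq, ↓reduceIte, Ψ.inner_map_map, inner_vec3] <;> ring
  · intro i
    fin_cases i <;> simp only [Fin.sum_univ_three, Fin.reduceFinMk, Fin.zero_eta, Fin.mk_one,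
      Matrix.cons_val, Ψ.inner_map_map, inner_vec3, ← map_add, ← map_smul, smul_vec3, add_vec3] <;>
      congr 2 <;> ring
  · rw [← map_add, ← map_add, cross_vec3_cyclic, ← map_smul]
    congr 2; ring

theorem LagTriple.vol_ne_zero {f a b c : ImO} (h : LagTriple f a b c) : tripleVol f a b c ≠ 0 := by
  intro h0
  set E := Submodule.span ℝ (Set.range ![f, a, b, c]) with hE
  have hm : ∀ i, ![f, a, b, c] i ∈ E := fun i => Submodule.subset_span ⟨i, rfl⟩
  have hW : cross f (cross b c) ∈ E := by
    rw [cross_anticomm]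
    exact E.neg_mem (h.phiZero.cross_mem h.finrank (h.phiZero.cross_perp (hm 2) (hm 3)) (hm 0))
  have hperp : ∀ q ∈ E, ⟪cross f (cross b c), q⟫ = 0 := by
    intro q hq
    induction hq using Submodule.span_induction with
    | zero => simp
    | add a a' _ _ h1 h2 => rw [inner_add_right, h1, h2, add_zero]
    | smul r a _ h1 => rw [inner_smul_right, h1, mul_zero]
    | mem q hq =>
      obtain ⟨i, rfl⟩ := hq
      have h1 := h.algebra.1 0
      simp only [h0, neg_zero, ite_self] at h1
      fin_cases i
      · simp
      · exact h1 0
      · exact h1 1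
      · exact h1 2
  have hW0 : cross f (cross b c) = 0 := inner_self_eq_zero.mp (hperp _ hW)
  have h1 := cross_cross_self f (cross b c)
  have hf : ⟪f, f⟫ = 1 := inner_self_of_norm_one h.norm_eq
  have hbc : ⟪cross b c, f⟫ = 0 := h.phiZero.cross_perp (hm 2) (hm 3) f (hm 0)
  rw [hW0, cross_zero_right, real_inner_comm, hbc, hf] at h1
  simp at h1
  have h2 := inner_cross_cross b c c
  rw [h1, inner_zero_left] at h2
  -- equality in the Cauchy-Schwarz inequality
  have h3 := Fintype.linearIndependent_iff.mp h.indep ![0, ⟪c, c⟫, -⟪b, c⟫] (by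
    simp only [Fin.sum_univ_three, Matrix.cons_val, zero_smul, zero_add]
    rw [← inner_self_eq_zero (𝕜 := ℝ)]
    simp only [inner_add_left, inner_add_right, inner_smul_left, inner_smul_right,
      real_inner_comm b c, conj_trivial]
    linear_combination -⟪c, c⟫ * h2)
  have h4 := h3 1
  simp only [Matrix.cons_val, inner_self_eq_zero] at h4
  exact h.indep.ne_zero 2 h4

/-! ### Unique continuation for Lagrangian patches -/

/-- A parametrized Lagrangian 3-fold in `𝒮⁶`. -/
structure IsLagPatch {E : Type*} [NormedAddCommGroup E] [NormedSpace ℝ E] (f : E → ImO) : Prop where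
  smooth : Smooth f
  norm_eq : ∀ x, ‖f x‖ = 1
  inj : ∀ x, Function.Injective (𝒟 f x)
  lag : ∀ x v w, ⟪cross (f x) (𝒟 f x v), 𝒟 f x w⟫ = 0

namespace IsLagPatch
section
variable {E : Type*} [NormedAddCommGroup E] [NormedSpace ℝ E] {f : E → ImO} (hf : IsLagPatch f)
include hf

theorem diff : Differentiable ℝ f := hf.smooth.diff

theorem diff_apply (v : E) : Differentiable ℝ (fun y => 𝒟 f y v) :=
  (contDiff_fderiv_apply hf.smooth v).diff

/-- The derivative of the condition `ω = 0`. -/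
theorem deriv_lag (x z v w : E) :
    ⟪cross (𝒟 f x z) (𝒟 f x v), 𝒟 f x w⟫ +
    ⟪(cross (f x) (𝒟 (fun y => 𝒟 f y v) x z)), 𝒟 f x w⟫ +
    ⟪cross (f x) (𝒟 f x v), (𝒟 (fun y => 𝒟 f y w) x z)⟫ = 0 := by
  have h := inner_fderiv_add (f := fun y => cross (f y) (𝒟 f y v))
    (g := fun y => 𝒟 f y w) (x := x) (c := 0)
    ((hf.smooth.cross (contDiff_fderiv_apply hf.smooth v)).diff x)
    (hf.diff_apply w x) (Filter.Eventually.of_forall fun y => hf.lag y v w) z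
  rw [fderiv_cross (hf.diff x) (hf.diff_apply v x), inner_add_left] at h
  exact h

theorem phi_zero (x z v w : E) :
    ⟪cross (𝒟 f x z) (𝒟 f x v), 𝒟 f x w⟫ = 0 := by
  have h1 := hf.deriv_lag x z v w
  have h2 := hf.deriv_lag x v w z
  have h3 := hf.deriv_lag x w z v
  rw [← inner_cross_cyclic] at h2
  rw [inner_cross_cyclic] at h3
  have e1 := fderiv_fderiv_symm (x := x) hf.smooth.contDiffAt z v
  have e2 := fderiv_fderiv_symm (x := x) hf.smooth.contDiffAt v w
  have e3 := fderiv_fderiv_symm (x := x) hf.smooth.contDiffAt w z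
  rw [← e1] at h1
  rw [← e2] at h2
  rw [← e3] at h3
  rw [inner_cross_swap' (f x) (𝒟 f x v)] at h1
  rw [inner_cross_swap' (f x) (𝒟 f x w)] at h2
  rw [inner_cross_swap' (f x) (𝒟 f x z)] at h3
  linarith

theorem lagTriple (x : E) {a b c : E} (h : LinearIndependent ℝ ![a, b, c]) :
    LagTriple (f x) (𝒟 f x a) (𝒟 f x b) (𝒟 f x c) where
  norm_eq := hf.norm_eq x
  perp_a := inner_fderiv_self (hf.diff x) (.of_forall hf.norm_eq) a
  perp_b := inner_fderiv_self (hf.diff x) (.of_forall hf.norm_eq) b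
  perp_c := inner_fderiv_self (hf.diff x) (.of_forall hf.norm_eq) c
  indep := by
    have := h.map' (𝒟 f x).toLinearMap (LinearMap.ker_eq_bot.mpr (hf.inj x))
    rw [show ![𝒟 f x a, 𝒟 f x b, 𝒟 f x c] =
      (𝒟 f x).toLinearMap ∘ ![a, b, c] by ext i; fin_cases i <;> rfl]
    exact this
  fab := hf.lag x a b
  fbc := hf.lag x b c
  fca := hf.lag x c a
  abc := hf.phi_zero x a b c

end

variable {f : R3 → ImO} (hf : IsLagPatch f)
include hf

omit hf in
theorem indep_std : LinearIndependent ℝ ![(EuclideanSpace.single 0 1 : R3),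
    EuclideanSpace.single 1 1, EuclideanSpace.single 2 1] := by
  rw [Fintype.linearIndependent_iff]
  intro g hg i
  have h := congrFun (congrArg WithLp.ofLp hg) i
  simp [Fin.sum_univ_three] at h
  fin_cases i <;> simpa using h

omit hf in
/-- The partial derivatives. -/
def der (f : R3 → ImO) (i : Fin 3) (x : R3) : ImO := 𝒟 f x (EuclideanSpace.single i 1)

theorem lagTriple_der (x : R3) : LagTriple (f x) (der f 0 x) (der f 1 x) (der f 2 x) :=
  hf.lagTriple x indep_std

theorem smooth_der (i : Fin 3) : Smooth (der f i) := contDiff_fderiv_apply hf.smooth _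

omit hf in
/-- The dual frame. -/
def dual (f : R3 → ImO) (i : Fin 3) (x : R3) : ImO :=
  dualTriple (f x) (der f 0 x) (der f 1 x) (der f 2 x) i

theorem smooth_dual (i : Fin 3) : Smooth (dual f i) := by
  have h0 := hf.smooth_der 0
  have h1 := hf.smooth_der 1
  have h2 := hf.smooth_der 2
  have hs := hf.smooth
  fin_cases i
  · exact hs.cross (h1.cross h2)
  · exact hs.cross (h2.cross h0)
  · exact hs.cross (h0.cross h1)

omit hf in
/-- The volume density. -/
def vol (f : R3 → ImO) (x : R3) : ℝ := tripleVol (f x) (der f 0 x) (der f 1 x) (der f 2 x)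

theorem smooth_vol : Smooth (vol f) :=
  (ContDiff.cross (hf.smooth_der 1) (hf.smooth_der 2)).inner ℝ (hf.smooth.cross (hf.smooth_der 0))

theorem vol_ne_zero (x : R3) : vol f x ≠ 0 := (hf.lagTriple_der x).vol_ne_zero

theorem exists_sign : ∃ s : ℝ, ∀ x, 0 < s * vol f x := by
  have hc : IsPreconnected (Set.range (vol f)) :=
    isPreconnected_range hf.smooth_vol.continuous
  rcases lt_or_gt_of_ne (hf.vol_ne_zero 0) with h0 | h0
  · refine ⟨-1, fun x => ?_⟩
    by_contra h
    have hx : 0 < vol f x := lt_of_le_of_ne (by linarith) (hf.vol_ne_zero x).symm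
    obtain ⟨y, hy⟩ := hc.ordConnected.out ⟨0, rfl⟩ ⟨x, rfl⟩ ⟨h0.le, hx.le⟩
    exact hf.vol_ne_zero y hy
  · refine ⟨1, fun x => ?_⟩
    by_contra h
    have hx : vol f x < 0 := lt_of_le_of_ne (by linarith) (hf.vol_ne_zero x)
    obtain ⟨y, hy⟩ := hc.ordConnected.out ⟨x, rfl⟩ ⟨0, rfl⟩ ⟨hx.le, h0.le⟩
    exact hf.vol_ne_zero y hy

theorem div_dual (x : R3) :
    ∑ i, 𝒟 (dual f i) x (EuclideanSpace.single i 1) = (3 * vol f x) • f x := by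
  have hd : ∀ i, DifferentiableAt ℝ (der f i) x := fun i =>
    (hf.smooth_der i).diff x
  have hc : ∀ i j, DifferentiableAt ℝ (fun y => cross (der f i y) (der f j y)) x := fun i j =>
    (ContDiff.cross (hf.smooth_der i) (hf.smooth_der j)).diff x
  have key : ∀ i j v, 𝒟 (fun y => cross (f y) (cross (der f i y) (der f j y))) x v =
      cross (𝒟 f x v) (cross (der f i x) (der f j x)) +
      cross (f x) (cross (𝒟 (der f i) x v) (der f j x) +
        cross (der f i x) (𝒟 (der f j) x v)) := by
    intro i j v
    rw [fderiv_cross (hf.diff x) (hc i j), fderiv_cross (hd i) (hd j)]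
  have e0 : dual f 0 = fun y => cross (f y) (cross (der f 1 y) (der f 2 y)) := rfl
  have e1 : dual f 1 = fun y => cross (f y) (cross (der f 2 y) (der f 0 y)) := rfl
  have e2 : dual f 2 = fun y => cross (f y) (cross (der f 0 y) (der f 1 y)) := rfl
  rw [Fin.sum_univ_three, e0, e1, e2, key, key, key]
  have s01 : 𝒟 (der f 0) x (EuclideanSpace.single 1 1) =
    𝒟 (der f 1) x (EuclideanSpace.single 0 1) := fderiv_fderiv_symm hf.smooth.contDiffAt _ _
  have s02 : 𝒟 (der f 0) x (EuclideanSpace.single 2 1) =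
    𝒟 (der f 2) x (EuclideanSpace.single 0 1) := fderiv_fderiv_symm hf.smooth.contDiffAt _ _
  have s12 : 𝒟 (der f 1) x (EuclideanSpace.single 2 1) =
    𝒟 (der f 2) x (EuclideanSpace.single 1 1) := fderiv_fderiv_symm hf.smooth.contDiffAt _ _
  have h3 := (hf.lagTriple_der x).algebra.2.2
  rw [s01, s02, s12]
  rw [show (3 * vol f x) • f x = _ from h3.symm]
  change cross (der f 0 x) _ + _ + (cross (der f 1 x) _ + _) + (cross (der f 2 x) _ + _) = _
  generalize 𝒟 (der f 1) x (EuclideanSpace.single 0 1) = A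
  generalize 𝒟 (der f 2) x (EuclideanSpace.single 0 1) = B
  generalize 𝒟 (der f 2) x (EuclideanSpace.single 1 1) = C
  rw [cross_anticomm A, cross_anticomm B, cross_anticomm C]
  simp only [cross_add_right, cross_neg_right]
  abel

theorem unique_continuation (n : ImO) {O : Set R3} (hO : IsOpen O) (hne : O.Nonempty)
    (hz : ∀ x ∈ O, ⟪f x, n⟫ = 0) (x : R3) : ⟪f x, n⟫ = 0 := by
  obtain ⟨s, hs⟩ := hf.exists_sign
  set G : Fin 3 → Fin 3 → R3 → ℝ := fun i j x =>
    s / vol f x * ⟪dual f i x, dual f j x⟫ with hG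
  have hsn : s ≠ 0 := fun h => by simpa [h] using hs 0
  have hpos : ∀ x, 0 < s / vol f x := fun x => by
    rw [div_eq_mul_inv]
    have h1 : s * (vol f x)⁻¹ = s * vol f x * ((vol f x)⁻¹ * (vol f x)⁻¹) := by
      field_simp [hf.vol_ne_zero x]
    rw [h1]
    exact mul_pos (hs x) (mul_self_pos.mpr (inv_ne_zero (hf.vol_ne_zero x)))
  have hGs : ∀ i j, Smooth (G i j) := fun i j =>
    (contDiff_const.div hf.smooth_vol hf.vol_ne_zero).mul
      ((hf.smooth_dual i).inner ℝ (hf.smooth_dual j))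
  have hh : Smooth (fun y => ⟪f y, n⟫) := hf.smooth.inner ℝ contDiff_const
  have hflux : ∀ i, flux G i (fun y => ⟪f y, n⟫) = fun y => -s * ⟪dual f i y, n⟫ := by
    intro i
    funext y
    have h2 := congrArg (fun w => ⟪w, n⟫) ((hf.lagTriple_der y).algebra.2.1 i)
    simp only [sum_inner, inner_smul_left, conj_trivial] at h2
    have hp : ∀ j, pd j (fun y => ⟪f y, n⟫) y = ⟪![der f 0 y, der f 1 y, der f 2 y] j, n⟫ := by
      intro j
      unfold pd
      rw [fderiv_inner_apply' (hf.diff y) (by fun_prop)]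
      fin_cases j <;> simp [der]
    simp only [flux, hp, hG]
    simp only [mul_assoc, ← Finset.mul_sum]
    rw [show ∑ j, ⟪dual f i y, dual f j y⟫ *
      ⟪![der f 0 y, der f 1 y, der f 2 y] j, n⟫ = _ from h2]
    have := hf.vol_ne_zero y
    simp only [vol] at this ⊢
    change s / _ * (-_ * ⟪dual f i y, n⟫) = _
    field_simp
  refine S6.unique_continuation (G := G) hGs (fun i j y => by simp only [hG, real_inner_comm])
    ?_ hh (V := fun y => -3 * s * vol f y) (by have := hf.smooth_vol.continuous; fun_prop) ?_ hO hne hz x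
  · intro y ξ hξ
    have e : ∑ i, ∑ j, G i j y * ξ i * ξ j = s / vol f y *
        ⟪(∑ i, ξ i • dual f i y), (∑ i, ξ i • dual f i y)⟫ := by
      simp only [sum_inner, inner_sum, inner_smul_left, inner_smul_right, hG, Finset.mul_sum,
        conj_trivial]
      refine Finset.sum_congr rfl fun i _ => Finset.sum_congr rfl fun j _ => ?_
      rw [real_inner_comm]; ring
    rw [e]
    refine mul_pos (hpos y) (lt_of_le_of_ne real_inner_self_nonneg fun h0 => hξ ?_)
    have h1 := inner_self_eq_zero.mp h0.symm
    ext k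
    have h2 := congrArg (fun w => ⟪w, ![der f 0 y, der f 1 y, der f 2 y] k⟫) h1
    simp only [sum_inner, inner_smul_left, conj_trivial, inner_zero_left] at h2
    have h3 := fun i => (hf.lagTriple_der y).algebra.1 i k
    simp only [dual, h3] at h2
    simpa [(hf.lagTriple_der y).vol_ne_zero] using h2
  · intro y
    unfold Pop
    simp only [hflux]
    have hp : ∀ i, pd i (fun y => -s * ⟪dual f i y, n⟫) y =
        -s * ⟪𝒟 (dual f i) y (EuclideanSpace.single i 1), n⟫ := by
      intro i
      have hd : DifferentiableAt ℝ (dual f i) y := (hf.smooth_dual i).diff y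
      unfold pd
      rw [fderiv_const_mul (hd.inner ℝ (differentiableAt_const n)), smul_apply,
        fderiv_inner_apply' hd (by fun_prop)]
      simp
    simp only [hp, ← Finset.mul_sum, ← sum_inner, hf.div_dual y, inner_smul_left, conj_trivial]
    ring

end IsLagPatch

open Set Filter Topology OpenPartialHomeomorph Function

/-! ### Parametrizations of manifolds -/

/-- `ℝⁿ`. -/
abbrev Rn (n : ℕ) : Type := EuclideanSpace ℝ (Fin n)

section Param
variable {n : ℕ} {M : Type*} [TopologicalSpace M] [ChartedSpace (Rn n) M]

/-- A diffeomorphism of `ℝⁿ` onto an open subset of a manifold. -/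
structure IsParam (κ : Rn n → M) : Prop where
  smooth : ContMDiff (𝓡 n) (𝓡 n) ∞ κ
  isOpen_range : IsOpen (range κ)
  inv : ∃ g : M → Rn n, ContMDiffOn (𝓡 n) (𝓡 n) ∞ g (range κ) ∧ Function.LeftInverse g κ

theorem IsParam.isOpenEmbedding {κ : Rn n → M} (h : IsParam κ) : IsOpenEmbedding κ := by
  obtain ⟨g, hg, hl⟩ := h.inv
  refine .of_continuous_injective_isOpenMap h.smooth.continuous hl.injective fun O hO => ?_
  have : κ '' O = range κ ∩ g ⁻¹' O := by
    ext m
    constructor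
    · rintro ⟨z, hz, rfl⟩
      exact ⟨⟨z, rfl⟩, by simpa [hl z] using hz⟩
    · rintro ⟨⟨z, rfl⟩, hz⟩
      exact ⟨z, by simpa [hl z] using hz, rfl⟩
  rw [this]
  exact hg.continuousOn.isOpen_inter_preimage h.isOpen_range hO

theorem exists_param [IsManifold (𝓡 n) ∞ M] (p : M) {U : Set M} (hU : U ∈ 𝓝 p) :
    ∃ κ : Rn n → M, IsParam κ ∧ κ 0 = p ∧ range κ ⊆ U := by
  set e := extChartAt (𝓡 n) p with he
  have ht : IsOpen e.target := isOpen_extChartAt_target p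
  have hpt : e p ∈ e.target := mem_extChartAt_target p
  have hc : ContinuousAt e.symm (e p) := continuousAt_extChartAt_symm p
  have h1 : e.target ∩ e.symm ⁻¹' U ∈ 𝓝 (e p) :=
    inter_mem (ht.mem_nhds hpt) (hc (by rwa [extChartAt_to_inv]))
  obtain ⟨r, hr, hb⟩ := Metric.mem_nhds_iff.mp h1
  have hub : ∀ z, univBall (e p) r z ∈ ball (e p) r := fun z => by
    rw [← univBall_target _ hr]
    exact (univBall (e p) r).map_source (by simp)
  have hrange : range (fun z => e.symm (univBall (e p) r z)) = e.source ∩ e ⁻¹' (ball (e p) r) := by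
    ext m
    constructor
    · rintro ⟨z, rfl⟩
      exact ⟨e.map_target (hb (hub z)).1, by
        simpa [e.right_inv (hb (hub z)).1] using hub z⟩
    · rintro ⟨hm, hm'⟩
      refine ⟨(univBall (e p) r).symm (e m), ?_⟩
      simp only
      rw [(univBall (e p) r).right_inv (by rwa [univBall_target _ hr]), e.left_inv hm]
  refine ⟨fun z => e.symm (univBall (e p) r z), ⟨?_, ?_, ?_⟩, ?_, ?_⟩
  · have h2 : ContMDiffOn (𝓡 n) (𝓡 n) ∞ e.symm e.target := contMDiffOn_extChartAt_symm p
    have h3 : ContMDiff (𝓡 n) (𝓡 n) ∞ (univBall (e p) r : Rn n → Rn n) :=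
      contDiff_univBall.contMDiff
    exact h2.comp_contMDiff h3 fun z => (hb (hub z)).1
  · rw [hrange]
    exact (continuousOn_extChartAt p).isOpen_inter_preimage (isOpen_extChartAt_source p) isOpen_ball
  · refine ⟨fun m => (univBall (e p) r).symm (e m), ?_, fun z => ?_⟩
    · rw [hrange]
      have h2 : ContMDiffOn (𝓡 n) (𝓡 n) ∞ e e.source := by
        rw [he, extChartAt_source]; exact contMDiffOn_extChartAt
      have h3 : ContMDiffOn (𝓡 n) (𝓡 n) ∞ ((univBall (e p) r).symm : Rn n → Rn n)
          (ball (e p) r) := contDiffOn_univBall_symm.contMDiffOn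
      exact h3.comp (h2.mono inter_subset_left) fun m hm => hm.2
    · simp only
      rw [e.right_inv (hb (hub z)).1, (univBall (e p) r).left_inv (by simp)]
  · simp [he]
  · rintro _ ⟨z, rfl⟩
    exact (hb (hub z)).2

/-- Restriction of a parametrization to a ball. -/
theorem IsParam.ball {κ : Rn n → M} (h : IsParam κ) (c : Rn n) {r : ℝ} (hr : 0 < r) :
    IsParam (fun z => κ (univBall c r z)) ∧ range (fun z => κ (univBall c r z)) = κ '' ball c r := by
  have hrange : range (fun z => κ (univBall c r z)) = κ '' Metric.ball c r := by
    rw [← univBall_target c hr, ← (univBall c r).image_source_eq_target, univBall_source,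
      image_univ, ← range_comp]; rfl
  obtain ⟨g, hg, hl⟩ := h.inv
  refine ⟨⟨?_, ?_, fun m => (univBall c r).symm (g m), ?_, fun z => ?_⟩, hrange⟩
  · have h3 : ContMDiff (𝓡 n) (𝓡 n) ∞ (univBall c r : Rn n → Rn n) :=
      contDiff_univBall.contMDiff
    exact h.smooth.comp h3
  · rw [hrange]; exact h.isOpenEmbedding.isOpenMap _ isOpen_ball
  · rw [hrange]
    have h3 : ContMDiffOn (𝓡 n) (𝓡 n) ∞ ((univBall c r).symm : Rn n → Rn n) (Metric.ball c r) :=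
      contDiffOn_univBall_symm.contMDiffOn
    refine h3.comp (hg.mono (image_subset_range _ _)) ?_
    rintro _ ⟨z, hz, rfl⟩
    simpa [hl z] using hz
  · simp only
    rw [hl, (univBall c r).left_inv (by simp)]

variable {F : Type*} [NormedAddCommGroup F] [NormedSpace ℝ F]
  {E : Type*} [NormedAddCommGroup E] [NormedSpace ℝ E]

/-- The chain rule for `E → M → F`. -/
theorem fderiv_comp_mfld {f : M → F} {j : E → M} {z : E}
    (hf : MDifferentiableAt (𝓡 n) 𝓘(ℝ, F) f (j z)) (hj : MDifferentiableAt 𝓘(ℝ, E) (𝓡 n) j z)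
    (v : E) : 𝒟 (fun w => f (j w)) z v =
      mfderiv (𝓡 n) 𝓘(ℝ, F) f (j z) (mfderiv 𝓘(ℝ, E) (𝓡 n) j z v) := by
  have := mfderiv_comp z hf hj
  rw [← mfderiv_eq_fderiv]
  change mfderiv 𝓘(ℝ, E) 𝓘(ℝ, F) (f ∘ j) z v = _
  rw [this]; rfl

theorem ContMDiff.contDiff_comp {f : M → F} {j : E → M} (hf : ContMDiff (𝓡 n) 𝓘(ℝ, F) ∞ f)
    (hj : ContMDiff 𝓘(ℝ, E) (𝓡 n) ∞ j) : Smooth (fun w => f (j w)) :=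
  contMDiff_iff_contDiff.mp (hf.comp hj)

theorem IsParam.mfderiv_bijective {κ : Rn n → M} (h : IsParam κ) (z : Rn n) :
    Bijective (mfderiv (𝓡 n) (𝓡 n) κ z) := by
  obtain ⟨g, hg, hl⟩ := h.inv
  have hgz : MDifferentiableAt (𝓡 n) (𝓡 n) g (κ z) :=
    (hg.contMDiffAt (h.isOpen_range.mem_nhds ⟨z, rfl⟩)).mdifferentiableAt (by simp)
  have hκ : MDifferentiableAt (𝓡 n) (𝓡 n) κ z := h.smooth.mdifferentiableAt (by simp)
  have hinj : Injective (mfderiv (𝓡 n) (𝓡 n) κ z) := by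
    intro v w hvw
    have h1 := fderiv_comp_mfld hgz hκ v
    have h2 := fderiv_comp_mfld hgz hκ w
    have h3 : (fun w => g (κ w)) = id := funext hl
    rw [h3] at h1 h2
    rw [fderiv_id] at h1 h2
    exact h1.trans ((congrArg _ hvw).trans h2.symm)
  let A : Rn n →L[ℝ] Rn n := mfderiv (𝓡 n) (𝓡 n) κ z
  exact ⟨hinj, (LinearMap.injective_iff_surjective (f := A.toLinearMap)).mp hinj⟩

end Param

/-! ### Inverse functions -/

section Inverse
variable {E : Type*} [NormedAddCommGroup E] [NormedSpace ℝ E] [FiniteDimensional ℝ E]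
  {F : Type*} [NormedAddCommGroup F] [NormedSpace ℝ F] [FiniteDimensional ℝ F]

theorem exists_local_inverse {f : E → F} {a : E}
    (hf : ContDiffAt ℝ ∞ f a) (hi : Injective (𝒟 f a))
    (hd : Module.finrank ℝ E = Module.finrank ℝ F) :
    ∃ g : F → E, ContDiffAt ℝ ∞ g (f a) ∧ g (f a) = a ∧ (∀ᶠ z in 𝓝 a, g (f z) = z) ∧
      (∀ᶠ w in 𝓝 (f a), f (g w) = w) := by
  let A : E ≃L[ℝ] F := (LinearEquiv.ofInjectiveOfFinrankEq (𝒟 f a).toLinearMap hi hd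
    ).toContinuousLinearEquiv
  have hA : HasFDerivAt f (A : E →L[ℝ] F) a := by
    have := (hf.differentiableAt (by simp)).hasFDerivAt
    exact this
  have := FiniteDimensional.complete ℝ E
  have hs : HasStrictFDerivAt f (A : E →L[ℝ] F) a := hf.hasStrictFDerivAt' hA (by simp)
  exact ⟨hf.localInverse hA (by simp), hf.to_localInverse hA (by simp),
    hf.localInverse_apply_image hA (by simp), hs.eventually_left_inverse,
    hs.eventually_right_inverse⟩

/-- An immersion has a local smooth left inverse. -/
theorem exists_local_left_inverse {f : E → F} {a : E}
    (hf : ContDiffAt ℝ ∞ f a) (hi : Injective (𝒟 f a)) :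
    ∃ g : F → E, ContDiffAt ℝ ∞ g (f a) ∧ g (f a) = a ∧ (∀ᶠ z in 𝓝 a, g (f z) = z) := by
  obtain ⟨P, hP⟩ := ContinuousLinearMap.HasLeftInverse.of_injective_of_finiteDimensional hi
  have hPf : ContDiffAt ℝ ∞ (fun z => P (f z)) a := P.contDiff.contDiffAt.comp a hf
  have hd : 𝒟 (fun z => P (f z)) a = P.comp (𝒟 f a) :=
    (P.hasFDerivAt.comp a (hf.differentiableAt (by simp)).hasFDerivAt).fderiv
  obtain ⟨g, h1, h2, h3, -⟩ := exists_local_inverse hPf (by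
    rw [hd]; exact fun v w h => by rw [← hP v, ← hP w]; exact h) rfl
  exact ⟨fun w => g (P w), h1.comp _ P.contDiff.contDiffAt, h2, h3⟩

theorem injOn_nhds_of_immersion {f : E → F} {a : E}
    (hf : ContDiffAt ℝ ∞ f a) (hi : Injective (𝒟 f a)) :
    ∃ N ∈ 𝓝 a, InjOn f N := by
  obtain ⟨g, -, -, hg⟩ := exists_local_left_inverse hf hi
  exact ⟨_, hg, fun z hz w hw h => by
    rw [← show g (f z) = z from hz, ← show g (f w) = w from hw, h]⟩

theorem map_nhds_of_bijective {f : E → F} {a : E}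
    (hf : ContDiffAt ℝ ∞ f a) (hi : Injective (𝒟 f a))
    (hd : Module.finrank ℝ E = Module.finrank ℝ F) : map f (𝓝 a) = 𝓝 (f a) := by
  have := FiniteDimensional.complete ℝ E
  have := FiniteDimensional.complete ℝ F
  refine (hf.hasStrictFDerivAt (by simp)).map_nhds_eq_of_surj ?_
  exact LinearMap.range_eq_top.mpr ((LinearMap.injective_iff_surjective_of_finrank_eq_finrank hd).mp hi)

end Inverse

/-! ### Immersed Lagrangians -/

section Lag
variable {n : ℕ} {L : Type*} [TopologicalSpace L] [ChartedSpace (Rn n) L]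

variable {ι : L → ImO}
  {E : Type*} [NormedAddCommGroup E] [NormedSpace ℝ E]

theorem IsImmersedInS6.fderiv_comp (hι : IsImmersedInS6 (n := n) ι) {j : E → L} {z : E}
    (hj : ContMDiffAt 𝓘(ℝ, E) (𝓡 n) ∞ j z) (v : E) : 𝒟 (fun w => ι (j w)) z v =
      mfderiv (𝓡 n) 𝓘(ℝ, ImO) ι (j z) (mfderiv 𝓘(ℝ, E) (𝓡 n) j z v) :=
  fderiv_comp_mfld (hι.smooth.mdifferentiableAt (by simp)) (hj.mdifferentiableAt (by simp)) v

theorem IsImmersedInS6.comp_param (hι : IsImmersedInS6 (n := n) ι) {κ : Rn n → L} (hκ : IsParam κ) :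
    Smooth (fun z => ι (κ z)) ∧ ∀ z, Injective (𝒟 (fun z => ι (κ z)) z) := by
  refine ⟨ContMDiff.contDiff_comp hι.smooth hκ.smooth, fun z v w h => ?_⟩
  rw [hι.fderiv_comp hκ.smooth.contMDiffAt, hι.fderiv_comp hκ.smooth.contMDiffAt] at h
  exact (hκ.mfderiv_bijective z).1 (hι.immersive _ h)

theorem IsLagrangian.patch {L : Type*} [TopologicalSpace L] [ChartedSpace (Rn 3) L] {ι : L → ImO}
    (hl : IsLagrangian ι) (hι : IsImmersedInS6 (n := 3) ι) {j : E → L}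
    (hj : ContMDiff 𝓘(ℝ, E) (𝓡 3) ∞ j)
    (hi : ∀ z, Injective (𝒟 (fun w => ι (j w)) z)) :
    IsLagPatch (fun w => ι (j w)) where
  smooth := ContMDiff.contDiff_comp hι.smooth hj
  norm_eq := fun x => hι.norm_eq_one _
  inj := hi
  lag := fun x v w => by
    rw [hι.fderiv_comp hj.contMDiffAt, hι.fderiv_comp hj.contMDiffAt]
    exact hl _ _ _

theorem IsLagrangian.patch_param {L : Type*} [TopologicalSpace L] [ChartedSpace (Rn 3) L] {ι : L → ImO}
    (hl : IsLagrangian ι) (hι : IsImmersedInS6 (n := 3) ι) {κ : R3 → L}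
    (hκ : IsParam κ) : IsLagPatch (fun w => ι (κ w)) :=
  hl.patch hι hκ.smooth (hι.comp_param hκ).2

theorem IsLagrangian.of_patch {L : Type*} [TopologicalSpace L] [ChartedSpace (Rn 3) L] {ι : L → ImO}
    (hι : IsImmersedInS6 (n := 3) ι) {κ : R3 → L} (hκ : IsParam κ) {z : R3}
    (h : ∀ v w, ⟪(cross (ι (κ z)) (𝒟 (fun w => ι (κ w)) z v)),
      (𝒟 (fun w => ι (κ w)) z w)⟫ = 0) (v w : TangentSpace (𝓡 3) (κ z)) :
    omega (ι (κ z)) (mfderiv (𝓡 3) 𝓘(ℝ, ImO) ι (κ z) v) (mfderiv (𝓡 3) 𝓘(ℝ, ImO) ι (κ z) w) = 0 := by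
  obtain ⟨v, rfl⟩ := (hκ.mfderiv_bijective z).2 v
  obtain ⟨w, rfl⟩ := (hκ.mfderiv_bijective z).2 w
  have h1 := hι.fderiv_comp (z := z) hκ.smooth.contMDiffAt v
  have h2 := hι.fderiv_comp (z := z) hκ.smooth.contMDiffAt w
  have := h v w
  rw [h1, h2] at this
  exact this

/-- Unique continuation on a connected Lagrangian. -/
theorem IsLagrangian.unique_continuation {L : Type*} [TopologicalSpace L] [ChartedSpace (Rn 3) L]
    [IsManifold (𝓡 3) ∞ L] [ConnectedSpace L] {ι : L → ImO}
    (hl : IsLagrangian ι) (hι : IsImmersedInS6 (n := 3) ι) {U : Set L} (hU : IsOpen U)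
    (hne : U.Nonempty) {m : ImO} (hz : ∀ x ∈ U, ⟪ι x, m⟫ = 0) (x : L) :
    ⟪ι x, m⟫ = 0 := by
  set O : Set L := {x | ∀ᶠ y in 𝓝 x, ⟪ι y, m⟫ = 0} with hO
  have hOo : IsOpen O := isOpen_setOfPred_eventually_nhds
  have hOc : IsClosed O := by
    rw [← closure_subset_iff_isClosed]
    intro y hy
    obtain ⟨κ, hκ, h0, -⟩ := exists_param (n := 3) y univ_mem
    obtain ⟨w, ⟨z, rfl⟩, hw⟩ := mem_closure_iff.mp hy _ hκ.isOpen_range ⟨0, h0⟩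
    have := (hl.patch_param hι hκ).unique_continuation m (O := κ ⁻¹' O)
      (hOo.preimage hκ.smooth.continuous) ⟨z, hw⟩ (fun z hz => (show ∀ᶠ _ in _, _ from hz).self_of_nhds)
    filter_upwards [hκ.isOpen_range.mem_nhds ⟨0, h0⟩]
    rintro _ ⟨z, rfl⟩
    exact this z
  have : O = univ := IsClopen.eq_univ ⟨hOc, hOo⟩ (by
    obtain ⟨y, hy⟩ := hne
    exact ⟨y, by filter_upwards [hU.mem_nhds hy] with z hz' using hz z hz'⟩)
  exact (show ∀ᶠ y in 𝓝 x, ⟪ι y, m⟫ = 0 from (this ▸ mem_univ x : x ∈ O)).self_of_nhds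

theorem IsLagrangian.mem_of_open {L : Type*} [TopologicalSpace L] [ChartedSpace (Rn 3) L]
    [IsManifold (𝓡 3) ∞ L] [ConnectedSpace L] {ι : L → ImO}
    (hl : IsLagrangian ι) (hι : IsImmersedInS6 (n := 3) ι) {U : Set L} (hU : IsOpen U)
    (hne : U.Nonempty) {W : Submodule ℝ ImO} (hz : ∀ x ∈ U, ι x ∈ W) (x : L) : ι x ∈ W := by
  rw [← W.orthogonal_orthogonal]
  intro m hm
  rw [real_inner_comm]
  exact hl.unique_continuation hι hU hne (fun y hy => (W.mem_orthogonal m).mp hm _ (hz y hy)) x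

/-! ### Local types -/

/-- An open embedded piece of type `P`. -/
structure IsPiece {L : Type*} [TopologicalSpace L] (ι : L → ImO) (P : Set ImO → Prop) (V : Set L) :
    Prop where
  isOpen : IsOpen V
  emb : IsEmbedding (V.domRestrict ι)
  type : P (ι '' V)

theorem locallyOnDense_iff {L : Type*} [TopologicalSpace L] {ι : L → ImO} {P : Set ImO → Prop} :
    LocallyOnDense ι P ↔ ∀ U : Set L, IsOpen U → U.Nonempty →
      ∃ V, IsPiece ι P V ∧ (U ∩ V).Nonempty := by
  constructor
  · rintro ⟨D, hDo, hD, h⟩ U hU hne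
    obtain ⟨y, hyU, hyD⟩ := hD.inter_open_nonempty U hU hne
    obtain ⟨W, hW, hyW, he, hP⟩ := h y hyD
    exact ⟨W ∩ D, ⟨hW.inter hDo, he, hP⟩, y, hyU, hyW, hyD⟩
  · intro h
    refine ⟨⋃₀ {V | IsPiece ι P V}, isOpen_sUnion fun V hV => hV.isOpen, ?_, ?_⟩
    · rw [dense_iff_inter_open]
      intro U hU hne
      obtain ⟨V, hV, y, hyU, hyV⟩ := h U hU hne
      exact ⟨y, hyU, V, hV, hyV⟩
    · rintro x ⟨V, hV, hx⟩
      have e : V ∩ ⋃₀ {V | IsPiece ι P V} = V :=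
        inter_eq_left.mpr (subset_sUnion_of_mem hV)
      exact ⟨V, hV.isOpen, hx, by rw [e]; exact hV.emb, by rw [e]; exact hV.type⟩

theorem LocallyOnDense.mono {L : Type*} [TopologicalSpace L] {ι : L → ImO} {P Q : Set ImO → Prop}
    (h : LocallyOnDense ι P) (hPQ : ∀ A, P A → Q A) : LocallyOnDense ι Q := by
  rw [locallyOnDense_iff] at h ⊢
  intro U hU hne
  obtain ⟨V, hV, hy⟩ := h U hU hne
  exact ⟨V, ⟨hV.isOpen, hV.emb, hPQ _ hV.type⟩, hy⟩

theorem embedding_subset {L : Type*} [TopologicalSpace L] {ι : L → ImO} {V V' : Set L}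
    (h : IsEmbedding (V.domRestrict ι)) (hs : V' ⊆ V) : IsEmbedding (V'.domRestrict ι) :=
  h.comp (IsEmbedding.inclusion hs)

/-- Smooth maps with values in an embedded piece lift. -/
theorem exists_lift [IsManifold (𝓡 n) ∞ L] (hι : IsImmersedInS6 (n := n) ι) {V : Set L}
    (he : IsEmbedding (V.domRestrict ι)) {H : E → ImO} (hH : Smooth H)
    (hm : ∀ z, H z ∈ ι '' V) :
    ∃ j : E → L, ContMDiff 𝓘(ℝ, E) (𝓡 n) ∞ j ∧ (∀ z, ι (j z) = H z) ∧ ∀ z, j z ∈ V := by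
  choose j hjV hj using hm
  refine ⟨j, fun z => ?_, hj, hjV⟩
  have hc : Continuous fun z => (⟨j z, hjV z⟩ : V) := by
    rw [he.continuous_iff]
    have : (V.domRestrict ι ∘ fun z => (⟨j z, hjV z⟩ : V)) = H := funext hj
    rw [this]; exact hH.continuous
  have hjc : Continuous j := continuous_subtype_val.comp hc
  obtain ⟨κ, hκ, h0, -⟩ := exists_param (n := n) (j z) univ_mem
  obtain ⟨hs, hi⟩ := hι.comp_param hκ
  obtain ⟨g, hg, -, hgl⟩ := exists_local_left_inverse hs.contDiffAt (hi 0)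
  rw [h0, hj] at hg
  have h1 : ContMDiffAt 𝓘(ℝ, E) (𝓡 n) ∞ (fun w => κ (g (H w))) z :=
    hκ.smooth.contMDiffAt.comp z (hg.comp z hH.contDiffAt).contMDiffAt
  refine h1.congr_of_eventuallyEq ?_
  have h2 : ∀ᶠ m in 𝓝 (j z), κ (g (ι m)) = m := by
    rw [← h0, ← hκ.isOpenEmbedding.map_nhds_eq, eventually_map]
    filter_upwards [hgl] with w hw
    rw [hw]
  filter_upwards [hjc.continuousAt.eventually h2] with w hw
  rw [← hj]; exact hw.symm

end Lag

section

/-! ### Families of great circles -/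

/-- The plane of parameters of a family of great circles. -/
abbrev R2 : Type := EuclideanSpace ℝ (Fin 2)

/-- The family of great circles through `x d` with direction `e d`. -/
def tube (x e : R2 → ImO) (p : R2 × ℝ) : ImO := Real.cos p.2 • x p.1 + Real.sin p.2 • e p.1

/-- A smooth family of great circles. -/
structure IsTube (x e : R2 → ImO) : Prop where
  smooth_x : Smooth x
  smooth_e : Smooth e
  norm_x : ∀ d, ‖x d‖ = 1
  norm_e : ∀ d, ‖e d‖ = 1
  perp : ∀ d, ⟪x d, e d⟫ = 0

/-- The family is immersive along the circle over `d`. -/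
def Good (x e : R2 → ImO) (d : R2) : Prop :=
  ∀ t, Injective (𝒟 (tube x e) (d, t))

/-- The direction of the circles. -/
def tubeDir (x e : R2 → ImO) (p : R2 × ℝ) : ImO := -Real.sin p.2 • x p.1 + Real.cos p.2 • e p.1

namespace IsTube
variable {x e : R2 → ImO} (h : IsTube x e)
include h

theorem smooth : Smooth (tube x e) := by
  have h1 := h.smooth_x
  have h2 := h.smooth_e
  unfold tube
  exact ((Real.contDiff_cos.comp contDiff_snd).smul (h1.comp contDiff_fst)).add
    ((Real.contDiff_sin.comp contDiff_snd).smul (h2.comp contDiff_fst))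

theorem smooth_dir : Smooth (tubeDir x e) := by
  have h1 := h.smooth_x
  have h2 := h.smooth_e
  unfold tubeDir
  exact ((Real.contDiff_sin.comp contDiff_snd).neg.smul (h1.comp contDiff_fst)).add
    ((Real.contDiff_cos.comp contDiff_snd).smul (h2.comp contDiff_fst))

theorem inner_x (d : R2) (a b : ℝ) : ⟪x d, a • x d + b • e d⟫ = a := by
  simp [inner_add_right, inner_smul_right, h.perp, h.norm_x]

theorem inner_e (d : R2) (a b : ℝ) : ⟪e d, a • x d + b • e d⟫ = b := by
  have := h.perp d
  rw [real_inner_comm] at this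
  simp [inner_add_right, inner_smul_right, this, h.norm_e]

theorem cos_sin_eq {d : R2} {t t' : ℝ} (hT : tube x e (d, t) = tube x e (d, t')) :
    Real.cos t = Real.cos t' ∧ Real.sin t = Real.sin t' := by
  have h1 := congrArg (inner ℝ (x d)) hT
  have h2 := congrArg (inner ℝ (e d)) hT
  simp only [tube, h.inner_x, h.inner_e] at h1 h2
  exact ⟨h1, h2⟩

theorem norm_tube (p : R2 × ℝ) : ‖tube x e p‖ = 1 := by
  have h2 := h.perp p.1
  have h3 := h2
  rw [real_inner_comm] at h3
  have : ‖tube x e p‖ ^ 2 = 1 := by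
    rw [← real_inner_self_eq_norm_sq]
    simp only [tube, inner_add_left, inner_add_right, inner_smul_left, inner_smul_right, h2, h3,
      conj_trivial, real_inner_self_eq_norm_sq, h.norm_x, h.norm_e]
    nlinarith [Real.cos_sq_add_sin_sq p.2]
  nlinarith [norm_nonneg (tube x e p)]

theorem norm_dir (p : R2 × ℝ) : ‖tubeDir x e p‖ = 1 := by
  have h2 := h.perp p.1
  have h3 := h2
  rw [real_inner_comm] at h3
  have : ‖tubeDir x e p‖ ^ 2 = 1 := by
    rw [← real_inner_self_eq_norm_sq]
    simp only [tubeDir, inner_add_left, inner_add_right, inner_smul_left, inner_smul_right, h2, h3,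
      conj_trivial, real_inner_self_eq_norm_sq, h.norm_x, h.norm_e]
    nlinarith [Real.cos_sq_add_sin_sq p.2]
  nlinarith [norm_nonneg (tubeDir x e p)]

theorem inner_dir (p : R2 × ℝ) : ⟪tube x e p, tubeDir x e p⟫ = 0 := by
  have h2 := h.perp p.1
  have h3 := h2
  rw [real_inner_comm] at h3
  simp only [tube, tubeDir, inner_add_left, inner_add_right, inner_smul_left, inner_smul_right, h2, h3,
      conj_trivial, real_inner_self_eq_norm_sq, h.norm_x, h.norm_e]
  ring

theorem fderiv_tube (d : R2) (t : ℝ) (v : R2) (s : ℝ) : 𝒟 (tube x e) (d, t) (v, s) =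
    Real.cos t • 𝒟 x d v + Real.sin t • 𝒟 e d v + s • tubeDir x e (d, t) := by
  have hx : HasFDerivAt (fun p : R2 × ℝ => x p.1)
      ((𝒟 x d).comp (ContinuousLinearMap.fst ℝ R2 ℝ)) (d, t) :=
    ((h.smooth_x.diff d).hasFDerivAt).comp (d, t) hasFDerivAt_fst
  have he : HasFDerivAt (fun p : R2 × ℝ => e p.1)
      ((𝒟 e d).comp (ContinuousLinearMap.fst ℝ R2 ℝ)) (d, t) :=
    ((h.smooth_e.diff d).hasFDerivAt).comp (d, t) hasFDerivAt_fst
  have hc : HasFDerivAt (fun p : R2 × ℝ => Real.cos p.2)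
      ((-Real.sin t) • (ContinuousLinearMap.snd ℝ R2 ℝ)) (d, t) :=
    (hasFDerivAt_snd (𝕜 := ℝ) (p := (d, t))).cos
  have hs : HasFDerivAt (fun p : R2 × ℝ => Real.sin p.2)
      ((Real.cos t) • (ContinuousLinearMap.snd ℝ R2 ℝ)) (d, t) :=
    (hasFDerivAt_snd (𝕜 := ℝ) (p := (d, t))).sin
  have := ((hc.smul hx).add (hs.smul he)).fderiv
  change 𝒟 (fun p : R2 × ℝ => Real.cos p.2 • x p.1 + Real.sin p.2 • e p.1) (d, t) (v, s) = _
  rw [show (fun p : R2 × ℝ => Real.cos p.2 • x p.1 + Real.sin p.2 • e p.1) =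
    (fun p : R2 × ℝ => Real.cos p.2 • x p.1) + fun p : R2 × ℝ => Real.sin p.2 • e p.1 from rfl]
  erw [this]
  simp [tubeDir]
  module

end IsTube

theorem tube_add_int (x e : R2 → ImO) (d : R2) (t : ℝ) (k : ℤ) :
    tube x e (d, t + k * (2 * Real.pi)) = tube x e (d, t) := by
  simp [tube, Real.cos_add_int_mul_two_pi, Real.sin_add_int_mul_two_pi]

theorem tubeDir_add_int (x e : R2 → ImO) (d : R2) (t : ℝ) (k : ℤ) :
    tubeDir x e (d, t + k * (2 * Real.pi)) = tubeDir x e (d, t) := by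
  simp [tubeDir, Real.cos_add_int_mul_two_pi, Real.sin_add_int_mul_two_pi]

theorem exists_int_eq {t t' : ℝ} (hc : Real.cos t = Real.cos t') (hs : Real.sin t = Real.sin t') :
    ∃ k : ℤ, t' = t + k * (2 * Real.pi) := by
  have := Real.Angle.cos_sin_inj hc.symm hs.symm
  obtain ⟨k, hk⟩ := Real.Angle.angle_eq_iff_two_pi_dvd_sub.mp this
  exact ⟨k, by linarith⟩

theorem exists_int_mem (t : ℝ) : ∃ k : ℤ, t + k * (2 * Real.pi) ∈ Icc 0 (2 * Real.pi) := by
  obtain ⟨k, hk, -⟩ := existsUnique_add_zsmul_mem_Ico Real.two_pi_pos t 0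
  refine ⟨k, ?_⟩
  rw [zsmul_eq_mul, zero_add] at hk
  exact ⟨hk.1, hk.2.le⟩

variable {x e : R2 → ImO}

theorem IsTube.fderiv_add_int (h : IsTube x e) (d : R2) (t : ℝ) (k : ℤ) :
    𝒟 (tube x e) (d, t + k * (2 * Real.pi)) = 𝒟 (tube x e) (d, t) := by
  refine ContinuousLinearMap.ext fun ⟨v, s⟩ => ?_
  rw [h.fderiv_tube, h.fderiv_tube, tubeDir_add_int, Real.cos_add_int_mul_two_pi,
    Real.sin_add_int_mul_two_pi]

theorem IsTube.eventually_good (h : IsTube x e) {d : R2} (hg : Good x e d) :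
    ∀ᶠ d' in 𝓝 d, Good x e d' := by
  have hc : Continuous (𝒟 (tube x e)) := h.smooth.continuous_fderiv (by simp)
  have := isCompact_Icc (a := (0 : ℝ)) (b := 2 * Real.pi) |>.eventually_forall_of_forall_eventually
    (x₀ := d) (P := fun d t => Injective (𝒟 (tube x e) (d, t))) (fun t _ =>
      hc.continuousAt.eventually (ContinuousLinearMap.isOpen_injective.mem_nhds (hg t)))
  filter_upwards [this] with d' hd' t
  obtain ⟨k, hk⟩ := exists_int_mem t
  rw [← h.fderiv_add_int d' t k]
  exact hd' _ hk

theorem IsTube.exists_injective (h : IsTube x e) {d : R2} (hg : Good x e d) :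
    ∃ ρ > 0, ∀ a ∈ closedBall d ρ, ∀ b ∈ closedBall d ρ, ∀ s t,
      tube x e (a, s) = tube x e (b, t) → a = b := by
  have hTc := h.smooth.continuous
  have key := (isCompact_Icc (a := (0 : ℝ)) (b := 2 * Real.pi)).prod
    (isCompact_Icc (a := (0 : ℝ)) (b := 2 * Real.pi)) |>.eventually_forall_of_forall_eventually
    (x₀ := (d, d)) (P := fun a t => tube x e (a.1, t.1) = tube x e (a.2, t.2) → a.1 = a.2) (by
      rintro ⟨t, t'⟩ -
      by_cases hT : tube x e (d, t) = tube x e (d, t')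
      · obtain ⟨hcos, hsin⟩ := h.cos_sin_eq hT
        obtain ⟨k, rfl⟩ := exists_int_eq hcos hsin
        obtain ⟨N, hN, hinj⟩ := injOn_nhds_of_immersion h.smooth.contDiffAt (hg t)
        have h1 : ∀ᶠ z : (R2 × R2) × ℝ × ℝ in 𝓝 ((d, d), (t, t + k * (2 * Real.pi))),
            (z.1.1, z.2.1) ∈ N := by
          have : Continuous fun z : (R2 × R2) × ℝ × ℝ => (z.1.1, z.2.1) := by fun_prop
          exact this.continuousAt.eventually (by exact hN)
        have h2 : ∀ᶠ z : (R2 × R2) × ℝ × ℝ in 𝓝 ((d, d), (t, t + k * (2 * Real.pi))),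
            (z.1.2, z.2.2 - k * (2 * Real.pi)) ∈ N := by
          have : Continuous fun z : (R2 × R2) × ℝ × ℝ => (z.1.2, z.2.2 - k * (2 * Real.pi)) := by
            fun_prop
          exact this.continuousAt.eventually (by simpa using hN)
        filter_upwards [h1, h2] with z hz1 hz2 hzT
        have h3 := hinj hz1 hz2 (hzT.trans (by
          rw [← tube_add_int x e z.1.2 (z.2.2 - k * (2 * Real.pi)) k, sub_add_cancel]))
        exact (Prod.mk.inj h3).1
      · have h1 : ∀ᶠ z : (R2 × R2) × ℝ × ℝ in 𝓝 ((d, d), (t, t')),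
            tube x e (z.1.1, z.2.1) ≠ tube x e (z.1.2, z.2.2) := by
          have c1 : Continuous fun z : (R2 × R2) × ℝ × ℝ => tube x e (z.1.1, z.2.1) := by fun_prop
          have c2 : Continuous fun z : (R2 × R2) × ℝ × ℝ => tube x e (z.1.2, z.2.2) := by fun_prop
          exact (isOpen_ne_fun c1 c2).mem_nhds hT
        filter_upwards [h1] with z hz hzT using absurd hzT hz)
  rw [nhds_prod_eq, ((nhds_basis_closedBall (x := d)).prod_self).eventually_iff] at key
  obtain ⟨ρ, hρ, hk⟩ := key
  refine ⟨ρ, hρ, fun a ha b hb s t hT => ?_⟩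
  obtain ⟨k, hk1⟩ := exists_int_mem s
  obtain ⟨l, hl1⟩ := exists_int_mem t
  rw [← tube_add_int x e a s k, ← tube_add_int x e b t l] at hT
  exact hk (x := (a, b)) ⟨ha, hb⟩ (_, _) ⟨hk1, hl1⟩ hT

/-! ### Restriction to balls -/

/-- The diffeomorphism of the plane onto the ball of radius `ρ` about `c`. -/
abbrev ub (c : R2) (ρ : ℝ) : R2 → R2 := univBall c ρ

theorem isParam_ub (c : R2) {ρ : ℝ} (hρ : 0 < ρ) : IsParam (ub c ρ) ∧ range (ub c ρ) = ball c ρ := by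
  have hid : IsParam (id : R2 → R2) := ⟨contMDiff_id, by simp, id, contMDiffOn_id, fun _ => rfl⟩
  have := hid.ball c hρ
  simpa using this

theorem smooth_ub (c : R2) (ρ : ℝ) : Smooth (ub c ρ) := contDiff_univBall

theorem fderiv_ub_bijective (c : R2) {ρ : ℝ} (hρ : 0 < ρ) (z : R2) :
    Bijective (𝒟 (ub c ρ) z) := by
  have := (isParam_ub c hρ).1.mfderiv_bijective z
  rwa [mfderiv_eq_fderiv] at this

theorem ub_injective (c : R2) {ρ : ℝ} (hρ : 0 < ρ) : Injective (ub c ρ) :=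
  (isParam_ub c hρ).1.isOpenEmbedding.injective

theorem ub_zero (c : R2) (ρ : ℝ) : ub c ρ 0 = c := univBall_apply_zero c ρ

theorem ub_mem (c : R2) {ρ : ℝ} (hρ : 0 < ρ) (z : R2) : ub c ρ z ∈ ball c ρ := by
  rw [← (isParam_ub c hρ).2]; exact ⟨z, rfl⟩

/-- The family restricted to a ball. -/
theorem IsTube.comp (h : IsTube x e) {φ : R2 → R2} (hφ : Smooth φ) :
    IsTube (x ∘ φ) (e ∘ φ) :=
  ⟨h.smooth_x.comp hφ, h.smooth_e.comp hφ, fun _ => h.norm_x _, fun _ => h.norm_e _,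
    fun _ => h.perp _⟩

theorem tube_comp (φ : R2 → R2) (p : R2 × ℝ) : tube (x ∘ φ) (e ∘ φ) p = tube x e (φ p.1, p.2) := rfl

theorem IsTube.good_comp (h : IsTube x e) {φ : R2 → R2} (hφ : Smooth φ) {d : R2}
    (hd : Injective (𝒟 φ d)) (hg : Good x e (φ d)) : Good (x ∘ φ) (e ∘ φ) d := by
  intro t
  rw [injective_iff_map_eq_zero]
  rintro ⟨v, s⟩ hv
  rw [(h.comp hφ).fderiv_tube] at hv
  have c1 : ∀ f : R2 → ImO, Smooth f → 𝒟 (f ∘ φ) d v =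
      𝒟 f (φ d) (𝒟 φ d v) := by
    intro f hf
    rw [fderiv_comp d (hf.diff _) (hφ.diff _)]
    rfl
  rw [c1 x h.smooth_x, c1 e h.smooth_e] at hv
  have := (injective_iff_map_eq_zero _).mp (hg t) (𝒟 φ d v, s) (by
    rw [h.fderiv_tube]; exact hv)
  simp only [Prod.mk_eq_zero] at this ⊢
  exact ⟨(injective_iff_map_eq_zero _).mp hd v this.1, this.2⟩

end

section

/-! ### Ruled charts -/

section Factor
variable {n : ℕ} {L : Type*} [TopologicalSpace L] [ChartedSpace (Rn n) L]
  {E : Type*} [NormedAddCommGroup E] [NormedSpace ℝ E]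

theorem IsParam.factor {κ : Rn n → L} (hκ : IsParam κ) {j : E → L} {p : E}
    (hj : ContMDiffAt 𝓘(ℝ, E) (𝓡 n) ∞ j p) (hp : j p ∈ range κ) :
    ∃ h : E → Rn n, ContDiffAt ℝ ∞ h p ∧ ∀ᶠ q in 𝓝 p, κ (h q) = j q := by
  obtain ⟨g, hg, hl⟩ := hκ.inv
  refine ⟨fun q => g (j q), contMDiffAt_iff_contDiffAt.mp
    ((hg.contMDiffAt (hκ.isOpen_range.mem_nhds hp)).comp p hj), ?_⟩
  filter_upwards [hj.continuousAt.eventually (hκ.isOpen_range.mem_nhds hp)] with q hq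
  obtain ⟨z, hz⟩ := hq
  rw [← hz, hl]

/-- A map to a manifold whose composition with an immersion is an immersion is a local
diffeomorphism if the dimensions agree. -/
theorem local_inverse_of_immersion [FiniteDimensional ℝ E] [IsManifold (𝓡 n) ∞ L] {ι : L → ImO}
    (hι : IsImmersedInS6 (n := n) ι) {j : E → L} {p : E}
    (hj : ContMDiffAt 𝓘(ℝ, E) (𝓡 n) ∞ j p)
    (hi : Injective (𝒟 (fun q => ι (j q)) p)) (hd : Module.finrank ℝ E = n) :
    map j (𝓝 p) = 𝓝 (j p) ∧ ∃ G : L → E, ContMDiffAt (𝓡 n) 𝓘(ℝ, E) ∞ G (j p) ∧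
      ∀ᶠ q in 𝓝 p, G (j q) = q := by
  obtain ⟨κ, hκ, h0, -⟩ := exists_param (n := n) (j p) univ_mem
  obtain ⟨h, hh, hκh⟩ := hκ.factor hj ⟨0, h0⟩
  obtain ⟨hs, -⟩ := hι.comp_param hκ
  have hp : κ (h p) = j p := hκh.self_of_nhds
  have hinj : Injective (𝒟 h p) := by
    intro v w hvw
    apply hi
    have e1 : (fun q => ι (j q)) =ᶠ[𝓝 p] (fun z => ι (κ z)) ∘ h := by
      filter_upwards [hκh] with q hq
      simp [hq]
    rw [e1.fderiv_eq, fderiv_comp p (hs.diff _) (hh.differentiableAt (by simp))]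
    exact congrArg (𝒟 (fun z => ι (κ z)) (h p)) hvw
  have hd' : Module.finrank ℝ E = Module.finrank ℝ (Rn n) := by rw [hd]; simp
  have hm := map_nhds_of_bijective hh hinj hd'
  obtain ⟨g, hg, -, hgl, -⟩ := exists_local_inverse hh hinj hd'
  constructor
  · rw [← map_congr hκh]
    change map (κ ∘ h) _ = _
    rw [← map_map, hm, hκ.isOpenEmbedding.map_nhds_eq, hp]
  · obtain ⟨k, hk, hl⟩ := hκ.inv
    refine ⟨fun m => g (k m), ?_, ?_⟩
    · have h1 := hk.contMDiffAt (hκ.isOpen_range.mem_nhds ⟨0, h0⟩)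
      have h2 : k (j p) = h p := by rw [← hp, hl]
      rw [← h2] at hg
      exact hg.contMDiffAt.comp (j p) h1
    · filter_upwards [hκh, hgl] with q hq hq'
      rw [← hq, hl, hq']

end Factor

section Opens
variable {n : ℕ} {L : Type*} [TopologicalSpace L] [ChartedSpace (Rn n) L]

theorem mfderiv_subtype_val_injective [IsManifold (𝓡 n) ∞ L] (W : TopologicalSpace.Opens L) (w : W) :
    Injective (mfderiv (𝓡 n) (𝓡 n) (Subtype.val : W → L) w) := by
  classical
  let r : L → W := fun m => if h : m ∈ W then ⟨m, h⟩ else w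
  have hr : ContMDiffAt (𝓡 n) (𝓡 n) ∞ r (w : L) := by
    rw [← ContMDiffAt.subtypeVal_comp_iff]
    refine contMDiffAt_id.congr_of_eventuallyEq ?_
    filter_upwards [W.isOpen.mem_nhds w.2] with m hm
    have : m ∈ W := hm
    simp [r, this]
  have hv : ContMDiff (𝓡 n) (𝓡 n) ∞ (Subtype.val : W → L) := contMDiff_subtype_val
  have hc := mfderiv_comp w (hr.mdifferentiableAt (by simp)) (hv.mdifferentiableAt (by simp) (x := w))
  have hid : r ∘ Subtype.val = id := by
    ext m; simp [r, m.2]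
  rw [hid, mfderiv_id] at hc
  intro v v' hvv
  have h1 := congrArg (fun f => f v) hc
  have h2 := congrArg (fun f => f v') hc
  exact h1.trans ((congrArg (mfderiv (𝓡 n) (𝓡 n) r w) hvv).trans h2.symm)

theorem IsImmersedInS6.restrict [IsManifold (𝓡 n) ∞ L] {ι : L → ImO} (hι : IsImmersedInS6 (n := n) ι)
    (W : TopologicalSpace.Opens L) : IsImmersedInS6 (n := n) (fun y : W => ι y) where
  smooth := hι.smooth.comp contMDiff_subtype_val
  norm_eq_one := fun x => hι.norm_eq_one _
  immersive := fun x => by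
    have hv : ContMDiff (𝓡 n) (𝓡 n) ∞ (Subtype.val : W → L) := contMDiff_subtype_val
    have := mfderiv_comp x (hι.smooth.mdifferentiableAt (by simp) (x := (x : L)))
      (hv.mdifferentiableAt (by simp) (x := x))
    change Injective (mfderiv (𝓡 n) 𝓘(ℝ, ImO) (ι ∘ Subtype.val) x)
    rw [this]
    exact (hι.immersive _).comp (mfderiv_subtype_val_injective W x)

theorem IsLagrangian.restrict {L : Type*} [TopologicalSpace L] [ChartedSpace (Rn 3) L]
    [IsManifold (𝓡 3) ∞ L] {ι : L → ImO} (hl : IsLagrangian ι) (hι : IsImmersedInS6 (n := 3) ι)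
    (W : TopologicalSpace.Opens L) : IsLagrangian (fun y : W => ι y) := by
  intro x v w
  have hv : ContMDiff (𝓡 3) (𝓡 3) ∞ (Subtype.val : W → L) := contMDiff_subtype_val
  have := mfderiv_comp x (hι.smooth.mdifferentiableAt (by simp) (x := (x : L)))
    (hv.mdifferentiableAt (by simp) (x := x))
  change omega _ (mfderiv (𝓡 3) 𝓘(ℝ, ImO) (ι ∘ Subtype.val) x v)
    (mfderiv (𝓡 3) 𝓘(ℝ, ImO) (ι ∘ Subtype.val) x w) = 0
  rw [this]
  exact hl _ _ _

end Opens

variable {L : Type*} [TopologicalSpace L] [ChartedSpace (Rn 3) L]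

/-- An embedded open piece of `L` that is a family of great circles. -/
structure RuledChart (ι : L → ImO) (x e : R2 → ImO) (j : R2 × ℝ → L) : Prop where
  isTube : IsTube x e
  smooth : ContMDiff 𝓘(ℝ, R2 × ℝ) (𝓡 3) ∞ j
  eq : ∀ p, ι (j p) = tube x e p
  good : ∀ d, Good x e d
  inj : ∀ p q, tube x e p = tube x e q → p.1 = q.1
  emb : IsEmbedding ((range j).domRestrict ι)

theorem finrank_R2R : Module.finrank ℝ (R2 × ℝ) = 3 := by
  simp

section
variable {ι : L → ImO} {x e : R2 → ImO} {j : R2 × ℝ → L}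

omit [TopologicalSpace L] [ChartedSpace (Rn 3) L] in
theorem fun_eq_tube (heq : ∀ p, ι (j p) = tube x e p) : (fun q => ι (j q)) = tube x e := funext heq

theorem exists_ruledChart_of_lift (hι : IsImmersedInS6 (n := 3) ι) (h : IsTube x e)
    (hj : ContMDiff 𝓘(ℝ, R2 × ℝ) (𝓡 3) ∞ j) (heq : ∀ p, ι (j p) = tube x e p) {d : R2}
    (hg : Good x e d)
    (hper : ∀ d t t', tube x e (d, t) = tube x e (d, t') → j (d, t) = j (d, t')) :
    ∃ ρ > 0, ∀ r, 0 < r → r ≤ ρ →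
      RuledChart ι (x ∘ ub d r) (e ∘ ub d r) (fun p => j (ub d r p.1, p.2)) := by
  obtain ⟨ρ₁, hρ₁, hinj⟩ := h.exists_injective hg
  obtain ⟨ρ₂, hρ₂, hgood⟩ := nhds_basis_closedBall.eventually_iff.mp (h.eventually_good hg)
  refine ⟨min ρ₁ ρ₂, by positivity, fun r hr hle => ?_⟩
  have hle1 := hle.trans (min_le_left _ _)
  have hle2 := hle.trans (min_le_right _ _)
  have hmem : ∀ a, ub d r a ∈ closedBall d ρ₁ := fun a =>
    closedBall_subset_closedBall hle1 (ball_subset_closedBall (ub_mem d hr a))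
  refine ⟨h.comp (smooth_ub d r), ?_, fun p => heq _, fun a => ?_, fun p q hpq => ?_, ?_⟩
  · have : ContMDiff 𝓘(ℝ, R2 × ℝ) 𝓘(ℝ, R2 × ℝ) ∞ (fun p : R2 × ℝ => (ub d r p.1, p.2)) :=
      (((smooth_ub d r).comp contDiff_fst).prodMk contDiff_snd).contMDiff
    exact hj.comp this
  · refine h.good_comp (smooth_ub d r) (fderiv_ub_bijective d hr a).1 (hgood ?_)
    exact closedBall_subset_closedBall hle2 (ball_subset_closedBall (ub_mem d hr a))
  · exact ub_injective d hr (hinj _ (hmem _) _ (hmem _) _ _ hpq)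
  · set C : Set L := j '' (closedBall d ρ₁ ×ˢ Icc 0 (2 * Real.pi)) with hC
    have hCc : IsCompact C := ((isCompact_closedBall d ρ₁).prod isCompact_Icc).image hj.continuous
    have : CompactSpace C := isCompact_iff_compactSpace.mp hCc
    have hemb : IsEmbedding (C.domRestrict ι) := by
      refine (Continuous.isClosedEmbedding (hι.smooth.continuous.comp continuous_subtype_val)
        ?_).isEmbedding
      rintro ⟨_, ⟨a, s⟩, ⟨ha, _⟩, rfl⟩ ⟨_, ⟨b, t⟩, ⟨hb, _⟩, rfl⟩ hab
      have hab' : tube x e (a, s) = tube x e (b, t) := by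
        rw [← heq, ← heq]; exact hab
      obtain rfl := hinj a ha b hb s t hab'
      exact Subtype.ext (hper _ _ _ hab')
    refine embedding_subset hemb ?_
    rintro _ ⟨⟨a, t⟩, rfl⟩
    obtain ⟨k, hk⟩ := exists_int_mem t
    exact ⟨(ub d r a, t + k * (2 * Real.pi)), ⟨hmem a, hk⟩,
      hper _ _ _ (tube_add_int x e _ t k)⟩

namespace RuledChart
variable (hc : RuledChart ι x e j)
include hc

theorem image_range : ι '' range j = range (tube x e) := by
  rw [← range_comp]; exact congrArg range (fun_eq_tube hc.eq)

theorem immersive (p : R2 × ℝ) : Injective (𝒟 (fun q => ι (j q)) p) := by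
  rw [fun_eq_tube hc.eq]; exact hc.good p.1 p.2

theorem patch (hl : IsLagrangian ι) (hι : IsImmersedInS6 (n := 3) ι) : IsLagPatch (tube x e) := by
  have := hl.patch hι hc.smooth hc.immersive
  rwa [fun_eq_tube hc.eq] at this

variable [IsManifold (𝓡 3) ∞ L]

theorem isOpenMap (hι : IsImmersedInS6 (n := 3) ι) : IsOpenMap j := by
  rw [isOpenMap_iff_nhds_le]
  intro p
  rw [(local_inverse_of_immersion hι hc.smooth.contMDiffAt (hc.immersive p) finrank_R2R).1]

theorem isOpen_range (hι : IsImmersedInS6 (n := 3) ι) : IsOpen (range j) :=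
  (hc.isOpenMap hι).isOpen_range

omit [IsManifold (𝓡 3) ∞ L] in
theorem restrict (d : R2) {r : ℝ} (hr : 0 < r) :
    RuledChart ι (x ∘ ub d r) (e ∘ ub d r) (fun p => j (ub d r p.1, p.2)) where
  isTube := hc.isTube.comp (smooth_ub d r)
  smooth := by
    have : ContMDiff 𝓘(ℝ, R2 × ℝ) 𝓘(ℝ, R2 × ℝ) ∞ (fun p : R2 × ℝ => (ub d r p.1, p.2)) :=
      (((smooth_ub d r).comp contDiff_fst).prodMk contDiff_snd).contMDiff
    exact hc.smooth.comp this
  eq := fun p => hc.eq _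
  good := fun a => hc.isTube.good_comp (smooth_ub d r) (fderiv_ub_bijective d hr a).1 (hc.good _)
  inj := fun p q hpq => ub_injective d hr (hc.inj (ub d r p.1, p.2) (ub d r q.1, q.2) hpq)
  emb := embedding_subset hc.emb (by rintro _ ⟨p, rfl⟩; exact ⟨_, rfl⟩)

omit [IsManifold (𝓡 3) ∞ L] in
theorem cos_sin_eq {d : R2} {s t : ℝ} (h : tube x e (d, s) = tube x e (d, t)) :
    tubeDir x e (d, s) = tubeDir x e (d, t) := by
  obtain ⟨h1, h2⟩ := hc.isTube.cos_sin_eq h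
  simp [tubeDir, h1, h2]

/-- A ruled chart gives a ruled open subset. -/
theorem isRuled (hι : IsImmersedInS6 (n := 3) ι) :
    IsRuled (fun y : (⟨range j, hc.isOpen_range hι⟩ : TopologicalSpace.Opens L) => ι y) := by
  set W : TopologicalSpace.Opens L := ⟨range j, hc.isOpen_range hι⟩ with hW
  let j' : R2 × ℝ → W := fun p => ⟨j p, p, rfl⟩
  have hj' : ContMDiff 𝓘(ℝ, R2 × ℝ) (𝓡 3) ∞ j' := by
    rw [← ContMDiff.subtypeVal_comp_iff]; exact hc.smooth
  have hsurj : Surjective j' := by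
    rintro ⟨_, p, rfl⟩; exact ⟨p, rfl⟩
  choose c hcj using hsurj
  have hτ : ∀ p, tube x e (c (j' p)) = tube x e p := fun p => by
    rw [← hc.eq, ← hc.eq]; exact congrArg (fun w : W => ι w) (hcj (j' p))
  have hc1 : ∀ p, (c (j' p)).1 = p.1 := fun p => hc.inj _ _ (hτ p)
  have hc2 : ∀ p, tubeDir x e (c (j' p)) = tubeDir x e p := fun p => by
    have h1 := hc1 p
    have h2 := hτ p
    rcases hq : c (j' p) with ⟨d, s⟩
    rcases p with ⟨d', t⟩
    rw [hq] at h1 h2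
    obtain rfl : d = d' := h1
    exact hc.cos_sin_eq h2
  have hι' := hι.restrict W
  have hi' : ∀ p, Injective (𝒟 (fun q => ι (j' q)) p) := hc.immersive
  have hsm : ∀ {F : Type} [NormedAddCommGroup F] [NormedSpace ℝ F] (f : R2 × ℝ → F) (g : W → F),
      Smooth f → (∀ p, g (j' p) = f p) → ContMDiff (𝓡 3) 𝓘(ℝ, F) ∞ g := by
    intro F _ _ f g hf hg w
    obtain ⟨p, rfl⟩ : ∃ p, j' p = w := ⟨c w, hcj w⟩
    obtain ⟨hm, G, hG, hGj⟩ := local_inverse_of_immersion hι' hj'.contMDiffAt (hi' p) finrank_R2R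
    have : ContMDiffAt (𝓡 3) 𝓘(ℝ, F) ∞ (fun m => f (G m)) (j' p) :=
      hf.contMDiff.contMDiffAt.comp (j' p) hG
    refine this.congr_of_eventuallyEq ?_
    rw [← hm]
    change ∀ᶠ q in map j' (𝓝 p), _
    rw [eventually_map]
    filter_upwards [hGj] with q hq
    rw [hq, hg]
  refine ⟨⟨R2⟩, fun w => (c w).1, fun w => tubeDir x e (c w), ?_, ?_, ?_, ?_, ?_, ?_⟩
  · exact hsm Prod.fst _ contDiff_fst hc1
  · intro d
    exact ⟨j' (d, 0), hc1 (d, 0)⟩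
  · intro w
    obtain ⟨p, rfl⟩ : ∃ p, j' p = w := ⟨c w, hcj w⟩
    have h1 : ContMDiff (𝓡 3) (𝓡 2) ∞ (fun w => (c w).1) := hsm Prod.fst _ contDiff_fst hc1
    intro v
    refine ⟨mfderiv 𝓘(ℝ, R2 × ℝ) (𝓡 3) j' p (v, 0), ?_⟩
    have h2 := fderiv_comp_mfld (h1.mdifferentiableAt (by simp) (x := j' p))
      (hj'.mdifferentiableAt (by simp) (x := p)) (v, 0)
    have h3 : (fun q => (c (j' q)).1) = Prod.fst := funext hc1
    rw [h3, fderiv_fst] at h2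
    exact h2.symm
  · exact hsm _ _ hc.isTube.smooth_dir hc2
  · intro w
    obtain ⟨p, rfl⟩ : ∃ p, j' p = w := ⟨c w, hcj w⟩
    simp only [hc2]
    have hy := hc.isTube
    refine ⟨?_, ?_⟩
    · have := hy.norm_dir p
      exact this
    · rw [show ι (j' p) = _ from hc.eq p]
      exact hy.inner_dir p
  · intro w
    obtain ⟨⟨d, t⟩, rfl⟩ : ∃ p, j' p = w := ⟨c w, hcj w⟩
    simp only [hc2, hc1]
    have hrot : ∀ s, Real.cos s • ι (j' (d, t)) + Real.sin s • tubeDir x e (d, t) =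
        tube x e (d, t + s) := by
      intro s
      rw [show ι (j' (d, t)) = _ from hc.eq _]
      simp only [tube, tubeDir, Real.cos_add, Real.sin_add]
      module
    refine ⟨?_, ?_, ?_⟩
    · intro w hw
      obtain ⟨⟨d', t'⟩, rfl⟩ : ∃ p, j' p = w := ⟨c w, hcj w⟩
      obtain rfl : d' = d := by simpa [hc1] using hw
      refine ⟨t' - t, ?_⟩
      simp only [hrot]
      rw [show ι (j' (d', t')) = _ from hc.eq _, add_sub_cancel]
    · intro w _ w' _ hww
      exact hc.emb.injective hww
    · rintro _ ⟨s, rfl⟩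
      exact ⟨j' (d, t + s), by simp [hc1], by simp only [hrot]; exact hc.eq _⟩

end RuledChart
end

end

section

/-! ### Ruled charts of ruled manifolds -/

theorem exists_smooth_local_inverse {E F : Type*} [NormedAddCommGroup E] [NormedSpace ℝ E]
    [FiniteDimensional ℝ E] [NormedAddCommGroup F] [NormedSpace ℝ F] [FiniteDimensional ℝ F]
    {f : E → F} {a : E} (hf : Smooth f) (hi : Injective (𝒟 f a))
    (hd : Module.finrank ℝ E = Module.finrank ℝ F) :
    ∃ (g : F → E) (r : ℝ), 0 < r ∧ ContDiffOn ℝ ∞ g (ball (f a) r) ∧ g (f a) = a ∧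
      ∀ w ∈ ball (f a) r, f (g w) = w := by
  obtain ⟨g, hg, hga, -, hr⟩ := exists_local_inverse hf.contDiffAt hi hd
  have hc : Continuous (𝒟 f) := hf.continuous_fderiv (by simp)
  have h1 : ∀ᶠ z in 𝓝 a, Injective (𝒟 f z) :=
    hc.continuousAt.eventually (ContinuousLinearMap.isOpen_injective.mem_nhds hi)
  have h2 : ∀ᶠ w in 𝓝 (f a), Injective (𝒟 f (g w)) := by
    have := hg.continuousAt.tendsto
    rw [hga] at this
    exact this.eventually h1
  have h3 : ∀ᶠ w in 𝓝 (f a), ContinuousAt g w := by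
    have := (hg.of_le (show (1 : WithTop ℕ∞) ≤ ∞ by simp)).eventually (by simp)
    filter_upwards [this] with w hw using hw.continuousAt
  obtain ⟨r, hr0, hb⟩ := eventually_nhds_iff_ball.mp (hr.and (h2.and h3))
  refine ⟨g, r, hr0, fun w hw => ContDiffAt.contDiffWithinAt ?_, hga, fun w hw => (hb w hw).1⟩
  obtain ⟨hw1, hw2, hw3⟩ := hb w hw
  obtain ⟨g', hg', -, hl, -⟩ := exists_local_inverse hf.contDiffAt hw2 hd
  rw [hw1] at hg'
  refine hg'.congr_of_eventuallyEq ?_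
  filter_upwards [hw3.eventually hl, isOpen_ball.mem_nhds hw] with v hv hv'
  rw [← hv, (hb v hv').1]

theorem IsTube.immersive_of {x e : R2 → ImO} (h : IsTube x e) {p : R2 × ℝ} {f : R3 → ImO}
    {u : R2 × ℝ → R3} {q : R3 → R2} (hf : Differentiable ℝ f)
    (hfi : Injective (𝒟 f (u p))) (hu : DifferentiableAt ℝ u p)
    (hq : DifferentiableAt ℝ q (u p)) (h1 : ∀ᶠ r in 𝓝 p, f (u r) = tube x e r)
    (h2 : ∀ᶠ r in 𝓝 p, q (u r) = r.1) : Injective (𝒟 (tube x e) p) := by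
  rw [injective_iff_map_eq_zero]
  rintro ⟨v, s⟩ hv
  have e1 : tube x e =ᶠ[𝓝 p] f ∘ u := by
    filter_upwards [h1] with r hr using hr.symm
  have hdu : 𝒟 u p (v, s) = 0 := by
    apply hfi
    have := hv
    rw [e1.fderiv_eq, fderiv_comp p (hf _) hu] at this
    rw [map_zero]; exact this
  have e2 : Prod.fst =ᶠ[𝓝 p] q ∘ u := by
    filter_upwards [h2] with r hr using hr.symm
  have hv0 : v = 0 := by
    have h3 : 𝒟 (Prod.fst : R2 × ℝ → R2) p (v, s) = v := by rw [fderiv_fst]; rfl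
    rw [e2.fderiv_eq, fderiv_comp p hq hu] at h3
    rw [← h3]
    change 𝒟 q (u p) (𝒟 u p (v, s)) = 0
    rw [hdu, map_zero]
  subst hv0
  rw [show p = (p.1, p.2) from rfl, h.fderiv_tube] at hv
  simp only [map_zero, smul_zero, zero_add, smul_eq_zero] at hv
  rcases hv with hs | hn
  · rw [hs]; rfl
  · exfalso
    have := h.norm_dir p
    rw [show p = (p.1, p.2) from rfl, hn] at this
    simp at this

variable {L : Type*} [TopologicalSpace L] [ChartedSpace (Rn 3) L] [IsManifold (𝓡 3) ∞ L]
  {ι : L → ImO}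

/-- A local section of a submersion to a surface. -/
theorem exists_section {S : Surface} {π : L → S} (hπ : ContMDiff (𝓡 3) (𝓡 2) ∞ π)
    (hs : ∀ x, Surjective (mfderiv (𝓡 3) (𝓡 2) π x)) (y : L) :
    ∃ (σ : R2 → S) (s : R2 → L), IsParam σ ∧ ContMDiff (𝓡 2) (𝓡 3) ∞ s ∧ s 0 = y ∧
      ∀ d, π (s d) = σ d := by
  obtain ⟨σ, hσ, hσ0, -⟩ := exists_param (n := 2) (π y) univ_mem
  have hU : π ⁻¹' range σ ∈ 𝓝 y :=
    hπ.continuous.continuousAt.preimage_mem_nhds (hσ.isOpen_range.mem_nhds ⟨0, hσ0⟩)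
  obtain ⟨κ, hκ, hκ0, hκU⟩ := exists_param (n := 3) y hU
  obtain ⟨g, hg, hgl⟩ := hσ.inv
  have hmem : ∀ z, π (κ z) ∈ range σ := fun z => hκU ⟨z, rfl⟩
  set q : R3 → R2 := fun z => g (π (κ z)) with hq
  have hqs : Smooth q := contMDiff_iff_contDiff.mp
    (hg.comp_contMDiff (hπ.comp hκ.smooth) hmem)
  have hσq : ∀ z, σ (q z) = π (κ z) := fun z => by
    obtain ⟨w, hw⟩ := hmem z
    simp only [hq]; rw [← hw, hgl]
  have hq0 : q 0 = 0 := by simp only [hq]; rw [hκ0, ← hσ0, hgl]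
  have hqsurj : Surjective (𝒟 q 0) := by
    intro w
    obtain ⟨v, hv⟩ := hs _ (mfderiv (𝓡 2) (𝓡 2) σ (q 0) w)
    obtain ⟨v', hv'⟩ := (hκ.mfderiv_bijective 0).2 v
    have hmq : ContMDiff (𝓡 3) (𝓡 2) ∞ q := hqs.contMDiff
    have h1 : ∀ v : R3, (mfderiv (𝓡 3) (𝓡 2) (σ ∘ q) 0 v : R2) =
        mfderiv (𝓡 2) (𝓡 2) σ (q 0) (𝒟 q 0 v) := fun v => by
      rw [mfderiv_comp 0 (hσ.smooth.mdifferentiableAt (by simp))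
        (hmq.mdifferentiableAt (by simp)), mfderiv_eq_fderiv]
      rfl
    have h2 : (mfderiv (𝓡 3) (𝓡 2) (π ∘ κ) 0 v' : R2) =
        mfderiv (𝓡 3) (𝓡 2) π (κ 0) (mfderiv (𝓡 3) (𝓡 3) κ 0 v') := by
      rw [mfderiv_comp 0 (hπ.mdifferentiableAt (by simp))
        (hκ.smooth.mdifferentiableAt (by simp))]
      rfl
    have h3 : (mfderiv (𝓡 3) (𝓡 2) (σ ∘ q) 0 v' : R2) = mfderiv (𝓡 3) (𝓡 2) (π ∘ κ) 0 v' := by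
      rw [show σ ∘ q = π ∘ κ from funext hσq]
    rw [hv'] at h2
    exact ⟨v', (hσ.mfderiv_bijective (q 0)).1 ((h1 v').symm.trans (h3.trans (h2.trans hv)))⟩
  obtain ⟨B, hB⟩ := (𝒟 q 0).toLinearMap.exists_rightInverse_of_surjective
    (LinearMap.range_eq_top.mpr hqsurj)
  set B' : R2 →L[ℝ] R3 := LinearMap.toContinuousLinearMap B with hB'
  have hf : Smooth (fun d => q (B' d)) := hqs.comp B'.contDiff
  have hfi : Injective (𝒟 (fun d => q (B' d)) 0) := by
    have h1 : 𝒟 (fun d => q (B' d)) 0 = (𝒟 q (B' 0)).comp B' :=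
      ((hqs.diff _).hasFDerivAt.comp 0 B'.hasFDerivAt).fderiv
    rw [h1, map_zero]
    intro v w hvw
    have h2 := LinearMap.congr_fun hB v
    have h3 := LinearMap.congr_fun hB w
    exact h2.symm.trans (hvw.trans h3)
  obtain ⟨k, r, hr, hk, hk0, hkr⟩ := exists_smooth_local_inverse hf hfi rfl
  simp only [map_zero, hq0] at hk hk0 hkr
  refine ⟨fun d => σ (ub 0 r d), fun d => κ (B' (k (ub 0 r d))), (hσ.ball 0 hr).1, ?_, ?_, ?_⟩
  · have h1 : Smooth (fun d => B' (k (ub 0 r d))) :=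
      B'.contDiff.comp (hk.comp_contDiff (smooth_ub 0 r) (ub_mem 0 hr))
    exact hκ.smooth.comp h1.contMDiff
  · simp only [ub_zero, hk0, map_zero, hκ0]
  · intro d
    rw [← hσq, hkr _ (ub_mem 0 hr d)]

/-- `π` is a smooth fibration by great circles, oriented by `ε`. -/
structure IsRuling (ι : L → ImO) {S : Surface} (π : L → S) (ε : L → ImO) : Prop where
  smooth_base : ContMDiff (𝓡 3) (𝓡 2) ∞ π
  surjective : Surjective π
  submersive : ∀ x, Surjective (mfderiv (𝓡 3) (𝓡 2) π x)
  smooth_dir : ContMDiff (𝓡 3) 𝓘(ℝ, ImO) ∞ ε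
  unit : ∀ x, ‖ε x‖ = 1 ∧ ⟪ι x, ε x⟫ = 0
  bijOn : ∀ x, BijOn ι (π ⁻¹' {π x}) (greatCircle (ι x) (ε x))

omit [IsManifold (𝓡 3) ∞ L] in
theorem IsRuled.exists_ruling (h : IsRuled ι) :
    ∃ (S : Surface) (π : L → S) (ε : L → ImO), IsRuling ι π ε := by
  obtain ⟨S, π, ε, h1, h2, h3, h4, h5, h6⟩ := h
  exact ⟨S, π, ε, h1, h2, h3, h4, h5, h6⟩

theorem IsRuling.exists_tube (hι : IsImmersedInS6 (n := 3) ι) {S : Surface} {π : L → S} {ε : L → ImO}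
    (h : IsRuling ι π ε) (y : L) :
    ∃ (σ : R2 → S) (s : R2 → L) (j : R2 × ℝ → L), IsParam σ ∧ s 0 = y ∧ (∀ d, π (s d) = σ d) ∧
      IsTube (fun d => ι (s d)) (fun d => ε (s d)) ∧ ContMDiff 𝓘(ℝ, R2 × ℝ) (𝓡 3) ∞ j ∧
      (∀ p, ι (j p) = tube (fun d => ι (s d)) (fun d => ε (s d)) p) ∧ (∀ p, π (j p) = σ p.1) ∧
      (∀ d, Good (fun d => ι (s d)) (fun d => ε (s d)) d) ∧ j (0, 0) = y := by
  obtain ⟨hπ, -, hπs, hε, hn, hbij⟩ := h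
  obtain ⟨σ, s, hσ, hs, hs0, hπσ⟩ := exists_section hπ hπs y
  set x : R2 → ImO := fun d => ι (s d) with hx
  set e : R2 → ImO := fun d => ε (s d) with he
  have ht : IsTube x e := ⟨contMDiff_iff_contDiff.mp (hι.smooth.comp hs),
    contMDiff_iff_contDiff.mp (hε.comp hs), fun d => hι.norm_eq_one _, fun d => (hn _).1,
    fun d => (hn _).2⟩
  have hex : ∀ p : R2 × ℝ, ∃ m, π m = σ p.1 ∧ ι m = tube x e p := by
    intro p
    obtain ⟨m, hm, hm'⟩ := (hbij (s p.1)).2.2 ⟨p.2, rfl⟩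
    exact ⟨m, by rw [← hπσ]; exact hm, hm'⟩
  have huniq : ∀ d m m', π m = σ d → π m' = σ d → ι m = ι m' → m = m' := by
    intro d m m' h1 h2 h3
    exact (hbij (s d)).2.1 (by simp [hπσ, h1]) (by simp [hπσ, h2]) h3
  choose j hjπ hjι using hex
  have hj0 : j (0, 0) = y := huniq 0 _ _ (hjπ _) (by rw [← hπσ, hs0])
    (by rw [hjι, ← hs0]; simp [tube, hx])
  have key : ∀ p, ContMDiffAt 𝓘(ℝ, R2 × ℝ) (𝓡 3) ∞ j p ∧
      Injective (𝒟 (tube x e) p) := by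
    rintro ⟨d₀, t₀⟩
    have hU : π ⁻¹' range σ ∈ 𝓝 (j (d₀, t₀)) := hπ.continuous.continuousAt.preimage_mem_nhds
      (hσ.isOpen_range.mem_nhds ⟨d₀, (hjπ (d₀, t₀)).symm⟩)
    obtain ⟨κ, hκ, hκ0, hκU⟩ := exists_param (n := 3) _ hU
    obtain ⟨g, hg, hgl⟩ := hσ.inv
    have hmem : ∀ z, π (κ z) ∈ range σ := fun z => hκU ⟨z, rfl⟩
    set q : R3 → R2 := fun z => g (π (κ z)) with hq
    have hqs : Smooth q := contMDiff_iff_contDiff.mp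
      (hg.comp_contMDiff (hπ.comp hκ.smooth) hmem)
    have hσq : ∀ z, π (κ z) = σ (q z) := fun z => by
      obtain ⟨w, hw⟩ := hmem z
      simp only [hq]; rw [← hw, hgl]
    have hσi := hσ.isOpenEmbedding.injective
    have hq0 : q 0 = d₀ := hσi (by rw [← hσq, hκ0, hjπ])
    obtain ⟨hfs, hfi⟩ := hι.comp_param hκ
    set f : R3 → ImO := fun z => ι (κ z) with hf
    have hcirc : ∀ z, ∃ t, f z = tube x e (q z, t) := by
      intro z
      have hz : κ z ∈ π ⁻¹' {π (s (q z))} := by simp [hπσ, hσq]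
      obtain ⟨t, ht'⟩ := (hbij (s (q z))).1 hz
      exact ⟨t, ht'.symm⟩
    set A : R3 × ℝ → R2 × ℝ × ℝ := fun w =>
      (q w.1, w.2 * ⟪x (q w.1), f w.1⟫, w.2 * ⟪e (q w.1), f w.1⟫) with hA
    have hq1 : Smooth (fun w : R3 × ℝ => q w.1) := hqs.comp contDiff_fst
    have hf1 : Smooth (fun w : R3 × ℝ => f w.1) := hfs.comp contDiff_fst
    have hAs : Smooth A := hq1.prodMk
      ((contDiff_snd.mul ((ht.smooth_x.comp hq1).inner ℝ hf1)).prodMk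
        (contDiff_snd.mul ((ht.smooth_e.comp hq1).inner ℝ hf1)))
    set Q : R2 × ℝ × ℝ → ImO := fun w => w.2.1 • x w.1 + w.2.2 • e w.1 with hQ
    have hQs : Smooth Q :=
      ((contDiff_fst.comp contDiff_snd).smul (ht.smooth_x.comp contDiff_fst)).add
      ((contDiff_snd.comp contDiff_snd).smul (ht.smooth_e.comp contDiff_fst))
    have hQA : ∀ w : R3 × ℝ, Q (A w) = w.2 • f w.1 := by
      intro w
      obtain ⟨t, ht'⟩ := hcirc w.1
      simp only [hQ, hA, ht', tube, ht.inner_x, ht.inner_e]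
      module
    have hAi : Injective (𝒟 A (0, 1)) := by
      rw [injective_iff_map_eq_zero]
      rintro ⟨v, c⟩ hv
      have h1 : 𝒟 (fun w : R3 × ℝ => w.2 • f w.1) (0, 1) (v, c) = 0 := by
        rw [← funext hQA]
        change 𝒟 (Q ∘ A) (0, 1) (v, c) = 0
        rw [fderiv_comp _ (hQs.diff _) (hAs.diff _)]
        change 𝒟 Q _ (𝒟 A (0, 1) (v, c)) = 0
        rw [hv, map_zero]
      have h2 : HasFDerivAt (fun w : R3 × ℝ => f w.1)
          ((𝒟 f 0).comp (ContinuousLinearMap.fst ℝ R3 ℝ)) (0, 1) :=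
        HasFDerivAt.comp (g := f) (f := Prod.fst) ((0, 1) : R3 × ℝ)
          ((hfs.diff 0).hasFDerivAt) hasFDerivAt_fst
      have h3 := (hasFDerivAt_snd (𝕜 := ℝ) (p := ((0, 1) : R3 × ℝ))).smul h2
      have h7 : 𝒟 (fun w : R3 × ℝ => w.2 • f w.1) (0, 1) = _ := h3.fderiv
      rw [h7] at h1
      simp at h1
      have h4 := inner_fderiv_self (hfs.diff 0)
        (.of_forall fun z => hι.norm_eq_one (κ z)) v
      have h5 := congrArg (inner ℝ (f 0)) h1
      have h6 : ⟪f 0, f 0⟫ = 1 := by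
        rw [real_inner_self_eq_norm_sq, show ‖f 0‖ = 1 from hι.norm_eq_one _]; norm_num
      rw [inner_add_right, h4, inner_smul_right, h6, inner_zero_right] at h5
      have hc : c = 0 := by linarith
      subst hc
      rw [zero_smul, add_zero] at h1
      have hv0 := (injective_iff_map_eq_zero _).mp (hfi 0) v h1
      rw [hv0]; rfl
    obtain ⟨G, hG, hG0, -, hGr⟩ := exists_local_inverse hAs.contDiffAt hAi (by simp)
    have hf0 : f 0 = tube x e (d₀, t₀) := by rw [← hjι, ← hκ0]
    have hA0 : A (0, 1) = (d₀, Real.cos t₀, Real.sin t₀) := by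
      simp only [hA, hq0, hf0, one_mul, tube, ht.inner_x, ht.inner_e]
    rw [hA0] at hG hG0 hGr
    set C : R2 × ℝ → R2 × ℝ × ℝ := fun p => (p.1, Real.cos p.2, Real.sin p.2) with hC
    have hCs : Smooth C := contDiff_fst.prodMk
      ((Real.contDiff_cos.comp contDiff_snd).prodMk (Real.contDiff_sin.comp contDiff_snd))
    have hGC : ContDiffAt ℝ ∞ (fun p => G (C p)) (d₀, t₀) := hG.comp (d₀, t₀) hCs.contDiffAt
    set u : R2 × ℝ → R3 := fun p => (G (C p)).1 with hu
    have hus : ContDiffAt ℝ ∞ u (d₀, t₀) := hGC.fst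
    have hu0 : u (d₀, t₀) = 0 := by simp [hu, hC, hG0]
    have h1 : ∀ᶠ p in 𝓝 (d₀, t₀), A (G (C p)) = C p :=
      (hCs.continuous.continuousAt (x := (d₀, t₀))).eventually (by exact hGr)
    have h2 : ∀ᶠ p in 𝓝 (d₀, t₀), 0 < (G (C p)).2 := by
      have : ContinuousAt (fun p => (G (C p)).2) (d₀, t₀) := hGC.snd.continuousAt
      refine this.eventually (isOpen_Ioi.mem_nhds ?_)
      simp [hC, hG0]
    have h3 : ∀ᶠ p in 𝓝 (d₀, t₀), q (u p) = p.1 ∧ f (u p) = tube x e p := by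
      filter_upwards [h1, h2] with p hp hp'
      have e1 : q (u p) = p.1 := congrArg Prod.fst hp
      have e2 : (G (C p)).2 • f (u p) = tube x e p := by
        rw [← hQA, hp]
        rfl
      have e3 := congrArg norm e2
      rw [norm_smul, ht.norm_tube, show ‖f (u p)‖ = 1 from hι.norm_eq_one _, mul_one,
        Real.norm_of_nonneg hp'.le] at e3
      rw [e3, one_smul] at e2
      exact ⟨e1, e2⟩
    constructor
    · have h4 : ContMDiffAt 𝓘(ℝ, R2 × ℝ) (𝓡 3) ∞ (fun p => κ (u p)) (d₀, t₀) :=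
        hκ.smooth.contMDiffAt.comp (d₀, t₀) hus.contMDiffAt
      refine h4.congr_of_eventuallyEq ?_
      filter_upwards [h3] with p hp
      exact huniq p.1 _ _ (hjπ p) (by rw [hσq, hp.1])
        ((hjι p).trans hp.2.symm)
    · refine ht.immersive_of (hfs.diff) (hfi _) (hus.differentiableAt (by simp))
        (hqs.diff _) ?_ ?_
      · filter_upwards [h3] with p hp using hp.2
      · filter_upwards [h3] with p hp using hp.1
  exact ⟨σ, s, j, hσ, hs0, hπσ, ht, fun p => (key p).1, hjι, hjπ, fun d t => (key _).2, hj0⟩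

theorem IsRuling.exists_ruledChart (hι : IsImmersedInS6 (n := 3) ι) {S : Surface} {π : L → S}
    {ε : L → ImO} (h : IsRuling ι π ε) (y : L) :
    ∃ x e j, RuledChart ι x e j ∧ j (0, 0) = y ∧ x 0 = ι y ∧ e 0 = ε y := by
  obtain ⟨σ, s, j, hσ, hs0, hπσ, ht, hj, hjι, hjπ, hg, hj0⟩ := h.exists_tube hι y
  obtain ⟨ρ, hρ, hch⟩ := exists_ruledChart_of_lift hι ht hj hjι (hg 0) (fun d t t' hT =>
    (h.bijOn (s d)).2.1 (by simp [hπσ, hjπ]) (by simp [hπσ, hjπ]) (by rw [hjι, hjι, hT]))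
  refine ⟨_, _, _, hch ρ hρ le_rfl, ?_, ?_, ?_⟩
  · simp only [ub_zero, hj0]
  · simp only [Function.comp_apply, ub_zero, hs0]
  · simp only [Function.comp_apply, ub_zero, hs0]

theorem exists_ruledChart (hι : IsImmersedInS6 (n := 3) ι) (hr : IsRuled ι) (y : L) :
    ∃ x e j, RuledChart ι x e j ∧ j (0, 0) = y := by
  obtain ⟨S, π, ε, h⟩ := hr.exists_ruling
  obtain ⟨x, e, j, hc, hj, -⟩ := h.exists_ruledChart hι y
  exact ⟨x, e, j, hc, hj⟩

end

section

/-! ### The coassociative spaces of a Lagrangian patch -/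

section Tang
variable {E : Type*} [NormedAddCommGroup E] [NormedSpace ℝ E]

/-- The span of the position and the tangent space. -/
def tang (f : E → ImO) (p : E) : Submodule ℝ ImO :=
  Submodule.span ℝ {f p} ⊔ LinearMap.range (𝒟 f p).toLinearMap

theorem mem_tang {f : E → ImO} {p : E} {q : ImO} :
    q ∈ tang f p ↔ ∃ (a : ℝ) (v : E), q = a • f p + 𝒟 f p v := by
  simp only [tang, Submodule.mem_sup, Submodule.mem_span_singleton, LinearMap.mem_range]
  constructor
  · rintro ⟨_, ⟨a, rfl⟩, _, ⟨v, rfl⟩, rfl⟩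
    exact ⟨a, v, rfl⟩
  · rintro ⟨a, v, rfl⟩
    exact ⟨_, ⟨a, rfl⟩, _, ⟨v, rfl⟩, rfl⟩

variable {f : E → ImO} (hf : IsLagPatch f)
include hf

omit hf in
theorem tang_eq {p : E} {b : Fin 3 → E} (hb : ⊤ ≤ Submodule.span ℝ (range b)) :
    tang f p = Submodule.span ℝ (range ![f p, 𝒟 f p (b 0), 𝒟 f p (b 1),
      𝒟 f p (b 2)]) := by
  set S := Submodule.span ℝ (range ![f p, 𝒟 f p (b 0), 𝒟 f p (b 1),
      𝒟 f p (b 2)]) with hS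
  have hm : ∀ i, ![f p, 𝒟 f p (b 0), 𝒟 f p (b 1), 𝒟 f p (b 2)] i ∈ S :=
    fun i => Submodule.subset_span ⟨i, rfl⟩
  apply le_antisymm
  · refine sup_le ?_ ?_
    · rw [Submodule.span_singleton_le_iff_mem]; exact hm 0
    · rintro _ ⟨v, rfl⟩
      have hv : v ∈ Submodule.span ℝ (range b) := hb trivial
      change 𝒟 f p v ∈ S
      induction hv using Submodule.span_induction with
      | zero => simp
      | add a a' _ _ h1 h2 => rw [map_add]; exact S.add_mem h1 h2
      | smul r a _ h1 => rw [map_smul]; exact S.smul_mem _ h1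
      | mem q hq =>
        obtain ⟨i, rfl⟩ := hq
        fin_cases i
        · exact hm 1
        · exact hm 2
        · exact hm 3
  · rw [hS, Submodule.span_le]
    rintro _ ⟨i, rfl⟩
    fin_cases i
    · exact mem_tang.mpr ⟨1, 0, by simp⟩
    · exact mem_tang.mpr ⟨0, b 0, by simp⟩
    · exact mem_tang.mpr ⟨0, b 1, by simp⟩
    · exact mem_tang.mpr ⟨0, b 2, by simp⟩

theorem IsLagPatch.coassociative (hd : Module.finrank ℝ E = 3) (p : E) :
    PhiZero (tang f p) ∧ Module.finrank ℝ (tang f p) = 4 := by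
  have : Module.Finite ℝ E := Module.finite_of_finrank_eq_succ hd
  set b := Module.finBasisOfFinrankEq ℝ E hd with hb
  rw [tang_eq (b := b) b.span_eq.ge]
  have ht : LagTriple (f p) (𝒟 f p (b 0)) (𝒟 f p (b 1)) (𝒟 f p (b 2)) := by
    refine hf.lagTriple p ?_
    have := b.linearIndependent
    convert this using 1
    ext i; fin_cases i <;> rfl
  exact ⟨ht.phiZero, ht.finrank⟩

/-- The span is determined by a 4-dimensional subspace containing the patch. -/
theorem IsLagPatch.tang_eq_of_mem (hd : Module.finrank ℝ E = 3) {p : E} {P : Submodule ℝ ImO}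
    (hP : Module.finrank ℝ P = 4) (h : ∀ᶠ q in 𝓝 p, f q ∈ P) : tang f p = P := by
  refine Submodule.eq_of_le_of_finrank_eq (sup_le ?_ ?_) (by rw [(hf.coassociative hd p).2, hP])
  · rw [Submodule.span_singleton_le_iff_mem]; exact h.self_of_nhds
  · rintro _ ⟨v, rfl⟩
    change 𝒟 f p v ∈ P
    rw [← P.orthogonal_orthogonal]
    intro m hm
    have h1 : ∀ᶠ q in 𝓝 p, ⟪f q, m⟫ = 0 := by
      filter_upwards [h] with q hq using (P.mem_orthogonal m).mp hm _ hq
    have := inner_fderiv_add (hf.diff p) (differentiableAt_const m) h1 v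
    simp at this
    rw [real_inner_comm]
    exact this

end Tang

/-- The cone over an immersion in the sphere is immersed. -/
theorem fderiv_cone_injective {E : Type*} [NormedAddCommGroup E] [NormedSpace ℝ E] {f : E → ImO}
    (hf : Differentiable ℝ f) (hn : ∀ z, ‖f z‖ = 1) {z : E} (hi : Injective (𝒟 f z)) :
    Injective (𝒟 (fun w : E × ℝ => w.2 • f w.1) (z, 1)) := by
  rw [injective_iff_map_eq_zero]
  rintro ⟨v, c⟩ h1
  have h2 : HasFDerivAt (fun w : E × ℝ => f w.1)
      ((𝒟 f z).comp (ContinuousLinearMap.fst ℝ E ℝ)) (z, 1) :=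
    HasFDerivAt.comp (g := f) (f := Prod.fst) ((z, 1) : E × ℝ) (hf z).hasFDerivAt hasFDerivAt_fst
  have h3 := (hasFDerivAt_snd (𝕜 := ℝ) (p := ((z, 1) : E × ℝ))).smul h2
  have h7 : 𝒟 (fun w : E × ℝ => w.2 • f w.1) (z, 1) = _ := h3.fderiv
  rw [h7] at h1
  simp at h1
  have h4 := inner_fderiv_self (hf z) (.of_forall hn) v
  have h5 := congrArg (inner ℝ (f z)) h1
  have h6 : ⟪f z, f z⟫ = 1 := inner_self_of_norm_one (hn z)
  rw [inner_add_right, h4, inner_smul_right, h6, inner_zero_right] at h5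
  have hc : c = 0 := by linarith
  subst hc
  rw [zero_smul, add_zero] at h1
  have hv0 := (injective_iff_map_eq_zero _).mp hi v h1
  rw [hv0]; rfl

/-! ### Lagrangians in a 3-sphere -/

variable {L : Type*} [TopologicalSpace L] [ChartedSpace (Rn 3) L] [IsManifold (𝓡 3) ∞ L]
  {ι : L → ImO} {V : Set L} {P : Submodule ℝ ImO}

theorem phiZero_of_mem (hl : IsLagrangian ι) (hι : IsImmersedInS6 (n := 3) ι) (hV : IsOpen V)
    (hne : V.Nonempty) (hP : Module.finrank ℝ P = 4) (hVP : ∀ m ∈ V, ι m ∈ P) : PhiZero P := by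
  obtain ⟨m, hm⟩ := hne
  obtain ⟨κ, hκ, -, hκV⟩ := exists_param (n := 3) m (hV.mem_nhds hm)
  have hp := hl.patch_param hι hκ
  have hd : Module.finrank ℝ R3 = 3 := by simp
  rw [← hp.tang_eq_of_mem hd (p := 0) hP (.of_forall fun z => hVP _ (hκV ⟨z, rfl⟩))]
  exact (hp.coassociative hd 0).1

/-- An immersed hypersurface of a 3-sphere is open. -/
theorem open_in_sphere (hι : IsImmersedInS6 (n := 3) ι) (hV : IsOpen V)
    (hP : Module.finrank ℝ P = 4) (hVP : ∀ m ∈ V, ι m ∈ P) {m : L} (hm : m ∈ V) :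
    ∀ᶠ q in 𝓝 (ι m), q ∈ P → ‖q‖ = 1 → q ∈ ι '' V := by
  obtain ⟨κ, hκ, hκ0, hκV⟩ := exists_param (n := 3) m (hV.mem_nhds hm)
  obtain ⟨hfs, hfi⟩ := hι.comp_param hκ
  have hmem : ∀ z, ι (κ z) ∈ P := fun z => hVP _ (hκV ⟨z, rfl⟩)
  set f : R3 → ImO := fun z => ι (κ z) with hf
  let pr := P.orthogonalProjectionOnto
  have hpr : ∀ z, (pr (f z) : ImO) = f z := fun z =>
    P.starProjection_eq_self_iff.mpr (hmem z)
  set F : R3 × ℝ → P := fun w => w.2 • pr (f w.1) with hF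
  have hFs : Smooth F := contDiff_snd.smul (pr.contDiff.comp (hfs.comp contDiff_fst))
  have hFv : ∀ w, (F w : ImO) = w.2 • f w.1 := fun w => by
    simp only [hF, Submodule.coe_smul, hpr]
  have hFi : Injective (𝒟 F (0, 1)) := by
    have h1 := fderiv_cone_injective (hfs.diff) (fun z => hι.norm_eq_one (κ z))
      (hfi 0)
    have h2 : 𝒟 (fun w : R3 × ℝ => w.2 • f w.1) (0, 1) =
        P.subtypeL.comp (𝒟 F (0, 1)) := by
      rw [← funext hFv]
      exact (P.subtypeL.hasFDerivAt.comp _ (hFs.diff _).hasFDerivAt).fderiv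
    rw [h2] at h1
    exact Injective.of_comp (f := P.subtypeL) h1
  have hmap := map_nhds_of_bijective hFs.contDiffAt hFi (by simp [hP])
  have h3 : ∀ᶠ w : R3 × ℝ in 𝓝 (0, 1), 0 < w.2 :=
    continuous_snd.continuousAt.eventually (isOpen_Ioi.mem_nhds (by simp))
  have h4 : ∀ᶠ q : P in 𝓝 (F (0, 1)), ‖(q : ImO)‖ = 1 → (q : ImO) ∈ ι '' V := by
    rw [← hmap, eventually_map]
    filter_upwards [h3] with w hw hn
    rw [hFv] at hn ⊢
    rw [norm_smul, show ‖f w.1‖ = 1 from hι.norm_eq_one _, mul_one, Real.norm_of_nonneg hw.le] at hn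
    rw [hn, one_smul]
    exact ⟨κ w.1, hκV ⟨_, rfl⟩, rfl⟩
  have h5 : (F (0, 1) : ImO) = ι m := by rw [hFv, one_smul, hf]; simp only [hκ0]
  rw [nhds_subtype_eq_comap, h5, eventually_comap] at h4
  filter_upwards [h4] with q hq hqP hqn
  exact hq ⟨q, hqP⟩ rfl hqn

/-- Families of great circles in an embedded piece. -/
theorem exists_ruledChart_of_mem (hι : IsImmersedInS6 (n := 3) ι)
    (he : IsEmbedding (V.domRestrict ι)) {x e : R2 → ImO} (ht : IsTube x e)
    (hm : ∀ p, tube x e p ∈ ι '' V) {d : R2} (hg : Good x e d) :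
    ∃ ρ > 0, ∀ r, 0 < r → r ≤ ρ → ∃ j,
      RuledChart ι (x ∘ ub d r) (e ∘ ub d r) j ∧ range j ⊆ V := by
  obtain ⟨j, hj, hjι, hjV⟩ := exists_lift hι he ht.smooth hm
  obtain ⟨ρ, hρ, h⟩ := exists_ruledChart_of_lift hι ht hj hjι hg (fun d t t' h => by
    have := he.injective (a₁ := ⟨_, hjV (d, t)⟩) (a₂ := ⟨_, hjV (d, t')⟩) (by
      change ι _ = ι _; rw [hjι, hjι, h])
    exact congrArg Subtype.val this)
  exact ⟨ρ, hρ, fun r h0 hr => ⟨_, h r h0 hr, by rintro _ ⟨p, rfl⟩; exact hjV _⟩⟩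

/-- The same for families defined near `0`. -/
theorem exists_ruledChart_of_eventually (hι : IsImmersedInS6 (n := 3) ι)
    (he : IsEmbedding (V.domRestrict ι)) {x e : R2 → ImO} (ht : IsTube x e)
    {d : R2} (hm : ∀ᶠ d in 𝓝 d, ∀ t, tube x e (d, t) ∈ ι '' V) (hg : Good x e d) :
    ∃ φ : R2 → R2, Smooth φ ∧ φ 0 = d ∧ ∃ j,
      RuledChart ι (x ∘ φ) (e ∘ φ) j ∧ range j ⊆ V := by
  obtain ⟨ρ, hρ, hb⟩ := eventually_nhds_iff_ball.mp hm
  have h1 := ht.good_comp (smooth_ub d ρ) (d := 0) (fderiv_ub_bijective d hρ 0).1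
    (by rwa [ub_zero])
  obtain ⟨r, hr, h2⟩ := exists_ruledChart_of_mem hι he (ht.comp (smooth_ub d ρ))
    (fun p => hb _ (ub_mem d hρ p.1) p.2) h1
  obtain ⟨j, hj, hjV⟩ := h2 r hr le_rfl
  exact ⟨ub d ρ ∘ ub 0 r, (smooth_ub d ρ).comp (smooth_ub 0 r), by simp, j, hj, hjV⟩

/-- A Lagrangian in a 3-sphere containing a great circle is ruled near it, by Hopf circles. -/
theorem exists_ruledChart_of_sphere (hl : IsLagrangian ι) (hι : IsImmersedInS6 (n := 3) ι)
    (hV : IsOpen V) (he : IsEmbedding (V.domRestrict ι))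
    (hP : Module.finrank ℝ P = 4) (hVP : ∀ m ∈ V, ι m ∈ P) {x₀ e₀ : ImO} (hx : ‖x₀‖ = 1)
    (hee : ‖e₀‖ = 1) (hxe : ⟪x₀, e₀⟫ = 0)
    (hc : ∀ t : ℝ, Real.cos t • x₀ + Real.sin t • e₀ ∈ ι '' V) :
    ∃ x e j, RuledChart ι x e j ∧ range j ⊆ V ∧ (∀ d, cross (x d) (e d) = cross x₀ e₀) ∧
      x 0 = x₀ ∧ e 0 = e₀ := by
  have hne : V.Nonempty := by
    obtain ⟨m, hm, -⟩ := hc 0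
    exact ⟨m, hm⟩
  have hφ := phiZero_of_mem hl hι hV hne hP hVP
  have hmemP : ∀ q ∈ ι '' V, q ∈ P := by rintro _ ⟨m, hm, rfl⟩; exact hVP m hm
  have hxP : x₀ ∈ P := by simpa using hmemP _ (hc 0)
  have heP : e₀ ∈ P := by simpa using hmemP _ (hc (Real.pi / 2))
  set n := cross x₀ e₀ with hn
  have hnP : ∀ q ∈ P, ⟪n, q⟫ = 0 := hφ.cross_perp hxP heP
  have hxx : ⟪x₀, x₀⟫ = 1 := inner_self_of_norm_one hx
  have hee' : ⟪e₀, e₀⟫ = 1 := inner_self_of_norm_one hee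
  have hnn : ⟪n, n⟫ = 1 := by
    rw [hn, inner_cross_cross, hxx, hee', hxe]; norm_num
  have hnx : cross n x₀ = e₀ := by
    rw [hn, cross_anticomm, cross_cross_self, hxx, hxe]; simp
  have hne0 : cross n e₀ = -x₀ := by
    rw [hn, cross_anticomm x₀ e₀, cross_neg_left, cross_anticomm, neg_neg, cross_cross_self, hee',
      real_inner_comm, hxe]; simp
  have hJP : ∀ q ∈ P, cross n q ∈ P := fun q hq => hφ.cross_mem hP hnP hq
  have hJJ : ∀ q ∈ P, ∀ q' ∈ P, ⟪cross n q, cross n q'⟫ = ⟪q, q'⟫ := by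
    intro q hq q' hq'
    rw [inner_cross_cross, hnn, hnP q hq, hnP q' hq']; ring
  obtain ⟨w, hwP, hw, hwp⟩ := exists_unit_perp (E := P) ![x₀, e₀] (by rw [hP]; norm_num)
  have hwx : ⟪x₀, w⟫ = 0 := hwp 0
  have hwe : ⟪e₀, w⟫ = 0 := hwp 1
  have hww : ⟪w, w⟫ = 1 := inner_self_of_norm_one hw
  set w' := cross n w with hw'
  have hw'P : w' ∈ P := hJP w hwP
  have hw'x : ⟪x₀, w'⟫ = 0 := by
    rw [real_inner_comm, hw', inner_cross_swap', hnx, hwe, neg_zero]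
  have hw'e : ⟪e₀, w'⟫ = 0 := by
    rw [real_inner_comm, hw', inner_cross_swap', hne0, inner_neg_left, hwx]; simp
  have hw'w : ⟪w, w'⟫ = 0 := by rw [real_inner_comm]; simp [hw']
  have hw'w' : ⟪w', w'⟫ = 1 := by rw [hw', hJJ w hwP w hwP, hww]
  have hnw' : cross n w' = -w := by
    rw [hw', cross_cross_self, hnn, hnP w hwP]; simp
  set ℓ : R2 → ImO := fun d => d 0 • w + d 1 • w' with hℓ
  set ρ : R2 → ℝ := fun d => (Real.sqrt (1 + ‖d‖ ^ 2))⁻¹ with hρ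
  have hpos : ∀ d : R2, 0 < 1 + ‖d‖ ^ 2 := fun d => by positivity
  have hρs : Smooth ρ := by
    refine ContDiff.inv ?_ fun d => (Real.sqrt_pos.mpr (hpos d)).ne'
    exact (contDiff_const.add (contDiff_norm_sq ℝ)).sqrt fun d => (hpos d).ne'
  have hℓs : Smooth ℓ := by
    have h0 : Smooth (fun d : R2 => d 0) := (EuclideanSpace.proj (𝕜 := ℝ) (0 : Fin 2)).contDiff
    have h1 : Smooth (fun d : R2 => d 1) := (EuclideanSpace.proj (𝕜 := ℝ) (1 : Fin 2)).contDiff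
    exact (h0.smul contDiff_const).add (h1.smul contDiff_const)
  have hℓP : ∀ d, x₀ + ℓ d ∈ P := fun d =>
    P.add_mem hxP (P.add_mem (P.smul_mem _ hwP) (P.smul_mem _ hw'P))
  set x : R2 → ImO := fun d => ρ d • (x₀ + ℓ d) with hxdef
  set e : R2 → ImO := fun d => cross n (x d) with hedef
  have hxdP : ∀ d, x d ∈ P := fun d => P.smul_mem _ (hℓP d)
  have hnx1 : ∀ d, ‖x d‖ = 1 := by
    intro d
    have h1 : ‖x₀ + ℓ d‖ ^ 2 = 1 + ‖d‖ ^ 2 := by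
      rw [← real_inner_self_eq_norm_sq, EuclideanSpace.norm_sq_eq, Fin.sum_univ_two]
      have hwx' := hwx
      have hw'x' := hw'x
      have hw'w'' := hw'w
      rw [real_inner_comm] at hwx' hw'x' hw'w''
      simp only [hℓ, inner_add_left, inner_add_right, inner_smul_left, inner_smul_right, hxx, hwx,
        hw'x, hww, hw'w', hw'w, hwx', hw'x', hw'w'', conj_trivial, Real.norm_eq_abs, sq_abs]
      ring
    have h2 : ‖x₀ + ℓ d‖ = Real.sqrt (1 + ‖d‖ ^ 2) := by
      rw [← h1, Real.sqrt_sq (norm_nonneg _)]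
    simp only [hxdef, norm_smul, h2, hρ, norm_inv, Real.norm_eq_abs,
      abs_of_nonneg (Real.sqrt_nonneg _)]
    exact inv_mul_cancel₀ (Real.sqrt_pos.mpr (hpos d)).ne'
  have hxs : Smooth x := hρs.smul (contDiff_const.add hℓs)
  have ht : IsTube x e := by
    refine ⟨hxs, contDiff_const.cross hxs, hnx1, fun d => ?_, fun d => ?_⟩
    · have h1 := hJJ (x d) (hxdP d) (x d) (hxdP d)
      rw [real_inner_self_eq_norm_sq, real_inner_self_eq_norm_sq, hnx1] at h1
      have h2 := norm_nonneg (cross n (x d))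
      simp only [hedef]
      nlinarith
    · rw [real_inner_comm]; simp [hedef]
  have hux : ∀ d, cross (x d) (e d) = n := by
    intro d
    simp only [hedef]
    rw [cross_anticomm n, cross_neg_right, cross_cross_self, real_inner_self_eq_norm_sq, hnx1,
      real_inner_comm, hnP _ (hxdP d)]
    simp
  have hρ0 : ρ 0 = 1 := by simp [hρ]
  have hℓ0 : ℓ 0 = 0 := by simp [hℓ]
  have hx0 : x 0 = x₀ := by simp [hxdef, hρ0, hℓ0]
  have he0 : e 0 = e₀ := by simp [hedef, hx0, hnx]
  have hTP : ∀ p, tube x e p ∈ P := fun p =>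
    P.add_mem (P.smul_mem _ (hxdP _)) (P.smul_mem _ (hJP _ (hxdP _)))
  have hdx : ∀ v, 𝒟 x 0 v = ℓ v := by
    intro v
    have h1 : 𝒟 ρ 0 = 0 := by
      refine IsLocalMax.fderiv_eq_zero (Eventually.of_forall fun d => ?_)
      rw [hρ0]
      refine inv_le_one_of_one_le₀ (Real.one_le_sqrt.mpr ?_)
      nlinarith [sq_nonneg ‖d‖]
    have h2 : HasFDerivAt (fun d => x₀ + ℓ d) ((EuclideanSpace.proj (𝕜 := ℝ) (0 : Fin 2)).smulRight w +
        (EuclideanSpace.proj (𝕜 := ℝ) (1 : Fin 2)).smulRight w' : R2 →L[ℝ] ImO) 0 :=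
      (((EuclideanSpace.proj (𝕜 := ℝ) (0 : Fin 2)).smulRight w +
        (EuclideanSpace.proj (𝕜 := ℝ) (1 : Fin 2)).smulRight w').hasFDerivAt (x := (0 : R2))).const_add x₀
    have h3 : 𝒟 x 0 = _ := ((hρs.diff 0).hasFDerivAt.smul h2).fderiv
    rw [h3, h1, hρ0]
    simp [hℓ]
  have hgood : Good x e 0 := by
    intro t
    rw [injective_iff_map_eq_zero]
    rintro ⟨v, s⟩ hv
    have hde : 𝒟 e 0 v = cross n (ℓ v) := by
      have := fderiv_cross (f := fun _ : R2 => n) (differentiableAt_const n)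
        (hxs.diff 0) v
      simp only [fderiv_fun_const, Pi.zero_apply, zero_apply] at this
      rw [cross_zero_left, zero_add, hdx] at this
      exact this
    rw [ht.fderiv_tube, hdx, hde] at hv
    simp only [tubeDir, hx0, he0, hℓ, cross_add_right, cross_smul_right, hnw', ← hw'] at hv
    have e1 := congrArg (inner ℝ x₀) hv
    have e2 := congrArg (inner ℝ e₀) hv
    have e3 := congrArg (inner ℝ w) hv
    have e4 := congrArg (inner ℝ w') hv
    have hwx' := hwx
    have hw'x' := hw'x
    have hw'w'' := hw'w
    have hwe' := hwe
    have hw'e' := hw'e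
    have hxe' := hxe
    rw [real_inner_comm] at hwx' hw'x' hw'w'' hwe' hw'e' hxe'
    simp only [inner_add_right, inner_smul_right, inner_neg_right, inner_zero_right, hxx, hwx,
        hw'x, hww, hw'w', hw'w, hwx', hw'x', hw'w'', hwe, hwe', hw'e, hw'e', hxe, hxe', hee',
        neg_smul] at e1 e2 e3 e4
    have hcs := Real.cos_sq_add_sin_sq t
    have hs : s = 0 := by linear_combination -s * hcs + Real.cos t * e2 - Real.sin t * e1
    have hv0 : v 0 = 0 := by linear_combination -v 0 * hcs + Real.cos t * e3 + Real.sin t * e4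
    have hv1 : v 1 = 0 := by linear_combination -v 1 * hcs + Real.cos t * e4 - Real.sin t * e3
    have hvz : v = 0 := by ext i; fin_cases i <;> simp [hv0, hv1]
    rw [hs, hvz]; rfl
  have hev : ∀ᶠ d in 𝓝 (0 : R2), ∀ t, tube x e (d, t) ∈ ι '' V := by
    have := (isCompact_Icc (a := (0 : ℝ)) (b := 2 * Real.pi)).eventually_forall_of_forall_eventually
      (x₀ := (0 : R2)) (P := fun d t => tube x e (d, t) ∈ ι '' V) (fun t _ => by
        have h1 : tube x e (0, t) ∈ ι '' V := by simp only [tube, hx0, he0]; exact hc t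
        obtain ⟨m, hm, hm'⟩ := h1
        have h2 := open_in_sphere hι hV hP hVP hm
        rw [hm'] at h2
        have h3 := (ht.smooth.continuous.continuousAt (x := ((0 : R2), t))).eventually h2
        filter_upwards [h3] with z hz using hz (hTP _) (ht.norm_tube _))
    filter_upwards [this] with d hd t
    obtain ⟨k, hk⟩ := exists_int_mem t
    rw [← tube_add_int x e d t k]
    exact hd _ hk
  obtain ⟨φ, -, hφ0, j, hj, hjV⟩ := exists_ruledChart_of_eventually hι he ht hev hgood
  exact ⟨_, _, j, hj, hjV, fun d => hux _, by simp [hφ0, hx0], by simp [hφ0, he0]⟩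

end

/-! ### Hopf lifts -/

theorem exists_unit_perp_top {k : ℕ} (s : Fin k → ImO) (h : k < 7) :
    ∃ e : ImO, ‖e‖ = 1 ∧ ∀ i, ⟪s i, e⟫ = 0 := by
  obtain ⟨e, -, h1, h2⟩ := exists_unit_perp (E := ⊤) s (by simpa using h)
  exact ⟨e, h1, h2⟩

theorem inner_eps (i : Fin 7) (v : ImO) : ⟪eps i, v⟫ = v i := by
  simp only [inner_eq_sum, eps]
  fin_cases i <;> simp

/-- Adapted isometries exist. -/
theorem exists_adapted {n : ImO} (hn : ‖n‖ = 1) :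
    ∃ (i : C3 →ₗᵢ[ℝ] ImO) (P : ImO →L[ℝ] C3), (∀ y, i (Complex.I • y) = cross n (i y)) ∧
      (∀ y, P (i y) = y) ∧ (∀ p, ⟪n, p⟫ = 0 → i (P p) = p) ∧ ∀ y, ⟪n, i y⟫ = 0 := by
  obtain ⟨a, ha, hpa⟩ := exists_unit_perp_top ![n] (by norm_num)
  obtain ⟨b, hb, hpb⟩ := exists_unit_perp_top ![n, a, cross n a] (by norm_num)
  obtain ⟨Ψ, hΨ, hs⟩ := exists_g2 hn ha hb (hpa 0) (hpb 0) (hpb 1) (hpb 2)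
  obtain rfl : Ψ (eps 0) = n := by rw [hs]; simp [eps]
  let i : C3 →ₗᵢ[ℝ] ImO :=
    { toFun := fun y => !₂[0, (y 0).re, (y 0).im, (y 1).re, (y 1).im, (y 2).re, (y 2).im]
      map_add' := fun y z => by ext k; fin_cases k <;> simp
      map_smul' := fun r y => by ext k; fin_cases k <;> simp
      norm_map' := fun y => by
        simp [EuclideanSpace.norm_eq, Fin.sum_univ_seven, Fin.sum_univ_three,
          ← Complex.normSq_eq_norm_sq, Complex.normSq_apply, ← pow_two, add_assoc] }
  let P : ImO →ₗ[ℝ] C3 :=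
    { toFun := fun c => !₂[⟨c 1, c 2⟩, ⟨c 3, c 4⟩, ⟨c 5, c 6⟩]
      map_add' := fun c d => by ext k; fin_cases k <;> rfl
      map_smul' := fun r c => by ext k; fin_cases k <;> apply Complex.ext <;> simp }
  refine ⟨Ψ.toLinearIsometry.comp i, (P ∘ₗ Ψ.symm.toLinearEquiv).toContinuousLinearMap,
    fun y => ?_, fun y => ?_, fun p hp => ?_, fun y => ?_⟩
  · change Ψ _ = cross (Ψ _) (Ψ _)
    rw [hΨ]; congr 1
    ext k; fin_cases k <;> simp [i, cross_apply, crossCoord, eps]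
  · change P (Ψ.symm (Ψ (i y))) = y
    rw [Ψ.symm_apply_apply]
    ext k; fin_cases k <;> rfl
  · obtain ⟨c, rfl⟩ := Ψ.surjective p
    rw [Ψ.inner_map_map, inner_eps] at hp
    change Ψ (i (P (Ψ.symm (Ψ c)))) = Ψ c
    rw [Ψ.symm_apply_apply]; congr 1
    ext k; fin_cases k <;> simp [i, P, hp]
  · change ⟪Ψ _, Ψ _⟫ = 0
    rw [Ψ.inner_map_map, inner_eps]; rfl

theorem adapted_smul {i : C3 →ₗᵢ[ℝ] ImO} {n : ImO} (hI : ∀ y, i (Complex.I • y) = cross n (i y))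
    (c : ℂ) (y : C3) : i (c • y) = c.re • i y + c.im • cross n (i y) := by
  have : c • y = c.re • y + c.im • (Complex.I • y) := by
    ext k
    simp only [PiLp.smul_apply, PiLp.add_apply, smul_eq_mul, Complex.real_smul]
    conv_lhs => rw [← Complex.re_add_im c]
    ring
  rw [this, map_add, map_smul, map_smul, hI]

/-- A ruled Lagrangian family with constant `x × e` consists of the Hopf circles of a holomorphic
family of complex lines. -/
theorem hopf_family {x e : R2 → ImO} (ht : IsTube x e) (hp : IsLagPatch (tube x e)) {n : ImO}
    (hn : ∀ d, cross (x d) (e d) = n) {i : C3 →ₗᵢ[ℝ] ImO} {P : ImO →L[ℝ] C3}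
    (hI : ∀ y, i (Complex.I • y) = cross n (i y)) (hiP : ∀ p, ⟪n, p⟫ = 0 → i (P p) = p) :
    (∀ p, i (P (tube x e p)) = tube x e p) ∧
    (∀ d (y : C3), y ∈ Submodule.span ℂ {P (x d)} ↔ ∃ a b : ℝ, i y = a • x d + b • e d) ∧
    Smooth (fun d => P (x d)) ∧ (∀ d, P (x d) ≠ 0) ∧
    (∀ d v, 𝒟 (fun d => P (x d)) d v ∈ Submodule.span ℂ {P (x d)} → v = 0) ∧
    ∀ d v, ∃ w, 𝒟 (fun d => P (x d)) d w -
      Complex.I • 𝒟 (fun d => P (x d)) d v ∈ Submodule.span ℂ {P (x d)} := by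
  have hxx : ∀ d, ⟪x d, x d⟫ = 1 := fun d => inner_self_of_norm_one (ht.norm_x d)
  have hnx : ∀ d, ⟪n, x d⟫ = 0 := fun d => by rw [← hn d]; simp
  have hne : ∀ d, ⟪n, e d⟫ = 0 := fun d => by rw [← hn d]; simp
  have hJx : ∀ d, cross n (x d) = e d := fun d => by
    rw [← hn d, cross_anticomm, cross_cross_self, hxx, ht.perp]; simp
  have hxd : Differentiable ℝ x := ht.smooth_x.diff
  set z : R2 → C3 := fun d => P (x d) with hz
  have hzs : Smooth z := P.contDiff.comp ht.smooth_x
  have hiz : ∀ d, i (z d) = x d := fun d => hiP _ (hnx d)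
  have hz0 : ∀ d, z d ≠ 0 := fun d h => by
    have := ht.norm_x d
    rw [← hiz, h, map_zero, norm_zero] at this
    exact zero_ne_one this
  have hspan : ∀ d (y : C3), y ∈ Submodule.span ℂ {z d} ↔
      ∃ a b : ℝ, i y = a • x d + b • e d := by
    intro d y
    rw [Submodule.mem_span_singleton]
    constructor
    · rintro ⟨c, rfl⟩
      exact ⟨c.re, c.im, by rw [adapted_smul hI, hiz, hJx]⟩
    · rintro ⟨a, b, hab⟩
      exact ⟨⟨a, b⟩, i.injective (by rw [adapted_smul hI, hiz, hJx, hab])⟩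
  have hdi : ∀ d v, i (𝒟 z d v) = 𝒟 x d v := by
    intro d v
    have h1 : 𝒟 z d v = P (𝒟 x d v) := by
      have : 𝒟 z d = P.comp (𝒟 x d) :=
        (P.hasFDerivAt.comp d (hxd d).hasFDerivAt).fderiv
      rw [this]; rfl
    rw [h1]
    apply hiP
    have h2 := inner_fderiv_add (f := fun _ : R2 => n) (differentiableAt_const n) (hxd d)
      (.of_forall hnx) v
    simpa using h2
  have hT0 : ∀ d v s, 𝒟 (tube x e) (d, 0) (v, s) = 𝒟 x d v + s • e d := by
    intro d v s
    rw [ht.fderiv_tube]; simp [tubeDir]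
  have hT00 : ∀ d, tube x e (d, 0) = x d := fun d => by simp [tube]
  refine ⟨fun p => hiP _ (by simp [tube, inner_add_right, inner_smul_right, hnx, hne]), hspan, hzs,
    hz0, ?_, ?_⟩
  · intro q v hv
    rw [hspan] at hv
    obtain ⟨a, b, hab⟩ := hv
    rw [hdi] at hab
    have h1 := inner_fderiv_self (hxd q) (.of_forall ht.norm_x) v
    rw [hab, ht.inner_x] at h1
    rw [h1, zero_smul, zero_add] at hab
    have h2 := (injective_iff_map_eq_zero _).mp (hp.inj (q, 0)) (v, -b) (by
      rw [hT0, hab]; module)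
    exact (Prod.mk_eq_zero.mp h2).1
  · intro q v
    obtain ⟨h1, h2⟩ := hp.coassociative finrank_R2R (q, 0)
    have hxE : x q ∈ tang (tube x e) (q, 0) := mem_tang.mpr ⟨1, 0, by simp [hT00]⟩
    have heE : e q ∈ tang (tube x e) (q, 0) := mem_tang.mpr ⟨0, (0, 1), by rw [hT0]; simp⟩
    have hvE : 𝒟 x q v ∈ tang (tube x e) (q, 0) :=
      mem_tang.mpr ⟨0, (v, 0), by rw [hT0]; simp⟩
    have hnE := h1.cross_perp hxE heE
    rw [hn] at hnE
    obtain ⟨a, ⟨w, s⟩, hw⟩ := mem_tang.mp (h1.cross_mem h2 hnE hvE)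
    rw [hT00, hT0] at hw
    refine ⟨w, ?_⟩
    rw [hspan]
    refine ⟨-a, -s, ?_⟩
    rw [map_sub, hI, hdi, hdi, hw]
    module

theorem norm_axis {x e : R2 → ImO} (ht : IsTube x e) {n : ImO}
    (hn : ∀ d, cross (x d) (e d) = n) : ‖n‖ = 1 := by
  have hnn : ‖n‖ ^ 2 = 1 := by
    rw [← real_inner_self_eq_norm_sq, ← hn 0, inner_cross_cross, ht.perp,
      real_inner_self_eq_norm_sq, real_inner_self_eq_norm_sq, ht.norm_x, ht.norm_e]
    norm_num
  nlinarith [norm_nonneg n]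

/-- A ruled Lagrangian family with constant `x × e` is a Hopf lift. -/
theorem isL3_of_const {x e : R2 → ImO} (ht : IsTube x e) (hp : IsLagPatch (tube x e)) {n : ImO}
    (hn : ∀ d, cross (x d) (e d) = n) : IsL3 (range (tube x e)) := by
  obtain ⟨i, P, hI, hPi, hiP, hni⟩ := exists_adapted (norm_axis ht hn)
  obtain ⟨hT, hspan, hzs, hz0, hh1, hh2⟩ := hopf_family ht hp hn hI hiP
  let S : Surface := ⟨R2⟩
  let u : S → CP2 := fun d => Projectivization.mk ℂ (P (x d)) (hz0 d)
  have hdl : ∀ (d : S) v, dlift (S := S) (fun d => P (x d)) d v =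
      𝒟 (fun d => P (x d)) d v := fun d v => by
    unfold dlift
    rw [mfderiv_eq_fderiv]
  refine ⟨S, u, i, ?_, ⟨n, norm_axis ht hn, hI⟩, ?_⟩
  · intro d
    refine ⟨univ, fun d => P (x d), isOpen_univ, trivial, hzs.contMDiff.contMDiffOn,
      fun q _ => ⟨⟨hz0 q, rfl⟩, ?_, ?_⟩⟩
    · intro v hv
      rw [hdl] at hv
      exact hh1 q v hv
    · intro v
      obtain ⟨w, hw⟩ := hh2 q v
      exact ⟨w, by rw [hdl, hdl]; exact hw⟩
  · ext p
    constructor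
    · rintro ⟨⟨d, t⟩, rfl⟩
      refine ⟨⟨(d, P (tube x e (d, t))), ?_, ?_⟩, ?_⟩
      · rw [← i.norm_map, hT, ht.norm_tube]
      · rw [Projectivization.submodule_mk, hspan]
        exact ⟨Real.cos t, Real.sin t, hT _⟩
      · exact hT _
    · rintro ⟨⟨⟨d, y⟩, hy1, hy2⟩, rfl⟩
      rw [Projectivization.submodule_mk, hspan] at hy2
      obtain ⟨a, b, hab⟩ := hy2
      simp only at hab hy1
      have h1 : a ^ 2 + b ^ 2 = 1 := by
        have h2 := congrArg (fun v => ⟪v, v⟫) hab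
        simp only [inner_add_left, inner_smul_left, ht.inner_x, ht.inner_e, conj_trivial] at h2
        rw [real_inner_self_eq_norm_sq, i.norm_map, hy1] at h2
        linarith
      have h3 : ‖(⟨a, b⟩ : ℂ)‖ = 1 := by
        rw [← Real.sqrt_one, Complex.norm_def, Complex.normSq_apply]; congr 1; simp; linarith
      have h4 := Complex.norm_mul_cos_arg (⟨a, b⟩ : ℂ)
      have h5 := Complex.norm_mul_sin_arg (⟨a, b⟩ : ℂ)
      rw [h3, one_mul] at h4 h5
      refine ⟨(d, Complex.arg ⟨a, b⟩), ?_⟩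
      simp only [tube, h4, h5]
      exact hab.symm

/-! ### Pointwise algebra of ruled Lagrangians -/

theorem exists_g2_frame {u x τ : ImO} (hu : ‖u‖ = 1) (hx : ‖x‖ = 1) (hτ : ‖τ‖ = 1)
    (hux : ⟪u, x⟫ = 0) (huτ : ⟪u, τ⟫ = 0) (hxτ : ⟪x, τ⟫ = 0)
    (hφ : ⟪cross u x, τ⟫ = 0) :
    ∃ Ψ : ImO ≃ₗᵢ[ℝ] ImO, IsG2 Ψ ∧ u = Ψ (eps 0) ∧ x = Ψ (eps 1) ∧ cross u x = Ψ (eps 2) ∧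
      τ = Ψ (eps 3) ∧ cross u τ = Ψ (eps 4) ∧ cross x τ = Ψ (eps 5) ∧
      cross u (cross x τ) = Ψ (eps 6) := by
  obtain ⟨Ψ, hΨ, h⟩ := exists_g2 hu hx hτ hux huτ hxτ hφ
  refine ⟨Ψ, hΨ, ?_, ?_, ?_, ?_, ?_, ?_, ?_⟩ <;> rw [h] <;> simp [eps]

/-- The conditions on two tangent vectors of a family of great circles, in a `G₂`-frame. -/
theorem tube_algebra {a a' b' : ImO} {r : ℝ} (hr : r ≠ 0) (ha0 : a 0 = 0) (ha1 : a 1 = 0)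
    (ha0' : a' 0 = 0) (ha1' : a' 1 = 0) (hb0 : b' 0 = 0) (hb1 : b' 1 = 0) (hb2 : b' 2 = 0)
    {q q' : ImO} (hq : q = cross (eps 0) a + cross (r • eps 3) (eps 1))
    (hq' : q' = cross (eps 0) a' + cross b' (eps 1))
    (h1 : ⟪cross (eps 1) a, a'⟫ = 0) (h2 : ⟪cross (eps 2) a, a'⟫ = 0)
    (h3 : ⟪cross (eps 1) q, q'⟫ = 0) (h4 : ⟪cross (eps 2) q, q'⟫ = 0)
    (h5 : ⟪cross (eps 1) a, q'⟫ + ⟪cross (eps 1) q, a'⟫ = 0)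
    (h6 : ⟪cross (eps 2) a, q'⟫ + ⟪cross (eps 2) q, a'⟫ = 0) :
    (b' 5 = 0 ∧ b' 6 = 0) ∧
    (a 3 * b' 3 + a 4 * b' 4 = r * a' 3 ∧ a 4 * b' 3 - a 3 * b' 4 = r * a' 4) ∧
    (a 3 * a' 5 - a 4 * a' 6 = a 5 * a' 3 - a 6 * a' 4 ∧
      a 3 * a' 6 + a 4 * a' 5 = a 5 * a' 4 + a 6 * a' 3) := by
  subst hq hq'
  simp [inner_eq_sum, cross_apply, crossCoord, eps, ha0, ha1, ha0', ha1', hb0, hb1, hb2]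
    at h1 h2 h3 h4 h5 h6
  have e5 : b' 5 = 0 := by
    apply mul_left_cancel₀ hr
    linear_combination h3 - h1 - h6
  have e6 : b' 6 = 0 := by
    apply mul_left_cancel₀ hr
    linear_combination h4 - h2 + h5
  refine ⟨⟨e5, e6⟩, ⟨?_, ?_⟩, ?_, ?_⟩
  · linear_combination 2 * h2 - h5 - a 5 * e5 - a 6 * e6
  · linear_combination h6 + 2 * h1 - a 6 * e5 + a 5 * e6
  · linear_combination h1
  · linear_combination -h2

section TubeRelations
variable {x e : R2 → ImO} (ht : IsTube x e) (hp : IsLagPatch (tube x e)) {d : R2}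

/-- The field `x × e`, constant along the circles. -/
def axis (x e : R2 → ImO) (d : R2) : ImO := cross (x d) (e d)

theorem cross_of_orthonormal {a b : ImO} (ha : ‖a‖ = 1) (hb : ‖b‖ = 1) (hab : ⟪a, b⟫ = 0) :
    ‖cross a b‖ = 1 ∧ ⟪cross a b, a⟫ = 0 ∧ ⟪cross a b, b⟫ = 0 ∧
      cross (cross a b) a = b ∧ cross (cross a b) b = -a := by
  have haa : ⟪a, a⟫ = 1 := inner_self_of_norm_one ha
  have hbb : ⟪b, b⟫ = 1 := inner_self_of_norm_one hb
  refine ⟨?_, by simp, by simp, ?_, ?_⟩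
  · have : ‖cross a b‖ ^ 2 = 1 := by
      rw [← real_inner_self_eq_norm_sq, inner_cross_cross, haa, hbb, hab]; norm_num
    nlinarith [norm_nonneg (cross a b)]
  · rw [cross_anticomm, cross_cross_self, haa, hab]; simp
  · rw [cross_anticomm a b, cross_neg_left, cross_anticomm, neg_neg, cross_cross_self, hbb,
      real_inner_comm, hab]; simp

include ht in
theorem IsTube.axis_facts (d : R2) : ‖axis x e d‖ = 1 ∧ ⟪axis x e d, x d⟫ = 0 ∧
    ⟪axis x e d, e d⟫ = 0 ∧ cross (axis x e d) (x d) = e d ∧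
    cross (axis x e d) (e d) = -x d :=
  cross_of_orthonormal (ht.norm_x d) (ht.norm_e d) (ht.perp d)

include ht in
theorem IsTube.smooth_axis : Smooth (axis x e) := ht.smooth_x.cross ht.smooth_e

include ht in
theorem IsTube.diff_x : Differentiable ℝ x := ht.smooth_x.diff
include ht in
theorem IsTube.diff_e : Differentiable ℝ e := ht.smooth_e.diff
include ht in
theorem IsTube.diff_axis : Differentiable ℝ (axis x e) := ht.smooth_axis.diff

include ht in
theorem IsTube.de_eq (v : R2) : 𝒟 e d v =
    cross (axis x e d) (𝒟 x d v) + cross (𝒟 (axis x e) d v) (x d) := by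
  have : e = fun d => cross (axis x e d) (x d) := funext fun d => (ht.axis_facts d).2.2.2.1.symm
  conv_lhs => rw [this]
  rw [fderiv_cross (ht.diff_axis d) (ht.diff_x d), add_comm]

include ht in
theorem IsTube.daxis_eq (v : R2) : 𝒟 (axis x e) d v =
    cross (𝒟 x d v) (e d) + cross (x d) (𝒟 e d v) :=
  fderiv_cross (ht.diff_x d) (ht.diff_e d) v

include ht in
theorem IsTube.mem_tang_x (t : ℝ) : x d ∈ tang (tube x e) (d, t) := by
  refine mem_tang.mpr ⟨Real.cos t, (0, -Real.sin t), ?_⟩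
  rw [ht.fderiv_tube]
  simp only [tube, tubeDir, map_zero, smul_zero, zero_add]
  have := Real.cos_sq_add_sin_sq t
  calc x d = (Real.cos t ^ 2 + Real.sin t ^ 2) • x d := by rw [this, one_smul]
    _ = _ := by module

include ht in
theorem IsTube.mem_tang_e (t : ℝ) : e d ∈ tang (tube x e) (d, t) := by
  refine mem_tang.mpr ⟨Real.sin t, (0, Real.cos t), ?_⟩
  rw [ht.fderiv_tube]
  simp only [tube, tubeDir, map_zero, smul_zero, zero_add]
  have := Real.cos_sq_add_sin_sq t
  calc e d = (Real.cos t ^ 2 + Real.sin t ^ 2) • e d := by rw [this, one_smul]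
    _ = _ := by module

include ht in
theorem IsTube.mem_tang_d (t : ℝ) (v : R2) :
    Real.cos t • 𝒟 x d v + Real.sin t • 𝒟 e d v ∈ tang (tube x e) (d, t) := by
  refine mem_tang.mpr ⟨0, (v, 0), ?_⟩
  rw [ht.fderiv_tube]; simp

include ht hp in
theorem phi_tube {g : ImO} (hg : ∀ t, g ∈ tang (tube x e) (d, t)) (v w : R2) :
    ⟪cross g (𝒟 x d v), 𝒟 x d w⟫ = 0 ∧
    ⟪cross g (𝒟 e d v), 𝒟 e d w⟫ = 0 ∧
    ⟪cross g (𝒟 x d v), 𝒟 e d w⟫ +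
      ⟪cross g (𝒟 e d v), 𝒟 x d w⟫ = 0 := by
  have key : ∀ t, ⟪cross g (Real.cos t • 𝒟 x d v + Real.sin t • 𝒟 e d v),
      Real.cos t • 𝒟 x d w + Real.sin t • 𝒟 e d w⟫ = 0 := fun t =>
    (hp.coassociative finrank_R2R (d, t)).1 _ (hg t) _ (ht.mem_tang_d t v) _ (ht.mem_tang_d t w)
  have h0 := key 0
  have h1 := key (Real.pi / 2)
  have h2 := key (Real.pi / 4)
  simp only [Real.cos_zero, Real.sin_zero, one_smul, zero_smul, add_zero, Real.cos_pi_div_two,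
    Real.sin_pi_div_two, zero_add] at h0 h1
  refine ⟨h0, h1, ?_⟩
  simp only [Real.cos_pi_div_four, Real.sin_pi_div_four, cross_add_right, cross_smul_right,
    inner_add_left, inner_add_right, inner_smul_left, inner_smul_right, conj_trivial, h0, h1] at h2
  have h3 : (Real.sqrt 2 / 2) * (Real.sqrt 2 / 2) = 1 / 2 := by
    have := Real.mul_self_sqrt (show (0 : ℝ) ≤ 2 by norm_num)
    linear_combination this / 4
  linear_combination 2 * h2 + (-2 * ⟪cross g (𝒟 x d v), 𝒟 e d w⟫ -
      2 * ⟪cross g (𝒟 e d v), 𝒟 x d w⟫) * h3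

include ht hp in
theorem axis_perp (v : R2) : ⟪axis x e d, 𝒟 x d v⟫ = 0 ∧
    ⟪axis x e d, 𝒟 e d v⟫ = 0 := by
  have key : ∀ t, ⟪axis x e d,
      Real.cos t • 𝒟 x d v + Real.sin t • 𝒟 e d v⟫ = 0 := fun t =>
    (hp.coassociative finrank_R2R (d, t)).1 _ (ht.mem_tang_x t) _ (ht.mem_tang_e t) _
      (ht.mem_tang_d t v)
  have h0 := key 0
  have h1 := key (Real.pi / 2)
  simp only [Real.cos_zero, Real.sin_zero, one_smul, zero_smul, add_zero, Real.cos_pi_div_two,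
    Real.sin_pi_div_two, zero_add] at h0 h1
  exact ⟨h0, h1⟩

include ht hp in
theorem daxis_perp (v : R2) : ⟪axis x e d, 𝒟 (axis x e) d v⟫ = 0 ∧
    ⟪x d, 𝒟 (axis x e) d v⟫ = 0 ∧
    ⟪e d, 𝒟 (axis x e) d v⟫ = 0 := by
  have h := axis_perp ht hp (d := d) v
  refine ⟨inner_fderiv_self (ht.diff_axis d) (.of_forall fun d => (ht.axis_facts d).1) v, ?_, ?_⟩
  · have h1 := inner_fderiv_add (ht.diff_axis d) (ht.diff_x d)
      (.of_forall fun d => (ht.axis_facts d).2.1) v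
    rw [h.1, add_zero, real_inner_comm] at h1
    exact h1
  · have h1 := inner_fderiv_add (ht.diff_axis d) (ht.diff_e d)
      (.of_forall fun d => (ht.axis_facts d).2.2.1) v
    rw [h.2, add_zero, real_inner_comm] at h1
    exact h1

include ht hp in
/-- The relations between `dx` and `du`, `u = x × e`, where `du ≠ 0`. -/
theorem tube_relations {v w : R2} {τ : ImO} {r : ℝ} (hr : r ≠ 0) (hτ : ‖τ‖ = 1)
    (hv : 𝒟 (axis x e) d v = r • τ) :
    let u := axis x e d
    let y := cross (x d) τ
    let dx := 𝒟 x d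
    let du := 𝒟 (axis x e) d
    (⟪y, du w⟫ = 0 ∧ ⟪cross u y, du w⟫ = 0) ∧
    (⟪τ, dx v⟫ * ⟪τ, du w⟫ + ⟪cross u τ, dx v⟫ * ⟪cross u τ, du w⟫ =
        r * ⟪τ, dx w⟫ ∧
      ⟪cross u τ, dx v⟫ * ⟪τ, du w⟫ - ⟪τ, dx v⟫ * ⟪cross u τ, du w⟫ =
        r * ⟪cross u τ, dx w⟫) ∧
    (⟪τ, dx v⟫ * ⟪y, dx w⟫ - ⟪cross u τ, dx v⟫ * ⟪cross u y, dx w⟫ =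
        ⟪y, dx v⟫ * ⟪τ, dx w⟫ - ⟪cross u y, dx v⟫ * ⟪cross u τ, dx w⟫ ∧
      ⟪τ, dx v⟫ * ⟪cross u y, dx w⟫ + ⟪cross u τ, dx v⟫ * ⟪y, dx w⟫ =
        ⟪y, dx v⟫ * ⟪cross u τ, dx w⟫ +
          ⟪cross u y, dx v⟫ * ⟪τ, dx w⟫) := by
  intro u y dx du
  obtain ⟨hu, hux, hue, hJx, hJe⟩ := ht.axis_facts d
  obtain ⟨p1, p2, p3⟩ := daxis_perp ht hp (d := d) v
  rw [hv, inner_smul_right] at p1 p2 p3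
  have q1 := (mul_eq_zero.mp p1).resolve_left hr
  have q2 := (mul_eq_zero.mp p2).resolve_left hr
  have q3 := (mul_eq_zero.mp p3).resolve_left hr
  obtain ⟨Ψ, hΨ, k0, k1, k2, k3, k4, k5, k6⟩ := exists_g2_frame hu (ht.norm_x d) hτ hux q1 q2
    (by rw [hJx]; exact q3)
  have he2 : e d = Ψ (eps 2) := hJx.symm.trans k2
  obtain ⟨a, ha⟩ := Ψ.surjective (𝒟 x d v)
  obtain ⟨a', ha'⟩ := Ψ.surjective (𝒟 x d w)
  obtain ⟨b', hb'⟩ := Ψ.surjective (𝒟 (axis x e) d w)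
  obtain ⟨q, hq⟩ := Ψ.surjective (𝒟 e d v)
  obtain ⟨q', hq'⟩ := Ψ.surjective (𝒟 e d w)
  obtain ⟨a1, a2, a3⟩ := phi_tube ht hp (fun t => ht.mem_tang_x (d := d) t) v w
  obtain ⟨c1, c2, c3⟩ := phi_tube ht hp (fun t => ht.mem_tang_e (d := d) t) v w
  have dv := ht.de_eq (d := d) v
  have dw := ht.de_eq (d := d) w
  obtain ⟨b0, b1, b2⟩ := daxis_perp ht hp (d := d) w
  have x0 := (axis_perp ht hp (d := d) v).1
  have x0' := (axis_perp ht hp (d := d) w).1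
  have x1 := inner_fderiv_self (ht.diff_x d) (.of_forall ht.norm_x) v
  have x1' := inner_fderiv_self (ht.diff_x d) (.of_forall ht.norm_x) w
  rw [hv] at dv
  simp only [u, y, dx, du]
  rw [k6, k5, k4, k3]
  rw [k3] at dv
  simp only [he2, k0, k1, ← ha, ← ha', ← hb', ← hq, ← hq', hΨ _ _, Ψ.inner_map_map, ← map_add,
    ← map_smul, Ψ.injective.eq_iff] at a1 a2 a3 c1 c2 c3 dv dw b0 b1 b2 x0 x0' x1 x1' ⊢
  simp only [inner_eps] at b0 b1 b2 x0 x0' x1 x1' ⊢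
  exact tube_algebra hr x0 x1 x0' x1' b0 b1 b2 dv dw a1 c1 a2 c2 a3 c3

end TubeRelations

section

/-! ### Constant associative planes -/

theorem smooth_normalize {σ : R2 → ImO} (hσ : Smooth σ) (h0 : ∀ d, σ d ≠ 0) :
    Smooth (fun d => ‖σ d‖⁻¹ • σ d) :=
  ((hσ.norm ℝ h0).inv fun d => norm_ne_zero_iff.mpr (h0 d)).smul hσ

theorem norm_normalize {σ : ImO} (h0 : σ ≠ 0) : ‖‖σ‖⁻¹ • σ‖ = 1 := by
  rw [norm_smul, norm_inv, norm_norm, inv_mul_cancel₀ (norm_ne_zero_iff.mpr h0)]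

/-- An orthonormal associative frame that moves in its own span has constant span. -/
theorem const_plane_unit {u τ : R2 → ImO} (hu : Smooth u) (hτ : Smooth τ)
    (hn : ∀ d, ‖u d‖ = 1) (hn' : ∀ d, ‖τ d‖ = 1) (hp : ∀ d, ⟪u d, τ d⟫ = 0)
    (hdu : ∀ d v, ∃ a b c : ℝ, 𝒟 u d v = a • u d + b • τ d + c • cross (u d) (τ d))
    (hdτ : ∀ d v, ∃ a b c : ℝ, 𝒟 τ d v = a • u d + b • τ d + c • cross (u d) (τ d)) :
    ∃ P : Submodule ℝ ImO, Module.finrank ℝ P = 4 ∧ ∀ d q, ⟪u d, q⟫ = 0 →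
      ⟪τ d, q⟫ = 0 → ⟪cross (u d) (τ d), q⟫ = 0 → q ∈ P := by
  have hu' : Differentiable ℝ u := hu.diff
  have hτ' : Differentiable ℝ τ := hτ.diff
  set J : R2 → ImO := fun d => cross (u d) (τ d) with hJ
  have hJs : Smooth J := hu.cross hτ
  have hJ' : Differentiable ℝ J := hJs.diff
  have huu : ∀ d, ⟪u d, u d⟫ = 1 := fun d => inner_self_of_norm_one (hn d)
  have hττ : ∀ d, ⟪τ d, τ d⟫ = 1 := fun d => inner_self_of_norm_one (hn' d)
  have hτu : ∀ d, ⟪τ d, u d⟫ = 0 := fun d => by rw [real_inner_comm, hp]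
  have huJ : ∀ d, ⟪u d, J d⟫ = 0 := fun d => by rw [real_inner_comm]; simp [hJ]
  have hJu : ∀ d, ⟪J d, u d⟫ = 0 := fun d => by simp [hJ]
  have hτJ : ∀ d, ⟪τ d, J d⟫ = 0 := fun d => by rw [real_inner_comm]; simp [hJ]
  have hJτ : ∀ d, ⟪J d, τ d⟫ = 0 := fun d => by simp [hJ]
  have hJJ : ∀ d, ⟪J d, J d⟫ = 1 := fun d => by
    simp only [hJ]; rw [inner_cross_cross, huu, hττ, hp]; norm_num
  have huJ' : ∀ d, cross (u d) (J d) = -τ d := fun d => by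
    simp only [hJ]; rw [cross_cross_self, hp, huu]; simp
  have hJτ' : ∀ d, cross (J d) (τ d) = -u d := fun d =>
    (cross_of_orthonormal (hn d) (hn' d) (hp d)).2.2.2.2
  -- the structure equations
  have key : ∀ d v, ∃ b c c' : ℝ, 𝒟 u d v = b • τ d + c • J d ∧
      𝒟 τ d v = -b • u d + c' • J d ∧ 𝒟 J d v = -c • u d - c' • τ d := by
    intro d v
    obtain ⟨a, b, c, h1⟩ := hdu d v
    obtain ⟨a', b', c', h2⟩ := hdτ d v
    have e1 := inner_fderiv_self (hu' d) (.of_forall hn) v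
    have e2 := inner_fderiv_self (hτ' d) (.of_forall hn') v
    have e3 := inner_fderiv_add (hu' d) (hτ' d) (.of_forall hp) v
    rw [show cross (u d) (τ d) = J d from rfl] at h1 h2
    rw [h1] at e1 e3
    rw [h2] at e2 e3
    simp only [inner_add_left, inner_add_right, inner_smul_left, inner_smul_right, huu, hττ, hp, hτu,
      huJ, hJτ, hτJ, conj_trivial] at e1 e2 e3
    have ha : a = 0 := by linarith
    have hb' : b' = 0 := by linarith
    have ha' : a' = -b := by linarith
    subst ha hb' ha'
    rw [zero_smul, zero_add] at h1
    rw [zero_smul, add_zero] at h2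
    refine ⟨b, c, c', h1, h2, ?_⟩
    simp only [hJ]
    rw [fderiv_cross (hu' d) (hτ' d), h1, h2, cross_add_left, cross_add_right, cross_smul_left,
      cross_smul_left, cross_smul_right, cross_smul_right, cross_self, cross_self, hJτ', huJ']
    module
  set Q : ImO → R2 → ImO := fun q d =>
    ⟪u d, q⟫ • u d + ⟪τ d, q⟫ • τ d + ⟪J d, q⟫ • J d with hQ
  have hconst : ∀ q d, Q q d = Q q 0 := by
    intro q d
    have hin : ∀ f : R2 → ImO, Differentiable ℝ f → ∀ d, DifferentiableAt ℝ (fun d => ⟪f d, q⟫) d :=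
      fun f hf d => (hf d).inner ℝ (differentiableAt_const q)
    have hd1 : ∀ f : R2 → ImO, Differentiable ℝ f → ∀ d,
        DifferentiableAt ℝ (fun d => ⟪f d, q⟫ • f d) d := fun f hf d => (hin f hf d).smul (hf d)
    have hd2 : ∀ f : R2 → ImO, Differentiable ℝ f → ∀ d v,
        𝒟 (fun d => ⟪f d, q⟫ • f d) d v =
          ⟪f d, q⟫ • 𝒟 f d v + ⟪𝒟 f d v, q⟫ • f d := by
      intro f hf d v
      rw [fderiv_fun_smul (hin f hf d) (hf d)]
      have := fderiv_inner_apply' (hf d) (differentiableAt_const q) v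
      simp only [fderiv_fun_const, Pi.zero_apply, zero_apply, inner_zero_right,
        add_zero] at this
      simp [this]
    refine is_const_of_fderiv_eq_zero (𝕜 := ℝ) (f := Q q) (fun d =>
      ((hd1 u hu' d).add (hd1 τ hτ' d)).add (hd1 J hJ' d)) (fun d => ?_) d 0
    ext1 v
    obtain ⟨b, c, c', h1, h2, h3⟩ := key d v
    have : 𝒟 (Q q) d = 𝒟 (fun d => ⟪u d, q⟫ • u d) d +
        𝒟 (fun d => ⟪τ d, q⟫ • τ d) d + 𝒟 (fun d => ⟪J d, q⟫ • J d) d :=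
      (((hd1 u hu' d).hasFDerivAt.fun_add (hd1 τ hτ' d).hasFDerivAt).fun_add
        (hd1 J hJ' d).hasFDerivAt).fderiv
    rw [this, add_apply, add_apply, hd2 u hu', hd2 τ hτ', hd2 J hJ', h1, h2, h3]
    simp only [inner_add_left, inner_sub_left, inner_smul_left, conj_trivial, zero_apply]
    module
  refine ⟨(Submodule.span ℝ (range ![u 0, τ 0, J 0]))ᗮ, ?_, fun d q h1 h2 h3 => ?_⟩
  · have hli : LinearIndependent ℝ ![u 0, τ 0, J 0] := by
      rw [Fintype.linearIndependent_iff]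
      intro g hg
      simp only [Fin.sum_univ_three, Matrix.cons_val] at hg
      have e1 := congrArg (inner ℝ (u 0)) hg
      have e2 := congrArg (inner ℝ (τ 0)) hg
      have e3 := congrArg (inner ℝ (J 0)) hg
      simp only [inner_add_right, inner_smul_right, huu, hττ, hJJ, hp, hτu, huJ, hJτ, hτJ, hJu,
        inner_zero_right] at e1 e2 e3
      intro i
      fin_cases i
      · change g 0 = 0; linarith
      · change g 1 = 0; linarith
      · change g 2 = 0; linarith
    have h1 := Submodule.finrank_add_finrank_orthogonal (Submodule.span ℝ (range ![u 0, τ 0, J 0]))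
    rw [finrank_span_eq_card hli] at h1
    have h3 : Module.finrank ℝ ImO = 7 := by simp
    simp only [Fintype.card_fin] at h1
    omega
  · have h4 := hconst q d
    simp only [hQ, h1, h2, show ⟪J d, q⟫ = 0 from h3, zero_smul, add_zero] at h4
    have e1 := congrArg (inner ℝ (u 0)) h4
    have e2 := congrArg (inner ℝ (τ 0)) h4
    have e3 := congrArg (inner ℝ (J 0)) h4
    simp only [inner_add_right, inner_smul_right, huu, hττ, hJJ, hp, hτu, huJ, hJτ, hτJ, hJu,
        inner_zero_right] at e1 e2 e3
    rw [Submodule.mem_orthogonal]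
    intro w hw
    induction hw using Submodule.span_induction with
    | zero => simp
    | add a a' _ _ h1 h2 => rw [inner_add_left, h1, h2, add_zero]
    | smul r a _ h1 => rw [inner_smul_left, h1, mul_zero]
    | mem w hw =>
      obtain ⟨i, rfl⟩ := hw
      fin_cases i
      · change ⟪u 0, q⟫ = 0; linarith
      · change ⟪τ 0, q⟫ = 0; linarith
      · change ⟪J 0, q⟫ = 0; linarith

theorem const_plane {u σ : R2 → ImO} (hu : Smooth u) (hσ : Smooth σ)
    (hn : ∀ d, ‖u d‖ = 1) (h0 : ∀ d, σ d ≠ 0) (hp : ∀ d, ⟪u d, σ d⟫ = 0)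
    (hdu : ∀ d v, ∃ a b c : ℝ, 𝒟 u d v = a • u d + b • σ d + c • cross (u d) (σ d))
    (hdσ : ∀ d v, ∃ a b c : ℝ, 𝒟 σ d v = a • u d + b • σ d + c • cross (u d) (σ d)) :
    ∃ P : Submodule ℝ ImO, Module.finrank ℝ P = 4 ∧ ∀ d q, ⟪u d, q⟫ = 0 →
      ⟪σ d, q⟫ = 0 → ⟪cross (u d) (σ d), q⟫ = 0 → q ∈ P := by
  have hr : ∀ d, ‖σ d‖ ≠ 0 := fun d => norm_ne_zero_iff.mpr (h0 d)
  have hσ' : ∀ d, σ d = ‖σ d‖ • (‖σ d‖⁻¹ • σ d) := fun d => by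
    rw [smul_smul, mul_inv_cancel₀ (hr d), one_smul]
  have hinv : Smooth (fun d => ‖σ d‖⁻¹) := (hσ.norm ℝ h0).inv hr
  obtain ⟨P, hP, h⟩ := const_plane_unit hu (smooth_normalize hσ h0) hn
    (fun d => norm_normalize (h0 d)) (fun d => by rw [inner_smul_right, hp, mul_zero])
    (fun d v => by
      obtain ⟨a, b, c, h⟩ := hdu d v
      refine ⟨a, b * ‖σ d‖, c * ‖σ d‖, ?_⟩
      rw [h, cross_smul_right, smul_smul, smul_smul, mul_assoc, mul_assoc, mul_inv_cancel₀ (hr d),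
        mul_one, mul_one])
    (fun d v => by
      obtain ⟨a, b, c, h⟩ := hdσ d v
      rw [fderiv_fun_smul (hinv.diff d) (hσ.diff d)]
      simp only [add_apply, smul_apply, ContinuousLinearMap.smulRight_apply]
      rw [h]
      refine ⟨‖σ d‖⁻¹ * a, b + 𝒟 (fun d => ‖σ d‖⁻¹) d v * ‖σ d‖, c, ?_⟩
      rw [cross_smul_right, add_smul, mul_smul _ (‖σ d‖), ← hσ']
      module)
  refine ⟨P, hP, fun d q h1 h2 h3 => h d q h1 ?_ ?_⟩
  · rw [inner_smul_left, h2, mul_zero]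
  · rw [cross_smul_right, inner_smul_left, h3, mul_zero]

/-! ### Pieces of ruled Lagrangians -/

theorem frame_expand {u x τ : ImO} (hu : ‖u‖ = 1) (hx : ‖x‖ = 1) (hτ : ‖τ‖ = 1)
    (hux : ⟪u, x⟫ = 0) (huτ : ⟪u, τ⟫ = 0) (hxτ : ⟪x, τ⟫ = 0)
    (hφ : ⟪cross u x, τ⟫ = 0) (q : ImO) :
    q = ⟪u, q⟫ • u + ⟪x, q⟫ • x + ⟪cross u x, q⟫ • cross u x + ⟪τ, q⟫ • τ +
      ⟪cross u τ, q⟫ • cross u τ + ⟪cross x τ, q⟫ • cross x τ +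
      ⟪cross u (cross x τ), q⟫ • cross u (cross x τ) := by
  obtain ⟨Ψ, hΨ, k0, k1, k2, k3, k4, k5, k6⟩ := exists_g2_frame hu hx hτ hux huτ hxτ hφ
  obtain ⟨q, rfl⟩ := Ψ.surjective q
  rw [k6, k5, k4, k2, k0, k1, k3]
  simp only [Ψ.inner_map_map, inner_eps, ← map_smul, ← map_add]
  congr 1
  ext i
  fin_cases i <;> simp [eps]

variable {L : Type*} [TopologicalSpace L] [ChartedSpace (Rn 3) L] [IsManifold (𝓡 3) ∞ L]
  {ι : L → ImO} {x e : R2 → ImO} {j : R2 × ℝ → L}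

namespace RuledChart
variable (hl : IsLagrangian ι) (hι : IsImmersedInS6 (n := 3) ι) (hc : RuledChart ι x e j)
include hl hι hc

theorem isPiece_of_const {n : ImO} (hn : ∀ d, axis x e d = n) : IsPiece ι IsL3 (range j) :=
  ⟨hc.isOpen_range hι, hc.emb, by
    rw [hc.image_range]; exact isL3_of_const hc.isTube (hc.patch hl hι) hn⟩

theorem isPiece_of_sphere {P : Submodule ℝ ImO} (hP : Module.finrank ℝ P = 4)
    (hxP : ∀ d, x d ∈ P) (heP : ∀ d, e d ∈ P) (p : R2 × ℝ) : ∃ V, IsPiece ι IsL3 V ∧ j p ∈ V := by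
  have hVP : ∀ m ∈ range j, ι m ∈ P := by
    rintro _ ⟨p, rfl⟩
    rw [hc.eq]; exact P.add_mem (P.smul_mem _ (hxP _)) (P.smul_mem _ (heP _))
  obtain ⟨x', e', j', hc', hr, hn, hx0, he0⟩ := exists_ruledChart_of_sphere hl hι
    (hc.isOpen_range hι) hc.emb hP hVP (hc.isTube.norm_x p.1) (hc.isTube.norm_e p.1)
    (hc.isTube.perp p.1) (fun t => ⟨j (p.1, t), ⟨_, rfl⟩, hc.eq _⟩)
  refine ⟨range j', hc'.isPiece_of_const hl hι hn, (0, p.2), ?_⟩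
  have := hc.emb.injective (a₁ := ⟨j' (0, p.2), hr ⟨_, rfl⟩⟩) (a₂ := ⟨j p, p, rfl⟩) (by
    change ι _ = ι _
    rw [hc'.eq, hc.eq]; simp only [tube, hx0, he0])
  exact congrArg Subtype.val this

end RuledChart

end

section

/-! ### Derivatives of the axis -/

theorem frame_expand_smul {u x σ : ImO} (hu : ‖u‖ = 1) (hx : ‖x‖ = 1) (hσ : σ ≠ 0)
    (hux : ⟪u, x⟫ = 0) (huσ : ⟪u, σ⟫ = 0) (hxσ : ⟪x, σ⟫ = 0)
    (hφ : ⟪cross u x, σ⟫ = 0) (q : ImO) :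
    ⟪σ, σ⟫ • q = ⟪σ, σ⟫ • (⟪u, q⟫ • u + ⟪x, q⟫ • x +
      ⟪cross u x, q⟫ • cross u x) + (⟪σ, q⟫ • σ +
      ⟪cross u σ, q⟫ • cross u σ + ⟪cross x σ, q⟫ • cross x σ +
      ⟪cross u (cross x σ), q⟫ • cross u (cross x σ)) := by
  obtain ⟨r, τ, hr, hτ, rfl⟩ : ∃ (r : ℝ) (τ : ImO), r ≠ 0 ∧ ‖τ‖ = 1 ∧ σ = r • τ :=
    ⟨‖σ‖, ‖σ‖⁻¹ • σ, norm_ne_zero_iff.mpr hσ, norm_normalize hσ, by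
      rw [smul_smul, mul_inv_cancel₀ (norm_ne_zero_iff.mpr hσ), one_smul]⟩
  rw [inner_smul_right] at huσ hxσ hφ
  have h := frame_expand hu hx hτ hux ((mul_eq_zero.mp huσ).resolve_left hr)
    ((mul_eq_zero.mp hxσ).resolve_left hr) ((mul_eq_zero.mp hφ).resolve_left hr) q
  have hττ : ⟪τ, τ⟫ = 1 := inner_self_of_norm_one hτ
  simp only [inner_smul_left, inner_smul_right, conj_trivial, cross_smul_right, hττ, mul_one]
  conv_lhs => rw [h]
  module

theorem inner_cross_of_smul {u x σ q : ImO} (hσ : σ ≠ 0) (huσ : ⟪u, σ⟫ = 0)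
    (hux : ⟪u, x⟫ = 0) {a b : ℝ}
    (h : ⟪σ, σ⟫ • q = a • σ + b • cross u σ) : ⟪σ, cross q x⟫ = 0 := by
  apply mul_left_cancel₀ (inner_self_ne_zero.mpr hσ : ⟪σ, σ⟫ ≠ (0 : ℝ))
  rw [mul_zero, ← inner_smul_right, ← cross_smul_left, h, real_inner_comm, inner_cross_swap',
    cross_anticomm]
  simp only [cross_add_right, cross_smul_right, cross_self, smul_zero, zero_add]
  rw [cross_anticomm u, cross_neg_right, cross_cross_self, real_inner_comm u, huσ]
  simp [inner_smul_left, hux]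

theorem exists_associative {u x σ D X : ImO} (hu : ‖u‖ = 1) (hx : ‖x‖ = 1) (hσ : σ ≠ 0)
    (hux : ⟪u, x⟫ = 0) (huσ : ⟪u, σ⟫ = 0) (hxσ : ⟪x, σ⟫ = 0)
    (hφ : ⟪cross u x, σ⟫ = 0) (huX : ⟪u, X⟫ = 0) (hxX : ⟪x, X⟫ = 0)
    (hσX : ⟪σ, X⟫ = 0) (hJX : ⟪cross u σ, X⟫ = 0) (hX : ∀ c : ℝ, X ≠ c • cross u x)
    (hxD : ⟪x, D⟫ = 0) (heD : ⟪cross u x, D⟫ = 0) (hD : ⟪D, X⟫ = 0)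
    (hD' : ⟪D, cross u X⟫ = 0) : ∃ a b c : ℝ, D = a • u + b • σ + c • cross u σ := by
  have hex := frame_expand_smul hu hx hσ hux huσ hxσ hφ
  have hs : ⟪σ, σ⟫ ≠ 0 := inner_self_ne_zero.mpr hσ
  have hXe := hex X
  rw [huX, hxX, hσX, hJX] at hXe
  set y := cross x σ with hy
  have huu : ⟪u, u⟫ = 1 := inner_self_of_norm_one hu
  have huy : ⟪u, y⟫ = 0 := by rw [hy, real_inner_comm, ← inner_cross_cyclic, hφ]
  set a : ℝ := ⟪y, X⟫
  set b : ℝ := ⟪cross u y, X⟫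
  have hJXe := congrArg (cross u) hXe
  simp only [cross_smul_right, cross_add_right, zero_smul, zero_add, cross_cross_self, huy, huu,
    hux] at hXe hJXe
  have hab : a * a + b * b ≠ 0 := by
    intro h
    have ha0 : a = 0 := by nlinarith [mul_self_nonneg a, mul_self_nonneg b]
    have hb0 : b = 0 := by nlinarith [mul_self_nonneg a, mul_self_nonneg b]
    rw [ha0, hb0] at hXe
    simp only [zero_smul, add_zero] at hXe
    exact hX _ (smul_right_injective _ hs hXe)
  have m1 := congrArg (inner ℝ D) hXe
  have m2 := congrArg (inner ℝ D) hJXe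
  rw [real_inner_comm] at hxD heD
  simp only [inner_add_right, inner_smul_right, hD, hD', hxD, heD, mul_zero, zero_add,
    zero_sub, inner_neg_right, one_mul, neg_zero] at m1 m2
  have n1 : ⟪y, D⟫ = 0 := by
    rw [real_inner_comm]
    apply mul_left_cancel₀ hab
    linear_combination -a * m1 + b * m2
  have n2 : ⟪cross u y, D⟫ = 0 := by
    rw [real_inner_comm]
    apply mul_left_cancel₀ hab
    linear_combination -b * m1 - a * m2
  have hfin := hex D
  rw [real_inner_comm] at hxD heD
  rw [hxD, heD, n1, n2] at hfin
  simp only [zero_smul, add_zero] at hfin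
  rw [(eq_inv_smul_iff₀ hs).mpr hfin]
  exact ⟨⟪u, D⟫, _, _, by
    rw [smul_add, inv_smul_smul₀ hs, smul_add, smul_smul, smul_smul, add_assoc]⟩

section
variable {x e : R2 → ImO} (ht : IsTube x e) (hp : IsLagPatch (tube x e)) {d : R2}

include ht in
theorem IsTube.good_ne (hg : Good x e d) {w : R2} (hw : w ≠ 0) (c : ℝ) :
    𝒟 x d w ≠ c • e d := by
  intro h
  have h1 := hg 0
  rw [injective_iff_map_eq_zero] at h1
  have h2 := h1 (w, -c) (by rw [ht.fderiv_tube]; simp [tubeDir, h])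
  exact hw (congrArg Prod.fst h2)

include ht hp in
theorem tube_relations_smul {v : R2} (h0 : 𝒟 (axis x e) d v ≠ 0) (w : R2) :
    let u := axis x e d
    let dx := 𝒟 x d
    let du := 𝒟 (axis x e) d
    let σ := du v
    let y := cross (x d) σ
    (⟪y, du w⟫ = 0 ∧ ⟪cross u y, du w⟫ = 0) ∧
    (⟪σ, dx v⟫ * ⟪σ, du w⟫ + ⟪cross u σ, dx v⟫ * ⟪cross u σ, du w⟫ =
        ⟪σ, σ⟫ * ⟪σ, dx w⟫ ∧
      ⟪cross u σ, dx v⟫ * ⟪σ, du w⟫ - ⟪σ, dx v⟫ * ⟪cross u σ, du w⟫ =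
        ⟪σ, σ⟫ * ⟪cross u σ, dx w⟫) ∧
    (⟪σ, dx v⟫ * ⟪y, dx w⟫ - ⟪cross u σ, dx v⟫ * ⟪cross u y, dx w⟫ =
        ⟪y, dx v⟫ * ⟪σ, dx w⟫ - ⟪cross u y, dx v⟫ * ⟪cross u σ, dx w⟫ ∧
      ⟪σ, dx v⟫ * ⟪cross u y, dx w⟫ + ⟪cross u σ, dx v⟫ * ⟪y, dx w⟫ =
        ⟪y, dx v⟫ * ⟪cross u σ, dx w⟫ +
          ⟪cross u y, dx v⟫ * ⟪σ, dx w⟫) := by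
  intro u dx du σ y
  obtain ⟨r, τ, hr, hτ, hσ⟩ : ∃ (r : ℝ) (τ : ImO), r ≠ 0 ∧ ‖τ‖ = 1 ∧ σ = r • τ :=
    ⟨‖σ‖, ‖σ‖⁻¹ • σ, norm_ne_zero_iff.mpr h0, norm_normalize h0, by
      rw [smul_smul, mul_inv_cancel₀ (norm_ne_zero_iff.mpr h0), one_smul]⟩
  obtain ⟨⟨a1, a2⟩, ⟨b1, b2⟩, c1, c2⟩ := tube_relations ht hp hr hτ hσ (w := w)
  have hττ : ⟪τ, τ⟫ = 1 := inner_self_of_norm_one hτ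
  simp only [y, hσ, inner_smul_left, inner_smul_right, conj_trivial, cross_smul_right, hττ, mul_one]
  refine ⟨⟨?_, ?_⟩, ⟨?_, ?_⟩, ?_, ?_⟩
  · rw [a1, mul_zero]
  · rw [a2, mul_zero]
  · linear_combination r ^ 2 * b1
  · linear_combination r ^ 2 * b2
  · linear_combination r ^ 2 * c1
  · linear_combination r ^ 2 * c2

include ht hp in
/-- The differential of the axis takes values in a complex line. -/
theorem daxis_expand {v : R2} (h0 : 𝒟 (axis x e) d v ≠ 0) (w : R2) :
    let u := axis x e d
    let du := 𝒟 (axis x e) d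
    let σ := du v
    ⟪σ, σ⟫ • du w = ⟪σ, du w⟫ • σ + ⟪cross u σ, du w⟫ • cross u σ := by
  intro u du σ
  obtain ⟨hu, hux, hue, hJx, hJe⟩ := ht.axis_facts d
  obtain ⟨p1, p2, p3⟩ := daxis_perp ht hp (d := d) v
  obtain ⟨q1, q2, q3⟩ := daxis_perp ht hp (d := d) w
  obtain ⟨⟨a1, a2⟩, -, -⟩ := tube_relations_smul ht hp h0 w
  have := frame_expand_smul hu (ht.norm_x d) h0 hux p1 p2 (by rw [hJx]; exact p3) (du w)
  rw [q1, q2, hJx, q3, a1, a2] at this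
  rw [this]
  module

include ht hp in
theorem inner_daxis_de {v : R2} (h0 : 𝒟 (axis x e) d v ≠ 0) (w : R2) :
    ⟪𝒟 (axis x e) d v, 𝒟 e d w⟫ =
      -⟪cross (axis x e d) (𝒟 (axis x e) d v), 𝒟 x d w⟫ := by
  obtain ⟨hu, hux, hue, hJx, hJe⟩ := ht.axis_facts d
  obtain ⟨p1, p2, p3⟩ := daxis_perp ht hp (d := d) v
  have h := daxis_expand ht hp h0 w
  have h1 := inner_cross_of_smul h0 p1 hux h
  rw [ht.de_eq, inner_add_right, h1, add_zero, real_inner_comm, inner_cross_swap',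
    real_inner_comm]
end

variable {L : Type*} [TopologicalSpace L] [ChartedSpace (Rn 3) L] [IsManifold (𝓡 3) ∞ L]
  {ι : L → ImO} {x e : R2 → ImO} {j : R2 × ℝ → L}

namespace RuledChart
variable (hl : IsLagrangian ι) (hι : IsImmersedInS6 (n := 3) ι) (hc : RuledChart ι x e j)
include hc in
/-- If the axis moves in a fixed associative 3-plane over `O`, then the circles lie in a
4-dimensional subspace. -/
theorem exists_submodule {σ : R2 → ImO} (hσs : Smooth σ) {O : Set R2} (hO : IsOpen O)
    (h0 : ∀ d ∈ O, σ d ≠ 0) (hσ : ∀ d ∈ O, ⟪axis x e d, σ d⟫ = 0 ∧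
      ⟪σ d, x d⟫ = 0 ∧ ⟪σ d, e d⟫ = 0)
    (hdu : ∀ d ∈ O, ∀ v, ∃ a b c : ℝ, 𝒟 (axis x e) d v =
      a • axis x e d + b • σ d + c • cross (axis x e d) (σ d))
    (hdσ : ∀ d ∈ O, ∀ v, ∃ a b c : ℝ, 𝒟 σ d v =
      a • axis x e d + b • σ d + c • cross (axis x e d) (σ d)) {d : R2} (hd : d ∈ O) :
    ∃ r > 0, ∃ P : Submodule ℝ ImO, Module.finrank ℝ P = 4 ∧
      ∀ z, x (ub d r z) ∈ P ∧ e (ub d r z) ∈ P := by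
  have ht := hc.isTube
  obtain ⟨r, hr, hrO⟩ := Metric.isOpen_iff.mp hO d hd
  have hφs : Smooth (ub d r) := smooth_ub d r
  have hφ : ∀ z, ub d r z ∈ O := fun z => hrO (ub_mem d hr z)
  have hcomp : ∀ {f : R2 → ImO}, Smooth f → ∀ z v,
      𝒟 (fun z => f (ub d r z)) z v = 𝒟 f (ub d r z) (𝒟 (ub d r) z v) := by
    intro f hf z v
    change 𝒟 (f ∘ ub d r) z v = _
    rw [fderiv_comp _ (hf.diff _) (hφs.diff _)]; rfl
  obtain ⟨P, hP, h⟩ := const_plane (u := fun z => axis x e (ub d r z))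
    (σ := fun z => σ (ub d r z)) (ht.smooth_axis.comp hφs) (hσs.comp hφs)
    (fun z => (ht.axis_facts _).1) (fun z => h0 _ (hφ z)) (fun z => (hσ _ (hφ z)).1)
    (fun z v => by rw [hcomp ht.smooth_axis]; exact hdu _ (hφ z) _)
    (fun z v => by rw [hcomp hσs]; exact hdσ _ (hφ z) _)
  refine ⟨r, hr, P, hP, fun z => ⟨?_, ?_⟩⟩
  · obtain ⟨-, h1, h2⟩ := hσ _ (hφ z)
    have hf := ht.axis_facts (ub d r z)
    refine h z _ hf.2.1 h1 ?_
    rw [inner_cross_swap', hf.2.2.2.1, real_inner_comm, h2, neg_zero]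
  · obtain ⟨-, h1, h2⟩ := hσ _ (hφ z)
    have hf := ht.axis_facts (ub d r z)
    refine h z _ hf.2.2.1 h2 ?_
    rw [inner_cross_swap', hf.2.2.2.2, inner_neg_left, real_inner_comm, h1]; simp

include hl hι hc
theorem isPiece_of_submodule {P : Submodule ℝ ImO} (hP : Module.finrank ℝ P = 4) {d : R2} {r : ℝ}
    (hr : 0 < r) (h : ∀ z, x (ub d r z) ∈ P ∧ e (ub d r z) ∈ P) (t : ℝ) :
    ∃ V, IsPiece ι IsL3 V ∧ j (d, t) ∈ V := by
  obtain ⟨V, hV, hm⟩ := (hc.restrict d hr).isPiece_of_sphere hl hι hP (fun z => (h z).1)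
    (fun z => (h z).2) (0, t)
  exact ⟨V, hV, by simpa [ub_zero] using hm⟩

/-- The axis moves in a fixed associative 3-plane, which also contains the values of its second
derivative. -/
theorem isPiece_of_second {v₀ : R2} {O : Set R2} (hO : IsOpen O)
    (h0 : ∀ d ∈ O, 𝒟 (axis x e) d v₀ ≠ 0)
    (hdσ : ∀ d ∈ O, ∀ v, ∃ a b c : ℝ, 𝒟 (fun d => 𝒟 (axis x e) d v₀) d v =
      a • axis x e d + b • 𝒟 (axis x e) d v₀ +
        c • cross (axis x e d) (𝒟 (axis x e) d v₀)) {d : R2} (hd : d ∈ O) (t : ℝ) :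
    ∃ V, IsPiece ι IsL3 V ∧ j (d, t) ∈ V := by
  have ht := hc.isTube
  have hp := hc.patch hl hι
  obtain ⟨r, hr, P, hP, h⟩ := hc.exists_submodule (contDiff_fderiv_apply ht.smooth_axis v₀) hO h0
    (fun d _ => ⟨(daxis_perp ht hp v₀).1, inner_eq_zero_symm.1 (daxis_perp ht hp v₀).2.1,
      inner_eq_zero_symm.1 (daxis_perp ht hp v₀).2.2⟩) (fun d hd v => by
      have h := daxis_expand ht hp (h0 _ hd) v
      have hs : ⟪𝒟 (axis x e) d v₀, 𝒟 (axis x e) d v₀⟫ ≠ 0 :=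
        inner_self_ne_zero.mpr (h0 _ hd)
      rw [← eq_inv_smul_iff₀ hs] at h
      rw [h]
      exact ⟨0, _, _, by rw [zero_smul, zero_add, smul_add, smul_smul, smul_smul]⟩) hdσ hd
  exact hc.isPiece_of_submodule hl hι hP hr h t

/-- The axis traces a curve. -/
theorem isPiece_of_rank_one {v₀ : R2} {O : Set R2} (hO : IsOpen O)
    (h0 : ∀ d ∈ O, 𝒟 (axis x e) d v₀ ≠ 0)
    (h1 : ∀ d ∈ O, ∃ w ≠ 0, 𝒟 (axis x e) d w = 0) {d₀ : R2} (hd₀ : d₀ ∈ O) (t : ℝ) :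
    ∃ V, IsPiece ι IsL3 V ∧ j (d₀, t) ∈ V := by
  have ht := hc.isTube
  have hp := hc.patch hl hι
  set σ : R2 → ImO := fun d => 𝒟 (axis x e) d v₀ with hσ
  have hσs : Smooth σ := contDiff_fderiv_apply ht.smooth_axis v₀
  have hσd : Differentiable ℝ σ := hσs.diff
  have hs : ∀ d ∈ O, ⟪σ d, σ d⟫ ≠ 0 := fun d hd =>
    inner_self_ne_zero.mpr (h0 d hd)
  -- `σ` and `J σ` are orthogonal to `dx`
  have hβ : ∀ d ∈ O, ∀ v, ⟪σ d, 𝒟 x d v⟫ = 0 ∧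
      ⟪cross (axis x e d) (σ d), 𝒟 x d v⟫ = 0 ∧
      ⟪σ d, 𝒟 e d v⟫ = 0 := by
    intro d hd
    obtain ⟨w, hw, hdw⟩ := h1 d hd
    obtain ⟨hu, hux, hue, hJx, hJe⟩ := ht.axis_facts d
    obtain ⟨p1, p2, p3⟩ := daxis_perp ht hp (d := d) v₀
    obtain ⟨-, ⟨b1, b2⟩, c1, c2⟩ := tube_relations_smul ht hp (h0 d hd) w
    simp only [hdw, inner_zero_right, mul_zero, add_zero, sub_zero] at b1 b2
    have b1' := (mul_eq_zero.mp b1.symm).resolve_left (hs d hd)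
    have b2' := (mul_eq_zero.mp b2.symm).resolve_left (hs d hd)
    rw [b1', b2'] at c1 c2
    simp only [mul_zero, add_zero, sub_zero] at c1 c2
    have hv0 : ⟪σ d, 𝒟 x d v₀⟫ = 0 ∧
        ⟪cross (axis x e d) (σ d), 𝒟 x d v₀⟫ = 0 := by
      by_contra hne
      set A : ℝ := ⟪σ d, 𝒟 x d v₀⟫
      set B : ℝ := ⟪cross (axis x e d) (σ d), 𝒟 x d v₀⟫
      have hAB : A * A + B * B ≠ 0 := fun h => hne
        ⟨by nlinarith [mul_self_nonneg A, mul_self_nonneg B],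
          by nlinarith [mul_self_nonneg A, mul_self_nonneg B]⟩
      have z1 : ⟪cross (x d) (σ d), 𝒟 x d w⟫ = 0 := by
        apply mul_left_cancel₀ hAB
        linear_combination A * c1 + B * c2
      have z2 : ⟪cross (axis x e d) (cross (x d) (σ d)), 𝒟 x d w⟫ = 0 := by
        apply mul_left_cancel₀ hAB
        linear_combination A * c2 - B * c1
      have := frame_expand_smul hu (ht.norm_x d) (h0 d hd) hux p1 p2 (by rw [hJx]; exact p3)
        (𝒟 x d w)
      rw [z1, z2, b1', b2', (axis_perp ht hp w).1,
        inner_fderiv_self (ht.diff_x d) (.of_forall ht.norm_x) w, hJx, ← smul_add] at this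
      simp only [zero_smul, zero_add, add_zero] at this
      exact ht.good_ne (hc.good d) hw _ (smul_right_injective _ (hs d hd) this)
    have key : ∀ v, ⟪σ d, 𝒟 x d v⟫ = 0 ∧
      ⟪cross (axis x e d) (σ d), 𝒟 x d v⟫ = 0 := by
      intro v
      obtain ⟨-, ⟨b1, b2⟩, -⟩ := tube_relations_smul ht hp (h0 d hd) v
      rw [hv0.1, hv0.2] at b1 b2
      simp only [zero_mul, add_zero, sub_zero] at b1 b2
      exact ⟨(mul_eq_zero.mp b1.symm).resolve_left (hs d hd),
        (mul_eq_zero.mp b2.symm).resolve_left (hs d hd)⟩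
    exact fun v => ⟨(key v).1, (key v).2, by
      rw [inner_daxis_de ht hp (h0 d hd), (key v).2, neg_zero]⟩
  -- symmetry of `⟨dσ, dx⟩` and `⟨dσ, de⟩`
  have hsym : ∀ {f : R2 → ImO}, Smooth f →
      (∀ d ∈ O, ∀ v, ⟪σ d, 𝒟 f d v⟫ = 0) → ∀ d ∈ O, ∀ a b, ⟪𝒟 σ d a, 𝒟 f d b⟫ =
        ⟪𝒟 σ d b, 𝒟 f d a⟫ := by
    intro f hf h d hd a b
    have s1 := inner_fderiv_add (hσd d) ((contDiff_fderiv_apply hf b).diff d)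
      (by filter_upwards [hO.mem_nhds hd] with d hd using h d hd b) a
    have s2 := inner_fderiv_add (hσd d) ((contDiff_fderiv_apply hf a).diff d)
      (by filter_upwards [hO.mem_nhds hd] with d hd using h d hd a) b
    rw [fderiv_fderiv_symm hf.contDiffAt a b] at s2
    linarith
  refine hc.isPiece_of_second hl hι hO h0 (fun d hd v => ?_) hd₀ t
  obtain ⟨w, hw, hdw⟩ := h1 d hd
  obtain ⟨hu, hux, hue, hJx, hJe⟩ := ht.axis_facts d
  obtain ⟨p1, p2, p3⟩ := daxis_perp ht hp (d := d) v₀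
  -- `dσ w` is a multiple of `σ`
  have hrank : ∀ d' ∈ O, ⟪σ d', σ d'⟫ • 𝒟 (axis x e) d' w =
      ⟪𝒟 (axis x e) d' w, σ d'⟫ • σ d' := by
    intro d' hd'
    obtain ⟨w', hw', hdw'⟩ := h1 d' hd'
    have hli : ∃ a b : ℝ, w = a • w' + b • v₀ := by
      have hb : LinearIndependent ℝ ![w', v₀] := by
        rw [LinearIndependent.pair_iff]
        intro s t hst
        have h2 := congrArg (𝒟 (axis x e) d') hst
        simp only [map_add, map_smul, hdw', smul_zero, zero_add, map_zero] at h2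
        have h3 : t = 0 := (smul_eq_zero.mp h2).resolve_right (h0 d' hd')
        subst h3
        rw [zero_smul, add_zero] at hst
        exact ⟨(smul_eq_zero.mp hst).resolve_right hw', rfl⟩
      have hsp := hb.span_eq_top_of_card_eq_finrank (by simp)
      have hmem : w ∈ Submodule.span ℝ (range ![w', v₀]) := hsp ▸ Submodule.mem_top
      simp only [Matrix.range_cons, Matrix.range_empty, union_empty] at hmem
      obtain ⟨a, b, h⟩ := Submodule.mem_span_pair.mp hmem
      exact ⟨a, b, h.symm⟩
    obtain ⟨a, b, rfl⟩ := hli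
    simp only [map_add, map_smul, hdw', smul_zero, zero_add, inner_smul_left, conj_trivial]
    rw [show 𝒟 (axis x e) d' v₀ = σ d' from rfl]
    module
  have hdσw : ∃ c : ℝ, 𝒟 σ d w = c • σ d := by
    have hD : Differentiable ℝ (fun d => 𝒟 (axis x e) d w) :=
      (contDiff_fderiv_apply ht.smooth_axis w).diff
    have e1 := congrArg (fun F => F v₀) (EventuallyEq.fderiv_eq (𝕜 := ℝ) (x := d)
      (show (fun d' => ⟪σ d', σ d'⟫ • 𝒟 (axis x e) d' w) =ᶠ[𝓝 d] fun d' =>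
        ⟪𝒟 (axis x e) d' w, σ d'⟫ • σ d' by
        filter_upwards [hO.mem_nhds hd] with d' hd' using hrank d' hd'))
    beta_reduce at e1
    rw [fderiv_fun_smul ((hσd d).inner ℝ (hσd d)) (hD d),
      fderiv_fun_smul ((hD d).inner ℝ (hσd d)) (hσd d)] at e1
    simp only [add_apply, smul_apply, ContinuousLinearMap.smulRight_apply, hdw, smul_zero,
      add_zero, inner_zero_left, zero_smul, zero_add] at e1
    rw [fderiv_fderiv_symm ht.smooth_axis.contDiffAt] at e1
    exact ⟨_, ((eq_inv_smul_iff₀ (hs d hd)).mpr e1).trans (smul_smul _ _ _)⟩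
  obtain ⟨c, hcw⟩ := hdσw
  have k1 : ⟪𝒟 σ d v, 𝒟 x d w⟫ = 0 := by
    rw [hsym ht.smooth_x (fun d hd v => (hβ d hd v).1) d hd, hcw, inner_smul_left, (hβ d hd v).1, mul_zero]
  have k2 : ⟪𝒟 σ d v, 𝒟 e d w⟫ = 0 := by
    rw [hsym ht.smooth_e (fun d hd v => (hβ d hd v).2.2) d hd, hcw, inner_smul_left, (hβ d hd v).2.2, mul_zero]
  have k3 : ⟪x d, 𝒟 σ d v⟫ = 0 := by
    have := inner_fderiv_add (ht.diff_x d) (hσd d)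
      (.of_forall fun d => (daxis_perp ht hp (d := d) v₀).2.1) v
    rw [real_inner_comm, (hβ d hd v).1, zero_add] at this
    exact this
  have k4 : ⟪e d, 𝒟 σ d v⟫ = 0 := by
    have := inner_fderiv_add (ht.diff_e d) (hσd d)
      (.of_forall fun d => (daxis_perp ht hp (d := d) v₀).2.2) v
    rw [real_inner_comm, (hβ d hd v).2.2, zero_add] at this
    exact this
  have hew : 𝒟 e d w = cross (axis x e d) (𝒟 x d w) := by
    rw [ht.de_eq, hdw, cross_zero_left, add_zero]
  rw [hew] at k2
  exact exists_associative hu (ht.norm_x d) (h0 d hd) hux p1 p2 (by rw [hJx]; exact p3)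
    (axis_perp ht hp w).1 (inner_fderiv_self (ht.diff_x d) (.of_forall ht.norm_x) w) (hβ d hd w).1
    (hβ d hd w).2.1 (fun c => by rw [hJx]; exact ht.good_ne (hc.good d) hw c) k3
    (by rw [hJx]; exact k4) k1 k2

end RuledChart

end

/-! ### The holomorphicity condition -/

/-- The component of `dx` in the second factor of the normal bundle of the axis is antilinear with
respect to the complex structure induced by the axis. -/
def AntiHol (x e : R2 → ImO) (v d : R2) : Prop :=
  ∀ w, let u := axis x e d
    let dx := 𝒟 x d
    let du := 𝒟 (axis x e) d
    let σ := du v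
    let y := cross (x d) σ
    ⟪σ, σ⟫ * ⟪y, dx w⟫ =
      ⟪y, dx v⟫ * ⟪σ, du w⟫ + ⟪cross u y, dx v⟫ * ⟪cross u σ, du w⟫ ∧
    ⟪σ, σ⟫ * ⟪cross u y, dx w⟫ =
      ⟪cross u y, dx v⟫ * ⟪σ, du w⟫ - ⟪y, dx v⟫ * ⟪cross u σ, du w⟫

/-- The derivatives of `du v` at `d` lie in the span of `u` and the tangent plane. -/
def SecondFlat (x e : R2 → ImO) (v d : R2) : Prop :=
  ∀ w, ∃ a b c : ℝ, 𝒟 (fun d => 𝒟 (axis x e) d v) d w =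
    a • axis x e d + b • 𝒟 (axis x e) d v + c • cross (axis x e d) (𝒟 (axis x e) d v)

section
variable {x e : R2 → ImO} (ht : IsTube x e) (hp : IsLagPatch (tube x e)) {d : R2}

include ht hp in
theorem antiHol_of_ne {v : R2} (h0 : 𝒟 (axis x e) d v ≠ 0)
    (hβ : ¬ (⟪𝒟 (axis x e) d v, 𝒟 x d v⟫ = 0 ∧
      ⟪cross (axis x e d) (𝒟 (axis x e) d v), 𝒟 x d v⟫ = 0)) :
    AntiHol x e v d := by
  intro w u dx du σ y
  obtain ⟨-, ⟨b1, b2⟩, c1, c2⟩ := tube_relations_smul ht hp h0 w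
  set A : ℝ := ⟪𝒟 (axis x e) d v, 𝒟 x d v⟫
  set B : ℝ := ⟪cross (axis x e d) (𝒟 (axis x e) d v), 𝒟 x d v⟫
  have hAB : A * A + B * B ≠ 0 := fun h => hβ
    ⟨by nlinarith [mul_self_nonneg A, mul_self_nonneg B],
      by nlinarith [mul_self_nonneg A, mul_self_nonneg B]⟩
  set s : ℝ := ⟪σ, σ⟫
  set Yv : ℝ := ⟪y, dx v⟫
  set Zv : ℝ := ⟪cross u y, dx v⟫
  constructor
  · apply mul_left_cancel₀ hAB
    linear_combination s * A * c1 + s * B * c2 - (A * Yv + B * Zv) * b1 + (A * Zv - B * Yv) * b2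
  · apply mul_left_cancel₀ hAB
    linear_combination s * A * c2 - s * B * c1 - (A * Zv - B * Yv) * b1 - (A * Yv + B * Zv) * b2

include ht hp in
theorem exists_daxis_J (hi : Injective (𝒟 (axis x e) d)) (v : R2) :
    ∃ w, 𝒟 (axis x e) d w = cross (axis x e d) (𝒟 (axis x e) d v) := by
  by_cases hv : v = 0
  · exact ⟨0, by simp [hv, cross_zero_right]⟩
  have h0 : 𝒟 (axis x e) d v ≠ 0 := fun h => hv (hi (h.trans (map_zero _).symm))
  have hs : ⟪𝒟 (axis x e) d v, 𝒟 (axis x e) d v⟫ ≠ 0 :=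
    inner_self_ne_zero.mpr h0
  obtain ⟨w, hw⟩ : ∃ w : R2, w ∉ Submodule.span ℝ {v} := by
    by_contra! h
    have h1 : Submodule.span ℝ {v} = ⊤ := Submodule.eq_top_iff'.mpr h
    have h2 := finrank_span_singleton (K := ℝ) hv
    rw [h1, finrank_top] at h2
    simp at h2
  have h := daxis_expand ht hp h0 w
  set b : ℝ := ⟪cross (axis x e d) (𝒟 (axis x e) d v), 𝒟 (axis x e) d w⟫
  set a : ℝ := ⟪𝒟 (axis x e) d v, 𝒟 (axis x e) d w⟫
  set s : ℝ := ⟪𝒟 (axis x e) d v, 𝒟 (axis x e) d v⟫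
  have hb : b ≠ 0 := by
    intro hb
    apply hw
    have h1 : s • w = a • v := hi (by
      rw [map_smul, map_smul]
      have h' := h
      simp only at h'
      rw [h', show ⟪cross (axis x e d) (𝒟 (axis x e) d v), 𝒟 (axis x e) d w⟫ =
        (0 : ℝ) from hb, zero_smul, add_zero])
    rw [← eq_inv_smul_iff₀ hs] at h1
    rw [h1, smul_smul]
    exact Submodule.smul_mem _ _ (Submodule.mem_span_singleton_self v)
  refine ⟨b⁻¹ • (s • w - a • v), ?_⟩
  rw [map_smul, map_sub, map_smul, map_smul, inv_smul_eq_iff₀ hb, sub_eq_iff_eq_add']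
  exact h

include ht hp in
/-- Complex linearity of the second fundamental form of the axis, in a fixed normal direction. -/
theorem inner_second_J {v w a : R2} {ν : R2 → ImO} (hν : Smooth ν)
    (h1 : ∀ d w, ⟪ν d, 𝒟 (axis x e) d w⟫ = 0)
    (h2 : ∀ d w, ⟪ν d, cross (axis x e d) (𝒟 (axis x e) d w)⟫ = 0)
    (hu : ⟪axis x e d, ν d⟫ = 0)
    (h0 : 𝒟 (axis x e) d v ≠ 0)
    (hw : 𝒟 (axis x e) d w = cross (axis x e d) (𝒟 (axis x e) d v)) :
    ⟪ν d, (𝒟 (fun d => 𝒟 (axis x e) d w) d a)⟫ =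
      ⟪ν d, (cross (axis x e d) (𝒟 (fun d => 𝒟 (axis x e) d v) d a))⟫ := by
  have hν' : Differentiable ℝ ν := hν.diff
  have hD : ∀ w, Differentiable ℝ (fun d => 𝒟 (axis x e) d w) := fun w =>
    (contDiff_fderiv_apply ht.smooth_axis w).diff
  have hX : Smooth (fun d => cross (axis x e d) (𝒟 (axis x e) d v)) :=
    ht.smooth_axis.cross (contDiff_fderiv_apply ht.smooth_axis v)
  have e1 := inner_fderiv_add (hν' d) (hD w d) (.of_forall fun d => h1 d w) a
  have e2 := inner_fderiv_add (hν' d) (hX.diff d)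
    (.of_forall fun d => h2 d v) a
  rw [fderiv_cross (ht.diff_axis d) (hD v d), inner_add_right] at e2
  rw [hw] at e1
  have e3 : ⟪ν d, cross (𝒟 (axis x e) d a) (𝒟 (axis x e) d v)⟫ = 0 := by
    have hs : ⟪𝒟 (axis x e) d v, 𝒟 (axis x e) d v⟫ ≠ 0 :=
      inner_self_ne_zero.mpr h0
    obtain ⟨p1, p2, p3⟩ := daxis_perp ht hp (d := d) v
    have h := daxis_expand ht hp h0 a
    simp only at h
    apply mul_left_cancel₀ hs
    rw [mul_zero, ← inner_smul_right, ← cross_smul_left, h]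
    simp only [cross_add_left, cross_smul_left, cross_self, smul_zero, zero_add]
    rw [cross_anticomm (cross _ _), cross_anticomm (axis x e d), cross_neg_right, cross_cross_self,
      real_inner_comm (axis x e d), p1]
    simp only [neg_neg, zero_smul, zero_sub, smul_neg, inner_neg_right, inner_smul_right]
    rw [real_inner_comm (axis x e d), hu]; simp
  rw [e3, zero_add] at e2
  linarith

include ht hp in
theorem inner_cross_daxis (d v w : R2) :
    ⟪cross (x d) (𝒟 (axis x e) d v), 𝒟 (axis x e) d w⟫ = 0 ∧
    ⟪cross (x d) (𝒟 (axis x e) d v),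
      cross (axis x e d) (𝒟 (axis x e) d w)⟫ = 0 := by
  by_cases h0 : 𝒟 (axis x e) d v = 0
  · simp [h0, cross_zero_right]
  obtain ⟨⟨h1, h2⟩, -⟩ := tube_relations_smul ht hp h0 w
  refine ⟨h1, ?_⟩
  rw [real_inner_comm, inner_cross_swap', h2, neg_zero]

include ht hp in
theorem antiHol_of_zero {v : R2} (hv : v ≠ 0)
    (hi : ∀ d, Injective (𝒟 (axis x e) d))
    (hβ : ∀ᶠ d in 𝓝 d, ⟪𝒟 (axis x e) d v, 𝒟 x d v⟫ = 0 ∧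
      ⟪cross (axis x e d) (𝒟 (axis x e) d v), 𝒟 x d v⟫ = 0)
    (hnf : ¬ SecondFlat x e v d) : AntiHol x e v d := by
  have h0 : ∀ d, 𝒟 (axis x e) d v ≠ 0 := fun d h => hv (hi d (h.trans (map_zero _).symm))
  have hs : ∀ d, ⟪𝒟 (axis x e) d v, 𝒟 (axis x e) d v⟫ ≠ 0 :=
    fun d => inner_self_ne_zero.mpr (h0 d)
  have hD : ∀ w, Differentiable ℝ (fun d => 𝒟 (axis x e) d w) := fun w =>
    (contDiff_fderiv_apply ht.smooth_axis w).diff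
  obtain ⟨w, hw⟩ := exists_daxis_J ht hp (hi d) v
  obtain ⟨hu, hux, hue, hJx, hJe⟩ := ht.axis_facts d
  obtain ⟨p1, p2, p3⟩ := daxis_perp ht hp (d := d) v
  have hex := frame_expand_smul hu (ht.norm_x d) (h0 d) hux p1 p2 (by rw [hJx]; exact p3)
  -- `du` is orthogonal to `dx` and `de`
  have hβ' : ∀ᶠ d in 𝓝 d, ∀ a b, ⟪𝒟 x d a, 𝒟 (axis x e) d b⟫ = 0 ∧
      ⟪𝒟 e d a, 𝒟 (axis x e) d b⟫ = 0 := by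
    filter_upwards [hβ] with d hβ
    have key : ∀ a, ⟪𝒟 (axis x e) d v, 𝒟 x d a⟫ = 0 ∧
      ⟪cross (axis x e d) (𝒟 (axis x e) d v), 𝒟 x d a⟫ = 0 := by
      intro a
      obtain ⟨-, ⟨b1, b2⟩, -⟩ := tube_relations_smul ht hp (h0 d) a
      rw [hβ.1, hβ.2] at b1 b2
      simp only [zero_mul, add_zero, sub_zero] at b1 b2
      exact ⟨(mul_eq_zero.mp b1.symm).resolve_left (hs d),
        (mul_eq_zero.mp b2.symm).resolve_left (hs d)⟩
    have hx : ∀ a b, ⟪𝒟 x d a, 𝒟 (axis x e) d b⟫ = 0 ∧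
        ⟪𝒟 x d a, cross (axis x e d) (𝒟 (axis x e) d b)⟫ = 0 := by
      intro a b
      have h := daxis_expand ht hp (h0 d) b
      simp only at h
      obtain ⟨k1, k2⟩ := key a
      rw [real_inner_comm] at k1 k2
      constructor
      · apply mul_left_cancel₀ (hs d)
        rw [mul_zero, ← inner_smul_right, h, inner_add_right, inner_smul_right, inner_smul_right,
          k1, k2]; simp
      · apply mul_left_cancel₀ (hs d)
        rw [mul_zero, ← inner_smul_right, ← cross_smul_right, h, cross_add_right, cross_smul_right,
          cross_smul_right, cross_cross_self, (daxis_perp ht hp (d := d) v).1, inner_add_right,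
          inner_smul_right, inner_smul_right, k2, inner_sub_right, inner_smul_right,
          inner_smul_right, k1]; simp
    refine fun a b => ⟨(hx a b).1, ?_⟩
    by_cases hb : 𝒟 (axis x e) d b = 0
    · simp [hb]
    · rw [real_inner_comm, inner_daxis_de ht hp hb, real_inner_comm, (hx a b).2, neg_zero]
  have hβd := hβ'.self_of_nhds
  have hxD : ∀ a b, ⟪x d, (𝒟 (fun d => 𝒟 (axis x e) d b) d a)⟫ = 0 := by
    intro a b
    have := inner_fderiv_add (ht.diff_x d) (hD b d)
      (.of_forall fun d => (daxis_perp ht hp (d := d) b).2.1) a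
    rwa [(hβd a b).1, zero_add] at this
  have heD : ∀ a b, ⟪e d, (𝒟 (fun d => 𝒟 (axis x e) d b) d a)⟫ = 0 := by
    intro a b
    have := inner_fderiv_add (ht.diff_e d) (hD b d)
      (.of_forall fun d => (daxis_perp ht hp (d := d) b).2.2) a
    rwa [(hβd a b).2, zero_add] at this
  have hS : ∀ a b c, ⟪𝒟 x d a, (𝒟 (fun d => 𝒟 (axis x e) d c) d b)⟫ =
      ⟪𝒟 x d b, (𝒟 (fun d => 𝒟 (axis x e) d c) d a)⟫ := by
    intro a b c
    have s1 := inner_fderiv_add ((contDiff_fderiv_apply ht.smooth_x a).diff d)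
      (hD c d) (by filter_upwards [hβ'] with d h using (h a c).1) b
    have s2 := inner_fderiv_add ((contDiff_fderiv_apply ht.smooth_x b).diff d)
      (hD c d) (by filter_upwards [hβ'] with d h using (h b c).1) a
    rw [fderiv_fderiv_symm ht.smooth_x.contDiffAt a b] at s1
    linarith
  -- the second fundamental form
  have hJ2 : ∀ a, ⟪cross (x d) (𝒟 (axis x e) d v),
      (𝒟 (fun d => 𝒟 (axis x e) d w) d a)⟫ =
      ⟪cross (x d) (𝒟 (axis x e) d v),
        (cross (axis x e d) (𝒟 (fun d => 𝒟 (axis x e) d v) d a))⟫ := fun a =>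
    inner_second_J ht hp (ν := fun d => cross (x d) (𝒟 (axis x e) d v))
      (ht.smooth_x.cross (contDiff_fderiv_apply ht.smooth_axis v))
      (fun d w => (inner_cross_daxis ht hp d v w).1) (fun d w => (inner_cross_daxis ht hp d v w).2)
      (by rw [real_inner_comm, ← inner_cross_cyclic, hJx, p3]) (h0 d) hw
  have hJ3 : ∀ a, ⟪cross (axis x e d) (cross (x d) (𝒟 (axis x e) d v)),
      (𝒟 (fun d => 𝒟 (axis x e) d w) d a)⟫ =
      ⟪cross (axis x e d) (cross (x d) (𝒟 (axis x e) d v)),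
        (cross (axis x e d) (𝒟 (fun d => 𝒟 (axis x e) d v) d a))⟫ := fun a =>
    inner_second_J ht hp (ν := fun d => cross (axis x e d) (cross (x d) (𝒟 (axis x e) d v)))
      (ContDiff.cross ht.smooth_axis
        (ht.smooth_x.cross (contDiff_fderiv_apply ht.smooth_axis v)))
      (fun d w => by
        rw [inner_cross_swap', real_inner_comm, (inner_cross_daxis ht hp d v w).2, neg_zero])
      (fun d w => by
        rw [inner_cross_cross, (inner_cross_daxis ht hp d v w).1, (daxis_perp ht hp (d := d) w).1]
        ring)
      (inner_self_cross_left _ _) (h0 d) hw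
  have huu : ⟪axis x e d, axis x e d⟫ = 1 := inner_self_of_norm_one hu
  have huy : ⟪axis x e d, cross (x d) (𝒟 (axis x e) d v)⟫ = 0 := by
    rw [real_inner_comm, ← inner_cross_cyclic, hJx, p3]
  have hspan : ∀ a, ⟪𝒟 (axis x e) d v, 𝒟 (axis x e) d v⟫ • a =
      ⟪𝒟 (axis x e) d v, 𝒟 (axis x e) d a⟫ • v +
      ⟪cross (axis x e d) (𝒟 (axis x e) d v), 𝒟 (axis x e) d a⟫ • w :=
    fun a => hi d (by rw [map_add, map_smul, map_smul, map_smul, hw]; exact daxis_expand ht hp (h0 d) a)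
  have hsymm : 𝒟 (fun d => 𝒟 (axis x e) d v) d w =
      𝒟 (fun d => 𝒟 (axis x e) d w) d v :=
    fderiv_fderiv_symm ht.smooth_axis.contDiffAt _ _
  set Dv := 𝒟 (fun d => 𝒟 (axis x e) d v) d
  set Dw := 𝒟 (fun d => 𝒟 (axis x e) d w) d
  set s : ℝ := ⟪𝒟 (axis x e) d v, 𝒟 (axis x e) d v⟫
  have hsd : s ≠ 0 := hs d
  set y := cross (x d) (𝒟 (axis x e) d v) with hy
  have hJ2' : ∀ a, ⟪y, Dw a⟫ = -⟪cross (axis x e d) y, Dv a⟫ := fun a => by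
    rw [hJ2, real_inner_comm (cross (axis x e d) (Dv a)), inner_cross_swap' (axis x e d) (Dv a)]
  have hJ3' : ∀ a, ⟪cross (axis x e d) y, Dw a⟫ = ⟪y, Dv a⟫ := fun a => by
    rw [hJ3, inner_cross_cross, huu, huy]; ring
  have hXD : ∀ a D, ⟪x d, D⟫ = 0 → ⟪e d, D⟫ = 0 →
      s * ⟪𝒟 x d a, D⟫ = ⟪y, D⟫ * ⟪y, 𝒟 x d a⟫ +
        ⟪cross (axis x e d) y, D⟫ * ⟪cross (axis x e d) y, 𝒟 x d a⟫ := by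
    intro a D h1 h2
    have h3 := congrArg (inner ℝ (𝒟 x d a)) (hex D)
    have k1 := (hβd a v).1
    have k2 := (hβd a w).1
    have k3 := (axis_perp ht hp (d := d) a).1
    rw [real_inner_comm] at k3
    rw [hw] at k2
    rw [hJx, h1, h2] at h3
    simp only [inner_add_right, inner_smul_right, k1, k2, k3] at h3
    rw [real_inner_comm y, real_inner_comm (cross (axis x e d) y)] at h3
    linear_combination h3
  have hPQ : ¬ (⟪y, Dv v⟫ = 0 ∧ ⟪cross (axis x e d) y, Dv v⟫ = 0) := by
    rintro ⟨hP, hQ⟩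
    refine hnf fun a => ?_
    have k1 : ⟪y, Dv a⟫ = 0 := by
      apply mul_left_cancel₀ hsd
      rw [mul_zero, ← inner_smul_right, ← map_smul, hspan, map_add, map_smul, map_smul, hsymm,
        inner_add_right, inner_smul_right, inner_smul_right, hJ2', hP, hQ]; simp
    have k2 : ⟪cross (axis x e d) y, Dv a⟫ = 0 := by
      apply mul_left_cancel₀ hsd
      rw [mul_zero, ← inner_smul_right, ← map_smul, hspan, map_add, map_smul, map_smul, hsymm,
        inner_add_right, inner_smul_right, inner_smul_right, hJ3', hP, hQ]; simp
    have h := hex (Dv a)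
    rw [hxD, hJx, heD, k1, k2] at h
    simp only [zero_smul, add_zero] at h
    refine ⟨⟪axis x e d, Dv a⟫, s⁻¹ * ⟪𝒟 (axis x e) d v, Dv a⟫,
      s⁻¹ * ⟪cross (axis x e d) (𝒟 (axis x e) d v), Dv a⟫, ?_⟩
    refine ((eq_inv_smul_iff₀ hsd).mpr h).trans ?_
    rw [smul_add, inv_smul_smul₀ hsd, mul_smul, mul_smul, add_assoc, ← smul_add]
  have s1 := congrArg (s * ·) (hS v w v)
  have s2 := congrArg (s * ·) (hS v w w)
  simp only [hXD _ _ (hxD _ _) (heD _ _)] at s1 s2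
  change ⟪y, Dv w⟫ * _ + ⟪_, Dv w⟫ * _ = ⟪y, Dv v⟫ * _ + ⟪_, Dv v⟫ * _
    at s1
  change ⟪y, Dw w⟫ * _ + ⟪_, Dw w⟫ * _ = ⟪y, Dw v⟫ * _ + ⟪_, Dw v⟫ * _
    at s2
  rw [hJ2', hJ3', hJ2', hJ3', hsymm, hJ2', hJ3'] at s2
  rw [hsymm, hJ2', hJ3'] at s1
  set P : ℝ := ⟪y, Dv v⟫
  set Q : ℝ := ⟪cross (axis x e d) y, Dv v⟫
  have hne : P * P + Q * Q ≠ 0 := fun h => hPQ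
    ⟨by nlinarith [mul_self_nonneg P, mul_self_nonneg Q],
      by nlinarith [mul_self_nonneg P, mul_self_nonneg Q]⟩
  have r1 : ⟪y, 𝒟 x d w⟫ = ⟪cross (axis x e d) y, 𝒟 x d v⟫ := by
    apply mul_left_cancel₀ hne
    linear_combination -P * s1 + Q * s2
  have r2 : ⟪cross (axis x e d) y, 𝒟 x d w⟫ = -⟪y, 𝒟 x d v⟫ := by
    apply mul_left_cancel₀ hne
    linear_combination -Q * s1 - P * s2
  intro a
  have h := congrArg (𝒟 x d) (hspan a)
  rw [map_add, map_smul, map_smul, map_smul] at h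
  have h1 := congrArg (inner ℝ y) h
  have h2 := congrArg (inner ℝ (cross (axis x e d) y)) h
  rw [inner_add_right, inner_smul_right, inner_smul_right, inner_smul_right, r1] at h1
  rw [inner_add_right, inner_smul_right, inner_smul_right, inner_smul_right, r2] at h2
  exact ⟨by linear_combination h1, by linear_combination h2⟩

include ht in
theorem isClosed_antiHol (v : R2) : IsClosed {d | AntiHol x e v d} := by
  have hu := ht.smooth_axis
  have hx : ∀ w, Smooth (fun d => 𝒟 x d w) := contDiff_fderiv_apply ht.smooth_x
  have hdu : ∀ w, Smooth (fun d => 𝒟 (axis x e) d w) := contDiff_fderiv_apply hu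
  have hy : Smooth (fun d => cross (x d) (𝒟 (axis x e) d v)) :=
    ht.smooth_x.cross (hdu v)
  have hJy := hu.cross hy
  have hJ := hu.cross (hdu v)
  have hin : ∀ {f g : R2 → ImO}, Smooth f → Smooth g →
      Continuous fun d => ⟪f d, g d⟫ := fun hf hg => (hf.inner ℝ hg).continuous
  simp only [AntiHol, ofPred_forall, ofPred_and]
  refine isClosed_iInter fun w => IsClosed.inter (isClosed_eq ?_ ?_) (isClosed_eq ?_ ?_)
  · exact (hin (hdu v) (hdu v)).mul (hin hy (hx w))
  · exact ((hin hy (hx v)).mul (hin (hdu v) (hdu w))).add ((hin hJy (hx v)).mul (hin hJ (hdu w)))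
  · exact (hin (hdu v) (hdu v)).mul (hin hJy (hx w))
  · exact ((hin hJy (hx v)).mul (hin (hdu v) (hdu w))).sub ((hin hy (hx v)).mul (hin hJ (hdu w)))

include ht hp in
theorem antiHol_of_dense {v : R2} (hv : v ≠ 0)
    (hi : ∀ d, Injective (𝒟 (axis x e) d))
    (hd : Dense {d | ¬ SecondFlat x e v d}) (d : R2) : AntiHol x e v d := by
  have h0 : ∀ d, 𝒟 (axis x e) d v ≠ 0 := fun d h => hv (hi d (h.trans (map_zero _).symm))
  suffices h : Dense {d | AntiHol x e v d} by
    have := (isClosed_antiHol ht v).closure_eq ▸ h d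
    exact this
  rw [dense_iff_inter_open]
  intro U hU hne
  by_cases h : ∃ d ∈ U, ¬ (⟪𝒟 (axis x e) d v, 𝒟 x d v⟫ = 0 ∧
      ⟪cross (axis x e d) (𝒟 (axis x e) d v), 𝒟 x d v⟫ = 0)
  · obtain ⟨d, hdU, h⟩ := h
    exact ⟨d, hdU, antiHol_of_ne ht hp (h0 d) h⟩
  · push Not at h
    obtain ⟨d, hdU, hd⟩ := hd.inter_open_nonempty U hU hne
    exact ⟨d, hdU, antiHol_of_zero ht hp hv hi
      (by filter_upwards [hU.mem_nhds hdU] with d hd using h d hd) hd⟩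
end

/-! ### Complexification -/

section Complexification
variable (a b c d : ImO)

theorem toC_add : toC (a + b) = toC a + toC b := by ext i; simp [toC]
theorem toC_sub : toC (a - b) = toC a - toC b := by ext i; simp [toC]
theorem toC_neg : toC (-a) = -toC a := by ext i; simp [toC]
theorem toC_injective : Injective toC := fun a b h => by
  ext i
  have := congrFun h i
  simpa [toC] using this

theorem crossCoord_toC : crossCoord (toC a) (toC b) = toC (cross a b) := by
  ext i
  fin_cases i <;> simp [toC, cross_apply, crossCoord]

theorem dot_toC : toC a ⬝ᵥ toC b = (⟪a, b⟫ : ℂ) := by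
  simp [inner_eq_sum, toC, dotProduct, Fin.sum_univ_seven]

variable (z w t : ImOC) (k : ℂ)

theorem crossCoord_sub_left : crossCoord (z - w) t = crossCoord z t - crossCoord w t := by
  ext i; fin_cases i <;> simp [crossCoord] <;> ring
theorem crossCoord_sub_right : crossCoord t (z - w) = crossCoord t z - crossCoord t w := by
  ext i; fin_cases i <;> simp [crossCoord] <;> ring
theorem crossCoord_smul_left : crossCoord (k • z) t = k • crossCoord z t := by
  ext i; fin_cases i <;> simp [crossCoord] <;> ring
theorem crossCoord_smul_right : crossCoord t (k • z) = k • crossCoord t z := by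
  ext i; fin_cases i <;> simp [crossCoord] <;> ring

/-- The vector `(a - i b) / 2`. -/
def cz : ImOC := (1 / 2 : ℂ) • (toC a - Complex.I • toC b)

theorem cz_apply (i : Fin 7) : cz a b i = ⟨a i / 2, -(b i) / 2⟩ := by
  apply Complex.ext <;> simp [cz, toC] <;> ring

theorem cz_inj {a b c d : ImO} : cz a b = cz c d ↔ a = c ∧ b = d := by
  refine ⟨fun h => ⟨?_, ?_⟩, fun h => by rw [h.1, h.2]⟩
  · ext i
    have := congrArg Complex.re (congrFun h i)
    simp only [cz_apply] at this
    linarith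
  · ext i
    have := congrArg Complex.im (congrFun h i)
    simp only [cz_apply] at this
    linarith

theorem exists_cz (z : ImOC) : ∃ a b, z = cz a b :=
  ⟨WithLp.toLp 2 fun i => 2 * (z i).re, WithLp.toLp 2 fun i => -2 * (z i).im, by
    ext i; rw [cz_apply]; apply Complex.ext <;> simp⟩

theorem star_cz : star (cz a b) = cz a (-b) := by
  ext i; simp only [Pi.star_apply, cz_apply]; apply Complex.ext <;> simp; ring

theorem cz_add_star : cz a b + star (cz a b) = toC a := by
  ext i; simp only [Pi.add_apply, Pi.star_apply, cz_apply]; apply Complex.ext <;> simp [toC]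

theorem I_smul_cz : Complex.I • cz a b = cz b (-a) := by
  ext i; simp only [Pi.smul_apply, cz_apply]; apply Complex.ext <;> simp <;> ring

theorem phase_eq (t : ℝ) : phase t = ⟨Real.cos t, Real.sin t⟩ := by
  rw [phase, Complex.exp_mul_I, ← Complex.ofReal_cos, ← Complex.ofReal_sin]
  apply Complex.ext <;> simp only [Complex.add_re, Complex.add_im, Complex.mul_re, Complex.mul_im,
    Complex.ofReal_re, Complex.ofReal_im, Complex.I_re, Complex.I_im] <;> ring

theorem phase_smul_cz (t : ℝ) : phase t • cz a b =
    cz (Real.cos t • a + Real.sin t • b) (Real.cos t • b - Real.sin t • a) := by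
  ext i
  simp only [Pi.smul_apply, cz_apply, phase_eq]
  apply Complex.ext <;> simp <;> ring

theorem crossCoord_toC_cz : crossCoord (toC a) (cz b c) = cz (cross a b) (cross a c) := by
  simp only [cz, crossCoord_smul_right, crossCoord_sub_right, crossCoord_toC]

theorem crossCoord_cz : crossCoord (cz a b) (cz c d) =
    (1 / 2 : ℂ) • cz (cross a c - cross b d) (cross a d + cross b c) := by
  simp only [cz, crossCoord_smul_right, crossCoord_sub_right, crossCoord_smul_left,
    crossCoord_sub_left, crossCoord_toC, toC_add, toC_sub]
  ext i
  simp only [Pi.smul_apply, Pi.sub_apply, Pi.add_apply, smul_eq_mul]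
  linear_combination (1 / 4 : ℂ) * toC (cross b d) i * Complex.I_sq

theorem dot_cz : cz a b ⬝ᵥ star (cz c d) =
    ⟨(⟪a, c⟫ + ⟪b, d⟫) / 4, (⟪a, d⟫ - ⟪b, c⟫) / 4⟩ := by
  rw [star_cz]
  simp only [cz, smul_dotProduct, dotProduct_smul, sub_dotProduct, dotProduct_sub, dot_toC,
    toC_neg, smul_neg, dotProduct_neg, smul_eq_mul]
  apply Complex.ext <;> simp <;> ring

theorem toC_dot_cz : toC a ⬝ᵥ star (cz c d) = ⟨⟪a, c⟫ / 2, ⟪a, d⟫ / 2⟩ := by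
  rw [star_cz]
  simp only [cz, dotProduct_smul, dotProduct_sub, dot_toC,
    toC_neg, smul_neg, dotProduct_neg, smul_eq_mul]
  apply Complex.ext <;> simp <;> ring

theorem half_cz : (1 / 2 : ℂ) • cz ((2 : ℝ) • a) ((2 : ℝ) • b) = cz a b := by
  ext i
  simp only [Pi.smul_apply, cz_apply]
  apply Complex.ext <;> simp <;> ring

end Complexification

/-! ### Adapted frames -/

theorem norm_eps (i : Fin 7) : ‖eps i‖ = 1 := by simp [eps]

theorem eps_apply (i j : Fin 7) : eps i j = if j = i then 1 else 0 := by
  simp [eps]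


/-- `u`, `x`, `τ` are orthonormal and `u × x ⟂ τ`. -/
structure IsG2Triple (u x τ : ImO) : Prop where
  norm_u : ‖u‖ = 1
  norm_x : ‖x‖ = 1
  norm_t : ‖τ‖ = 1
  ux : ⟪u, x⟫ = 0
  ut : ⟪u, τ⟫ = 0
  xt : ⟪x, τ⟫ = 0
  phi : ⟪cross u x, τ⟫ = 0

/-- The special unitary frame given by a triple. -/
def frameOf (u x τ : ImO) : Fin 3 → ImOC :=
  ![cz τ (cross u τ), cz (cross x τ) (cross u (cross x τ)), cz x (cross u x)]

theorem IsG2Triple.exists_frame {u x τ : ImO} (h : IsG2Triple u x τ) :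
    ∃ Ψ : ImO ≃ₗᵢ[ℝ] ImO, IsG2 Ψ ∧ u = Ψ (eps 0) ∧ x = Ψ (eps 1) ∧ cross u x = Ψ (eps 2) ∧
      τ = Ψ (eps 3) ∧ cross u τ = Ψ (eps 4) ∧ cross x τ = Ψ (eps 5) ∧
      cross u (cross x τ) = Ψ (eps 6) :=
  exists_g2_frame h.norm_u h.norm_x h.norm_t h.ux h.ut h.xt h.phi

theorem IsG2Triple.cross_eq {u x τ : ImO} (h : IsG2Triple u x τ) :
    cross τ (cross x τ) - cross (cross u τ) (cross u (cross x τ)) = (2 : ℝ) • x ∧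
    cross τ (cross u (cross x τ)) + cross (cross u τ) (cross x τ) = (2 : ℝ) • -cross u x ∧
    cross u (cross u τ) = -τ ∧ cross u (cross u (cross x τ)) = -cross x τ ∧
    cross u (cross u x) = -x := by
  obtain ⟨Ψ, hΨ, k0, k1, k2, k3, k4, k5, k6⟩ := h.exists_frame
  rw [k6, k5, k4, k2]
  rw [k0, k1, k3]
  simp only [hΨ _ _, ← map_neg, ← map_smul, ← map_sub, ← map_add, Ψ.injective.eq_iff]
  refine ⟨?_, ?_, ?_, ?_, ?_⟩ <;> ext i <;> fin_cases i <;>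
    simp [eps, cross_apply, crossCoord] <;> norm_num

theorem isAdaptedFrame_frameOf {S : Surface} {u : S → ImO} {p : S} {x τ : ImO}
    (h : IsG2Triple (u p) x τ) (ht : ∃ a, dmap u p a = τ) :
    IsAdaptedFrame u p (frameOf (u p) x τ) where
  type_one_zero := by
    obtain ⟨-, -, h1, h2, h3⟩ := h.cross_eq
    intro j
    fin_cases j <;> simp [frameOf, crossCoord_toC_cz, I_smul_cz, h1, h2, h3]
  unitary := by
    obtain ⟨Ψ, hΨ, k0, k1, k2, k3, k4, k5, k6⟩ := h.exists_frame
    intro j k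
    simp only [frameOf]
    rw [k6, k5, k4, k2, k3, k1]
    fin_cases j <;> fin_cases k <;>
      simp [-one_div, dot_cz, Ψ.inner_map_map, inner_eps, eps_apply, norm_eps, Complex.ext_iff] <;> norm_num
  special := by
    obtain ⟨h1, h2, -⟩ := h.cross_eq
    simp only [frameOf, Matrix.cons_val]
    rw [crossCoord_cz, h1, h2, half_cz, star_cz]
  tangent := by
    obtain ⟨a, rfl⟩ := ht
    exact ⟨a, rfl⟩

/-! ### Ruled families over holomorphic curves in `𝒳(Σ)` -/

/-- `cz` as a real linear map. -/
def czL : ImO × ImO →L[ℝ] ImOC :=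
  LinearMap.toContinuousLinearMap
    { toFun := fun p => cz p.1 p.2
      map_add' := fun p q => by
        ext i; simp only [cz_apply, Pi.add_apply]
        apply Complex.ext <;> simp <;> ring
      map_smul' := fun r p => by
        ext i; simp only [cz_apply, Pi.smul_apply]
        apply Complex.ext <;> simp <;> ring }

theorem contDiff_cz {E : Type*} [NormedAddCommGroup E] [NormedSpace ℝ E] {a b : E → ImO}
    (ha : Smooth a) (hb : Smooth b) : Smooth (fun d => cz (a d) (b d)) :=
  czL.contDiff.comp (ha.prodMk hb)

theorem fderiv_cz {E : Type*} [NormedAddCommGroup E] [NormedSpace ℝ E] {a b : E → ImO} {d : E}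
    (ha : DifferentiableAt ℝ a d) (hb : DifferentiableAt ℝ b d) (v : E) :
    𝒟 (fun d => cz (a d) (b d)) d v = cz (𝒟 a d v) (𝒟 b d v) := by
  have h : HasFDerivAt (fun d => cz (a d) (b d)) (czL.comp ((𝒟 a d).prod (𝒟 b d))) d :=
    czL.hasFDerivAt.comp d (ha.hasFDerivAt.prodMk hb.hasFDerivAt)
  rw [h.fderiv]; rfl

/-- The plane as a surface. -/
abbrev planeSurface : Surface := ⟨R2⟩

theorem dmap_plane (u : R2 → ImO) (d : R2) : dmap (S := planeSurface) u d = 𝒟 u d := by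
  unfold dmap
  exact mfderiv_eq_fderiv

theorem secondFF_plane {u : R2 → ImO} {d : R2} (h : IsGeodesicPoint (S := planeSurface) u d)
    (hu : Smooth u) (a b : R2) :
    ∃ (c : ℝ) (w : R2), 𝒟 (fun d => 𝒟 u d b) d a = c • u d + 𝒟 u d w := by
  have h1 := h a b
  unfold secondFF at h1
  rw [Submodule.starProjection_apply_eq_zero_iff] at h1
  unfold normalSpace at h1
  rw [Submodule.orthogonal_orthogonal, dmap_plane] at h1
  have h2 : 𝒟 (𝒟 (u ∘ (extChartAt (M := planeSurface) (𝓡 2) d).symm))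
      (extChartAt (M := planeSurface) (𝓡 2) d d) a b = 𝒟 (fun d => 𝒟 u d b) d a := by
    have hd : DifferentiableAt ℝ (𝒟 u) d :=
      (hu.contDiffAt.fderiv_right (m := ∞) (by simp)).differentiableAt (by simp)
    rw [fderiv_clm_apply hd (by fun_prop)]
    simp only [fderiv_fun_const, Pi.zero_apply]
    simp
    rfl
  have h3 := h2 ▸ h1
  obtain ⟨_, hc, _, ⟨w, rfl⟩, hcw⟩ := Submodule.mem_sup.mp h3
  obtain ⟨c, rfl⟩ := Submodule.mem_span_singleton.mp hc
  exact ⟨c, w, hcw.symm⟩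

theorem IsG2Triple.cross_eq' {u x τ : ImO} (h : IsG2Triple u x τ) :
    cross (cross u τ) x = cross u (cross x τ) ∧ cross (cross u x) τ = -cross u (cross x τ) ∧
    ⟪u, cross x τ⟫ = 0 ∧ ‖cross x τ‖ = 1 ∧ ⟪cross x τ, cross u x⟫ = 0 ∧
    ⟪cross u (cross x τ), x⟫ = 0 ∧ ⟪cross u (cross x τ), cross u x⟫ = 0 := by
  obtain ⟨Ψ, hΨ, k0, k1, k2, k3, k4, k5, k6⟩ := h.exists_frame
  rw [k6, k5, k4, k2]
  rw [k0, k1, k3]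
  simp only [hΨ _ _, ← map_neg, Ψ.injective.eq_iff, Ψ.inner_map_map, Ψ.norm_map, norm_eps, inner_eps,
    eps_apply]
  refine ⟨?_, ?_, ?_⟩
  · ext i; fin_cases i <;> simp [eps, cross_apply, crossCoord]
  · ext i; fin_cases i <;> simp [eps, cross_apply, crossCoord]
  · simp

theorem IsG2Triple.inner_cross_add {u x τ : ImO} (h : IsG2Triple u x τ) (c c' : ℝ) (ξ : ImO) :
    let η := cross (c • τ + c' • cross u τ) x + cross u ξ
    ⟪cross x τ, η⟫ = -⟪cross u (cross x τ), ξ⟫ - c ∧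
      ⟪cross u (cross x τ), η⟫ = ⟪cross x τ, ξ⟫ + c' := by
  obtain ⟨Ψ, hΨ, k0, k1, k2, k3, k4, k5, k6⟩ := h.exists_frame
  obtain ⟨α, rfl⟩ := Ψ.surjective ξ
  rw [k6, k5, k4]
  rw [k0, k1, k3]
  simp only [hΨ _ _, ← map_add, ← map_smul, Ψ.inner_map_map, inner_eps]
  constructor <;> simp [cross_apply, crossCoord, eps] <;> ring

theorem theta_frameOf (u x τ ξ : ImO) : Complex.I * (toC ξ ⬝ᵥ star (frameOf u x τ 0)) =
    ⟨-⟪cross u τ, ξ⟫ / 2, ⟪τ, ξ⟫ / 2⟩ := by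
  simp only [frameOf, Matrix.cons_val]
  rw [toC_dot_cz, real_inner_comm τ, real_inner_comm (cross u τ)]
  apply Complex.ext <;> simp
  ring

theorem contDiff_frameOf {u x τ : R2 → ImO} (hu : Smooth u) (hx : Smooth x)
    (hτ : Smooth τ) (j : Fin 3) : Smooth fun d => frameOf (u d) (x d) (τ d) j := by
  have hy : Smooth fun d => cross (x d) (τ d) := hx.cross hτ
  fin_cases j
  · exact contDiff_cz hτ (hu.cross hτ)
  · exact contDiff_cz hy (hu.cross hy)
  · exact contDiff_cz hx (hu.cross hx)

theorem kappa_frameOf {u x τ : R2 → ImO} (hu : Smooth u) (hx : Smooth x)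
    (hτ : Smooth τ) (htr : ∀ d, IsG2Triple (u d) (x d) (τ d)) {d w : R2} {c c' : ℝ}
    (hd : 𝒟 u d w = c • τ d + c' • cross (u d) (τ d)) :
    2 * (𝒟 (fun d => frameOf (u d) (x d) (τ d) 1) d w ⬝ᵥ star (frameOf (u d) (x d) (τ d) 2)) =
      ⟨-⟪cross (x d) (τ d), 𝒟 x d w⟫ - c' / 2,
        ⟪cross (u d) (cross (x d) (τ d)), 𝒟 x d w⟫ + c / 2⟩ := by
  have dx := hx.diff d
  have du := hu.diff d
  have dJx := (hu.cross hx).diff d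
  have hys : Smooth fun d => cross (x d) (τ d) := hx.cross hτ
  have dy := hys.diff d
  have dJy := (hu.cross hys).diff d
  simp only [frameOf, Matrix.cons_val]
  rw [fderiv_cz dy dJy, dot_cz]
  have k1 := inner_fderiv_add dy dx (.of_forall fun d => inner_cross_left_self _ _) w
  have k2 := inner_fderiv_add dy dJx (.of_forall fun d => (htr d).cross_eq'.2.2.2.2.1) w
  have k3 := inner_fderiv_add dJy dx (.of_forall fun d => (htr d).cross_eq'.2.2.2.2.2.1) w
  have k4 := inner_fderiv_add dJy dJx (.of_forall fun d => (htr d).cross_eq'.2.2.2.2.2.2) w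
  have hJ : 𝒟 (fun d => cross (u d) (x d)) d w =
      cross (c • τ d + c' • cross (u d) (τ d)) (x d) + cross (u d) (𝒟 x d w) := by
    rw [fderiv_cross du dx, hd]
  obtain ⟨e1, e2⟩ := (htr d).inner_cross_add c c' (𝒟 x d w)
  rw [hJ] at k2 k4
  apply Complex.ext <;> simp <;> linarith

section
variable {x e : R2 → ImO} (ht : IsTube x e) (hp : IsLagPatch (tube x e))

/-- The unit tangent field of the axis. -/
def unitDir (x e : R2 → ImO) (v d : R2) : ImO := ‖𝒟 (axis x e) d v‖⁻¹ • 𝒟 (axis x e) d v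

include ht in
theorem smooth_unitDir {v : R2} (h0 : ∀ d, 𝒟 (axis x e) d v ≠ 0) :
    Smooth (unitDir x e v) :=
  smooth_normalize (contDiff_fderiv_apply ht.smooth_axis v) h0

include ht hp in
theorem isG2Triple_unitDir {v d : R2} (h0 : 𝒟 (axis x e) d v ≠ 0) :
    IsG2Triple (axis x e d) (x d) (unitDir x e v d) := by
  obtain ⟨hu, hux, hue, hJx, hJe⟩ := ht.axis_facts d
  obtain ⟨p1, p2, p3⟩ := daxis_perp ht hp (d := d) v
  refine ⟨hu, ht.norm_x d, norm_normalize h0, hux, ?_, ?_, ?_⟩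
  · rw [unitDir, inner_smul_right, p1, mul_zero]
  · rw [unitDir, inner_smul_right, p2, mul_zero]
  · rw [unitDir, inner_smul_right, hJx, p3, mul_zero]

include ht hp in
theorem daxis_unit {v d : R2} (h0 : 𝒟 (axis x e) d v ≠ 0) (w : R2) :
    𝒟 (axis x e) d w =
      ⟪unitDir x e v d, 𝒟 (axis x e) d w⟫ • unitDir x e v d +
      ⟪cross (axis x e d) (unitDir x e v d), 𝒟 (axis x e) d w⟫ •
        cross (axis x e d) (unitDir x e v d) := by
  have h := daxis_expand ht hp h0 w
  have hr := norm_ne_zero_iff.mpr h0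
  simp only at h
  rw [real_inner_self_eq_norm_sq, ← eq_inv_smul_iff₀ (pow_ne_zero 2 hr)] at h
  refine h.trans ?_
  simp only [unitDir, inner_smul_left, cross_smul_right, conj_trivial]
  module

theorem isG2Triple_rotate {u x τ : ImO} (h : IsG2Triple u x τ) (t : ℝ) :
    IsG2Triple u (Real.cos t • x + Real.sin t • cross u x) τ ∧
    frameOf u (Real.cos t • x + Real.sin t • cross u x) τ =
      ![frameOf u x τ 0, phase (-t) • frameOf u x τ 1, phase t • frameOf u x τ 2] := by
  obtain ⟨-, c2, -⟩ := h.cross_eq'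
  obtain ⟨-, -, -, c5, c6⟩ := h.cross_eq
  have hxx : ⟪x, x⟫ = 1 := inner_self_of_norm_one h.norm_x
  have huu : ⟪u, u⟫ = 1 := inner_self_of_norm_one h.norm_u
  have hux' : ⟪u, cross u x⟫ = 0 := inner_self_cross_left _ _
  have hxx' : ⟪x, cross u x⟫ = 0 := inner_self_cross_right _ _
  refine ⟨⟨h.norm_u, ?_, h.norm_t, ?_, h.ut, ?_, ?_⟩, ?_⟩
  · have : ‖Real.cos t • x + Real.sin t • cross u x‖ ^ 2 = 1 := by
      rw [← real_inner_self_eq_norm_sq]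
      simp only [inner_add_left, inner_add_right, inner_smul_left, inner_smul_right, conj_trivial,
        hxx, hxx', inner_cross_right_self, inner_cross_cross, huu, h.ux]
      linear_combination Real.cos_sq_add_sin_sq t
    nlinarith [norm_nonneg (Real.cos t • x + Real.sin t • cross u x)]
  · rw [inner_add_right, inner_smul_right, inner_smul_right, h.ux, hux']; simp
  · rw [inner_add_left, inner_smul_left, inner_smul_left, h.xt, h.phi]; simp
  · rw [cross_add_right, cross_smul_right, cross_smul_right, c6, inner_add_left, inner_smul_left,
      inner_smul_left, h.phi, inner_neg_left, h.xt]; simp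
  · simp only [frameOf, Matrix.cons_val, phase_smul_cz, Real.cos_neg, Real.sin_neg]
    congr 2
    · rw [cz_inj]
      simp only [cross_add_left, cross_smul_left, c2, cross_add_right, cross_smul_right,
        cross_neg_right, c5]
      constructor <;> module
    · congr 1
      rw [cz_inj]
      simp only [cross_add_right, cross_smul_right, c6]
      exact ⟨trivial, by module⟩

theorem exists_toX_iff {S : Surface} {u : S → ImO} (b : FrameBundle u) {x τ : ImO}
    (h : IsG2Triple (u b.pt) x τ) (hb : b.frame = frameOf (u b.pt) x τ) (z : ImO) :
    (∃ c : FrameBundle u, toX u c = toX u b ∧ toC z = c.frame 2 + star (c.frame 2)) ↔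
      ∃ t, z = Real.cos t • x + Real.sin t • cross (u b.pt) x := by
  constructor
  · rintro ⟨c, hc, hz⟩
    obtain ⟨-, s, t, -, -, h2⟩ := Quotient.exact hc
    have h3 : c.frame 2 = phase (-2 * t) • b.frame 2 := by
      rw [h2, phase_mul, show -2 * t + 2 * t = 0 by ring, phase_zero]
    refine ⟨-2 * t, toC_injective ?_⟩
    rw [hz, h3, hb]
    simp only [frameOf, Matrix.cons_val]
    rw [phase_smul_cz, cz_add_star]
  · rintro ⟨t, rfl⟩
    obtain ⟨a, ha⟩ := b.adapted.tangent
    rw [hb] at ha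
    obtain ⟨r1, r2⟩ := isG2Triple_rotate h t
    let c : FrameBundle u := ⟨b.pt, _, isAdaptedFrame_frameOf r1 ⟨a, (cz_inj.mp ha).1.symm⟩⟩
    have hc : c.frame = frameOf (u b.pt) (Real.cos t • x + Real.sin t • cross (u b.pt) x) τ := rfl
    have hr : (torusSetoid u).r b c := by
      refine ⟨rfl, t / 2, t / 2, ?_, ?_, ?_⟩
      · rw [sub_self, phase_zero, hc, r2, hb]; simp only [Matrix.cons_val]
      · rw [show -(t / 2) - t / 2 = -t by ring, hc, r2, hb]; simp only [Matrix.cons_val]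
      · rw [show 2 * (t / 2) = t by ring, hc, r2, hb]; simp only [Matrix.cons_val]
    refine ⟨c, (Quotient.sound hr).symm, ?_⟩
    simp only [c, frameOf, Matrix.cons_val]
    rw [cz_add_star]

/-- The lift of the plane to the frame bundle of the axis. -/
def axisLift (ht : IsTube x e) (hp : IsLagPatch (tube x e)) {v : R2}
    (h0 : ∀ d, 𝒟 (axis x e) d v ≠ 0) (d : planeSurface) :
    FrameBundle (S := planeSurface) (axis x e) :=
  ⟨d, frameOf (axis x e d) (x d) (unitDir x e v d),
    isAdaptedFrame_frameOf (isG2Triple_unitDir ht hp (h0 d))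
      ⟨‖𝒟 (axis x e) d v‖⁻¹ • v, by rw [map_smul, dmap_plane]; rfl⟩⟩

section
variable {v : R2} (h0 : ∀ d, 𝒟 (axis x e) d v ≠ 0)

theorem theta1_axisLift (d w : R2) : theta1 (S := planeSurface) (G := planeSurface) (axis x e) (axisLift ht hp h0) d w =
    ⟨-⟪cross (axis x e d) (unitDir x e v d), 𝒟 (axis x e) d w⟫ / 2,
      ⟪unitDir x e v d, 𝒟 (axis x e) d w⟫ / 2⟩ := by
  have h : dmap (S := planeSurface) (fun q' => axis x e (axisLift ht hp h0 q').pt) d =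
    𝒟 (axis x e) d := dmap_plane _ d
  rw [theta1, h]
  exact theta_frameOf _ (x d) _ _

theorem kappa32_axisLift (d w : R2) : kappa32 (S := planeSurface) (G := planeSurface) (axis x e) (axisLift ht hp h0) d w =
    ⟨-⟪cross (x d) (unitDir x e v d), 𝒟 x d w⟫ -
      ⟪cross (axis x e d) (unitDir x e v d), 𝒟 (axis x e) d w⟫ / 2,
    ⟪cross (axis x e d) (cross (x d) (unitDir x e v d)), 𝒟 x d w⟫ +
      ⟪unitDir x e v d, 𝒟 (axis x e) d w⟫ / 2⟩ := by
  rw [← kappa_frameOf ht.smooth_axis ht.smooth_x (smooth_unitDir ht h0)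
    (fun d => isG2Triple_unitDir ht hp (h0 d)) (daxis_unit ht hp (h0 d) w), kappa32]
  have := mfderiv_eq_fderiv (𝕜 := ℝ) (E := R2) (E' := ImOC) (x := d)
    (f := fun d => frameOf (axis x e d) (x d) (unitDir x e v d) 1)
  exact congrArg (fun T : R2 →L[ℝ] ImOC => 2 * (T w ⬝ᵥ _)) this

include h0 in
omit ht hp in
theorem AntiHol.unit {d : R2} (hA : AntiHol x e v d) : ∃ A B : ℝ, ∀ w,
    ⟪cross (x d) (unitDir x e v d), 𝒟 x d w⟫ =
      A * ⟪unitDir x e v d, 𝒟 (axis x e) d w⟫ +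
      B * ⟪cross (axis x e d) (unitDir x e v d), 𝒟 (axis x e) d w⟫ ∧
    ⟪cross (axis x e d) (cross (x d) (unitDir x e v d)), 𝒟 x d w⟫ =
      B * ⟪unitDir x e v d, 𝒟 (axis x e) d w⟫ -
      A * ⟪cross (axis x e d) (unitDir x e v d), 𝒟 (axis x e) d w⟫ := by
  have hr := norm_ne_zero_iff.mpr (h0 d)
  refine ⟨‖𝒟 (axis x e) d v‖⁻¹ *
      ⟪cross (x d) (unitDir x e v d), 𝒟 x d v⟫,
    ‖𝒟 (axis x e) d v‖⁻¹ *
      ⟪cross (axis x e d) (cross (x d) (unitDir x e v d)), 𝒟 x d v⟫,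
    fun w => ?_⟩
  obtain ⟨a1, a2⟩ := hA w
  rw [real_inner_self_eq_norm_sq] at a1 a2
  simp only [unitDir, cross_smul_right, inner_smul_left, conj_trivial]
  set r := ‖𝒟 (axis x e) d v‖
  constructor
  · field_simp
    linear_combination a1
  · field_simp
    linear_combination a2

include ht hp in
theorem isHolomorphicCurveX_axisLift (hi : ∀ d, Injective (𝒟 (axis x e) d))
    (hA : ∀ d, AntiHol x e v d) : IsHolomorphicCurveX (S := planeSurface) (axis x e)
      (G := planeSurface) (fun q => toX (S := planeSurface) (axis x e) (axisLift ht hp h0 q)) := by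
  have htr := fun d => isG2Triple_unitDir ht hp (h0 d)
  intro q₀
  refine ⟨univ, axisLift ht hp h0, isOpen_univ, trivial, contMDiffOn_id, fun j => ?_,
    fun q _ => ⟨rfl, ?_, ?_⟩⟩
  · exact (contDiff_frameOf ht.smooth_axis ht.smooth_x (smooth_unitDir ht h0) j).contMDiff.contMDiffOn
  · intro w hw _
    rw [theta1_axisLift] at hw
    have e1 := congrArg Complex.re hw
    have e2 := congrArg Complex.im hw
    simp only [Complex.zero_re, Complex.zero_im] at e1 e2
    have h := daxis_unit ht hp (h0 q) w
    rw [show ⟪unitDir x e v q, 𝒟 (axis x e) q w⟫ = 0 by linarith,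
      show ⟪cross (axis x e q) (unitDir x e v q), 𝒟 (axis x e) q w⟫ = 0 by
        linarith, zero_smul, zero_smul, add_zero] at h
    exact hi q (h.trans (map_zero _).symm)
  · intro w
    obtain ⟨w', h⟩ := exists_daxis_J ht hp (hi q) w
    obtain ⟨A, B, hAB⟩ := (hA q).unit h0
    have huu : ⟪axis x e q, axis x e q⟫ = 1 := inner_self_of_norm_one ((htr q).norm_u)
    have j1 : ⟪unitDir x e v q, 𝒟 (axis x e) q w'⟫ =
        -⟪cross (axis x e q) (unitDir x e v q), 𝒟 (axis x e) q w⟫ := by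
      rw [h, real_inner_comm, inner_cross_swap']
    have j2 : ⟪cross (axis x e q) (unitDir x e v q), 𝒟 (axis x e) q w'⟫ =
        ⟪unitDir x e v q, 𝒟 (axis x e) q w⟫ := by
      rw [h, inner_cross_cross, huu, (htr q).ut]; ring
    refine ⟨w', ?_, ?_⟩
    · rw [theta1_axisLift, theta1_axisLift, j1, j2]
      apply Complex.ext <;> simp <;> ring
    · rw [kappa32_axisLift, kappa32_axisLift, (hAB w').1, (hAB w').2, (hAB w).1, (hAB w).2, j1, j2]
      apply Complex.ext <;> simp <;> ring

theorem range_tube_eq : range (tube x e) = {z | ∃ (q : planeSurface)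
    (b : FrameBundle (S := planeSurface) (axis x e)),
      toX (S := planeSurface) (axis x e) b = toX (S := planeSurface) (axis x e) (axisLift ht hp h0 q) ∧
      toC z = b.frame 2 + star (b.frame 2)} := by
  have key := fun d => exists_toX_iff (axisLift ht hp h0 d) (isG2Triple_unitDir ht hp (h0 d)) rfl
  have hJx : ∀ d, cross (axis x e d) (x d) = e d := fun d => (ht.axis_facts d).2.2.2.1
  ext z
  constructor
  · rintro ⟨⟨d, t⟩, rfl⟩
    obtain ⟨c, hc⟩ := (key d _).2 ⟨t, by rw [show (axisLift ht hp h0 d).pt = d from rfl, hJx]⟩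
    exact ⟨d, c, hc⟩
  · rintro ⟨q, c, hc⟩
    obtain ⟨t, rfl⟩ := (key q z).1 ⟨c, hc⟩
    exact ⟨(q, t), by rw [show (axisLift ht hp h0 q).pt = q from rfl, hJx]; rfl⟩
end

include ht hp in
theorem isL6_of_antiHol {v : R2} (hv : v ≠ 0)
    (hi : ∀ d, Injective (𝒟 (axis x e) d)) (hA : ∀ d, AntiHol x e v d)
    (hn : ∃ d, ¬ SecondFlat x e v d) : IsL6 (range (tube x e)) := by
  have h0 : ∀ d, 𝒟 (axis x e) d v ≠ 0 := fun d h => hv (hi d (h.trans (map_zero _).symm))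
  have hus := ht.smooth_axis
  refine ⟨planeSurface, axis x e, planeSurface, _, ⟨?_, ⟨⟨?_, ?_, ?_⟩, ?_⟩, ?_⟩,
    isHolomorphicCurveX_axisLift ht hp h0 hi hA, range_tube_eq ht hp h0⟩
  · exact inferInstanceAs (ConnectedSpace R2)
  · exact hus.contMDiff
  · exact fun d => (ht.axis_facts d).1
  · intro d
    have := hi d
    rw [← dmap_plane] at this
    exact this
  · intro d w
    obtain ⟨w', h⟩ := exists_daxis_J ht hp (hi d) w
    exact ⟨w', by rw [dmap_plane]; exact h⟩
  · obtain ⟨d, hd⟩ := hn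
    refine ⟨d, fun hg => hd fun w => ?_⟩
    obtain ⟨c, w', h⟩ := secondFF_plane hg hus w v
    have h2 := daxis_unit ht hp (h0 d) w'
    refine ⟨c, ⟪unitDir x e v d, 𝒟 (axis x e) d w'⟫ * ‖𝒟 (axis x e) d v‖⁻¹,
      ⟪cross (axis x e d) (unitDir x e v d), 𝒟 (axis x e) d w'⟫ *
        ‖𝒟 (axis x e) d v‖⁻¹, h.trans ?_⟩
    conv_lhs => rw [h2]
    rw [mul_smul, mul_smul, add_assoc, ← cross_smul_right ‖𝒟 (axis x e) d v‖⁻¹]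
    rfl
end

section

/-! ### The local classification -/

variable {L : Type*} [TopologicalSpace L] [ChartedSpace (Rn 3) L] [IsManifold (𝓡 3) ∞ L]
  {ι : L → ImO} {x e : R2 → ImO} {j : R2 × ℝ → L}

theorem axis_comp (x e : R2 → ImO) (φ : R2 → R2) : axis (x ∘ φ) (e ∘ φ) = axis x e ∘ φ := rfl

namespace RuledChart
variable (hl : IsLagrangian ι) (hι : IsImmersedInS6 (n := 3) ι) (hc : RuledChart ι x e j)
include hl hι hc

theorem exists_piece_of_immersed (hi : ∀ d, Injective (𝒟 (axis x e) d)) (t : ℝ) :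
    ∃ d V, IsPiece ι (fun A => IsL3 A ∨ IsL6 A) V ∧ j (d, t) ∈ V := by
  have ht := hc.isTube
  have hp := hc.patch hl hι
  obtain ⟨v, hv⟩ := exists_ne (0 : R2)
  by_cases hd : Dense {d | ¬ SecondFlat x e v d}
  · obtain ⟨d, hd'⟩ := hd.nonempty
    refine ⟨0, range j, ⟨hc.isOpen_range hι, hc.emb, .inr ?_⟩, (0, t), rfl⟩
    rw [hc.image_range]
    exact isL6_of_antiHol ht hp hv hi (antiHol_of_dense ht hp hv hi hd) ⟨d, hd'⟩
  · simp only [dense_iff_inter_open, not_forall, exists_prop] at hd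
    obtain ⟨U, hU, ⟨d, hdU⟩, hne⟩ := hd
    obtain ⟨V, hV, hm⟩ := hc.isPiece_of_second hl hι (v₀ := v) hU
      (fun d _ h => hv (hi d (h.trans (map_zero _).symm)))
      (fun d hd => by
        by_contra h
        exact hne ⟨d, hd, h⟩) hdU t
    exact ⟨d, V, ⟨hV.isOpen, hV.emb, .inl hV.type⟩, hm⟩

theorem isPiece_of_daxis_eq_zero {O : Set R2} (hO : IsOpen O)
    (h : ∀ d ∈ O, ∀ v, 𝒟 (axis x e) d v = 0) {d : R2} (hd : d ∈ O) (t : ℝ) :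
    ∃ V, IsPiece ι IsL3 V ∧ j (d, t) ∈ V := by
  have ht := hc.isTube
  obtain ⟨r, hr, hrO⟩ := Metric.isOpen_iff.mp hO d hd
  have hV := (hc.restrict d hr).isPiece_of_const hl hι (n := axis x e d) (fun z => by
    rw [axis_comp]
    have h3 := is_const_of_fderiv_eq_zero (𝕜 := ℝ) (f := axis x e ∘ ub d r)
      (ht.diff_axis.comp ((smooth_ub d r).diff)) (fun z => by
        ext1 v
        rw [fderiv_comp _ (ht.diff_axis _) ((smooth_ub d r).diff _)]
        exact h _ (hrO (ub_mem d hr z)) _) z 0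
    rw [h3, Function.comp_apply, ub_zero])
  exact ⟨_, hV, (0, t), by simp⟩

theorem exists_piece {O : Set R2} (hO : IsOpen O) (hne : O.Nonempty) (t : ℝ) :
    ∃ d ∈ O, ∃ V, IsPiece ι (fun A => IsL3 A ∨ IsL6 A) V ∧ j (d, t) ∈ V := by
  have ht := hc.isTube
  have hcont : Continuous (𝒟 (axis x e)) := ht.smooth_axis.continuous_fderiv (by simp)
  by_cases h1 : ∃ d ∈ O, Injective (𝒟 (axis x e) d)
  · obtain ⟨d, hd, hi⟩ := h1
    obtain ⟨r, hr, hrO⟩ := Metric.isOpen_iff.mp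
      (hO.inter (ContinuousLinearMap.isOpen_injective.preimage hcont)) d ⟨hd, hi⟩
    have hφ := fun z => hrO (ub_mem d hr z)
    obtain ⟨d', V, hV, hm⟩ := (hc.restrict d hr).exists_piece_of_immersed hl hι (fun z => by
      rw [axis_comp, fderiv_comp _ (ht.diff_axis _) ((smooth_ub d r).diff _)]
      exact (hφ z).2.comp (fderiv_ub_bijective d hr z).1) t
    exact ⟨ub d r d', (hφ d').1, V, hV, hm⟩
  · push Not at h1
    by_cases h2 : ∃ d ∈ O, ∃ v, 𝒟 (axis x e) d v ≠ 0
    · obtain ⟨d, hd, v, hv⟩ := h2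
      obtain ⟨V, hV, hm⟩ := hc.isPiece_of_rank_one hl hι (v₀ := v)
        (O := O ∩ {d | 𝒟 (axis x e) d v ≠ 0})
        (hO.inter (isOpen_ne_fun (hcont.clm_apply continuous_const) continuous_const))
        (fun d hd => hd.2) (fun d hd => by
          have := h1 d hd.1
          rw [injective_iff_map_eq_zero] at this
          push Not at this
          obtain ⟨w, hw, hw0⟩ := this
          exact ⟨w, hw0, hw⟩) ⟨hd, hv⟩ t
      exact ⟨d, hd, V, ⟨hV.isOpen, hV.emb, .inl hV.type⟩, hm⟩
    · push Not at h2
      obtain ⟨d, hd⟩ := hne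
      obtain ⟨V, hV, hm⟩ := hc.isPiece_of_daxis_eq_zero hl hι hO h2 hd t
      exact ⟨d, hd, V, ⟨hV.isOpen, hV.emb, .inl hV.type⟩, hm⟩

end RuledChart

theorem IsRuled.locallyOnDense (hl : IsLagrangian ι) (hι : IsImmersedInS6 (n := 3) ι)
    (hr : IsRuled ι) : LocallyOnDense ι fun A => IsL3 A ∨ IsL6 A := by
  rw [locallyOnDense_iff]
  rintro U hU ⟨y, hy⟩
  obtain ⟨x, e, j, hc, rfl⟩ := exists_ruledChart hι hr y
  obtain ⟨d, hd, V, hV, hm⟩ := hc.exists_piece hl hι (O := (fun d => j (d, 0)) ⁻¹' U)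
    (hU.preimage (hc.smooth.continuous.comp (by fun_prop))) ⟨0, hy⟩ 0
  exact ⟨V, hV, _, hd, hm⟩

omit [ChartedSpace (Rn 3) L] [IsManifold (𝓡 3) ∞ L] in
theorem IsPiece.of_opens {P : Set ImO → Prop} {W : TopologicalSpace.Opens L} {V : Set W}
    (h : IsPiece (fun y : W => ι y) P V) : IsPiece ι P (Subtype.val '' V) where
  isOpen := W.isOpen.isOpenMap_subtype_val _ h.isOpen
  emb := by
    let k : (Subtype.val '' V : Set L) → V := fun m =>
      ⟨⟨m, by obtain ⟨w, -, hw⟩ := m.2; rw [← hw]; exact w.2⟩, by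
        obtain ⟨w, hw, hw'⟩ := m.2
        have : w = ⟨m, by rw [← hw']; exact w.2⟩ := Subtype.ext hw'
        exact this ▸ hw⟩
    have hk : IsEmbedding k := by
      refine .of_comp ?_ (continuous_subtype_val.comp continuous_subtype_val)
        (IsEmbedding.subtypeVal (p := (· ∈ Subtype.val '' V)))
      exact Continuous.subtype_mk (Continuous.subtype_mk continuous_subtype_val _) _
    exact h.emb.comp hk
  type := by
    have := h.type
    rwa [← image_comp]

theorem IsGenericallyLocallyRuled.locallyOnDense (hl : IsLagrangian ι)
    (hι : IsImmersedInS6 (n := 3) ι) (hr : IsGenericallyLocallyRuled ι) :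
    LocallyOnDense ι fun A => IsL3 A ∨ IsL6 A := by
  rw [locallyOnDense_iff]
  rintro U hU hne
  obtain ⟨O, hO, hd, h⟩ := hr
  obtain ⟨y, hyU, hyO⟩ := hd.inter_open_nonempty U hU hne
  obtain ⟨W, hyW, hW⟩ := h y hyO
  obtain ⟨V, hV, w, hwU, hwV⟩ := locallyOnDense_iff.mp
    (hW.locallyOnDense (hl.restrict hι W) (hι.restrict W)) (Subtype.val ⁻¹' U)
    (hU.preimage continuous_subtype_val) ⟨⟨y, hyW⟩, hyU⟩
  exact ⟨_, hV.of_opens, w, hwU, w, hwV, rfl⟩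

end

section

/-! ### Ruled Lagrangians in a totally geodesic 5-sphere -/

section
variable {x e : R2 → ImO} (ht : IsTube x e) (hp : IsLagPatch (tube x e)) {n : ImO}
  (hx : ∀ d, ⟪n, x d⟫ = 0) (he : ∀ d, ⟪n, e d⟫ = 0) (d : R2)

/-- The component of `n` orthogonal to the axis. -/
def axisPerp (x e : R2 → ImO) (n : ImO) (d : R2) : ImO := n - ⟪axis x e d, n⟫ • axis x e d

include ht in
theorem smooth_axisPerp : Smooth (axisPerp x e n) :=
  contDiff_const.sub ((ht.smooth_axis.inner ℝ contDiff_const).smul ht.smooth_axis)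

include ht hx he in
theorem axisPerp_facts : ⟪axis x e d, axisPerp x e n d⟫ = 0 ∧
    ⟪axisPerp x e n d, x d⟫ = 0 ∧ ⟪axisPerp x e n d, e d⟫ = 0 := by
  have h := ht.axis_facts d
  have huu : ⟪axis x e d, axis x e d⟫ = 1 := inner_self_of_norm_one h.1
  refine ⟨?_, ?_, ?_⟩
  · rw [axisPerp, inner_sub_right, inner_smul_right, huu]; ring
  · rw [axisPerp, inner_sub_left, inner_smul_left, h.2.1, hx]; simp
  · rw [axisPerp, inner_sub_left, inner_smul_left, h.2.2.1, he]; simp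

include ht hp hx he in
theorem inner_daxis_of_perp (v : R2) :
    ⟪cross (x d) (axisPerp x e n d), 𝒟 (axis x e) d v⟫ = 0 ∧
    ⟪cross (axis x e d) (cross (x d) (axisPerp x e n d)), 𝒟 (axis x e) d v⟫ = 0 := by
  obtain ⟨hu, hux, hue, hJx, hJe⟩ := ht.axis_facts d
  obtain ⟨s1, s2, s3⟩ := axisPerp_facts ht hx he d
  have hT : ∀ p, ⟪n, tube x e p⟫ = 0 := fun p => by
    simp [tube, inner_add_right, inner_smul_right, hx, he]
  have hE : ∀ p, ∀ q ∈ tang (tube x e) p, ⟪n, q⟫ = 0 := by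
    intro p q hq
    obtain ⟨a, w, rfl⟩ := mem_tang.mp hq
    have h1 := inner_fderiv_add (f := fun _ : R2 × ℝ => n) (differentiableAt_const n)
      (ht.smooth.diff p) (.of_forall hT) w
    have h2 : ⟪n, 𝒟 (tube x e) p w⟫ = 0 := by simpa using h1
    rw [inner_add_right, inner_smul_right, hT, h2]; simp
  have hco := fun t => hp.coassociative finrank_R2R (d, t)
  have hnx := fun t => (hco t).1.cross_mem (hco t).2 (hE _) (ht.mem_tang_x (d := d) t)
  have hne := fun t => (hco t).1.cross_mem (hco t).2 (hE _) (ht.mem_tang_e (d := d) t)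
  have hn : n = axisPerp x e n d + ⟪axis x e d, n⟫ • axis x e d := by
    rw [axisPerp, sub_add_cancel]
  set σ := axisPerp x e n d with hσ
  set c : ℝ := ⟪axis x e d, n⟫
  have hY : ∀ t, cross (x d) σ ∈ tang (tube x e) (d, t) := by
    intro t
    have : cross (x d) σ = c • e d - cross n (x d) := by
      conv_rhs => rw [hn]
      rw [cross_add_left, cross_smul_left, hJx, cross_anticomm (x d)]; module
    rw [this]
    exact Submodule.sub_mem _ (Submodule.smul_mem _ _ (ht.mem_tang_e t)) (hnx t)
  have hJY : ∀ t, cross (axis x e d) (cross (x d) σ) ∈ tang (tube x e) (d, t) := by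
    intro t
    have : cross (axis x e d) (cross (x d) σ) = cross n (e d) + c • x d := by
      conv_rhs => rw [hn]
      rw [cross_add_left, cross_smul_left, hJe, ← hJx, cross_cross_anti (a := σ)
        (inner_eq_zero_symm.1 s1) s2 hux, cross_anticomm σ, cross_neg_right]; module
    rw [this]
    exact Submodule.add_mem _ (hne t) (Submodule.smul_mem _ _ (ht.mem_tang_x t))
  have hdx : 𝒟 x d v ∈ tang (tube x e) (d, 0) := by
    simpa using ht.mem_tang_d (d := d) 0 v
  have hde : 𝒟 e d v ∈ tang (tube x e) (d, Real.pi / 2) := by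
    simpa using ht.mem_tang_d (d := d) (Real.pi / 2) v
  have key : ∀ q, (∀ t, q ∈ tang (tube x e) (d, t)) → ⟪q, 𝒟 (axis x e) d v⟫ = 0 := by
    intro q hq
    rw [ht.daxis_eq, inner_add_right, real_inner_comm, real_inner_comm (cross (x d) _),
      (hco 0).1 _ hdx _ (ht.mem_tang_e 0) _ (hq 0),
      (hco (Real.pi / 2)).1 _ (ht.mem_tang_x _) _ hde _ (hq _), add_zero]
  exact ⟨key _ hY, key _ hJY⟩

include ht hp hx he in
theorem daxis_of_perp (h0 : axisPerp x e n d ≠ 0) (v : R2) :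
    (∃ a b c : ℝ, 𝒟 (axis x e) d v =
      a • axis x e d + b • axisPerp x e n d + c • cross (axis x e d) (axisPerp x e n d)) ∧
    ∃ a b c : ℝ, 𝒟 (axisPerp x e n) d v =
      a • axis x e d + b • axisPerp x e n d + c • cross (axis x e d) (axisPerp x e n d) := by
  obtain ⟨hu, hux, hue, hJx, hJe⟩ := ht.axis_facts d
  obtain ⟨s1, s2, s3⟩ := axisPerp_facts ht hx he d
  obtain ⟨q1, q2, q3⟩ := daxis_perp ht hp (d := d) v
  obtain ⟨k1, k2⟩ := inner_daxis_of_perp ht hp hx he d v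
  have h := frame_expand_smul hu (ht.norm_x d) h0 hux s1 (inner_eq_zero_symm.1 s2)
    (by rw [hJx, real_inner_comm]; exact s3) (𝒟 (axis x e) d v)
  rw [q1, q2, hJx, q3, k1, k2] at h
  simp only [zero_smul, add_zero, smul_zero, zero_add] at h
  obtain ⟨β, γ, h2⟩ : ∃ β γ : ℝ, 𝒟 (axis x e) d v =
      β • axisPerp x e n d + γ • cross (axis x e d) (axisPerp x e n d) := by
    have h2 := (eq_inv_smul_iff₀ (inner_self_ne_zero.mpr h0 :
      ⟪axisPerp x e n d, axisPerp x e n d⟫ ≠ 0)).mpr h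
    rw [smul_add, smul_smul, smul_smul] at h2
    exact ⟨_, _, h2⟩
  refine ⟨⟨0, β, γ, by rw [zero_smul, zero_add]; exact h2⟩, ?_⟩
  have h3 : 𝒟 (axisPerp x e n) d v = -(⟪𝒟 (axis x e) d v, n⟫ • axis x e d +
      ⟪axis x e d, n⟫ • 𝒟 (axis x e) d v) := by
    have hi : DifferentiableAt ℝ (fun d => ⟪axis x e d, n⟫) d :=
      (ht.diff_axis d).inner ℝ (differentiableAt_const n)
    have h4 : 𝒟 (fun d => ⟪axis x e d, n⟫) d v =
        ⟪𝒟 (axis x e) d v, n⟫ := by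
      rw [fderiv_inner_apply' (ht.diff_axis d) (differentiableAt_const n)]; simp
    unfold axisPerp
    rw [fderiv_const_sub, fderiv_fun_smul hi (ht.diff_axis d)]
    simp only [neg_apply, add_apply, smul_apply, ContinuousLinearMap.smulRight_apply, h4]
    module
  refine ⟨-⟪𝒟 (axis x e) d v, n⟫, -(⟪axis x e d, n⟫ * β),
    -(⟪axis x e d, n⟫ * γ), ?_⟩
  rw [h3]
  generalize ⟪𝒟 (axis x e) d v, n⟫ = a
  rw [h2]
  module
end

variable {L : Type*} [TopologicalSpace L] [ChartedSpace (Rn 3) L] [IsManifold (𝓡 3) ∞ L]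
  {ι : L → ImO} {x e : R2 → ImO} {j : R2 × ℝ → L}

namespace RuledChart
variable (hl : IsLagrangian ι) (hι : IsImmersedInS6 (n := 3) ι) (hc : RuledChart ι x e j)
include hl hι hc

theorem exists_submodule_of_perp {n : ImO} (hn : ∀ m, ⟪n, ι m⟫ = 0) {d : R2}
    (hd : axisPerp x e n d ≠ 0) :
    ∃ r > 0, ∃ P : Submodule ℝ ImO, Module.finrank ℝ P = 4 ∧
      ∀ z, x (ub d r z) ∈ P ∧ e (ub d r z) ∈ P := by
  have ht := hc.isTube
  have hx : ∀ d, ⟪n, x d⟫ = 0 := fun d => by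
    simpa [hc.eq, tube] using hn (j (d, 0))
  have he : ∀ d, ⟪n, e d⟫ = 0 := fun d => by
    simpa [hc.eq, tube] using hn (j (d, Real.pi / 2))
  have h := daxis_of_perp ht (hc.patch hl hι) hx he
  exact hc.exists_submodule (smooth_axisPerp ht)
    (isOpen_ne_fun (smooth_axisPerp ht (n := n)).continuous continuous_const) (fun d hd => hd)
    (fun d _ => axisPerp_facts ht hx he d) (fun d hd v => (h d hd v).1) (fun d hd v => (h d hd v).2) hd

theorem exists_piece_of_perp {n : ImO} (h1 : ‖n‖ = 1) (hn : ∀ m, ⟪n, ι m⟫ = 0) {O : Set R2}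
    (hO : IsOpen O) (hne : O.Nonempty) (t : ℝ) :
    ∃ d ∈ O, ∃ V, IsPiece ι IsL3 V ∧ j (d, t) ∈ V := by
  have ht := hc.isTube
  by_cases h : ∃ d ∈ O, axisPerp x e n d ≠ 0
  · obtain ⟨d, hd, h0⟩ := h
    obtain ⟨r, hr, P, hP, h⟩ := hc.exists_submodule_of_perp hl hι hn h0
    exact ⟨d, hd, hc.isPiece_of_submodule hl hι hP hr h t⟩
  · push Not at h
    obtain ⟨d, hd⟩ := hne
    refine ⟨d, hd, hc.isPiece_of_daxis_eq_zero hl hι hO (fun d hd v => ?_) hd t⟩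
    have hnu : ∀ d ∈ O, n = ⟪axis x e d, n⟫ • axis x e d := fun d hd =>
      sub_eq_zero.mp (h d hd)
    have hcc : ∀ d ∈ O, ⟪axis x e d, n⟫ * ⟪axis x e d, n⟫ = 1 := fun d hd => by
      have := congrArg (inner ℝ n) (hnu d hd)
      rw [real_inner_self_eq_norm_sq, h1, inner_smul_right, real_inner_comm (axis x e d) n] at this
      linarith
    have hun : ∀ d ∈ O, axis x e d = ⟪axis x e d, n⟫ • n := fun d hd => by
      have := congrArg (⟪axis x e d, n⟫ • ·) (hnu d hd)
      simp only [smul_smul, hcc d hd, one_smul] at this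
      exact this.symm
    have hi : DifferentiableAt ℝ (fun d => ⟪axis x e d, n⟫) d :=
      (ht.diff_axis d).inner ℝ (differentiableAt_const n)
    have hdu : 𝒟 (axis x e) d v = ⟪𝒟 (axis x e) d v, n⟫ • n := by
      have h4 : 𝒟 (fun d => ⟪axis x e d, n⟫) d v =
          ⟪𝒟 (axis x e) d v, n⟫ := by
        rw [fderiv_inner_apply' (ht.diff_axis d) (differentiableAt_const n)]; simp
      have h5 : axis x e =ᶠ[𝓝 d] fun d => ⟪axis x e d, n⟫ • n := by
        filter_upwards [hO.mem_nhds hd] with d hd using hun d hd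
      rw [← h4]
      conv_lhs => rw [h5.fderiv_eq, fderiv_smul_const hi]
      rfl
    have h0 := (daxis_perp ht (hc.patch hl hι) (d := d) v).1
    have h6 : ⟪axis x e d, n⟫ * ⟪𝒟 (axis x e) d v, n⟫ = 0 := by
      have h7 := h0
      rw [hun d hd, inner_smul_left, real_inner_comm] at h7
      simpa [real_inner_comm n] using h7
    rw [hdu, (mul_eq_zero.mp h6).resolve_left fun h => by simpa [h] using hcc d hd, zero_smul]

end RuledChart

omit [TopologicalSpace L] [ChartedSpace (Rn 3) L] [IsManifold (𝓡 3) ∞ L] in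
theorem exists_normal_of_not_full {ι : L → ImO} (h : ¬ IsLinearlyFull ι) :
    ∃ n : ImO, ‖n‖ = 1 ∧ ∀ m, ⟪n, ι m⟫ = 0 := by
  simp only [IsLinearlyFull, not_not] at h
  obtain ⟨W, hW, h⟩ := h
  have h1 : Wᗮ ≠ ⊥ := fun h => hW (by rw [← W.orthogonal_orthogonal, h, Submodule.bot_orthogonal_eq_top])
  obtain ⟨n, hn, hn0⟩ := Submodule.exists_mem_ne_zero_of_ne_bot h1
  refine ⟨‖n‖⁻¹ • n, norm_normalize hn0, fun m => ?_⟩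
  rw [inner_smul_left, real_inner_comm, hn _ (h m), mul_zero]

theorem IsRuled.locallyOnDense_of_not_full (hl : IsLagrangian ι) (hι : IsImmersedInS6 (n := 3) ι)
    (hr : IsRuled ι) (h : ¬ IsLinearlyFull ι) : LocallyOnDense ι IsL3 := by
  obtain ⟨n, hn1, hn⟩ := exists_normal_of_not_full h
  rw [locallyOnDense_iff]
  rintro U hU ⟨y, hy⟩
  obtain ⟨x, e, j, hc, rfl⟩ := exists_ruledChart hι hr y
  obtain ⟨d, hd, V, hV, hm⟩ := hc.exists_piece_of_perp hl hι hn1 hn (O := (fun d => j (d, 0)) ⁻¹' U)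
    (hU.preimage (hc.smooth.continuous.comp (by fun_prop))) ⟨0, hy⟩ 0
  exact ⟨V, hV, _, hd, hm⟩

theorem not_full_of_piece [ConnectedSpace L] (hl : IsLagrangian ι) (hι : IsImmersedInS6 (n := 3) ι)
    {U : Set L} (hU : IsOpen U) (hne : U.Nonempty) (h : IsL3 (ι '' U)) : ¬ IsLinearlyFull ι := by
  obtain ⟨S, u, i, -, ⟨n, hn1, hI⟩, h⟩ := h
  have hni : ∀ y, ⟪n, i y⟫ = 0 := by
    intro y
    have h1 : i (Complex.I • (Complex.I • y)) = -i y := by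
      rw [smul_smul, Complex.I_mul_I, neg_one_smul, map_neg]
    rw [hI, hI, cross_cross_self, real_inner_self_eq_norm_sq, hn1] at h1
    have h2 : ⟪n, i y⟫ • n = 0 := by
      have : ⟪n, i y⟫ • n = (⟪n, i y⟫ • n - (1 : ℝ) ^ 2 • i y) + i y := by module
      rw [this, h1]; simp
    exact (smul_eq_zero.mp h2).resolve_right (norm_ne_zero_iff.mp (by rw [hn1]; exact one_ne_zero))
  have hz : ∀ m ∈ U, ⟪ι m, n⟫ = 0 := by
    intro m hm
    have : ι m ∈ range (hopfMap u i) := h ▸ ⟨m, hm, rfl⟩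
    obtain ⟨y, hy⟩ := this
    rw [← hy, real_inner_comm]
    exact hni _
  have hall := hl.unique_continuation hι hU hne hz
  refine not_not.mpr ⟨(Submodule.span ℝ {n})ᗮ, fun h => ?_, fun m => ?_⟩
  · have h1 : n ∈ (Submodule.span ℝ {n})ᗮ := h ▸ Submodule.mem_top
    have h2 := h1 n (Submodule.mem_span_singleton_self n)
    rw [real_inner_self_eq_norm_sq, hn1] at h2
    norm_num at h2
  · rw [Submodule.mem_orthogonal_singleton_iff_inner_right, real_inner_comm]
    exact hall m

theorem LocallyOnDense.not_full [ConnectedSpace L] (hl : IsLagrangian ι)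
    (hι : IsImmersedInS6 (n := 3) ι) (h : LocallyOnDense ι IsL3) : ¬ IsLinearlyFull ι := by
  obtain ⟨V, hV, hne⟩ := locallyOnDense_iff.mp h univ isOpen_univ univ_nonempty
  exact not_full_of_piece hl hι hV.1 (hne.mono inter_subset_right) hV.type

theorem IsRuled.locallyOnDense_of_full [ConnectedSpace L] (hl : IsLagrangian ι)
    (hι : IsImmersedInS6 (n := 3) ι) (hr : IsRuled ι) (h : IsLinearlyFull ι) :
    LocallyOnDense ι IsL6 := by
  rw [locallyOnDense_iff]
  intro U hU hne
  obtain ⟨V, hV, hm⟩ := locallyOnDense_iff.mp (hr.locallyOnDense hl hι) U hU hne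
  refine ⟨V, ⟨hV.1, hV.emb, hV.type.resolve_left fun h3 => ?_⟩, hm⟩
  exact not_full_of_piece hl hι hV.1 (hm.mono inter_subset_right) h3 h

end

section

/-! ### Ruled Lagrangians that are Hopf lifts as a whole -/

theorem cos_sin_arg {a b : ℝ} (h : a ^ 2 + b ^ 2 = 1) :
    Real.cos (Complex.arg ⟨a, b⟩) = a ∧ Real.sin (Complex.arg ⟨a, b⟩) = b := by
  have h3 : ‖(⟨a, b⟩ : ℂ)‖ = 1 := by
    rw [← Real.sqrt_one, Complex.norm_def, Complex.normSq_apply]; congr 1; simp; linarith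
  have h4 := Complex.norm_mul_cos_arg (⟨a, b⟩ : ℂ)
  have h5 := Complex.norm_mul_sin_arg (⟨a, b⟩ : ℂ)
  rw [h3, one_mul] at h4 h5
  exact ⟨h4, h5⟩

theorem IsTube.eq_tube_of_norm {x e : R2 → ImO} (ht : IsTube x e) {d : R2} {p : ImO} (hp : ‖p‖ = 1)
    (h : ∃ a b : ℝ, p = a • x d + b • e d) :
    p = tube x e (d, Complex.arg ⟨⟪x d, p⟫, ⟪e d, p⟫⟩) := by
  obtain ⟨a, b, rfl⟩ := h
  have h1 : a ^ 2 + b ^ 2 = 1 := by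
    have h2 := real_inner_self_eq_norm_sq (a • x d + b • e d)
    rw [hp, inner_add_left, inner_smul_left, inner_smul_left, ht.inner_x, ht.inner_e] at h2
    simp only [conj_trivial] at h2
    linarith
  rw [ht.inner_x, ht.inner_e, tube]
  simp only [cos_sin_arg h1]

variable {L : Type*} [TopologicalSpace L] [ChartedSpace (Rn 3) L] [IsManifold (𝓡 3) ∞ L]
  {ι : L → ImO}

theorem IsRuling.axis_eq_of_not_simple [ConnectedSpace L] (hl : IsLagrangian ι)
    (hι : IsImmersedInS6 (n := 3) ι) {S : Surface} {π : L → S} {ε : L → ImO} (h : IsRuling ι π ε)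
    (hs : ¬ IsSimple ι) {n : ImO} (hn : ∀ m, ⟪n, ι m⟫ = 0) (y : L) :
    n = ⟪cross (ι y) (ε y), n⟫ • cross (ι y) (ε y) := by
  obtain ⟨x, e, j, hc, rfl, hx, he⟩ := h.exists_ruledChart hι y
  rw [← hx, ← he]
  by_contra h0
  obtain ⟨r, hr, P, hP, hm⟩ := hc.exists_submodule_of_perp hl hι hn (d := 0)
    (fun h => h0 (sub_eq_zero.mp h))
  refine hs ⟨P, hP, hl.mem_of_open hι ((hc.restrict 0 hr).isOpen_range hι) ⟨_, 0, rfl⟩ ?_⟩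
  rintro _ ⟨p, rfl⟩
  rw [hc.eq]
  exact P.add_mem (P.smul_mem _ (hm _).1) (P.smul_mem _ (hm _).2)

/-- The normal of a ruled Lagrangian in a totally geodesic 5-sphere is the axis of its circles. -/
theorem IsRuling.exists_axis [ConnectedSpace L] (hl : IsLagrangian ι)
    (hι : IsImmersedInS6 (n := 3) ι) {S : Surface} {π : L → S} {ε : L → ImO} (h : IsRuling ι π ε)
    (hs : ¬ IsSimple ι) (hf : ¬ IsLinearlyFull ι) : ∃ n, ∀ y, cross (ι y) (ε y) = n := by
  obtain ⟨n, hn1, hn⟩ := exists_normal_of_not_full hf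
  have hax := h.axis_eq_of_not_simple hl hι hs hn
  set c : L → ℝ := fun y => ⟪cross (ι y) (ε y), n⟫ with hc
  have hcc : ∀ y, c y * c y = 1 := fun y => by
    have := congrArg (inner ℝ n) (hax y)
    rw [real_inner_self_eq_norm_sq, hn1, inner_smul_right, real_inner_comm (cross _ _) n] at this
    simp only [hc]; linarith
  have hcont : Continuous c := by
    have h1 : Continuous fun y => crossB (ι y) (ε y) :=
      crossB.continuous₂.comp (hι.smooth.continuous.prodMk h.smooth_dir.continuous)
    exact Continuous.inner h1 continuous_const
  have hcn : ∀ y, cross (ι y) (ε y) = c y • n := fun y => by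
    have := congrArg (c y • ·) (hax y)
    simp only [smul_smul] at this
    rw [hcc, one_smul] at this
    exact this.symm
  rcases isPreconnected_univ.eq_one_or_eq_neg_one_of_sq_eq hcont.continuousOn
    (fun y _ => by simp [sq, hcc]) with h1 | h1
  · exact ⟨n, fun y => by rw [hcn, h1 (mem_univ y)]; simp⟩
  · exact ⟨-n, fun y => by rw [hcn, h1 (mem_univ y)]; simp⟩

theorem IsRuling.isGloballyL3 (hl : IsLagrangian ι) (hι : IsImmersedInS6 (n := 3) ι) {S : Surface}
    {π : L → S} {ε : L → ImO} (h : IsRuling ι π ε) {n : ImO} (hn : ∀ y, cross (ι y) (ε y) = n)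
    [Nonempty L] : IsGloballyL3 ι := by
  have hn1 : ‖n‖ = 1 := by
    obtain ⟨σ, s, j, -, -, -, ht, -⟩ := h.exists_tube hι (Classical.arbitrary L)
    exact norm_axis ht fun d => hn _
  obtain ⟨i, P, hI, hPi, hiP, hni⟩ := exists_adapted hn1
  have hnx : ∀ y, ⟪n, ι y⟫ = 0 := fun y => by rw [← hn y]; simp
  have hix : ∀ y, i (P (ι y)) = ι y := fun y => hiP _ (hnx y)
  have hJx : ∀ y, cross n (ι y) = ε y := fun y => by
    rw [← hn y, cross_anticomm, cross_cross_self, (h.unit y).2, real_inner_self_eq_norm_sq,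
      hι.norm_eq_one]; simp
  have hz0 : ∀ y, P (ι y) ≠ 0 := fun y h => by
    have := hι.norm_eq_one y
    rw [← hix, h, map_zero, norm_zero] at this
    exact zero_ne_one this
  have hspan : ∀ y (w : C3), w ∈ Submodule.span ℂ {P (ι y)} ↔
      ∃ a b : ℝ, i w = a • ι y + b • ε y := by
    intro y w
    rw [Submodule.mem_span_singleton]
    constructor
    · rintro ⟨c, rfl⟩
      exact ⟨c.re, c.im, by rw [adapted_smul hI, hix, hJx]⟩
    · rintro ⟨a, b, hab⟩
      exact ⟨⟨a, b⟩, i.injective (by rw [adapted_smul hI, hix, hJx, hab])⟩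
  choose k hk using h.surjective
  let u : S → CP2 := fun b => Projectivization.mk ℂ (P (ι (k b))) (hz0 _)
  have hu : ∀ y, u (π y) = Projectivization.mk ℂ (P (ι y)) (hz0 _) := by
    intro y
    rw [Projectivization.mk_eq_mk_iff']
    obtain ⟨t, ht⟩ := (h.bijOn y).1 (show k (π y) ∈ π ⁻¹' {π y} from hk _)
    rw [← Submodule.mem_span_singleton, hspan]
    exact ⟨_, _, (hix _).trans ht.symm⟩
  let Φ : L → HopfBundle u := fun y => ⟨(π y, P (ι y)), by
    rw [← i.norm_map, hix, hι.norm_eq_one], by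
    rw [hu, Projectivization.submodule_mk]; exact Submodule.mem_span_singleton_self _⟩
  have hΦc : Continuous Φ := Continuous.subtype_mk
    (h.smooth_base.continuous.prodMk (P.continuous.comp hι.smooth.continuous)) _
  have hΦi : Injective Φ := by
    intro y y' hy
    have h1 : (π y, P (ι y)) = (π y', P (ι y')) := congrArg Subtype.val hy
    rw [Prod.mk.injEq] at h1
    exact (h.bijOn y').2.1 h1.1 rfl (by rw [← hix, h1.2, hix])
  have key : ∀ y, ∃ Ψ : HopfBundle u → L, ContinuousAt Ψ (Φ y) ∧
      Ψ (Φ y) = y ∧ ∀ᶠ w in 𝓝 (Φ y), Φ (Ψ w) = w := by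
    intro y
    obtain ⟨σ, s, j, hσ, hs0, hπσ, ht, hj, hjι, hjπ, -, hj0⟩ := h.exists_tube hι y
    obtain ⟨g, hg, hgl⟩ := hσ.inv
    have hy : σ 0 = π y := by rw [← hπσ, hs0]
    have hgy : g (π y) = 0 := by rw [← hy, hgl]
    have hd : ContinuousAt (fun w : HopfBundle u => g w.1.1) (Φ y) := by
      have : ContinuousAt g (π y) :=
        (hg.contMDiffAt (hσ.isOpen_range.mem_nhds ⟨0, hy⟩)).continuousAt
      exact this.comp (f := fun w : HopfBundle u => w.1.1)
        (continuous_fst.comp continuous_subtype_val).continuousAt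
    have hiw : Continuous fun w : HopfBundle u => i w.1.2 :=
      i.continuous.comp (continuous_snd.comp continuous_subtype_val)
    set A : HopfBundle u → ℂ := fun w =>
      ⟨⟪ι (s (g w.1.1)), i w.1.2⟫, ⟪ε (s (g w.1.1)), i w.1.2⟫⟩ with hA
    have hA1 : A (Φ y) = 1 := by
      have h1 : A (Φ y) = ⟨⟪ι y, ι y⟫, ⟪ε y, ι y⟫⟩ := by
        simp only [hA, Φ, hgy, hs0, hix]
      rw [h1, real_inner_comm (ι y) (ε y), (h.unit y).2, real_inner_self_eq_norm_sq, hι.norm_eq_one]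
      simp [Complex.ext_iff]
    have hAc : ContinuousAt A (Φ y) := by
      have h1 : ContinuousAt (fun w : HopfBundle u => ι (s (g w.1.1))) (Φ y) :=
        ContinuousAt.comp (g := fun d => ι (s d)) ht.smooth_x.continuous.continuousAt hd
      have h2 : ContinuousAt (fun w : HopfBundle u => ε (s (g w.1.1))) (Φ y) :=
        ContinuousAt.comp (g := fun d => ε (s d)) ht.smooth_e.continuous.continuousAt hd
      have h3 := (h1.inner (𝕜 := ℝ) hiw.continuousAt).prodMk (h2.inner (𝕜 := ℝ) hiw.continuousAt)
      exact ContinuousAt.comp (g := Complex.equivRealProdCLM.symm)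
        Complex.equivRealProdCLM.symm.continuous.continuousAt h3
    refine ⟨fun w => j (g w.1.1, Complex.arg (A w)), ?_, ?_, ?_⟩
    · refine ContinuousAt.comp (g := j) hj.continuous.continuousAt (hd.prodMk ?_)
      exact ContinuousAt.comp (g := Complex.arg)
        (Complex.continuousAt_arg (by rw [hA1]; exact Complex.one_mem_slitPlane)) hAc
    · simp only [hA1, Complex.arg_one]
      rw [show (Φ y).1.1 = π y from rfl, hgy, hj0]
    · have hev : ∀ᶠ w : HopfBundle u in 𝓝 (Φ y), w.1.1 ∈ range σ :=
        (continuous_fst.comp continuous_subtype_val).continuousAt.eventually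
          (hσ.isOpen_range.mem_nhds ⟨0, hy⟩)
      filter_upwards [hev]
      rintro ⟨⟨b, w⟩, hw1, hw2⟩ ⟨d, hd⟩
      simp only at hd hw1 hw2
      subst hd
      have hgd : g (σ d) = d := hgl d
      rw [← hπσ, hu, Projectivization.submodule_mk, hspan] at hw2
      have h1 := ht.eq_tube_of_norm (by rw [i.norm_map, hw1]) hw2
      refine Subtype.ext (Prod.ext ?_ ?_)
      · simp only [Φ, hjπ, hgd]
      · simp only [Φ, hjι, hgd, hA]
        rw [← h1, hPi]
  have hΦs : Surjective Φ := by
    rintro ⟨⟨b, w⟩, hw1, hw2⟩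
    obtain ⟨y, rfl⟩ := h.surjective b
    simp only at hw1 hw2
    rw [hu, Projectivization.submodule_mk, hspan] at hw2
    obtain ⟨σ, s, j, -, hs0, hπσ, ht, -, hjι, hjπ, -⟩ := h.exists_tube hι y
    rw [← hs0] at hw2
    obtain ⟨t, h1⟩ : ∃ t, i w = tube (fun d => ι (s d)) (fun d => ε (s d)) (0, t) :=
      ⟨_, ht.eq_tube_of_norm (by rw [i.norm_map, hw1]) hw2⟩
    refine ⟨j (0, t), Subtype.ext (Prod.ext ?_ ?_)⟩
    · simp only [Φ, hjπ, ← hπσ, hs0]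
    · simp only [Φ, hjι]
      rw [← h1, hPi]
  let Θ := Equiv.ofBijective Φ ⟨hΦi, hΦs⟩
  have hΘ : Continuous Θ.symm := by
    rw [continuous_iff_continuousAt]
    intro w
    obtain ⟨y, rfl⟩ := hΦs w
    obtain ⟨Ψ, hΨ, -, hΨΦ⟩ := key y
    refine hΨ.congr ?_
    filter_upwards [hΨΦ] with w hw
    rw [Equiv.eq_symm_apply]
    exact hw
  refine ⟨S, u, i, ⟨Θ, hΦc, hΘ⟩, ?_, ⟨n, hn1, hI⟩, fun y => (hix y).symm⟩
  intro p
  obtain ⟨y, rfl⟩ := h.surjective p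
  obtain ⟨σ, s, j, hσ, hs0, hπσ, ht, hj, hjι, hjπ, hgood, -⟩ := h.exists_tube hι y
  have hp : IsLagPatch (tube (fun d => ι (s d)) (fun d => ε (s d))) := by
    have := hl.patch hι hj (by rw [fun_eq_tube hjι]; exact fun z => hgood z.1 z.2)
    rwa [fun_eq_tube hjι] at this
  obtain ⟨-, -, hzs, -, hh1, hh2⟩ := hopf_family ht hp (fun d => hn (s d)) hI hiP
  obtain ⟨g, hg, hgl⟩ := hσ.inv
  set z : S → C3 := fun q => P (ι (s (g q))) with hz
  have hzsm : ContMDiffOn (𝓡 2) 𝓘(ℝ, C3) ∞ z (range σ) := hzs.contMDiff.comp_contMDiffOn hg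
  have hzσ : (fun d => z (σ d)) = fun d => P (ι (s d)) := funext fun d => by simp only [hz, hgl d]
  have hdl : ∀ d v, dlift z (σ d) (mfderiv (𝓡 2) (𝓡 2) σ d v) =
      𝒟 (fun d => P (ι (s d))) d v := by
    intro d v
    rw [← hzσ]
    exact (fderiv_comp_mfld ((hzsm.contMDiffAt (hσ.isOpen_range.mem_nhds ⟨d, rfl⟩)
      ).mdifferentiableAt (by simp)) (hσ.smooth.mdifferentiableAt (by simp)) v).symm
  have hzd : ∀ d, z (σ d) = P (ι (s d)) := congrFun hzσ
  refine ⟨range σ, z, hσ.isOpen_range, ⟨0, by rw [← hπσ, hs0]⟩, hzsm, ?_⟩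
  rintro _ ⟨d, rfl⟩
  refine ⟨⟨hz0 _, by rw [← hπσ, hu]; simp only [hπσ, hzd]⟩, fun v hv => ?_, fun v => ?_⟩
  · obtain ⟨v, rfl⟩ := (hσ.mfderiv_bijective d).2 v
    rw [hdl, hzd] at hv
    have h0 := hh1 d v hv
    rw [h0]
    exact (mfderiv (𝓡 2) (𝓡 2) σ d : R2 →L[ℝ] R2).map_zero
  · obtain ⟨v, rfl⟩ := (hσ.mfderiv_bijective d).2 v
    obtain ⟨w, hw⟩ := hh2 d v
    exact ⟨mfderiv (𝓡 2) (𝓡 2) σ d w, by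
      rw [hdl, hzd, show dlift z (σ d) (mfderiv (𝓡 2) (𝓡 2) σ d w) = _ from hdl d w]; exact hw⟩

theorem IsRuled.isGloballyL3 [ConnectedSpace L] (hl : IsLagrangian ι)
    (hι : IsImmersedInS6 (n := 3) ι) (hr : IsRuled ι) (hf : ¬ IsLinearlyFull ι)
    (hs : ¬ IsSimple ι) : IsGloballyL3 ι := by
  obtain ⟨S, π, ε, h⟩ := hr.exists_ruling
  obtain ⟨n, hn⟩ := h.exists_axis hl hι hs hf
  exact h.isGloballyL3 hl hι hn

end

open scoped ComplexConjugate

/-! ### Framed families of great circles -/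

/-- The complex coordinate of `ξ` in the direction `a`. -/
def coordC (u a ξ : ImO) : ℂ := ⟨⟪a, ξ⟫, ⟪cross u a, ξ⟫⟩

section
variable {u x τ : ImO} (h : IsG2Triple u x τ) {ξ ξ' : ImO}
include h

theorem coordC_rotate (hu : ⟪u, ξ⟫ = 0) (hx : ⟪x, ξ⟫ = 0) (c : ℂ) (t : ℝ) :
    let ζ := Real.cos t • ξ + Real.sin t • (cross u ξ + cross (c.re • τ + c.im • cross u τ) x)
    let x' := Real.cos t • x + Real.sin t • cross u x
    ⟪u, ζ⟫ = 0 ∧ ⟪x', ζ⟫ = 0 ∧ coordC u τ ζ = phase t * coordC u τ ξ ∧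
      coordC u (cross x' τ) ζ =
        phase t * (phase t * coordC u (cross x τ) ξ - Real.sin t * conj c) := by
  obtain ⟨Ψ, hΨ, k0, k1, k2, k3, k4, k5, k6⟩ := h.exists_frame
  obtain ⟨α, rfl⟩ := Ψ.surjective ξ
  simp only [phase_eq]
  generalize Real.cos t = C
  generalize Real.sin t = s
  unfold coordC
  rw [k0, k1, k3] at *
  simp only [hΨ _ _, ← map_add, ← map_smul, Ψ.inner_map_map, inner_eps] at hu hx ⊢
  refine ⟨?_, ?_, ?_, ?_⟩
  · simp [cross_apply, crossCoord, eps, hu]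
  · simp [inner_eq_sum, cross_apply, crossCoord, eps, hu, hx]; ring
  · apply Complex.ext
    · simp [inner_eq_sum, cross_apply, crossCoord, eps]; ring
    · simp [inner_eq_sum, cross_apply, crossCoord, eps]
  · apply Complex.ext <;> simp [inner_eq_sum, cross_apply, crossCoord, eps] <;> ring

theorem inner_cross_of_coordC (hu : ⟪u, ξ⟫ = 0) (hx : ⟪x, ξ⟫ = 0) (hu' : ⟪u, ξ'⟫ = 0)
    (hx' : ⟪x, ξ'⟫ = 0)
    (hc : coordC u τ ξ * coordC u (cross x τ) ξ' = coordC u τ ξ' * coordC u (cross x τ) ξ) :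
    ⟪cross x ξ, ξ'⟫ = 0 ∧ ⟪cross x (cross u x), ξ⟫ = 0 := by
  obtain ⟨Ψ, hΨ, k0, k1, k2, k3, k4, k5, k6⟩ := h.exists_frame
  obtain ⟨α, rfl⟩ := Ψ.surjective ξ
  obtain ⟨α', rfl⟩ := Ψ.surjective ξ'
  unfold coordC at hc
  rw [k0, k1, k3] at *
  simp only [hΨ _ _, Ψ.inner_map_map, inner_eps] at hu hx hu' hx' hc ⊢
  have h1 := congrArg Complex.re hc
  simp [inner_eq_sum, cross_apply, crossCoord, eps] at h1
  constructor
  · simp [inner_eq_sum, cross_apply, crossCoord, eps, hu, hx, hu', hx']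
    linear_combination h1
  · simp [inner_eq_sum, cross_apply, crossCoord, eps, hu]
end

theorem IsG2Triple.eq_of_coordC {u x τ ξ : ImO} (h : IsG2Triple u x τ) (h0 : ⟪u, ξ⟫ = 0)
    (h1 : coordC u τ ξ = 0) (h2 : coordC u (cross x τ) ξ = 0) :
    ξ = ⟪x, ξ⟫ • x + ⟪cross u x, ξ⟫ • cross u x := by
  have e := frame_expand h.norm_u h.norm_x h.norm_t h.ux h.ut h.xt h.phi ξ
  have a1 : ⟪τ, ξ⟫ = 0 := congrArg Complex.re h1
  have a2 : ⟪cross u τ, ξ⟫ = 0 := congrArg Complex.im h1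
  have a3 : ⟪cross x τ, ξ⟫ = 0 := congrArg Complex.re h2
  have a4 : ⟪cross u (cross x τ), ξ⟫ = 0 := congrArg Complex.im h2
  rw [h0, a1, a2, a3, a4] at e
  simpa using e

/-- A smooth family of special unitary frames along a map `u` to `𝒮⁶` whose derivative is in the
direction of the first vector, such that the relevant components of `du` and `dx` are complex
multiples of one real isomorphism to `ℂ`. -/
structure HolFrame (u x τ : R2 → ImO) : Prop where
  smooth_u : Smooth u
  smooth_x : Smooth x
  smooth_t : Smooth τ
  triple : ∀ d, IsG2Triple (u d) (x d) (τ d)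
  hol : ∀ d, ∃ (ψ : R2 →ₗ[ℝ] ℂ) (A B C : ℂ), Injective ψ ∧ (B ≠ 0 ∨ C ≠ 0) ∧ ∀ v,
    𝒟 u d v = (C * ψ v).re • τ d + (C * ψ v).im • cross (u d) (τ d) ∧
    coordC (u d) (τ d) (𝒟 x d v) = A * conj (ψ v) ∧
    coordC (u d) (cross (x d) (τ d)) (𝒟 x d v) = B * conj (ψ v)

/-- The great circles of a framed family. -/
abbrev circ (u x : R2 → ImO) : R2 × ℝ → ImO := tube x fun d => cross (u d) (x d)

namespace HolFrame
variable {u x τ : R2 → ImO} (h : HolFrame u x τ)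
include h

theorem isTube : IsTube x fun d => cross (u d) (x d) where
  smooth_x := h.smooth_x
  smooth_e := h.smooth_u.cross h.smooth_x
  norm_x := fun d => (h.triple d).norm_x
  norm_e := fun d =>
    (cross_of_orthonormal (h.triple d).norm_u (h.triple d).norm_x (h.triple d).ux).1
  perp := fun _ => inner_self_cross_right _ _

theorem triple_circ (d : R2) (t : ℝ) : IsG2Triple (u d) (circ u x (d, t)) (τ d) :=
  (isG2Triple_rotate (h.triple d) t).1

theorem cross_circ (d : R2) (t : ℝ) :
    cross (u d) (circ u x (d, t)) = tubeDir x (fun d => cross (u d) (x d)) (d, t) := by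
  simp only [tube, tubeDir, cross_add_right, cross_smul_right, (h.triple d).cross_eq.2.2.2.2]
  module

theorem fderiv_circ (d : R2) (t : ℝ) (v : R2) (s : ℝ) : 𝒟 (circ u x) (d, t) (v, s) =
    𝒟 (circ u x) (d, t) (v, 0) + s • cross (u d) (circ u x (d, t)) := by
  rw [h.isTube.fderiv_tube, h.isTube.fderiv_tube, h.cross_circ]; module

theorem exists_coord (d : R2) : ∃ (ψ : R2 →ₗ[ℝ] ℂ) (A B C : ℂ), Injective ψ ∧
    (B ≠ 0 ∨ C ≠ 0) ∧ ∀ t v, ⟪u d, 𝒟 (circ u x) (d, t) (v, 0)⟫ = 0 ∧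
      ⟪circ u x (d, t), 𝒟 (circ u x) (d, t) (v, 0)⟫ = 0 ∧
      coordC (u d) (τ d) (𝒟 (circ u x) (d, t) (v, 0)) = phase t * A * conj (ψ v) ∧
      coordC (u d) (cross (circ u x (d, t)) (τ d)) (𝒟 (circ u x) (d, t) (v, 0)) =
        phase t * (phase t * B - Real.sin t * conj C) * conj (ψ v) := by
  obtain ⟨ψ, A, B, C, hψ, hBC, hv⟩ := h.hol d
  refine ⟨ψ, A, B, C, hψ, hBC, fun t v => ?_⟩
  obtain ⟨h1, h2, h3⟩ := hv v
  have hu := h.smooth_u.diff d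
  have hx := h.smooth_x.diff d
  have e1 := inner_fderiv_add hu hx (.of_forall fun d => (h.triple d).ux) v
  have e2 := inner_fderiv_self hx (.of_forall fun d => (h.triple d).norm_x) v
  have e3 : ⟪u d, 𝒟 x d v⟫ = 0 := by
    have hφ := (h.triple d).phi
    rw [← inner_cross_cyclic, inner_cross_swap', neg_eq_zero] at hφ
    rw [h1, inner_add_left, inner_smul_left, inner_smul_left, real_inner_comm, (h.triple d).xt,
      inner_cross_swap', (h.triple d).phi] at e1
    simpa using e1
  have hζ : 𝒟 (circ u x) (d, t) (v, 0) = Real.cos t • 𝒟 x d v + Real.sin t •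
      (cross (u d) (𝒟 x d v) +
        cross ((C * ψ v).re • τ d + (C * ψ v).im • cross (u d) (τ d)) (x d)) := by
    rw [h.isTube.fderiv_tube, fderiv_cross hu hx, h1]; module
  obtain ⟨g1, g2, g3, g4⟩ := coordC_rotate (h.triple d) e3 e2 (C * ψ v) t
  rw [← hζ] at g1 g2 g3 g4
  refine ⟨g1, g2, ?_, ?_⟩
  · rw [g3, h2]; ring
  · rw [show circ u x (d, t) = Real.cos t • x d + Real.sin t • cross (u d) (x d) from rfl, g4, h3,
      map_mul]; ring

theorem inner_cross_fderiv (p : R2 × ℝ) (ξ ξ' : R2 × ℝ) :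
    ⟪cross (circ u x p) (𝒟 (circ u x) p ξ), 𝒟 (circ u x) p ξ'⟫ = 0 := by
  obtain ⟨d, t⟩ := p
  obtain ⟨v, s⟩ := ξ
  obtain ⟨v', s'⟩ := ξ'
  obtain ⟨ψ, A, B, C, -, -, hv⟩ := h.exists_coord d
  have key : ∀ v v', _ := fun v v' => by
    obtain ⟨a1, a2, a3, a4⟩ := hv t v
    obtain ⟨b1, b2, b3, b4⟩ := hv t v'
    exact inner_cross_of_coordC (h.triple_circ d t) a1 a2 b1 b2 (by rw [a3, a4, b3, b4]; ring)
  rw [h.fderiv_circ d t v, h.fderiv_circ d t v', cross_add_right, cross_smul_right, inner_add_left,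
    inner_add_right, inner_add_right, inner_smul_left, inner_smul_left, inner_smul_right,
    inner_smul_right, (key v v').1, (key v' v).2, inner_cross_swap', (key v v').2,
    inner_cross_right_self]
  simp

theorem injective_of_coord {d : R2} {ψ : R2 →ₗ[ℝ] ℂ} {A B C : ℂ} (hψ : Injective ψ) {t : ℝ}
    (hv : ∀ v, coordC (u d) (τ d) (𝒟 (circ u x) (d, t) (v, 0)) = phase t * A * conj (ψ v) ∧
      coordC (u d) (cross (circ u x (d, t)) (τ d)) (𝒟 (circ u x) (d, t) (v, 0)) =
        phase t * (phase t * B - Real.sin t * conj C) * conj (ψ v))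
    (hA : A ≠ 0 ∨ phase t * B - Real.sin t * conj C ≠ 0) :
    Injective (𝒟 (circ u x) (d, t)) := by
  have hph : phase t ≠ 0 := Complex.exp_ne_zero _
  obtain ⟨-, -, -, k4, k5, k6, k7⟩ := (h.triple_circ d t).cross_eq'
  have ht := h.triple_circ d t
  rw [injective_iff_map_eq_zero]
  rintro ⟨v, s⟩ hz
  rw [h.fderiv_circ, ← eq_neg_iff_add_eq_zero, ← neg_smul] at hz
  obtain ⟨h1, h2⟩ := hv v
  have z1 : coordC (u d) (τ d) (𝒟 (circ u x) (d, t) (v, 0)) = 0 := by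
    rw [hz]; unfold coordC
    rw [inner_smul_right, inner_smul_right, real_inner_comm, ht.phi, inner_cross_cross, ht.ut, ht.ux,
      real_inner_comm (circ u x (d, t)) (τ d), ht.xt]
    simp [Complex.ext_iff]
  have z2 : coordC (u d) (cross (circ u x (d, t)) (τ d))
      (𝒟 (circ u x) (d, t) (v, 0)) = 0 := by
    rw [hz]; unfold coordC
    rw [inner_smul_right, inner_smul_right, k5, k7]
    simp [Complex.ext_iff]
  rw [z1] at h1
  rw [z2] at h2
  have hw : conj (ψ v) = 0 := by
    rcases hA with hA | hA
    · exact (mul_eq_zero.mp h1.symm).resolve_left (mul_ne_zero hph hA)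
    · exact (mul_eq_zero.mp h2.symm).resolve_left (mul_ne_zero hph hA)
  have hv0 : v = 0 := (injective_iff_map_eq_zero ψ).mp hψ v (by simpa using hw)
  subst hv0
  rw [show ((0 : R2), (0 : ℝ)) = 0 from rfl, map_zero] at hz
  have hn : cross (u d) (circ u x (d, t)) ≠ 0 := by
    rw [h.cross_circ]; exact norm_ne_zero_iff.mp (by rw [h.isTube.norm_dir]; exact one_ne_zero)
  have hs := (smul_eq_zero.mp hz.symm).resolve_right hn
  rw [neg_eq_zero.mp hs]; rfl

/-- The family is immersive at a dense set of points of each circle. -/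
theorem exists_injective (d : R2) (t : ℝ) {δ : ℝ} (hδ : 0 < δ) :
    ∃ t', |t' - t| < δ ∧ Injective (𝒟 (circ u x) (d, t')) := by
  obtain ⟨ψ, A, B, C, hψ, hBC, hv⟩ := h.exists_coord d
  by_contra! hno
  have key : ∀ t', |t' - t| < δ → phase t' * B - Real.sin t' * conj C = 0 := fun t' ht' => by
    by_contra h0
    exact hno t' ht' (h.injective_of_coord hψ (fun v => (hv t' v).2.2) (.inr h0))
  set ε := min (δ / 2) 1 with hε
  have hε0 : 0 < ε := lt_min (by linarith) one_pos
  have hε1 : ε ≤ 1 := min_le_right _ _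
  have h1 := key t (by simpa using hδ)
  have h2 := key (t + ε) (by
    rw [add_sub_cancel_left, abs_of_pos hε0]
    exact (min_le_left _ _).trans_lt (by linarith))
  have hs : (Real.sin ε : ℂ) ≠ 0 := by
    exact_mod_cast (Real.sin_pos_of_pos_of_le_one hε0 hε1).ne'
  have e1 : phase t * Real.sin (t + ε) - phase (t + ε) * Real.sin t = Real.sin ε := by
    rw [phase_eq, phase_eq, Real.sin_add, Real.cos_add]
    have := Real.sin_sq_add_cos_sq t
    generalize Real.cos t = c at *
    generalize Real.sin t = s at *
    generalize Real.cos ε = c' at *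
    generalize Real.sin ε = s' at *
    apply Complex.ext <;> simp
    · linear_combination s' * this
    · ring
  have hB : B = 0 := by
    apply (mul_eq_zero.mp (_ : (Real.sin ε : ℂ) * B = 0)).resolve_left hs
    rw [← e1]
    linear_combination Real.sin (t + ε) * h1 - Real.sin t * h2
  have hC := hBC.resolve_left (not_not.mpr hB)
  have hC' : conj C ≠ 0 := by simpa using hC
  rw [hB, mul_zero, zero_sub, neg_eq_zero] at h1 h2
  have s1 := (mul_eq_zero.mp h1).resolve_right hC'
  have s2 := (mul_eq_zero.mp h2).resolve_right hC'
  rw [s1, s2] at e1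
  simp at e1
  exact hs (by exact_mod_cast e1.symm)

/-- Where the family is not immersive along a circle. -/
theorem of_not_good {d : R2} (hd : ¬ Good x (fun d => cross (u d) (x d)) d) :
    (∀ t v, coordC (u d) (τ d) (𝒟 (circ u x) (d, t) (v, 0)) = 0) ∧
    ∃ t, ∀ v, ∃ s, 𝒟 (circ u x) (d, t) (v, s) = 0 := by
  obtain ⟨ψ, A, B, C, hψ, hBC, hv⟩ := h.exists_coord d
  unfold Good at hd
  push Not at hd
  obtain ⟨t, ht⟩ := hd
  have hA : ¬ (A ≠ 0 ∨ phase t * B - Real.sin t * conj C ≠ 0) := fun h0 =>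
    ht (h.injective_of_coord hψ (fun v => (hv t v).2.2) h0)
  push Not at hA
  refine ⟨fun t v => by rw [(hv t v).2.2.1, hA.1]; simp, t, fun v => ?_⟩
  obtain ⟨g1, g2, g3, g4⟩ := hv t v
  rw [hA.1] at g3
  rw [hA.2] at g4
  have := (h.triple_circ d t).eq_of_coordC g1 (by rw [g3]; ring) (by rw [g4]; ring)
  rw [g2, zero_smul, zero_add] at this
  refine ⟨-⟪cross (u d) (circ u x (d, t)), 𝒟 (circ u x) (d, t) (v, 0)⟫, ?_⟩
  rw [h.fderiv_circ, neg_smul, ← this, add_neg_cancel]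

end HolFrame

section

/-! ### Submanifolds covered by framed families of great circles -/

variable {L : Type*} [TopologicalSpace L] [ChartedSpace (Rn 3) L] [IsManifold (𝓡 3) ∞ L]
  {ι : L → ImO}

/-- A closed condition on the tangent spaces. -/
theorem IsLagrangian.of_dense (hι : IsImmersedInS6 (n := 3) ι)
    (hD : Dense {m : L | ∀ v w : TangentSpace (𝓡 3) m, omega (ι m)
      (mfderiv (𝓡 3) 𝓘(ℝ, ImO) ι m v) (mfderiv (𝓡 3) 𝓘(ℝ, ImO) ι m w) = 0}) : IsLagrangian ι := by
  intro m
  obtain ⟨κ, hκ, rfl, -⟩ := exists_param (n := 3) m univ_mem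
  obtain ⟨hfs, -⟩ := hι.comp_param hκ
  refine IsLagrangian.of_patch hι hκ fun v w => ?_
  have hc : ∀ v, Continuous (fun z => 𝒟 (fun z => ι (κ z)) z v) := fun v =>
    (hfs.continuous_fderiv (by simp)).clm_apply continuous_const
  have hcl : IsClosed {z | ⟪(crossB (ι (κ z)) (𝒟 (fun z => ι (κ z)) z v)),
      (𝒟 (fun z => ι (κ z)) z w)⟫ = 0} := by
    refine isClosed_eq (Continuous.inner ?_ (hc w)) continuous_const
    exact crossB.continuous₂.comp (hfs.continuous.prodMk (hc v))
  have hd := hD.preimage hκ.isOpenEmbedding.isOpenMap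
  refine hcl.closure_subset_iff.mpr ?_ (hd 0)
  intro z hz
  have := hz (mfderiv (𝓡 3) (𝓡 3) κ z v) (mfderiv (𝓡 3) (𝓡 3) κ z w)
  rw [← hι.fderiv_comp hκ.smooth.contMDiffAt, ← hι.fderiv_comp hκ.smooth.contMDiffAt] at this
  exact this

/-- The set `A` contains framed families of great circles near each of its points. -/
def HolCovered (A : Set ImO) : Prop := ∀ a ∈ A, ∀ O : Set ImO, IsOpen O → a ∈ O →
  ∃ (u x τ : R2 → ImO) (t : ℝ), HolFrame u x τ ∧ (∀ p, circ u x p ∈ A) ∧ circ u x (0, t) ∈ O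

theorem HolCovered.exists_lift (hι : IsImmersedInS6 (n := 3) ι) {V U : Set L}
    (he : IsEmbedding (V.domRestrict ι)) (hA : HolCovered (ι '' V)) (hU : IsOpen U)
    (hne : (U ∩ V).Nonempty) : ∃ (u x τ : R2 → ImO) (j : R2 × ℝ → L) (t : ℝ), HolFrame u x τ ∧
      ContMDiff 𝓘(ℝ, R2 × ℝ) (𝓡 3) ∞ j ∧ (∀ p, ι (j p) = circ u x p) ∧ (∀ p, j p ∈ V) ∧
      j (0, t) ∈ U := by
  obtain ⟨m, hmU, hmV⟩ := hne
  obtain ⟨O, hO, hOU⟩ := he.isInducing.isOpen_iff.mp (hU.preimage continuous_subtype_val (X := V))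
  have key : ∀ w : V, ι w ∈ O ↔ (w : L) ∈ U := fun w => by
    change w ∈ V.domRestrict ι ⁻¹' O ↔ w ∈ Subtype.val ⁻¹' U
    rw [hOU]
  obtain ⟨u, x, τ, t, h, hm, ht⟩ := hA _ ⟨m, hmV, rfl⟩ O hO ((key ⟨m, hmV⟩).mpr hmU)
  obtain ⟨j, hj, hjι, hjV⟩ := S6.exists_lift hι he h.isTube.smooth hm
  exact ⟨u, x, τ, j, t, h, hj, hjι, hjV, (key ⟨_, hjV _⟩).mp (by rw [hjι]; exact ht)⟩

namespace HolFrame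
variable {u x τ : R2 → ImO} (h : HolFrame u x τ) (hι : IsImmersedInS6 (n := 3) ι)
  {j : R2 × ℝ → L} (hj : ContMDiff 𝓘(ℝ, R2 × ℝ) (𝓡 3) ∞ j) (hjι : ∀ p, ι (j p) = circ u x p)

include hι hj hjι in
omit [IsManifold (𝓡 3) ∞ L] in
theorem exists_fderiv_eq {p : R2 × ℝ} (hp : Injective (𝒟 (circ u x) p))
    (w : TangentSpace (𝓡 3) (j p)) :
    ∃ ξ, mfderiv (𝓡 3) 𝓘(ℝ, ImO) ι (j p) w = 𝒟 (circ u x) p ξ := by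
  have key : ∀ ξ, 𝒟 (circ u x) p ξ =
      mfderiv (𝓡 3) 𝓘(ℝ, ImO) ι (j p) (mfderiv 𝓘(ℝ, R2 × ℝ) (𝓡 3) j p ξ) := fun ξ => by
    rw [← hι.fderiv_comp hj.contMDiffAt, fun_eq_tube hjι]
  let D : R2 × ℝ →ₗ[ℝ] R3 := (mfderiv 𝓘(ℝ, R2 × ℝ) (𝓡 3) j p : R2 × ℝ →L[ℝ] R3).toLinearMap
  have hD : Injective D := fun ξ ξ' he => hp (by
    rw [key, key]
    exact congrArg (mfderiv (𝓡 3) 𝓘(ℝ, ImO) ι (j p)) he)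
  obtain ⟨ξ, hξ⟩ := (LinearMap.injective_iff_surjective_of_finrank_eq_finrank (by simp)).mp hD w
  refine ⟨ξ, ?_⟩
  rw [key]
  exact congrArg (mfderiv (𝓡 3) 𝓘(ℝ, ImO) ι (j p)) hξ.symm

include h hι hj hjι in
omit [IsManifold (𝓡 3) ∞ L] in
theorem omega_eq_zero {p : R2 × ℝ} (hp : Injective (𝒟 (circ u x) p))
    (v w : TangentSpace (𝓡 3) (j p)) : omega (ι (j p)) (mfderiv (𝓡 3) 𝓘(ℝ, ImO) ι (j p) v)
      (mfderiv (𝓡 3) 𝓘(ℝ, ImO) ι (j p) w) = 0 := by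
  obtain ⟨ξ, hξ⟩ := exists_fderiv_eq hι hj hjι hp v
  obtain ⟨ξ', hξ'⟩ := exists_fderiv_eq hι hj hjι hp w
  rw [hξ, hξ', hjι]
  exact h.inner_cross_fderiv _ _ _

include h hj in
omit [IsManifold (𝓡 3) ∞ L] in
/-- Immersive points near a given point of a circle. -/
theorem exists_injective_mem {d : R2} {t : ℝ} {U : Set L} (hU : IsOpen U) (hm : j (d, t) ∈ U) :
    ∃ t', Injective (𝒟 (circ u x) (d, t')) ∧ j (d, t') ∈ U := by
  have hc : Continuous fun t => j (d, t) := hj.continuous.comp (by fun_prop)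
  obtain ⟨δ, hδ, hb⟩ := Metric.isOpen_iff.mp (hU.preimage hc) t hm
  obtain ⟨t', ht', hi⟩ := h.exists_injective d t hδ
  exact ⟨t', hi, hb (by rwa [mem_ball, Real.dist_eq])⟩

include h hι hj hjι in
/-- Vectors normal to the family are normal to the submanifold, also at the points where the family
is not immersive. -/
theorem inner_eq_zero {N : ImO} {d : R2} (hN : ∀ t ξ, ⟪N, 𝒟 (circ u x) (d, t) ξ⟫ = 0)
    {κ : R3 → L} (hκ : IsParam κ) {t : ℝ} {z : R3} (hz : κ z = j (d, t)) (e : R3) :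
    ⟪N, (𝒟 (fun z => ι (κ z)) z e)⟫ = 0 := by
  obtain ⟨hfs, -⟩ := hι.comp_param hκ
  obtain ⟨k, hk, hkj⟩ := hκ.factor (hj.contMDiffAt (x := (d, t))) ⟨z, hz⟩
  have hkz : k (d, t) = z := hκ.isOpenEmbedding.injective (hkj.self_of_nhds.trans hz.symm)
  by_contra h0
  have hl : ContinuousAt (fun t' : ℝ => (d, t')) t := by fun_prop
  have hc : ContinuousAt (fun t' => ⟪N, (𝒟 (fun z => ι (κ z)) (k (d, t')) e)⟫) t := by
    have h1 : Continuous (fun z => ⟪N, (𝒟 (fun z => ι (κ z)) z e)⟫) :=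
      continuous_const.inner ((hfs.continuous_fderiv (by simp)).clm_apply continuous_const)
    exact ContinuousAt.comp (g := fun z => ⟪N, (𝒟 (fun z => ι (κ z)) z e)⟫)
      h1.continuousAt (ContinuousAt.comp (g := k) hk.continuousAt hl)
  have hne := hc.eventually_ne (by rw [hkz]; exact h0)
  obtain ⟨δ, hδ, hb⟩ := eventually_nhds_iff_ball.mp (hne.and (hl.eventually hkj))
  obtain ⟨t', ht', hi⟩ := h.exists_injective d t hδ
  obtain ⟨b1, b2⟩ := hb t' (by rwa [mem_ball, Real.dist_eq])
  apply b1
  rw [hι.fderiv_comp hκ.smooth.contMDiffAt]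
  have := fun w => exists_fderiv_eq hι hj hjι hi w
  rw [← b2] at this
  obtain ⟨ξ, hξ⟩ := this (mfderiv 𝓘(ℝ, R3) (𝓡 3) κ (k (d, t')) e)
  rw [hξ]
  exact hN t' ξ

include h in
theorem inner_u (d : R2) (t : ℝ) (ξ : R2 × ℝ) :
    ⟪u d, 𝒟 (circ u x) (d, t) ξ⟫ = 0 := by
  obtain ⟨ω', A, B, C, -, -, hv⟩ := h.exists_coord d
  obtain ⟨v, s⟩ := ξ
  rw [h.fderiv_circ, inner_add_right, (hv t v).1, inner_smul_right, real_inner_comm,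
    inner_cross_left_self]; simp

include h in
theorem inner_t {d : R2} (hd : ¬ Good x (fun d => cross (u d) (x d)) d) (t : ℝ) (ξ : R2 × ℝ) :
    ⟪τ d, 𝒟 (circ u x) (d, t) ξ⟫ = 0 := by
  obtain ⟨v, s⟩ := ξ
  have h1 : ⟪τ d, 𝒟 (circ u x) (d, t) (v, 0)⟫ = 0 :=
    congrArg Complex.re ((h.of_not_good hd).1 t v)
  rw [h.fderiv_circ, inner_add_right, h1, inner_smul_right, real_inner_comm, (h.triple_circ d t).phi]
  simp

include h hι hj hjι in
/-- Where no circle is immersive, `τ` moves in the span of `u`, `τ` and `u × τ`. -/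
theorem exists_fderiv_t (hl : IsLagrangian ι) {O : Set R2} (hO : IsOpen O)
    (hbad : ∀ d ∈ O, ¬ Good x (fun d => cross (u d) (x d)) d) {d : R2} (hd : d ∈ O) (v : R2) :
    ∃ a b c : ℝ, 𝒟 τ d v = a • u d + b • τ d + c • cross (u d) (τ d) := by
  obtain ⟨t, ht⟩ := (h.of_not_good (hbad d hd)).2
  obtain ⟨s, hs⟩ := ht v
  obtain ⟨κ, hκ, hκ0, -⟩ := exists_param (n := 3) (j (d, t)) univ_mem
  obtain ⟨hfs, hfi⟩ := hι.comp_param hκ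
  obtain ⟨k, hk, hkj⟩ := hκ.factor (hj.contMDiffAt (x := (d, t))) ⟨0, hκ0⟩
  have hkz : k (d, t) = 0 := hκ.isOpenEmbedding.injective (hkj.self_of_nhds.trans hκ0.symm)
  have hp := hl.patch_param hι hκ
  set f : R3 → ImO := fun z => ι (κ z) with hf
  have hkd : DifferentiableAt ℝ k (d, t) := hk.differentiableAt (by simp)
  have hdk : 𝒟 k (d, t) (v, s) = 0 := by
    apply hfi (k (d, t))
    have h1 : circ u x =ᶠ[𝓝 (d, t)] f ∘ k := by
      filter_upwards [hkj] with q hq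
      simp only [hf, Function.comp_apply, hq, hjι]
    have h2 := hs
    rw [h1.fderiv_eq, fderiv_comp _ (hfs.diff _) hkd] at h2
    rw [map_zero]
    exact h2
  have hτd : DifferentiableAt ℝ (fun q : R2 × ℝ => τ q.1) (d, t) :=
    (h.smooth_t.comp contDiff_fst).diff _
  have hdτ : 𝒟 (fun q : R2 × ℝ => τ q.1) (d, t) (v, s) = 𝒟 τ d v := by
    have : HasFDerivAt (fun q : R2 × ℝ => τ q.1)
        ((𝒟 τ d).comp (ContinuousLinearMap.fst ℝ R2 ℝ)) (d, t) :=
      ((h.smooth_t.diff d).hasFDerivAt).comp (d, t) hasFDerivAt_fst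
    rw [this.fderiv]; rfl
  have htr := h.triple_circ d t
  have k1 : ⟪𝒟 τ d v, circ u x (d, t)⟫ = 0 := by
    have := inner_fderiv_add hτd (h.isTube.smooth.diff (d, t)) (c := 0)
      (.of_forall fun q => by rw [real_inner_comm]; exact (h.triple_circ q.1 q.2).xt) (v, s)
    rwa [hdτ, hs, inner_zero_right, add_zero] at this
  have k2 : ∀ e, ⟪𝒟 τ d v, 𝒟 f 0 e⟫ = 0 := by
    intro e
    have hG : Smooth (fun z => 𝒟 f z e) := contDiff_fderiv_apply hfs e
    have hGd := hG.diff (k (d, t))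
    have h1 : ∀ᶠ q in 𝓝 (d, t), ⟪τ q.1, 𝒟 f (k q) e⟫ = 0 := by
      filter_upwards [hkj, (hO.preimage continuous_fst).mem_nhds (show (d, t).1 ∈ O from hd)]
        with q hq hqO
      exact h.inner_eq_zero hι hj hjι (h.inner_t (hbad _ hqO)) hκ hq e
    have h2 := inner_fderiv_add hτd (hGd.comp (d, t) hkd) h1 (v, s)
    rw [fderiv_comp _ hGd hkd, hdτ, ContinuousLinearMap.comp_apply, hdk, map_zero,
      inner_zero_right, add_zero] at h2
    simpa [hkz] using h2
  have hf0 : f 0 = circ u x (d, t) := by simp only [hf, hκ0, hjι]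
  obtain ⟨hφ, hfr⟩ := hp.coassociative (by simp) 0
  have hK : ∀ {N : ImO}, ⟪N, circ u x (d, t)⟫ = 0 → (∀ e, ⟪N, 𝒟 f 0 e⟫ = 0) →
      ∀ q ∈ tang f 0, ⟪N, q⟫ = 0 := by
    intro N h1 h2 q hq
    obtain ⟨a, w, rfl⟩ := mem_tang.mp hq
    rw [inner_add_right, inner_smul_right, hf0, h1, h2]; simp
  have hu := hK htr.ux (h.inner_eq_zero hι hj hjι (h.inner_u d) hκ hκ0)
  have hτ := hK (inner_eq_zero_symm.1 htr.xt)
    (h.inner_eq_zero hι hj hjι (h.inner_t (hbad d hd)) hκ hκ0)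
  have hperp := hK k1 k2
  have m1 : circ u x (d, t) ∈ tang f 0 := mem_tang.mpr ⟨1, 0, by simp [hf0]⟩
  have m2 := hφ.cross_mem hfr hu m1
  have m3 : cross (circ u x (d, t)) (τ d) ∈ tang f 0 := by
    rw [cross_anticomm]; exact Submodule.neg_mem _ (hφ.cross_mem hfr hτ m1)
  have m4 := hφ.cross_mem hfr hu m3
  have := frame_expand htr.norm_u htr.norm_x htr.norm_t htr.ux htr.ut htr.xt htr.phi (𝒟 τ d v)
  rw [real_inner_comm _ (circ u x (d, t)), hperp _ m1, real_inner_comm _ (cross (u d) (circ u x (d, t))),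
    hperp _ m2, real_inner_comm _ (cross (circ u x (d, t)) (τ d)), hperp _ m3,
    real_inner_comm _ (cross (u d) (cross (circ u x (d, t)) (τ d))), hperp _ m4] at this
  simp only [zero_smul, add_zero] at this
  exact ⟨_, _, _, this⟩

include h hι hj hjι in
/-- If no circle over an open set is immersive, then the submanifold lies in a 3-sphere. -/
theorem exists_submodule_of_bad [ConnectedSpace L] (hl : IsLagrangian ι) {O : Set R2} (hO : IsOpen O)
    (hbad : ∀ d ∈ O, ¬ Good x (fun d => cross (u d) (x d)) d) {d : R2} (hd : d ∈ O) :
    ∃ P : Submodule ℝ ImO, Module.finrank ℝ P = 4 ∧ ∀ m, ι m ∈ P := by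
  obtain ⟨r, hr, hrO⟩ := Metric.isOpen_iff.mp hO d hd
  have hφs : Smooth (ub d r) := smooth_ub d r
  have hφ : ∀ z, ub d r z ∈ O := fun z => hrO (ub_mem d hr z)
  have hcomp : ∀ {f : R2 → ImO}, Smooth f → ∀ z v,
      𝒟 (fun z => f (ub d r z)) z v = 𝒟 f (ub d r z) (𝒟 (ub d r) z v) := by
    intro f hf z v
    change 𝒟 (f ∘ ub d r) z v = _
    rw [fderiv_comp _ (hf.diff _) (hφs.diff _)]; rfl
  obtain ⟨P, hP, hPm⟩ := const_plane_unit (u := fun z => u (ub d r z)) (τ := fun z => τ (ub d r z))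
    (h.smooth_u.comp hφs) (h.smooth_t.comp hφs) (fun z => (h.triple _).norm_u)
    (fun z => (h.triple _).norm_t) (fun z => (h.triple _).ut)
    (fun z v => by
      obtain ⟨ψ, A, B, C, -, -, hv⟩ := h.hol (ub d r z)
      rw [hcomp h.smooth_u, (hv _).1]
      exact ⟨0, _, _, by rw [zero_smul, zero_add]⟩)
    (fun z v => by
      rw [hcomp h.smooth_t]
      exact h.exists_fderiv_t hι hj hjι hl hO hbad (hφ z) _)
  have hmem : ∀ d' ∈ ball d r, ∀ t, circ u x (d', t) ∈ P := by
    intro d' hd' t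
    rw [← (isParam_ub d hr).2] at hd'
    obtain ⟨z, rfl⟩ := hd'
    have htr := h.triple_circ (ub d r z) t
    refine hPm z _ htr.ux (inner_eq_zero_symm.1 htr.xt) ?_
    rw [inner_cross_swap', htr.phi, neg_zero]
  obtain ⟨t', hi, -⟩ := h.exists_injective_mem hj isOpen_univ (mem_univ (j (d, 0)))
  have hmap := (local_inverse_of_immersion hι (hj.contMDiffAt (x := (d, t')))
    (by rw [fun_eq_tube hjι]; exact hi) finrank_R2R).1
  have hev : ∀ᶠ m in 𝓝 (j (d, t')), ι m ∈ P := by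
    rw [← hmap, eventually_map]
    filter_upwards [(isOpen_ball.preimage continuous_fst).mem_nhds
      (show (d, t').1 ∈ ball d r from mem_ball_self hr)] with q hq
    rw [hjι]
    exact hmem _ hq _
  obtain ⟨U, hUs, hU, hmU⟩ := mem_nhds_iff.mp hev
  exact ⟨P, hP, hl.mem_of_open hι hU ⟨_, hmU⟩ fun m hm => hUs hm⟩

end HolFrame

theorem LocallyOnDense.isLagrangian {P : Set ImO → Prop} (hι : IsImmersedInS6 (n := 3) ι)
    (hP : ∀ A, P A → HolCovered A) (hd : LocallyOnDense ι P) : IsLagrangian ι := by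
  refine IsLagrangian.of_dense hι (dense_iff_inter_open.mpr fun U hU hne => ?_)
  obtain ⟨V, hV, hne⟩ := locallyOnDense_iff.mp hd U hU hne
  obtain ⟨u, x, τ, j, t, h, hj, hjι, hjV, hm⟩ := (hP _ hV.type).exists_lift hι hV.emb hU hne
  obtain ⟨t', hi, hm'⟩ := h.exists_injective_mem hj hU hm
  exact ⟨_, hm', fun v w => h.omega_eq_zero hι hj hjι hi v w⟩

/-- A Lagrangian piece covered by framed families contains ruled charts. -/
theorem HolCovered.exists_ruledChart [ConnectedSpace L] (hl : IsLagrangian ι)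
    (hι : IsImmersedInS6 (n := 3) ι) {V U : Set L} (hV : IsOpen V)
    (he : IsEmbedding (V.domRestrict ι)) (hA : HolCovered (ι '' V)) (hU : IsOpen U)
    (hne : (U ∩ V).Nonempty) : ∃ x e j, RuledChart ι x e j ∧ (U ∩ range j).Nonempty := by
  obtain ⟨u, x, τ, j, t, h, hj, hjι, hjV, hm⟩ := hA.exists_lift hι he hU hne
  have hinj : ∀ {m : L} {p : R2 × ℝ}, m ∈ V → ι m = circ u x p → m = j p := fun hm h =>
    congrArg Subtype.val (he.injective (a₁ := ⟨_, hm⟩) (a₂ := ⟨_, hjV _⟩)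
      (by change ι _ = ι _; rw [h, hjι]))
  have hcm : ∀ p, circ u x p ∈ ι '' V := fun p => ⟨j p, hjV p, hjι p⟩
  set O : Set R2 := (fun d => j (d, t)) ⁻¹' U
  have hO : IsOpen O := hU.preimage (hj.continuous.comp (by fun_prop))
  by_cases hg : ∃ d ∈ O, Good x (fun d => cross (u d) (x d)) d
  · obtain ⟨d, hd, hg⟩ := hg
    obtain ⟨r, hr, hc⟩ := exists_ruledChart_of_mem hι he h.isTube hcm hg
    obtain ⟨j', hj', hj'V⟩ := hc r hr le_rfl
    refine ⟨_, _, j', hj', j' (0, t), ?_, mem_range_self _⟩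
    rw [hinj (p := (d, t)) (hj'V (mem_range_self _)) (by rw [hj'.eq, tube_comp, ub_zero])]
    exact hd
  · push Not at hg
    obtain ⟨P, hP, hPm⟩ := h.exists_submodule_of_bad hι hj hjι hl hO hg (d := 0) hm
    have ht := h.isTube
    obtain ⟨x', e', j', hj', hj'V, -, hx', he'⟩ := exists_ruledChart_of_sphere hl hι hV he hP
      (fun m _ => hPm m) (ht.norm_x 0) (ht.norm_e 0) (ht.perp 0) fun t => hcm (0, t)
    refine ⟨x', e', j', hj', j' (0, t), ?_, mem_range_self _⟩
    rw [hinj (p := (0, t)) (hj'V (mem_range_self _)) (by rw [hj'.eq, tube, hx', he']; rfl)]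
    exact hm

theorem isGenericallyLocallyRuled_of_charts (hι : IsImmersedInS6 (n := 3) ι)
    (h : ∀ U : Set L, IsOpen U → U.Nonempty → ∃ x e j, RuledChart ι x e j ∧ (U ∩ range j).Nonempty) :
    IsGenericallyLocallyRuled ι := by
  refine ⟨⋃₀ {W | ∃ x e j, RuledChart ι x e j ∧ W = range j}, isOpen_sUnion ?_,
    dense_iff_inter_open.mpr fun U hU hne => ?_, ?_⟩
  · rintro _ ⟨x, e, j, hc, rfl⟩
    exact hc.isOpen_range hι
  · obtain ⟨x, e, j, hc, m, hmU, hm⟩ := h U hU hne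
    exact ⟨m, hmU, _, ⟨x, e, j, hc, rfl⟩, hm⟩
  · rintro m ⟨_, ⟨x, e, j, hc, rfl⟩, hm⟩
    exact ⟨_, hm, hc.isRuled hι⟩

end

/-! ### Holomorphic curves in `𝒳(Σ)` and framed families -/

theorem eq_coord_of_mem_range {Λ : R2 →ₗ[ℝ] ImO} {p τ : ImO} (hp : ‖p‖ = 1) (hτ : ‖τ‖ = 1)
    (hpτ : ⟪p, τ⟫ = 0) (h1 : ∃ a, Λ a = τ) (h2 : ∃ b, Λ b = cross p τ) (v : R2) :
    Λ v = ⟪τ, Λ v⟫ • τ + ⟪cross p τ, Λ v⟫ • cross p τ := by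
  obtain ⟨a, ha⟩ := h1
  obtain ⟨b, hb⟩ := h2
  have e1 : ⟪τ, τ⟫ = 1 := inner_self_of_norm_one hτ
  have e2 : ⟪cross p τ, τ⟫ = 0 := inner_cross_right_self _ _
  have e3 : ⟪cross p τ, cross p τ⟫ = 1 := inner_self_of_norm_one ((cross_of_orthonormal hp hτ hpτ).1)
  have key : ∀ s t : ℝ, ⟪τ, s • τ + t • cross p τ⟫ = s ∧
      ⟪cross p τ, s • τ + t • cross p τ⟫ = t := fun s t => by
    simp only [inner_add_right, inner_smul_right, e1, e2, e3, real_inner_comm (cross p τ) τ]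
    constructor <;> ring
  have hli : LinearIndependent ℝ ![a, b] := by
    rw [LinearIndependent.pair_iff]
    intro s t hst
    have := congrArg Λ hst
    rw [map_add, map_smul, map_smul, ha, hb, map_zero] at this
    obtain ⟨k1, k2⟩ := key s t
    rw [this, inner_zero_right] at k1 k2
    exact ⟨k1.symm, k2.symm⟩
  have hv : v ∈ Submodule.span ℝ (range ![a, b]) := by
    rw [hli.span_eq_top_of_card_eq_finrank (by simp)]; trivial
  rw [Matrix.range_cons_cons_empty, Submodule.mem_span_pair] at hv
  obtain ⟨s, t, rfl⟩ := hv
  rw [map_add, map_smul, map_smul, ha, hb, (key s t).1, (key s t).2]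

/-- The normal components of the second derivative of a pseudoholomorphic curve. -/
theorem coordC_second {f X : R2 → ImO} {g : R2 → R2} {d : R2} {τ : ImO} (hf : Smooth f)
    (hg : DifferentiableAt ℝ g d) (hX : DifferentiableAt ℝ X d) (hn : ‖f (g d)‖ = 1)
    (hfX : ⟪f (g d), X d⟫ = 0) (hfτ : ⟪f (g d), τ⟫ = 0)
    (h1 : ∀ᶠ d' in 𝓝 d, ∀ v, ⟪X d', 𝒟 f (g d') v⟫ = 0 ∧
      ⟪cross (f (g d')) (X d'), 𝒟 f (g d') v⟫ = 0)
    (hτ : ∀ v, 𝒟 f (g d) v = ⟪τ, 𝒟 f (g d) v⟫ • τ +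
      ⟪cross (f (g d)) τ, 𝒟 f (g d) v⟫ • cross (f (g d)) τ) (w v : R2) :
    coordC (f (g d)) (X d) (𝒟 (fun z => 𝒟 f z v) (g d) (𝒟 g d w)) =
      -(conj (coordC (f (g d)) τ (𝒟 X d w)) * coordC (f (g d)) τ (𝒟 f (g d) v)) := by
  have df : DifferentiableAt ℝ f (g d) := hf.diff _
  have dD : DifferentiableAt ℝ (fun z => 𝒟 f z v) (g d) :=
    (contDiff_fderiv_apply hf v).diff _
  have dfg : DifferentiableAt ℝ (fun d => f (g d)) d := df.comp d hg
  have e1 : 𝒟 (fun d => 𝒟 f (g d) v) d w =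
      𝒟 (fun z => 𝒟 f z v) (g d) (𝒟 g d w) :=
    congrArg (fun T : R2 →L[ℝ] ImO => T w) (fderiv_comp d dD hg)
  have e2 : 𝒟 (fun d => f (g d)) d w = 𝒟 f (g d) (𝒟 g d w) :=
    congrArg (fun T : R2 →L[ℝ] ImO => T w) (fderiv_comp d df hg)
  have dJX : DifferentiableAt ℝ (fun d => cross (f (g d)) (X d)) d :=
    (crossB.hasFDerivAt_of_bilinear dfg.hasFDerivAt hX.hasFDerivAt).differentiableAt
  have k1 := inner_fderiv_add hX (dD.comp d hg) (h1.mono fun d' h => (h v).1) w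
  have k2 := inner_fderiv_add dJX (dD.comp d hg) (h1.mono fun d' h => (h v).2) w
  simp only [Function.comp_def] at k1 k2
  rw [e1] at k1 k2
  rw [fderiv_cross dfg hX, e2, hτ (𝒟 g d w), hτ v] at k2
  rw [hτ v] at k1
  unfold coordC
  have t1 : cross (cross (f (g d)) τ) τ = -⟪τ, τ⟫ • f (g d) := by
    rw [cross_anticomm, cross_anticomm (f (g d)), cross_neg_right, cross_cross_self,
      real_inner_comm, hfτ]
    module
  have t2 : ⟪cross τ (X d), cross (f (g d)) τ⟫ = 0 := by
    rw [inner_cross_cyclic, inner_cross_cyclic, t1, inner_smul_left, hfX, mul_zero]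
  have t3 : cross (f (g d)) (cross (f (g d)) τ) = -τ := by
    rw [cross_cross_self, hfτ, real_inner_self_eq_norm_sq, hn]; module
  have t4 : ⟪cross (cross (f (g d)) τ) (X d), τ⟫ = 0 := by
    rw [inner_cross_cyclic, inner_cross_swap, t2, neg_zero]
  have t5 : ⟪cross (f (g d)) (𝒟 X d w), cross (f (g d)) τ⟫ =
      ⟪τ, 𝒟 X d w⟫ := by
    rw [inner_cross_swap', t3, inner_neg_left, neg_neg]
  simp only [cross_add_left, cross_smul_left, inner_add_left, inner_add_right, inner_smul_left,
    inner_smul_right, conj_trivial, inner_cross_left_self, t2, t4, t5,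
    inner_cross_swap' (f (g d)) (𝒟 X d w) τ] at k2
  simp only [inner_add_right, inner_smul_right, real_inner_comm τ,
    real_inner_comm (cross (f (g d)) τ)] at k1
  apply Complex.ext <;> simp <;> linarith

theorem IsAdaptedFrame.exists_triple {S : Surface} {u : S → ImO} {p : S} {f : Fin 3 → ImOC}
    (hu : ‖u p‖ = 1) (h : IsAdaptedFrame u p f) :
    ∃ x τ, IsG2Triple (u p) x τ ∧ f = frameOf (u p) x τ ∧ ∃ a, dmap u p a = τ := by
  have key : ∀ j, ∃ a, f j = cz a (cross (u p) a) ∧ ‖a‖ = 1 ∧ ⟪u p, a⟫ = 0 := fun j => by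
    obtain ⟨a, b, hab⟩ := exists_cz (f j)
    have h1 := h.type_one_zero j
    rw [hab, crossCoord_toC_cz, I_smul_cz, cz_inj] at h1
    obtain ⟨rfl, h2⟩ := h1
    have h3 : ⟪u p, a⟫ = 0 := by
      have := congrArg (inner ℝ (u p)) h2
      rw [real_inner_comm, inner_cross_left_self, inner_neg_right] at this
      linarith
    have h4 := congrArg Complex.re (h.unitary j j)
    rw [hab, dot_cz, inner_cross_cross, h3, real_inner_self_eq_norm_sq, real_inner_self_eq_norm_sq,
      hu] at h4
    refine ⟨a, hab, ?_, h3⟩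
    have : ‖a‖ ^ 2 = 1 := by norm_num at h4; linarith
    nlinarith [norm_nonneg a]
  have orth : ∀ {j k : Fin 3} {a b : ImO}, j ≠ k → f j = cz a (cross (u p) a) →
      f k = cz b (cross (u p) b) → ⟪u p, a⟫ = 0 → ⟪a, b⟫ = 0 ∧
      ⟪cross (u p) a, b⟫ = 0 := fun {j k a b} hjk ha hb hua => by
    have h1 := h.unitary j k
    rw [if_neg hjk, ha, hb, dot_cz, inner_cross_cross, hua, real_inner_self_eq_norm_sq, hu,
      real_inner_comm (cross (u p) b), inner_cross_swap', real_inner_comm b] at h1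
    have h2 := congrArg Complex.re h1
    have h3 := congrArg Complex.im h1
    simp at h2 h3
    rw [real_inner_comm] at h2
    constructor <;> linarith
  obtain ⟨τ, h0, hτ, huτ⟩ := key 0
  obtain ⟨y, h1, hy, huy⟩ := key 1
  obtain ⟨x, h2, hx, hux⟩ := key 2
  obtain ⟨o1, o2⟩ := orth (j := 2) (k := 0) (by decide) h2 h0 hux
  obtain ⟨o3, o4⟩ := orth (j := 2) (k := 1) (by decide) h2 h1 hux
  obtain ⟨o5, o6⟩ := orth (j := 0) (k := 1) (by decide) h0 h1 huτ
  have htr : IsG2Triple (u p) x τ := ⟨hu, hx, hτ, hux, huτ, o1, o2⟩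
  have hyx : y = cross x τ := by
    have hs := h.special
    rw [h0, h1, h2, crossCoord_cz, star_cz, ← half_cz (a := x),
      (smul_right_injective _ (by norm_num : (1 / 2 : ℂ) ≠ 0)).eq_iff, cz_inj] at hs
    obtain ⟨s1, s2⟩ := hs
    obtain ⟨Ψ, hΨ, k0, k1, k2, k3, k4, k5, k6⟩ := htr.exists_frame
    obtain ⟨α, rfl⟩ := Ψ.surjective y
    rw [k2] at o4 s2
    rw [k4] at o6 s1 s2
    rw [k0] at huy s1 s2
    rw [k1] at o3 s1
    rw [k3] at o5 s1 s2
    rw [k5]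
    simp only [hΨ _ _, ← map_add, ← map_smul, ← map_sub, ← map_neg, Ψ.inner_map_map, inner_eps,
      Ψ.injective.eq_iff] at *
    have t1 := congrArg (fun v : ImO => v 1) s1
    have t2 := congrArg (fun v : ImO => v 2) s1
    simp [cross_apply, crossCoord, eps] at t1 t2
    ext i
    fin_cases i <;> simp [eps, *] <;> linarith
  refine ⟨x, τ, htr, ?_, ?_⟩
  · funext j
    fin_cases j
    · exact h0
    · exact h1.trans (by rw [hyx]; rfl)
    · exact h2
  · obtain ⟨a, ha⟩ := h.tangent
    exact ⟨a, (cz_inj.mp (h0.symm.trans ha)).1.symm⟩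

/-- Two real linear forms that are complex linear for a common complex structure. -/
theorem exists_complex_coordinate {α β : R2 →ₗ[ℝ] ℂ} (h0 : ∀ v, α v = 0 → β v = 0 → v = 0)
    (hJ : ∀ v, ∃ w, α w = Complex.I * α v ∧ β w = Complex.I * β v) :
    ∃ (ψ : R2 →ₗ[ℝ] ℂ) (a b : ℂ), Injective ψ ∧ ∀ v, α v = a * ψ v ∧ β v = b * ψ v := by
  obtain ⟨v, hv⟩ := exists_ne (0 : R2)
  obtain ⟨w, hw1, hw2⟩ := hJ v
  have hne : α v ≠ 0 ∨ β v ≠ 0 := by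
    by_contra hc; push Not at hc; exact hv (h0 v hc.1 hc.2)
  have hli : LinearIndependent ℝ ![v, w] := by
    rw [LinearIndependent.pair_iff]
    intro s t hst
    have e1 := congrArg α hst
    have e2 := congrArg β hst
    rw [map_add, map_smul, map_smul, hw1, map_zero] at e1
    rw [map_add, map_smul, map_smul, hw2, map_zero] at e2
    have e3 : (⟨s, t⟩ : ℂ) * α v = 0 := by
      rw [← e1]; apply Complex.ext <;> simp <;> ring
    have e4 : (⟨s, t⟩ : ℂ) * β v = 0 := by
      rw [← e2]; apply Complex.ext <;> simp <;> ring
    have : (⟨s, t⟩ : ℂ) = 0 := by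
      rcases hne with h | h
      · exact (mul_eq_zero.mp e3).resolve_right h
      · exact (mul_eq_zero.mp e4).resolve_right h
    exact ⟨congrArg Complex.re this, congrArg Complex.im this⟩
  have hsp : ∀ ξ : R2, ∃ z : ℂ, α ξ = α v * z ∧ β ξ = β v * z := fun ξ => by
    have hv : ξ ∈ Submodule.span ℝ (range ![v, w]) := by
      rw [hli.span_eq_top_of_card_eq_finrank (by simp)]; trivial
    rw [Matrix.range_cons_cons_empty, Submodule.mem_span_pair] at hv
    obtain ⟨s, t, rfl⟩ := hv
    refine ⟨⟨s, t⟩, ?_, ?_⟩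
    · rw [map_add, map_smul, map_smul, hw1]; apply Complex.ext <;> simp <;> ring
    · rw [map_add, map_smul, map_smul, hw2]; apply Complex.ext <;> simp <;> ring
  obtain ⟨χ, hχ⟩ : ∃ χ : R2 →ₗ[ℝ] ℂ, ∀ ξ z, α ξ = α v * z → β ξ = β v * z → χ ξ = z := by
    rcases hne with h | h
    · exact ⟨(LinearMap.mulLeft ℝ (α v)⁻¹).comp α, fun ξ z h1 _ => by simp [h1, h]⟩
    · exact ⟨(LinearMap.mulLeft ℝ (β v)⁻¹).comp β, fun ξ z _ h1 => by simp [h1, h]⟩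
  have hall : ∀ ξ, α ξ = α v * χ ξ ∧ β ξ = β v * χ ξ := fun ξ => by
    obtain ⟨z, h1, h2⟩ := hsp ξ
    rw [hχ ξ z h1 h2]; exact ⟨h1, h2⟩
  refine ⟨χ, α v, β v, ?_, hall⟩
  rw [← LinearMap.ker_eq_bot, LinearMap.ker_eq_bot']
  intro ξ hξ
  exact h0 ξ (by rw [(hall ξ).1, hξ, mul_zero]) (by rw [(hall ξ).2, hξ, mul_zero])

/-- `coordC` as a linear map. -/
def coordL (u a : ImO) : ImO →ₗ[ℝ] ℂ where
  toFun := coordC u a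
  map_add' v w := by apply Complex.ext <;> simp [coordC, inner_add_right]
  map_smul' r v := by apply Complex.ext <;> simp [coordC, inner_smul_right]

theorem IsPseudoholomorphic.dmap_eq {S : Surface} {u : S → ImO} (hu : IsPseudoholomorphic u) {p : S}
    {x τ : ImO} (htr : IsG2Triple (u p) x τ) (hτ : ∃ a, dmap u p a = τ) (v : R2) :
    dmap u p v = (coordC (u p) τ (dmap u p v)).re • τ +
      (coordC (u p) τ (dmap u p v)).im • cross (u p) τ := by
  refine eq_coord_of_mem_range (Λ := (dmap u p).toLinearMap) htr.norm_u htr.norm_t htr.ut hτ ?_ v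
  obtain ⟨a, rfl⟩ := hτ
  exact hu.tangent p a

theorem IsG2Triple.inner_tangent {u x τ : ImO} (h : IsG2Triple u x τ) (c : ℂ) :
    ⟪x, c.re • τ + c.im • cross u τ⟫ = 0 ∧
      ⟪cross u x, c.re • τ + c.im • cross u τ⟫ = 0 := by
  have e : ⟪x, cross u τ⟫ = 0 := by
    rw [real_inner_comm, inner_cross_swap', h.phi, neg_zero]
  simp only [inner_add_right, inner_smul_right, h.xt, h.phi, e, inner_cross_cross, h.ux, h.ut]
  constructor <;> ring

theorem IsPseudoholomorphic.coordC_facts {S : Surface} {u : S → ImO} (hu : IsPseudoholomorphic u)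
    {g : R2 → S} (hg : ContMDiff (𝓡 2) (𝓡 2) ∞ g) {x τ : R2 → ImO} (hx : Smooth x)
    (htr : ∀ d, IsG2Triple (u (g d)) (x d) (τ d)) (hτ : ∀ d, ∃ a, dmap u (g d) a = τ d) (d : R2) :
    (∀ v, 𝒟 (fun d => u (g d)) d v =
      (coordC (u (g d)) (τ d) (𝒟 (fun d => u (g d)) d v)).re • τ d +
      (coordC (u (g d)) (τ d) (𝒟 (fun d => u (g d)) d v)).im • cross (u (g d)) (τ d)) ∧
    ∃ A, ∀ v, coordC (u (g d)) (τ d) (𝒟 x d v) =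
      A * conj (coordC (u (g d)) (τ d) (𝒟 (fun d => u (g d)) d v)) := by
  have hum : ∀ p, MDifferentiableAt (𝓡 2) 𝓘(ℝ, ImO) u p := fun p =>
    hu.immersed.smooth.mdifferentiableAt (by simp)
  have hU : ∀ v, ∃ w, 𝒟 (fun d => u (g d)) d v = dmap u (g d) w := fun v =>
    ⟨_, fderiv_comp_mfld (hum _) (hg.mdifferentiableAt (by simp)) v⟩
  have hUeq : ∀ v, 𝒟 (fun d => u (g d)) d v =
      (coordC (u (g d)) (τ d) (𝒟 (fun d => u (g d)) d v)).re • τ d +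
      (coordC (u (g d)) (τ d) (𝒟 (fun d => u (g d)) d v)).im • cross (u (g d)) (τ d) := fun v => by
    obtain ⟨w, hw⟩ := hU v
    rw [hw]; exact hu.dmap_eq (htr d) (hτ d) w
  refine ⟨hUeq, ?_⟩
  obtain ⟨κ, hκ, h0, -⟩ := exists_param (n := 2) (g d) univ_mem
  obtain ⟨h, hh, he⟩ := hκ.factor (j := g) (p := d) hg.contMDiffAt ⟨0, h0⟩
  obtain ⟨hf, hfi⟩ := hu.immersed.comp_param hκ
  set f := fun z => u (κ z) with hfdef
  have hhd := hh.differentiableAt (by simp)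
  have hfd : ∀ z v, ∃ w, 𝒟 f z v = dmap u (κ z) w := fun z v =>
    ⟨_, fderiv_comp_mfld (hum _) (hκ.smooth.mdifferentiableAt (by simp)) v⟩
  have hgd : κ (h d) = g d := he.self_of_nhds
  have hfh : f (h d) = u (g d) := congrArg u hgd
  have key : ∀ v, 𝒟 f (h d) v = (coordC (f (h d)) (τ d) (𝒟 f (h d) v)).re • τ d +
      (coordC (f (h d)) (τ d) (𝒟 f (h d) v)).im • cross (f (h d)) (τ d) := fun v => by
    obtain ⟨w, hw⟩ := hfd (h d) v
    rw [hw, hfh, hgd]; exact hu.dmap_eq (htr d) (hτ d) w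
  have hch : ∀ w, 𝒟 (fun d => u (g d)) d w = 𝒟 f (h d) (𝒟 h d w) := fun w => by
    have e1 : (fun d => u (g d)) =ᶠ[𝓝 d] f ∘ h := by
      filter_upwards [he] with q hq
      exact congrArg u hq.symm
    rw [e1.fderiv_eq, fderiv_comp d (hf.diff _) hhd]; rfl
  have sec := coordC_second (f := f) (X := x) (g := h) (d := d) (τ := τ d) hf hhd
    (hx.diff d) (hfh ▸ (htr d).norm_u) (hfh ▸ (htr d).ux) (hfh ▸ (htr d).ut)
    (by
      filter_upwards [he] with q hq v
      obtain ⟨w, hw⟩ := hfd (h q) v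
      rw [hw, show f (h q) = u (g q) from congrArg u hq, hq, hu.dmap_eq (htr q) (hτ q) w]
      exact (htr q).inner_tangent _) key
  set a := fun v => coordC (u (g d)) (τ d) (𝒟 x d v)
  set c := fun v => coordC (u (g d)) (τ d) (𝒟 (fun d => u (g d)) d v)
  rw [hfh] at sec
  have symm : ∀ w w', conj (a w) * c w' = conj (a w') * c w := fun w w' => by
    have s1 := sec w (𝒟 h d w')
    rw [fderiv_fderiv_symm hf.contDiffAt, sec w' (𝒟 h d w), ← hch, ← hch] at s1
    exact (neg_injective s1).symm
  by_cases hc : ∃ w, c w ≠ 0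
  · obtain ⟨w, hw⟩ := hc
    refine ⟨a w / conj (c w), fun v => ?_⟩
    have := congrArg conj (symm v w)
    simp only [map_mul, Complex.conj_conj] at this
    have hw' : conj (c w) ≠ 0 := (map_ne_zero _).mpr hw
    change a v = _ * conj (c v)
    field_simp
    exact this
  · push Not at hc
    refine ⟨0, fun v => ?_⟩
    have hv : 𝒟 h d v = 0 := by
      apply hfi (h d)
      have h1 := hUeq v
      rw [show coordC (u (g d)) (τ d) (𝒟 (fun d => u (g d)) d v) = 0 from hc v] at h1
      rw [← hch, h1, map_zero]
      simp
    obtain ⟨v', hv'⟩ := exists_ne (0 : R2)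
    have s1 := sec v v'
    rw [hv, map_zero, show coordC (u (g d)) (x d) 0 = 0 by simp [coordC]; rfl, eq_comm, neg_eq_zero,
      mul_eq_zero, map_eq_zero] at s1
    rw [zero_mul]
    refine s1.resolve_right fun h1 => hv' (hfi (h d) ?_)
    rw [key v', hfh, h1, map_zero]
    simp

theorem IsL6.holCovered {A : Set ImO} (h : IsL6 A) : HolCovered A := by
  obtain ⟨S, u, G, γ, hu, hγ, rfl⟩ := h
  rintro a ⟨q, b, hb, ha⟩ O hO haO
  have hps := hu.pseudoholomorphic
  obtain ⟨W, F, hW, hq, hpt, hfr, hF⟩ := hγ q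
  obtain ⟨σ, hσ, rfl, hr⟩ := exists_param (n := 2) q (hW.mem_nhds hq)
  have hm : ∀ d, σ d ∈ W := fun d => hr ⟨d, rfl⟩
  choose x τ htr hfo hτ using fun d =>
    (F (σ d)).adapted.exists_triple (hps.immersed.norm_eq_one _)
  have hg : ContMDiff (𝓡 2) (𝓡 2) ∞ fun d => (F (σ d)).pt := hpt.comp_contMDiff hσ.smooth hm
  have hus : Smooth fun d => u (F (σ d)).pt := ContMDiff.contDiff_comp hps.immersed.smooth hg
  have hj : ∀ j, Smooth fun d => (F (σ d)).frame j := fun j =>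
    contMDiff_iff_contDiff.mp ((hfr j).comp_contMDiff hσ.smooth hm)
  obtain ⟨l, hl⟩ := LinearMap.exists_leftInverse_of_injective czL.toLinearMap
    (LinearMap.ker_eq_bot.mpr fun p q h => Prod.ext_iff.mpr (cz_inj.mp h))
  have hl' : ∀ a b, l (cz a b) = (a, b) := fun a b => LinearMap.congr_fun hl (a, b)
  have hls : ∀ j, Smooth fun d => (l ((F (σ d)).frame j)).1 := fun j =>
    contDiff_fst.comp ((LinearMap.toContinuousLinearMap l).contDiff.comp (hj j))
  have hxs : Smooth x := by
    convert hls 2 using 2 with d; rw [hfo d]; exact (congrArg Prod.fst (hl' _ _)).symm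
  have hτs : Smooth τ := by
    convert hls 0 using 2 with d; rw [hfo d]; exact (congrArg Prod.fst (hl' _ _)).symm
  have hmem := fun d => exists_toX_iff (F (σ d)) (htr d) (hfo d)
  obtain ⟨t, ht⟩ := (hmem 0 a).1 ⟨b, hb.trans (hF _ hq).1, ha⟩
  refine ⟨fun d => u (F (σ d)).pt, x, τ, t, ⟨hus, hxs, hτs, htr, fun d => ?_⟩, fun p => ?_, ?_⟩
  · obtain ⟨hUeq, A, hA⟩ := hps.coordC_facts hg hxs htr hτ d
    obtain ⟨-, hinj, hJ⟩ := hF _ (hm d)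
    have hWd := hW.mem_nhds (hm d)
    have hσd : MDifferentiableAt (𝓡 2) (𝓡 2) σ d := hσ.smooth.mdifferentiableAt (by simp)
    let α : R2 →ₗ[ℝ] ℂ := (LinearMap.mulLeft ℝ (Complex.I / 2)).comp
      ((coordL (u (F (σ d)).pt) (τ d)).comp (𝒟 (fun d => u (F (σ d)).pt) d).toLinearMap)
    let β : R2 →ₗ[ℝ] ℂ := α - Complex.conjAe.toLinearMap.comp
      ((coordL (u (F (σ d)).pt) (cross (x d) (τ d))).comp (𝒟 x d).toLinearMap)
    have hα : ∀ v, theta1 u F (σ d) (mfderiv (𝓡 2) (𝓡 2) σ d v) = α v := fun v => by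
      have h1 : dmap (fun q => u (F q).pt) (σ d) (mfderiv (𝓡 2) (𝓡 2) σ d v) =
          𝒟 (fun d => u (F (σ d)).pt) d v :=
        (fderiv_comp_mfld (f := fun q => u (F q).pt) ((hps.immersed.smooth.contMDiffAt.comp (σ d)
          (hpt.contMDiffAt hWd)).mdifferentiableAt (by simp)) hσd v).symm
      change Complex.I * (toC (dmap (fun q => u (F q).pt) (σ d) _) ⬝ᵥ _) = _
      rw [h1, hfo, theta_frameOf]
      change _ = Complex.I / 2 * coordC _ _ _
      apply Complex.ext <;> simp [coordC] <;> ring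
    have hβ : ∀ v, kappa32 u F (σ d) (mfderiv (𝓡 2) (𝓡 2) σ d v) = β v := fun v => by
      have h1 : (mfderiv (𝓡 2) 𝓘(ℝ, ImOC) (fun q => (F q).frame 1) (σ d)
          (mfderiv (𝓡 2) (𝓡 2) σ d v) : ImOC) =
          𝒟 (fun d => frameOf (u (F (σ d)).pt) (x d) (τ d) 1) d v := by
        simp only [← hfo]
        exact (fderiv_comp_mfld (f := fun q => (F q).frame 1)
          (((hfr 1).contMDiffAt hWd).mdifferentiableAt (by simp)) hσd v).symm
      change 2 * ((mfderiv (𝓡 2) 𝓘(ℝ, ImOC) (fun q => (F q).frame 1) (σ d) _ : ImOC) ⬝ᵥ _) = _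
      rw [h1, hfo, kappa_frameOf hus hxs hτs htr (hUeq v)]
      change _ = Complex.I / 2 * coordC _ _ _ - conj (coordC _ _ _)
      apply Complex.ext <;> simp [coordC] <;> ring
    obtain ⟨ψ, k, k', hψ, hk⟩ := exists_complex_coordinate (α := α) (β := β)
      (fun v h1 h2 => (hσ.mfderiv_bijective d).1
        ((hinj _ ((hα v).trans h1) ((hβ v).trans h2)).trans (map_zero _).symm))
      (fun v => by
        obtain ⟨w, h1, h2⟩ := hJ (mfderiv (𝓡 2) (𝓡 2) σ d v)
        obtain ⟨w, rfl⟩ := (hσ.mfderiv_bijective d).2 w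
        exact ⟨w, (hα w).symm.trans (h1.trans (congrArg (Complex.I * ·) (hα v))),
          (hβ w).symm.trans (h2.trans (congrArg (Complex.I * ·) (hβ v)))⟩)
    have hc : ∀ v, coordC (u (F (σ d)).pt) (τ d) (𝒟 (fun d => u (F (σ d)).pt) d v) =
        -2 * Complex.I * k * ψ v := fun v => by
      have key : ∀ X z : ℂ, Complex.I / 2 * X = z → X = -2 * Complex.I * z := fun X z h => by
        linear_combination (-2 * Complex.I) * h + X * Complex.I_sq
      exact (key _ _ (hk v).1).trans (by ring)
    have hd : ∀ v, coordC (u (F (σ d)).pt) (cross (x d) (τ d)) (𝒟 x d v) =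
        conj (k - k') * conj (ψ v) := fun v => by
      have h1 : α v - conj _ = _ := (hk v).2
      rw [← map_mul, sub_mul, ← (hk v).1, ← h1, sub_sub_cancel, Complex.conj_conj]; rfl
    refine ⟨ψ, A * conj (-2 * Complex.I * k), conj (k - k'), -2 * Complex.I * k, hψ, ?_, fun v => ?_⟩
    · by_contra hc
      push Not at hc
      obtain ⟨h1, h2⟩ := hc
      have hk0 : k = 0 := by simpa using h2
      have hk1 : k' = 0 := by
        have := (map_eq_zero _).mp h1
        rw [hk0, zero_sub, neg_eq_zero] at this; exact this
      obtain ⟨v, hv⟩ := exists_ne (0 : R2)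
      refine hv ((hσ.mfderiv_bijective d).1 ((hinj _ ((hα v).trans ?_) ((hβ v).trans ?_)).trans
        (map_zero _).symm))
      · rw [(hk v).1, hk0, zero_mul]
      · rw [(hk v).2, hk1, zero_mul]
    · rw [← hc]
      refine ⟨hUeq v, ?_, hd v⟩
      rw [hA, hc, map_mul]; ring
  · obtain ⟨c, h1, h2⟩ := (hmem p.1 _).2 ⟨p.2, rfl⟩
    exact ⟨σ p.1, c, h1.trans (hF _ (hm _)).1.symm, h2⟩
  · rw [show circ (fun d => u (F (σ d)).pt) x (0, t) = a from ht.symm]; exact haO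

section

/-! ### Hopf lifts are ruled -/

/-- Hopf lifts consist of immersed families of great circles. -/
theorem IsL3.exists_tube {A : Set ImO} (h : IsL3 A) {a : ImO} (ha : a ∈ A) : ∃ x e t,
    IsTube x e ∧ Good x e 0 ∧ (∀ p, tube x e p ∈ A) ∧ tube x e (0, t) = a := by
  obtain ⟨S, u, i, hu, ⟨n, hn, hI⟩, rfl⟩ := h
  obtain ⟨⟨⟨p, ζ⟩, hζ1, hζ⟩, rfl⟩ := ha
  obtain ⟨W, z, hW, hpW, hz, hzW⟩ := hu p
  obtain ⟨σ, hσ, rfl, hr⟩ := exists_param (n := 2) p (hW.mem_nhds hpW)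
  have hm : ∀ d, σ d ∈ W := fun d => hr ⟨d, rfl⟩
  have hks : Smooth fun d => z (σ d) :=
    contMDiff_iff_contDiff.mp (hz.comp_contMDiff hσ.smooth hm)
  have hKs : Smooth fun d => i (z (σ d)) := i.toContinuousLinearMap.contDiff.comp hks
  have hK0 : ∀ d, i (z (σ d)) ≠ 0 := fun d h0 => by
    obtain ⟨⟨h, -⟩, -⟩ := hzW _ (hm d)
    exact h (i.injective (h0.trans (map_zero i).symm))
  have hsub : ∀ d, (u (σ d)).submodule = Submodule.span ℂ {z (σ d)} := fun d => by
    obtain ⟨⟨h, e⟩, -⟩ := hzW _ (hm d)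
    rw [e, Projectivization.submodule_mk]
  have hcr : ∀ y, cross n (i y) = i (Complex.I • y) := fun y => (hI y).symm
  have hni : ∀ y, ⟪n, i y⟫ = 0 := fun y => by
    have : i y = cross n (i (-(Complex.I • y))) := by
      rw [hcr, smul_neg, smul_smul, Complex.I_mul_I]; simp
    rw [this, real_inner_comm, inner_cross_left_self]
  set r := fun d => ‖i (z (σ d))‖ with hrdef
  have hr0 : ∀ d, r d ≠ 0 := fun d => norm_ne_zero_iff.mpr (hK0 d)
  set x := fun d => (r d)⁻¹ • i (z (σ d)) with hxdef
  set e := fun d => cross n (x d) with hedef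
  have hxs : Smooth x := smooth_normalize hKs hK0
  have hx1 : ∀ d, ‖x d‖ = 1 := fun d => norm_normalize (hK0 d)
  have hnx : ∀ d, ⟪n, x d⟫ = 0 := fun d => by rw [hxdef, inner_smul_right, hni, mul_zero]
  have ht : IsTube x e := ⟨hxs, contDiff_const.cross hxs, hx1,
    fun d => (cross_of_orthonormal hn (hx1 d) (hnx d)).1,
    fun d => inner_self_cross_right _ _⟩
  have hKx : ∀ d, i (z (σ d)) = r d • x d := fun d => by rw [hxdef, smul_inv_smul₀ (hr0 d)]
  have hmem : ∀ d (c : ℂ), i (c • z (σ d)) = (c.re * r d) • x d + (c.im * r d) • e d := fun d c => by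
    rw [adapted_smul hI, show cross n (i (z (σ d))) = r d • e d from
      (congrArg (cross n) (hKx d)).trans (cross_smul_right _ _ _), smul_smul, mul_smul c.re, ← hKx]
  refine ⟨x, e, _, ht, fun t => ?_, fun p => ?_, (ht.eq_tube_of_norm (d := 0) ?_ ?_).symm⟩
  · rw [injective_iff_map_eq_zero]
    rintro ⟨v, s⟩ h0
    have hxd := hxs.diff (0 : R2)
    have hnd : ⟪n, 𝒟 x 0 v⟫ = 0 := by
      have := inner_fderiv_add (x := (0 : R2)) (differentiableAt_const n) hxd
        (.of_forall hnx) v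
      simpa using this
    have hed : 𝒟 e 0 v = cross n (𝒟 x 0 v) := by
      rw [hedef, fderiv_cross (differentiableAt_const n) hxd]
      simp [cross_zero_left]
    have hJ : ∀ q, ⟪n, q⟫ = 0 → cross n (cross n q) = -q := fun q hq => by
      rw [cross_cross_self, hq, real_inner_self_eq_norm_sq, hn]; module
    rw [ht.fderiv_tube, hed, tubeDir] at h0
    have h1 : Real.cos t • (𝒟 x 0 v + s • e 0) +
        Real.sin t • cross n (𝒟 x 0 v + s • e 0) = 0 := by
      rw [cross_add_right, cross_smul_right, show cross n (e 0) = -x 0 from hJ _ (hnx 0), ← h0]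
      module
    have hζn : ⟪n, 𝒟 x 0 v + s • e 0⟫ = 0 := by
      rw [inner_add_right, hnd, inner_smul_right, real_inner_comm, inner_cross_left_self]; ring
    have h2 : 𝒟 x 0 v + s • e 0 = 0 := by
      have h3 := congrArg (cross n) h1
      rw [cross_add_right, cross_smul_right, cross_smul_right, hJ _ hζn, cross_zero_right] at h3
      have h4 := congrArg₂ (fun a b => Real.cos t • a - Real.sin t • b) h1 h3
      simp only [smul_zero, sub_zero] at h4
      have h5 : ∀ q : ImO, q = (Real.cos t ^ 2 + Real.sin t ^ 2) • q := fun q => by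
        rw [Real.cos_sq_add_sin_sq, one_smul]
      rw [h5 (_ + _), ← h4]
      module
    have hKd : 𝒟 (fun d => i (z (σ d))) 0 v = i (dlift z (σ 0)
        (mfderiv (𝓡 2) (𝓡 2) σ 0 v)) := by
      have e1 := congrArg (fun T : R2 →L[ℝ] ImO => T v) (fderiv_comp (0 : R2)
        (i.toContinuousLinearMap.differentiableAt) (hks.diff 0))
      rw [ContinuousLinearMap.fderiv] at e1
      have e2 := fderiv_comp_mfld (f := z) (((hz.contMDiffAt (hW.mem_nhds (hm 0)))).mdifferentiableAt
        (by simp)) (hσ.smooth.mdifferentiableAt (by simp) (x := (0 : R2))) v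
      exact e1.trans (congrArg i e2)
    have hrs : DifferentiableAt ℝ r 0 := (hKs.diff 0).norm ℝ (hK0 0)
    have hKd' : 𝒟 (fun d => i (z (σ d))) 0 v =
        i ((⟨𝒟 r 0 v / r 0, -s⟩ : ℂ) • z (σ 0)) := by
      rw [hmem, funext hKx, fderiv_fun_smul hrs hxd]
      simp only [add_apply, smul_apply, ContinuousLinearMap.smulRight_apply]
      rw [eq_neg_of_add_eq_zero_left h2, div_mul_cancel₀ _ (hr0 0)]
      module
    have hv : (mfderiv (𝓡 2) (𝓡 2) σ 0 v : R2) = 0 :=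
      (hzW _ (hm 0)).2.1 _ (Submodule.mem_span_singleton.mpr
        ⟨_, i.injective (hKd'.symm.trans hKd)⟩)
    have hv0 : v = 0 := (hσ.mfderiv_bijective 0).1 (hv.trans (map_zero _).symm)
    subst hv0
    rw [map_zero, zero_add] at h2
    have hs : s = 0 := (smul_eq_zero.mp h2).resolve_right fun h => by
      have := ht.norm_e 0; rw [h, norm_zero] at this; norm_num at this
    rw [hs]; rfl
  · have hp : tube x e p =
        i ((⟨Real.cos p.2 / r p.1, Real.sin p.2 / r p.1⟩ : ℂ) • z (σ p.1)) := by
      rw [hmem, div_mul_cancel₀ _ (hr0 _), div_mul_cancel₀ _ (hr0 _)]; rfl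
    refine ⟨⟨(σ p.1, _), ?_, ?_⟩, hp.symm⟩
    · rw [← i.norm_map, ← hp]; exact ht.norm_tube p
    · rw [hsub]; exact Submodule.smul_mem _ _ (Submodule.mem_span_singleton_self _)
  · exact (i.norm_map _).trans hζ1
  · change ζ ∈ (u (σ 0)).submodule at hζ
    rw [hsub] at hζ
    obtain ⟨c, rfl⟩ := Submodule.mem_span_singleton.mp hζ
    exact ⟨_, _, hmem 0 c⟩

variable {L : Type*} [TopologicalSpace L] [ChartedSpace (Rn 3) L] [IsManifold (𝓡 3) ∞ L]
  {ι : L → ImO}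

theorem IsPiece.exists_ruledChart_of_isL3 (hι : IsImmersedInS6 (n := 3) ι) {V U : Set L}
    (hV : IsPiece ι IsL3 V) (hne : (U ∩ V).Nonempty) :
    ∃ x e j, RuledChart ι x e j ∧ (U ∩ range j).Nonempty := by
  obtain ⟨m, hmU, hmV⟩ := hne
  obtain ⟨x, e, t, ht, hg, hA, hm⟩ := hV.type.exists_tube ⟨m, hmV, rfl⟩
  obtain ⟨r, hr, hc⟩ := exists_ruledChart_of_mem hι hV.emb ht hA hg
  obtain ⟨j, hj, hjV⟩ := hc r hr le_rfl
  refine ⟨_, _, j, hj, j (0, t), ?_, mem_range_self _⟩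
  have : j (0, t) = m := congrArg Subtype.val (hV.emb.injective
    (a₁ := ⟨_, hjV (mem_range_self (0, t))⟩) (a₂ := ⟨m, hmV⟩) (by
      change ι _ = ι _; rw [hj.eq, tube_comp, ub_zero, hm]))
  rw [this]; exact hmU

end

/-! ### Tubes in the second normal bundle -/

section SecondForm
variable {S : Surface} {u : S → ImO} {p : S}

theorem mem_normalSpace {N : ImO} : N ∈ normalSpace u p ↔
    ⟪u p, N⟫ = 0 ∧ ∀ v, ⟪N, dmap u p v⟫ = 0 := by
  rw [normalSpace, ← Submodule.inf_orthogonal, Submodule.mem_inf,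
    Submodule.mem_orthogonal_singleton_iff_inner_right]
  refine and_congr Iff.rfl ⟨fun h v => ?_, ?_⟩
  · rw [real_inner_comm]; exact h _ ⟨v, rfl⟩
  · rintro h _ ⟨v, rfl⟩
    rw [real_inner_comm]; exact h v

theorem isGeodesicPoint_iff : IsGeodesicPoint u p ↔
    ∀ N ∈ normalSpace u p, ∀ a b, ⟪N, secondFF u p a b⟫ = 0 := by
  refine ⟨fun h N _ a b => by rw [h, inner_zero_right], fun h a b => ?_⟩
  exact inner_self_eq_zero.mp (h _ (Submodule.starProjection_apply_mem _ _) a b)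

/-- The second fundamental form in a parametrization. -/
theorem inner_secondFF_iff (hu : IsImmersedInS6 (n := 2) u) {κ : R2 → S} (hκ : IsParam κ) {z : R2}
    {N : ImO} (hN : N ∈ normalSpace u (κ z)) : (∀ a b, ⟪N, secondFF u (κ z) a b⟫ = 0) ↔
      ∀ a b, ⟪N, (𝒟 (fun w => 𝒟 (fun w => u (κ w)) w b) z a)⟫ = 0 := by
  set φ := extChartAt (𝓡 2) (κ z) with hφ
  set F := u ∘ φ.symm with hF
  set h := φ ∘ κ with hh
  have hFs : ContDiffAt ℝ ∞ F (h z) := by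
    rw [← contMDiffAt_iff_contDiffAt]
    exact hu.smooth.contMDiffAt.comp _ ((contMDiffOn_extChartAt_symm (κ z)).contMDiffAt
      (extChartAt_target_mem_nhds (κ z)))
  have hhs : ContDiffAt ℝ ∞ h z := by
    rw [← contMDiffAt_iff_contDiffAt]
    exact (contMDiffAt_extChartAt (x := κ z)).comp z hκ.smooth.contMDiffAt
  obtain ⟨hf, hfi⟩ := hu.comp_param hκ
  have hev : ∀ᶠ w in 𝓝 z, u (κ w) = F (h w) := by
    filter_upwards [hκ.smooth.continuous.continuousAt.eventually
      (extChartAt_source_mem_nhds (I := 𝓡 2) (κ z))] with w hw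
    exact congrArg u (φ.left_inv hw).symm
  have hfd : ∀ b, (fun w => 𝒟 (fun w => u (κ w)) w b) =ᶠ[𝓝 z]
      fun w => 𝒟 F (h w) (𝒟 h w b) := fun b => by
    have hFd := hhs.continuousAt.eventually
      (((hFs.of_le (by simp) : ContDiffAt ℝ 1 F (h z)).eventually (by simp)).mono
        fun w h => h.differentiableAt (by simp))
    have hhd := ((hhs.of_le (by simp) : ContDiffAt ℝ 1 h z).eventually (by simp)).mono
      fun w h => h.differentiableAt (by simp)
    filter_upwards [hev.eventually_nhds, hFd, hhd] with w h1 h2 h3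
    have h4 : (fun w => u (κ w)) =ᶠ[𝓝 w] F ∘ h := h1
    rw [h4.fderiv_eq, fderiv_comp w h2 h3]; rfl
  have hf0 : ∀ b, 𝒟 (fun w => u (κ w)) z b = 𝒟 F (h z) (𝒟 h z b) :=
    fun b => (hfd b).self_of_nhds
  have hd1 : DifferentiableAt ℝ (𝒟 F) (h z) :=
    (hFs.fderiv_right (m := ∞) (by simp)).differentiableAt (by simp)
  have hhd := hhs.differentiableAt (by simp)
  have hsec : ∀ a b, 𝒟 (fun w => 𝒟 (fun w => u (κ w)) w b) z a =
      𝒟 (𝒟 F) (h z) (𝒟 h z a) (𝒟 h z b) +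
        𝒟 F (h z) (𝒟 (fun w => 𝒟 h w b) z a) := fun a b => by
    have hd2 : DifferentiableAt ℝ (fun w => 𝒟 h w b) z :=
      (contDiffAt_fderiv_apply hhs b).differentiableAt (by simp)
    rw [(hfd b).fderiv_eq, fderiv_clm_apply (c := fun w => 𝒟 F (h w)) (hd1.comp z hhd) hd2]
    have := fderiv_comp z hd1 hhd
    rw [show (fun w => 𝒟 F (h w)) = 𝒟 F ∘ h from rfl, this]
    simp [add_comm]
  have hinj : Injective (𝒟 h z) := fun a b hab => hfi z (by
    rw [hf0, hf0, hab])
  have hsurj : Surjective (𝒟 h z) :=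
    (LinearMap.injective_iff_surjective (f := (𝒟 h z).toLinearMap)).mp hinj
  have hNF : ∀ y, ⟪N, 𝒟 F (h z) y⟫ = 0 := fun y => by
    obtain ⟨y, rfl⟩ := hsurj y
    rw [← hf0, hu.fderiv_comp hκ.smooth.contMDiffAt]
    exact (mem_normalSpace.mp hN).2 _
  have hNs : ∀ a b, ⟪N, secondFF u (κ z) a b⟫ =
      ⟪N, 𝒟 (𝒟 F) (h z) a b⟫ := fun a b => by
    rw [secondFF, ← Submodule.inner_starProjection_left_eq_right,
      Submodule.starProjection_eq_self_iff.mpr hN]; rfl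
  constructor
  · intro H a b
    rw [hsec, inner_add_right, hNF, add_zero, ← hNs]; exact H _ _
  · intro H a b
    obtain ⟨a, rfl⟩ := hsurj a
    obtain ⟨b, rfl⟩ := hsurj b
    have := H a b
    rwa [hsec, inner_add_right, hNF, add_zero, ← hNs] at this
end SecondForm

/-- The component orthogonal to `p`, `τ`, `p × τ`. -/
def nperp (p τ ξ : ImO) : ImO :=
  ξ - ⟪p, ξ⟫ • p - ⟪τ, ξ⟫ • τ - ⟪cross p τ, ξ⟫ • cross p τ

theorem nperp_facts {p τ : ImO} (hp : ‖p‖ = 1) (hτ : ‖τ‖ = 1) (hpτ : ⟪p, τ⟫ = 0) (ξ : ImO) :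
    ⟪p, nperp p τ ξ⟫ = 0 ∧ ⟪τ, nperp p τ ξ⟫ = 0 ∧
      ⟪cross p τ, nperp p τ ξ⟫ = 0 := by
  have e0 : ⟪p, p⟫ = 1 := inner_self_of_norm_one hp
  have e1 : ⟪τ, τ⟫ = 1 := inner_self_of_norm_one hτ
  have e3 : ⟪cross p τ, cross p τ⟫ = 1 := inner_self_of_norm_one ((cross_of_orthonormal hp hτ hpτ).1)
  have e4 : ⟪p, cross p τ⟫ = 0 := inner_self_cross_left _ _
  have e5 : ⟪τ, cross p τ⟫ = 0 := inner_self_cross_right _ _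
  simp only [nperp, inner_sub_right, inner_smul_right, e0, e1, e3, e4, e5, hpτ,
    real_inner_comm p τ, inner_cross_left_self, inner_cross_right_self]
  refine ⟨?_, ?_, ?_⟩
  all_goals ring

theorem coordC_nperp {p τ M : ImO} (hp : ‖p‖ = 1) (hpτ : ⟪p, τ⟫ = 0)
    (h0 : ⟪p, M⟫ = 0) (h1 : coordC p τ M = 0) (ξ : ImO) :
    coordC p M (nperp p τ ξ) = coordC p M ξ := by
  have h2 : ⟪τ, M⟫ = 0 := congrArg Complex.re h1
  have h3 : ⟪cross p τ, M⟫ = 0 := congrArg Complex.im h1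
  have e0 : ⟪p, p⟫ = 1 := inner_self_of_norm_one hp
  rw [real_inner_comm] at h2
  have h4 : ⟪cross p M, τ⟫ = 0 := by rw [inner_cross_swap', h3, neg_zero]
  have h5 : ⟪cross p M, cross p τ⟫ = 0 := by
    rw [inner_cross_cross, h2, hpτ]; ring
  rw [real_inner_comm] at h0 h3
  unfold coordC nperp
  simp only [inner_sub_right, inner_smul_right, h0, h2, h3, h4, h5, inner_cross_left_self, mul_zero,
    sub_zero]

theorem IsG2Triple.inner_eq {u x τ ξ η : ImO} (h : IsG2Triple u x τ) (h0 : ⟪u, ξ⟫ = 0)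
    (h1 : coordC u τ ξ = 0) (h2 : coordC u x η = 0) : ⟪ξ, η⟫ =
      (conj (coordC u (cross x τ) ξ) * coordC u (cross x τ) η).re := by
  have e := frame_expand h.norm_u h.norm_x h.norm_t h.ux h.ut h.xt h.phi ξ
  have a1 : ⟪τ, ξ⟫ = 0 := congrArg Complex.re h1
  have a2 : ⟪cross u τ, ξ⟫ = 0 := congrArg Complex.im h1
  have a3 : ⟪x, η⟫ = 0 := congrArg Complex.re h2
  have a4 : ⟪cross u x, η⟫ = 0 := congrArg Complex.im h2
  rw [h0, a1, a2] at e
  have := congrArg (fun q => ⟪q, η⟫) e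
  simp only [inner_add_left, inner_smul_left, a3, a4, conj_trivial] at this
  rw [this]
  simp [coordC]

/-- A unit normal vector orthogonal to a complex line gives a special triple. -/
theorem isG2Triple_of_normal {p τ Y : ImO} (hp : ‖p‖ = 1) (hτ : ‖τ‖ = 1) (hY : ‖Y‖ = 1)
    (hpτ : ⟪p, τ⟫ = 0) (hpY : ⟪p, Y⟫ = 0) (h : coordC p τ Y = 0) :
    IsG2Triple p Y τ := by
  have h1 : ⟪τ, Y⟫ = 0 := congrArg Complex.re h
  have h2 : ⟪cross p τ, Y⟫ = 0 := congrArg Complex.im h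
  exact ⟨hp, hY, hτ, hpY, hpτ, inner_eq_zero_symm.1 h1,
    by rw [inner_cross_swap', h2, neg_zero]⟩

theorem IsG2Triple.swap {u x τ : ImO} (h : IsG2Triple u x τ) : IsG2Triple u (cross τ x) τ ∧
    cross (cross τ x) τ = x ∧ coordC u (cross τ x) x = 0 := by
  obtain ⟨Ψ, hΨ, k0, k1, k2, k3, k4, k5, k6⟩ := h.exists_frame
  obtain ⟨p1, -, -, p2, -⟩ := cross_of_orthonormal h.norm_t h.norm_x
    (inner_eq_zero_symm.1 h.xt)
  refine ⟨⟨h.norm_u, p1, h.norm_t, ?_, h.ut, inner_cross_left_self _ _, ?_⟩, p2, ?_⟩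
  all_goals
    rw [k0, k1, k3]
    simp only [coordC, hΨ _ _, Ψ.inner_map_map]
    simp [cross_apply, crossCoord, eps, inner_eq_sum, Complex.ext_iff]

theorem IsG2Triple.coordC_zero {u x τ : ImO} (h : IsG2Triple u x τ) : coordC u τ x = 0 := by
  apply Complex.ext
  · exact (real_inner_comm _ _).trans h.xt
  · change ⟪cross u τ, x⟫ = 0
    rw [inner_cross_swap', h.phi, neg_zero]

/-- A parametrized pseudoholomorphic curve with a unit tangent field. -/
structure FramedCurve (f τ : R2 → ImO) : Prop where
  smooth : Smooth f
  smooth_t : Smooth τ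
  inj : ∀ z, Injective (𝒟 f z)
  norm_f : ∀ z, ‖f z‖ = 1
  norm_t : ∀ z, ‖τ z‖ = 1
  ft : ∀ z, ⟪f z, τ z⟫ = 0
  tang : ∀ z v, 𝒟 f z v = (coordC (f z) (τ z) (𝒟 f z v)).re • τ z +
    (coordC (f z) (τ z) (𝒟 f z v)).im • cross (f z) (τ z)

/-- The normal part of the second derivative in the direction `e`. -/
def secondNormal (f τ : R2 → ImO) (e z : R2) : ImO :=
  nperp (f z) (τ z) (𝒟 (fun w => 𝒟 f w e) z e)

namespace FramedCurve
variable {f τ : R2 → ImO} (h : FramedCurve f τ)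
include h

theorem coord_ne_zero (z : R2) {v : R2} (hv : v ≠ 0) :
    coordC (f z) (τ z) (𝒟 f z v) ≠ 0 := fun h0 => by
  have := h.tang z v
  rw [h0] at this
  simp only [Complex.zero_re, Complex.zero_im, zero_smul, add_zero] at this
  exact hv (h.inj z (this.trans (map_zero _).symm))

theorem exists_coord (z : R2) (c : ℂ) : ∃ v, coordC (f z) (τ z) (𝒟 f z v) = c := by
  let T : R2 →ₗ[ℝ] ℂ := (coordL (f z) (τ z)).comp (𝒟 f z).toLinearMap
  have hT : Injective T := (injective_iff_map_eq_zero T).mpr fun v hv => by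
    by_contra h0; exact h.coord_ne_zero z h0 hv
  exact (LinearMap.injective_iff_surjective_of_finrank_eq_finrank (by simp)).mp hT c

theorem coordC_field {X : R2 → ImO} (hX : Smooth X) (h0 : ∀ z, ⟪f z, X z⟫ = 0)
    (h1 : ∀ z, coordC (f z) (τ z) (X z) = 0) (z w v : R2) :
    coordC (f z) (X z) (𝒟 (fun z => 𝒟 f z v) z w) =
      -(conj (coordC (f z) (τ z) (𝒟 X z w)) * coordC (f z) (τ z) (𝒟 f z v)) := by
  have e1 : ∀ z, ⟪τ z, X z⟫ = 0 := fun z => congrArg Complex.re (h1 z)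
  have e2 : ∀ z, ⟪cross (f z) (τ z), X z⟫ = 0 := fun z => congrArg Complex.im (h1 z)
  have := coordC_second (f := f) (X := X) (g := id) (d := z) (τ := τ z) h.smooth
    differentiableAt_id (hX.diff z) (h.norm_f z) (h0 z) (h.ft z)
    (.of_forall fun z v => by
      have e3 : ⟪X z, cross (f z) (τ z)⟫ = 0 := by rw [real_inner_comm]; exact e2 z
      have e4 : ⟪cross (f z) (X z), τ z⟫ = 0 := by
        rw [inner_cross_swap', e2, neg_zero]
      rw [id, h.tang z v]
      simp only [inner_add_right, inner_smul_right, inner_cross_cross, e3, e4, h.ft, h0,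
        real_inner_comm (τ z) (X z), e1]
      constructor <;> ring) (h.tang z) w v
  rw [fderiv_id] at this
  exact this

theorem exists_bilinear (z : R2) {N : ImO} (h0 : ⟪f z, N⟫ = 0)
    (h1 : coordC (f z) (τ z) N = 0) : ∃ γ, ∀ a b,
      coordC (f z) N (𝒟 (fun z => 𝒟 f z b) z a) =
        γ * coordC (f z) (τ z) (𝒟 f z a) * coordC (f z) (τ z) (𝒟 f z b) := by
  have hf := h.smooth
  have ht := h.smooth_t
  have hJ : Smooth fun z => cross (f z) (τ z) := hf.cross ht
  have hn := fun z => nperp_facts (h.norm_f z) (h.norm_t z) (h.ft z) N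
  have hX : Smooth fun z => nperp (f z) (τ z) N :=
    ((contDiff_const.sub ((hf.inner ℝ contDiff_const).smul hf)).sub
      ((ht.inner ℝ contDiff_const).smul ht)).sub ((hJ.inner ℝ contDiff_const).smul hJ)
  have hN : nperp (f z) (τ z) N = N := by
    rw [nperp, h0, show ⟪τ z, N⟫ = 0 from congrArg Complex.re h1,
      show ⟪cross (f z) (τ z), N⟫ = 0 from congrArg Complex.im h1]
    module
  have key := h.coordC_field hX (fun z => (hn z).1)
    (fun z => Complex.ext (hn z).2.1 (hn z).2.2) z
  rw [hN] at key
  obtain ⟨v, hv⟩ := exists_ne (0 : R2)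
  have hc := h.coord_ne_zero z hv
  refine ⟨-(conj (coordC (f z) (τ z) (𝒟 (fun z => nperp (f z) (τ z) N) z v)) /
    coordC (f z) (τ z) (𝒟 f z v)), fun a b => ?_⟩
  have h2 := key a v
  rw [fderiv_fderiv_symm h.smooth.contDiffAt, key v a] at h2
  rw [key a b]
  field_simp
  linear_combination -coordC (f z) (τ z) (𝒟 f z b) * h2

theorem coordC_eq_zero {z : R2} {N : ImO} (h0 : ⟪f z, N⟫ = 0)
    (h1 : coordC (f z) (τ z) N = 0) {e : R2} (he : e ≠ 0)
    (h2 : coordC (f z) N (secondNormal f τ e z) = 0) (a b : R2) :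
    coordC (f z) N (𝒟 (fun z => 𝒟 f z b) z a) = 0 := by
  obtain ⟨γ, hγ⟩ := h.exists_bilinear z h0 h1
  rw [secondNormal, coordC_nperp (h.norm_f z) (h.ft z) h0 h1, hγ] at h2
  have hc := h.coord_ne_zero z he
  rw [hγ, (mul_eq_zero.mp ((mul_eq_zero.mp h2).resolve_right hc)).resolve_right hc]
  ring

theorem secondNormal_facts (e z : R2) : ⟪f z, secondNormal f τ e z⟫ = 0 ∧
    coordC (f z) (τ z) (secondNormal f τ e z) = 0 := by
  obtain ⟨h1, h2, h3⟩ := nperp_facts (h.norm_f z) (h.norm_t z) (h.ft z)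
    (𝒟 (fun w => 𝒟 f w e) z e)
  exact ⟨h1, Complex.ext h2 h3⟩

theorem secondNormal_eq_zero_iff {e : R2} (he : e ≠ 0) (z : R2) : secondNormal f τ e z = 0 ↔
    ∀ N, ⟪f z, N⟫ = 0 → coordC (f z) (τ z) N = 0 →
      ∀ a b, ⟪N, (𝒟 (fun z => 𝒟 f z b) z a)⟫ = 0 := by
  constructor
  · intro h0 N h1 h2 a b
    exact congrArg Complex.re (h.coordC_eq_zero h1 h2 he
      (by rw [h0]; apply Complex.ext <;> simp [coordC]) a b)
  · intro H
    obtain ⟨h1, h2⟩ := h.secondNormal_facts e z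
    have := H _ h1 h2 e e
    rw [← inner_self_eq_zero (𝕜 := ℝ)]
    exact (congrArg Complex.re (coordC_nperp (h.norm_f z) (h.ft z) h1 h2 _)).trans this

theorem smooth_secondNormal (e : R2) : Smooth (secondNormal f τ e) := by
  have hf := h.smooth
  have ht := h.smooth_t
  have hJ : Smooth fun z => cross (f z) (τ z) := hf.cross ht
  have hs : Smooth fun z => 𝒟 (fun w => 𝒟 f w e) z e :=
    contDiff_fderiv_apply (contDiff_fderiv_apply hf e) e
  exact ((hs.sub ((hf.inner ℝ hs).smul hf)).sub ((ht.inner ℝ hs).smul ht)).sub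
    ((hJ.inner ℝ hs).smul hJ)

/-- The second normal bundle as a framed family. -/
theorem holFrame {e : R2} (he : e ≠ 0) (hν : ∀ z, secondNormal f τ e z ≠ 0) : ∃ Y : R2 → ImO,
    (∀ z, IsG2Triple (f z) (Y z) (τ z)) ∧ HolFrame f (fun z => cross (τ z) (Y z)) τ ∧
    (∀ z, secondNormal f τ e z = ‖secondNormal f τ e z‖ • Y z) ∧
    ∀ z a b, coordC (f z) (cross (τ z) (Y z)) (𝒟 (fun z => 𝒟 f z b) z a) = 0 := by
  set Y := fun z => ‖secondNormal f τ e z‖⁻¹ • secondNormal f τ e z with hYdef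
  have hYs : Smooth Y := smooth_normalize (h.smooth_secondNormal e) hν
  have hνY : ∀ z, secondNormal f τ e z = ‖secondNormal f τ e z‖ • Y z := fun z => by
    rw [hYdef, smul_inv_smul₀ (norm_ne_zero_iff.mpr (hν z))]
  have hcs : ∀ z a (r : ℝ) ξ, coordC (f z) a (r • ξ) = r * coordC (f z) a ξ := fun z a r ξ => by
    apply Complex.ext <;> simp [coordC, inner_smul_right]
  have htY : ∀ z, IsG2Triple (f z) (Y z) (τ z) := fun z => by
    obtain ⟨h1, h2⟩ := h.secondNormal_facts e z
    refine isG2Triple_of_normal (h.norm_f z) (h.norm_t z) (norm_normalize (hν z)) (h.ft z) ?_ ?_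
    · rw [hYdef, inner_smul_right, h1, mul_zero]
    · rw [hYdef, hcs, h2, mul_zero]
  have htX := fun z => (htY z).swap
  set X := fun z => cross (τ z) (Y z) with hXdef
  have hXs : Smooth X := h.smooth_t.cross hYs
  have hXY : ∀ z, cross (X z) (τ z) = Y z := fun z => (htX z).2.1
  have hS : ∀ z a b, coordC (f z) (X z) (𝒟 (fun z => 𝒟 f z b) z a) = 0 := fun z =>
    h.coordC_eq_zero (htX z).1.ux (htX z).1.coordC_zero he (by rw [hνY, hcs, (htX z).2.2, mul_zero])
  refine ⟨Y, htY, ⟨h.smooth, hXs, h.smooth_t, fun z => (htX z).1, fun z => ?_⟩, hνY, hS⟩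
  set c : R2 → ℂ := fun v => coordC (f z) (τ z) (𝒟 f z v)
  have hce : c e ≠ 0 := h.coord_ne_zero z he
  have ha : ∀ w, coordC (f z) (τ z) (𝒟 X z w) = 0 := fun w => by
    have := h.coordC_field hXs (fun z => (htX z).1.ux) (fun z => (htX z).1.coordC_zero) z w e
    rw [hS, eq_comm, neg_eq_zero, mul_eq_zero, map_eq_zero] at this
    exact this.resolve_right hce
  obtain ⟨β, hβ⟩ := h.exists_bilinear z (htY z).ux (htY z).coordC_zero
  have hβ0 : β ≠ 0 := fun h0 => by
    have h1 := hβ e e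
    rw [h0, zero_mul, zero_mul, ← coordC_nperp (h.norm_f z) (h.ft z) (htY z).ux
      (htY z).coordC_zero] at h1
    change coordC _ _ (secondNormal f τ e z) = 0 at h1
    have h2 := congrArg Complex.re h1
    rw [hνY, hcs] at h2
    simp [coordC, (htY z).norm_x, hν z] at h2
  have hXf : ∀ w, ⟪f z, 𝒟 X z w⟫ = 0 := fun w => by
    have e1 := inner_fderiv_add (h.smooth.diff z)
      (hXs.diff z) (.of_forall fun z => (htX z).1.ux) w
    rw [h.tang z w, real_inner_comm, ((htX z).1.inner_tangent _).1, zero_add] at e1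
    exact e1
  set b : R2 → ℂ := fun w => coordC (f z) (Y z) (𝒟 X z w)
  have hre : ∀ w v v', (conj (b w) * (β * c v * c v')).re = -⟪X z,
      (𝒟 (fun z => 𝒟 (fun z => 𝒟 f z v') z v) z w)⟫ := fun w v v' => by
    have e1 := inner_fderiv_add (hXs.diff z)
      ((contDiff_fderiv_apply (contDiff_fderiv_apply h.smooth v') v).diff z)
      (.of_forall fun z => congrArg Complex.re (hS z v v')) w
    rw [(htX z).1.inner_eq (hXf w) (ha w) (hS z v v'), hXY, hβ] at e1
    linarith
  have hsym : ∀ w, b w = b e / conj (c e) * conj (c w) := fun w => by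
    have h1 : conj (b w) * c e - conj (b e) * c w = 0 := by
      obtain ⟨v', hv'⟩ := h.exists_coord z (conj (β * (conj (b w) * c e - conj (b e) * c w)))
      have h2 := hre w e v'
      rw [fderiv_fderiv_symm (contDiff_fderiv_apply h.smooth v').contDiffAt, ← hre e w v'] at h2
      have h3 : ((β * (conj (b w) * c e - conj (b e) * c w)) * c v').re = 0 := by
        rw [show β * (conj (b w) * c e - conj (b e) * c w) * c v' =
          conj (b w) * (β * c e * c v') - conj (b e) * (β * c w * c v') by ring, Complex.sub_re, h2,
          sub_self]
      rw [show c v' = _ from hv', Complex.mul_conj, Complex.ofReal_re, Complex.normSq_eq_zero] at h3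
      exact (mul_eq_zero.mp h3).resolve_left hβ0
    have h2 := congrArg conj h1
    simp only [map_sub, map_mul, Complex.conj_conj, map_zero] at h2
    have hce' : conj (c e) ≠ 0 := (map_ne_zero _).mpr hce
    field_simp
    linear_combination h2
  refine ⟨(coordL (f z) (τ z)).comp (𝒟 f z).toLinearMap, 0, b e / conj (c e), 1,
    (injective_iff_map_eq_zero _).mpr fun v hv => ?_, .inr one_ne_zero, fun v => ⟨?_, ?_, ?_⟩⟩
  · by_contra h0; exact h.coord_ne_zero z h0 hv
  · rw [one_mul]; exact h.tang z v
  · rw [ha, zero_mul]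
  · rw [hXY]; exact hsym v
end FramedCurve

theorem IsPseudoholomorphic.framedCurve {S : Surface} {u : S → ImO} (hu : IsPseudoholomorphic u)
    {κ : R2 → S} (hκ : IsParam κ) {e : R2} (he : e ≠ 0) : ∃ τ : R2 → ImO,
      FramedCurve (fun z => u (κ z)) τ ∧ ∀ z (N : ImO), N ∈ normalSpace u (κ z) ↔
        ⟪u (κ z), N⟫ = 0 ∧ coordC (u (κ z)) (τ z) N = 0 := by
  obtain ⟨hf, hfi⟩ := hu.immersed.comp_param hκ
  have hch : ∀ z v, 𝒟 (fun z => u (κ z)) z v =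
      dmap u (κ z) (mfderiv (𝓡 2) (𝓡 2) κ z v) := fun z v =>
    hu.immersed.fderiv_comp hκ.smooth.contMDiffAt v
  have h0 : ∀ z, 𝒟 (fun z => u (κ z)) z e ≠ 0 := fun z h =>
    he (hfi z (h.trans (map_zero _).symm))
  have hn := fun z => hu.immersed.norm_eq_one (κ z)
  obtain ⟨τ, hτs, hτ, hft, htan⟩ : ∃ τ : R2 → ImO, Smooth τ ∧ (∀ z, ‖τ z‖ = 1) ∧
      (∀ z, ⟪u (κ z), τ z⟫ = 0) ∧ ∀ z, ∃ a, dmap u (κ z) a = τ z :=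
    ⟨_, smooth_normalize (contDiff_fderiv_apply hf e) h0, fun z => norm_normalize (h0 z),
      fun z => by rw [inner_smul_right, inner_fderiv_self (hf.diff z)
        (.of_forall hn), mul_zero],
      fun z => ⟨‖𝒟 (fun z => u (κ z)) z e‖⁻¹ • (mfderiv (𝓡 2) (𝓡 2) κ z e : R2),
        (map_smul (dmap u (κ z)) _ (_ : R2)).trans (congrArg _ (hch z e).symm)⟩⟩
  have hd : ∀ z v, _ := fun z v => eq_coord_of_mem_range (Λ := (dmap u (κ z)).toLinearMap) (hn z)
    (hτ z) (hft z) (htan z) (by obtain ⟨a, ha⟩ := htan z; rw [← ha]; exact hu.tangent _ a) v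
  refine ⟨τ, ⟨hf, hτs, hfi, hn, hτ, hft,
    fun z v => by rw [hch]; exact hd z _⟩, fun z N => ?_⟩
  rw [mem_normalSpace]
  refine and_congr Iff.rfl ⟨fun h => ?_, fun h v => ?_⟩
  · obtain ⟨a, ha⟩ := htan z
    obtain ⟨b, hb⟩ := hu.tangent (κ z) a
    rw [ha] at hb
    apply Complex.ext
    · change ⟪_, _⟫ = 0
      rw [← ha, real_inner_comm]; exact h a
    · change ⟪_, _⟫ = 0
      rw [← hb, real_inner_comm]; exact h b
  · have h1 := hd z v
    rw [ContinuousLinearMap.coe_coe] at h1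
    rw [h1, inner_add_right, inner_smul_right, inner_smul_right, real_inner_comm (τ z) N,
      real_inner_comm (cross _ (τ z)) N, show ⟪_, N⟫ = 0 from congrArg Complex.re h,
      show ⟪cross _ _, N⟫ = 0 from congrArg Complex.im h]
    ring

theorem IsL4.holCovered {A : Set ImO} (h : IsL4 A) : HolCovered A := by
  obtain ⟨S, u, hu, rfl⟩ := h
  have hps := hu.pseudoholomorphic
  rintro _ ⟨⟨p₀, a⟩, hcl, rfl⟩ O hO ha
  obtain ⟨⟨p, N⟩, ⟨-, hNO⟩, hp, hNn, hN1, hN⟩ :=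
    mem_closure_iff.mp hcl (univ ×ˢ O) (isOpen_univ.prod hO) ⟨trivial, ha⟩
  obtain ⟨e, he⟩ := exists_ne (0 : R2)
  have key : ∀ {κ : R2 → S} {τ : R2 → ImO}, IsParam κ → FramedCurve (fun z => u (κ z)) τ →
      (∀ z (N : ImO), N ∈ normalSpace u (κ z) ↔
        ⟪u (κ z), N⟫ = 0 ∧ coordC (u (κ z)) (τ z) N = 0) → ∀ z,
      (IsGeodesicPoint u (κ z) ↔ secondNormal (fun z => u (κ z)) τ e z = 0) := by
    intro κ τ hκ hf hn z
    rw [hf.secondNormal_eq_zero_iff he, isGeodesicPoint_iff]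
    refine forall_congr' fun N => ⟨fun H h1 h2 => ?_, fun H hN => ?_⟩
    · have hN := (hn z N).2 ⟨h1, h2⟩
      exact (inner_secondFF_iff hps.immersed hκ hN).1 (H hN)
    · exact (inner_secondFF_iff hps.immersed hκ hN).2 (H ((hn z N).1 hN).1 ((hn z N).1 hN).2)
  obtain ⟨κ₀, hκ₀, h0, -⟩ := exists_param (n := 2) p univ_mem
  obtain ⟨τ₀, hf₀, hn₀⟩ := hps.framedCurve hκ₀ he
  have hU : κ₀ '' {z | secondNormal (fun z => u (κ₀ z)) τ₀ e z ≠ 0} ∈ 𝓝 p :=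
    (hκ₀.isOpenEmbedding.isOpenMap _ (isOpen_ne_fun (hf₀.smooth_secondNormal e).continuous
      continuous_const)).mem_nhds ⟨0, fun h => hp (by
        change IsGeodesicPoint u p
        rw [← h0]; exact (key hκ₀ hf₀ hn₀ 0).2 h), h0⟩
  obtain ⟨κ, hκ, rfl, hr⟩ := exists_param (n := 2) p hU
  obtain ⟨τ, hf, hn⟩ := hps.framedCurve hκ he
  have hng : ∀ z, ¬ IsGeodesicPoint u (κ z) := fun z hz => by
    obtain ⟨w, hw, hwz⟩ := hr ⟨z, rfl⟩
    exact hw ((key hκ₀ hf₀ hn₀ w).1 (hwz ▸ hz))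
  obtain ⟨Y, hY, hH, hνY, hS⟩ := hf.holFrame he fun z h => hng z ((key hκ hf hn z).2 h)
  have hX := fun z => (hY z).swap
  have hmem : ∀ q, circ (fun z => u (κ z)) (fun z => cross (τ z) (Y z)) q ∈
      Prod.snd '' closure (unitN2 u) := fun q => by
    have ht := hH.triple_circ q.1 q.2
    have hNs := (hn q.1 _).2 ⟨ht.ux, ht.coordC_zero⟩
    refine ⟨(κ q.1, _), subset_closure ⟨hng _, hNs, ht.norm_x, ?_⟩, rfl⟩
    refine (inner_secondFF_iff hps.immersed hκ hNs).2 fun a b => ?_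
    have h1 := hS q.1 a b
    simp only [circ, tube, inner_add_left, inner_smul_left]
    rw [show ⟪cross (τ q.1) (Y q.1), _⟫ = 0 from congrArg Complex.re h1,
      show ⟪cross _ (cross (τ q.1) (Y q.1)), _⟫ = 0 from congrArg Complex.im h1]
    simp
  obtain ⟨hN2, hN3⟩ := (hn 0 N).1 hNn
  have hNS := (inner_secondFF_iff hps.immersed hκ hNn).1 hN
  have hNY : coordC (u (κ 0)) (Y 0) N = 0 := by
    obtain ⟨γ, hγ⟩ := hf.exists_bilinear 0 hN2 hN3
    have hγ0 : γ = 0 := by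
      have hce := hf.coord_ne_zero 0 he
      obtain ⟨v, hv⟩ := hf.exists_coord 0
        (conj (γ * coordC (u (κ 0)) (τ 0) (𝒟 (fun z => u (κ z)) 0 e)))
      have h1 : (γ * coordC (u (κ 0)) (τ 0) (𝒟 (fun z => u (κ z)) 0 e) * _).re = 0 :=
        (congrArg Complex.re (hγ e v)).symm.trans (hNS e v)
      rw [hv, Complex.mul_conj, Complex.ofReal_re, Complex.normSq_eq_zero] at h1
      exact (mul_eq_zero.mp h1).resolve_right hce
    have h2 : coordC (u (κ 0)) N (secondNormal (fun z => u (κ z)) τ e 0) = 0 :=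
      (coordC_nperp (hf.norm_f 0) (hf.ft 0) hN2 hN3 _).trans (by rw [hγ, hγ0]; ring)
    rw [hνY] at h2
    have hne := norm_ne_zero_iff.mpr fun h => hng 0 ((key hκ hf hn 0).2 h)
    have h3 : ⟪N, Y 0⟫ = 0 := by
      have := congrArg Complex.re h2
      simpa [coordC, inner_smul_right, hne, mul_eq_zero, norm_eq_zero] using this
    have h4 : ⟪cross (u (κ 0)) N, Y 0⟫ = 0 := by
      have := congrArg Complex.im h2
      simpa [coordC, inner_smul_right, hne, mul_eq_zero, norm_eq_zero] using this
    apply Complex.ext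
    · exact (real_inner_comm _ _).trans h3
    · change ⟪cross _ _, _⟫ = 0
      rw [inner_cross_swap', h4, neg_zero]
  have hNX := (hX 0).1.eq_of_coordC hN2 hN3 (by rw [(hX 0).2.1]; exact hNY)
  exact ⟨_, _, τ, _, hH, hmem, mem_of_eq_of_mem
    (hH.isTube.eq_tube_of_norm (d := 0) hN1 ⟨_, _, hNX⟩).symm hNO⟩

end S6

end

theorem theorem7p3 {L : Type*} [TopologicalSpace L] [T2Space L] [SecondCountableTopology L]
    [ConnectedSpace L] [ChartedSpace (EuclideanSpace ℝ (Fin 3)) L] [IsManifold (𝓡 3) ∞ L]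
    (ι : L → S6.ImO) (hι : S6.IsImmersedInS6 (n := 3) ι) :
    (S6.IsLagrangian ι →
      -- ruled Lagrangians are locally of one of the three types on an open dense subset
      (S6.IsRuled ι → S6.LocallyOnDense ι fun A => S6.IsL3 A ∨ S6.IsL4 A ∨ S6.IsL6 A) ∧
      -- and being so characterises the ruled ones up to an open dense subset
      (S6.IsGenericallyLocallyRuled ι ↔
        S6.LocallyOnDense ι fun A => S6.IsL3 A ∨ S6.IsL4 A ∨ S6.IsL6 A) ∧
      (S6.IsRuled ι →
        -- not linearly full if and only if of the first type
        (¬ S6.IsLinearlyFull ι ↔ S6.LocallyOnDense ι S6.IsL3) ∧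
        (∀ U : Set L, IsOpen U → U.Nonempty → Topology.IsEmbedding (U.domRestrict ι) →
          S6.IsL3 (ι '' U) → ¬ S6.IsLinearlyFull ι) ∧
        (¬ S6.IsLinearlyFull ι → ¬ S6.IsSimple ι → S6.IsGloballyL3 ι) ∧
        -- the general ruled Lagrangian is of the third type
        (S6.IsLinearlyFull ι → S6.LocallyOnDense ι S6.IsL6))) ∧
    -- and the submanifolds of the third type are Lagrangian
    (S6.LocallyOnDense ι S6.IsL6 → S6.IsLagrangian ι) := by
  have mono : ∀ A, S6.IsL3 A ∨ S6.IsL6 A → S6.IsL3 A ∨ S6.IsL4 A ∨ S6.IsL6 A := by tauto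
  refine ⟨fun hl => ⟨fun hr => (hr.locallyOnDense hl hι).mono mono,
    ⟨fun hr => (hr.locallyOnDense hl hι).mono mono, fun hd => ?_⟩, fun hr =>
    ⟨⟨hr.locallyOnDense_of_not_full hl hι, fun hd => hd.not_full hl hι⟩,
      fun U hU hne _ h => S6.not_full_of_piece hl hι hU hne h, hr.isGloballyL3 hl hι,
      hr.locallyOnDense_of_full hl hι⟩⟩,
    fun hd => hd.isLagrangian hι fun A hA => hA.holCovered⟩
  refine S6.isGenericallyLocallyRuled_of_charts hι fun U hU hne => ?_
  obtain ⟨V, hV, hUV⟩ := S6.locallyOnDense_iff.mp hd U hU hne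
  rcases hV.type with h3 | h4 | h6
  · exact S6.IsPiece.exists_ruledChart_of_isL3 hι ⟨hV.isOpen, hV.emb, h3⟩ hUV
  · exact h4.holCovered.exists_ruledChart hl hι hV.isOpen hV.emb hU hUV
  · exact h6.holCovered.exists_ruledChart hl hι hV.isOpen hV.emb hU hUV
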